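/- Consider $i u_t=-u_{xx}+Vu-|u|^4u$ on $\mathbb R$, where $V$ is a real, even Schwartz function (i.e. $\langle x\rangle^nV^{(k)}\in L^\infty$ for all $n,k$), the set of eigenvalues of $-\partial_x^2+V$ is $\{-\omega_0,-\omega_1\}$ with $\omega_0>\omega_1>0$, and $0$ is not a resonance (a bounded $u$ with $u''=Vu$ vanishes). Let $\psi_0,\psi_1$ be real $L^2$-normalized eigenfunctions for $-\omega_0,-\omega_1$, and write $\langle f,g\rangle=\int_{\mathbb R}fg\,dx$. Let $a_0,m,M,\kappa>0$ be fixed and assume $$5\langle\psi_0^4,\psi_1^2\rangle-\langle\psi_0^6,1\rangle>a_0,\qquad 5\langle\psi_0^4,\psi_1^2\rangle^2-\langle\psi_0^6,1\rangle\langle\psi_0^2,\psi_1^4\rangle>a_0,$$ $|V|\le M$, $\omega_1\ge m$, and that the absence of a resonance is quantified by $$\int (f')^2+Vf^2\,dx\ \ge\ \kappa\int\psi_0^4f^2\,dx\qquad\text{for all } f\in C^1\text{ with } f,f'\in L^2,\ f\perp\psi_0,\psi_1 .$$ There are $\varepsilon,\delta,c,C>0$, depending only on $a_0,m,M,\kappa$,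 such that the following holds whenever $\omega_0-\omega_1<\delta$. Call an asymmetric branch a family of real $C^2$, $L^2$ solutions $\phi_s$, $|s|<r$ (some $r>0$), of $$-\phi_s''+V\phi_s+\omega(s)\phi_s=\phi_s^5,\qquad \phi_s=\rho_0(s)\psi_0+s\psi_1+\eta_s,\quad \eta_s\perp\psi_0,\psi_1,$$ with $\rho_0,\omega$ smooth on $(-r,r)$, $\omega(s)>\omega_0$, $\|\phi_s\|_{L^\infty}\le\varepsilon$ and $\rho_0(0)>0$; here $s=\rho_1$ is the coefficient of $\psi_1$. Put $\rho_0^*=\rho_0(0)$ and $\omega^*=\omega(0)$. An asymmetric branch exists, and for every asymmetric branch $c(\omega_0-\omega_1)\le(\rho_0^*)^4\le C(\omega_0-\omega_1)$ and there is $r'\in(0,r]$ such that: 1. For some $\omega_{\max}>\omega^*$, the map $s\mapsto\omega(s)$ is a bijection from each of $(0,r')$ and $(-r',0)$ onto $(\omega^*,\omega_{\max})$. The quantity $\|\phi_s\|_{L^2}^2$ ($0<|s|<r'$) depends only on $\omega=\omega(s)$, and as a function $q(\omega)$ it is differentiable on $(\omega^*,\omega_{\max})$ with $\frac{dq}{d\omega}>0$.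 2. For $0<|s|<r'$ the set of eigenvalues of $L_+=-\partial_x^2+V+\omega(s)-5\phi_s^4$ on $L^2(\mathbb R)$ is exactly $\{-\mu_0,\mu_1\}$ with $\mu_0,\mu_1>0$ (depending on $s$), $$\mu_0\ \ge\ 4(\rho_0^*)^4\langle\psi_0^6,1\rangle-C(\rho_0^*)^8,\qquad c\,(\rho_0^*)^2s^2\le\mu_1\le C\,(\rho_0^*)^2s^2 .$$ -/

import Mathlib

open scoped SchwartzMap
open MeasureTheory

/-- `u` is an `L²` eigenfunction of the Schrödinger operator `-∂ₓ² + W` on the line, with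
eigenvalue `lam`. (For the bounded smooth potentials `W` used below, every element of the
operator domain `H²` solving the equation is a classical solution, and conversely a classical
solution in `L²` has its second derivative in `L²`.) -/
def IsEigenfunction (W : ℝ → ℝ) (lam : ℝ) (u : ℝ → ℝ) : Prop :=
  u ≠ 0 ∧ ContDiff ℝ 2 u ∧ MemLp u 2 volume ∧
    ∀ x, -deriv (deriv u) x + W x * u x = lam * u x

/-- The set of eigenvalues of `-∂ₓ² + W` on `L²(ℝ)`. -/
def schrodingerEigenvalues (W : ℝ → ℝ) : Set ℝ :=
  {lam | ∃ u, IsEigenfunction W lam u}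

/-- `0` is not a resonance of `-∂ₓ² + V`: a bounded solution of `u'' = V u` vanishes. -/
def ZeroNotResonance (V : ℝ → ℝ) : Prop :=
  ∀ u : ℝ → ℝ, ContDiff ℝ 2 u → (∃ B, ∀ x, |u x| ≤ B) →
    (∀ x, deriv (deriv u) x = V x * u x) → u = 0

/-- Quantitative absence of a resonance at `0`: on the orthogonal complement of the two
eigenfunctions, the quadratic form of `-∂ₓ² + V` dominates `κ ∫ ψ₀⁴ f²`. -/
def NonResonantWithConstant (κ : ℝ) (V ψ₀ ψ₁ : ℝ → ℝ) : Prop :=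
  ∀ f : ℝ → ℝ, ContDiff ℝ 1 f → MemLp f 2 volume → MemLp (deriv f) 2 volume →
    ∫ x, f x * ψ₀ x = 0 → ∫ x, f x * ψ₁ x = 0 →
    κ * ∫ x, ψ₀ x ^ 4 * f x ^ 2 ≤ ∫ x, (deriv f x ^ 2 + V x * f x ^ 2)

/-- The standing hypotheses on the real potential `V` (a Schwartz function: all `⟨x⟩ⁿ V⁽ᵏ⁾` are
bounded), on the eigenvalues `-ω₀ < -ω₁ < 0` of `-∂ₓ² + V` and on normalized real eigenfunctions
`ψ₀`, `ψ₁`. The numbers `a₀, m, M, κ` quantify the hypotheses: they are what the constants in the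
result are allowed to depend on. -/
structure IsAdmissible (a₀ m M κ : ℝ) (V : 𝓢(ℝ, ℝ)) (ω₀ ω₁ : ℝ) (ψ₀ ψ₁ : ℝ → ℝ) : Prop where
  even : ∀ x, V (-x) = V x
  eigenvalues : schrodingerEigenvalues V = {-ω₀, -ω₁}
  lt : ω₁ < ω₀
  not_resonance : ZeroNotResonance V
  eigenfunction₀ : IsEigenfunction V (-ω₀) ψ₀
  eigenfunction₁ : IsEigenfunction V (-ω₁) ψ₁
  norm₀ : ∫ x, ψ₀ x ^ 2 = 1
  norm₁ : ∫ x, ψ₁ x ^ 2 = 1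
  interaction : a₀ < 5 * (∫ x, ψ₀ x ^ 4 * ψ₁ x ^ 2) - ∫ x, ψ₀ x ^ 6
  interaction' : a₀ < 5 * (∫ x, ψ₀ x ^ 4 * ψ₁ x ^ 2) ^ 2
    - (∫ x, ψ₀ x ^ 6) * ∫ x, ψ₀ x ^ 2 * ψ₁ x ^ 4
  bound : ∀ x, |V x| ≤ M
  eigenvalue_bound : m ≤ ω₁
  nonresonant : NonResonantWithConstant κ V ψ₀ ψ₁

/-- `φ` is the real profile of a standing wave `e^{iωt} φ(x)` of
`i uₜ = -uₓₓ + V u - |u|⁴ u`. -/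
def IsStandingWave (V : ℝ → ℝ) (ω : ℝ) (φ : ℝ → ℝ) : Prop :=
  ContDiff ℝ 2 φ ∧ MemLp φ 2 volume ∧
    ∀ x, -deriv (deriv φ) x + V x * φ x + ω * φ x = φ x ^ 5

/-- The small asymmetric branch of standing waves. It is a family
`φ s = ρ₀(s) ψ₀ + s ψ₁ + η(s)`, `η(s) ⟂ ψ₀, ψ₁`, of standing waves with frequencies
`ω(s) > ω₀` and with smooth `ρ₀(s)`, `ω(s)`, parametrized for `|s| < r` by the coefficient
`s = ρ₁` of `ψ₁`. It crosses the line of even states (`s = 0`) at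
`(ρ₀*, ω*) = (ρ₀(0), ω(0))`. -/
structure IsAsymmetricBranch (V : ℝ → ℝ) (ω₀ : ℝ) (ψ₀ ψ₁ : ℝ → ℝ) (ε r : ℝ)
    (ρ₀ ω : ℝ → ℝ) (φ : ℝ → ℝ → ℝ) : Prop where
  r_pos : 0 < r
  smooth_ρ₀ : ContDiffOn ℝ ((⊤ : ℕ∞) : WithTop ℕ∞) ρ₀ (Set.Ioo (-r) r)
  smooth_ω : ContDiffOn ℝ ((⊤ : ℕ∞) : WithTop ℕ∞) ω (Set.Ioo (-r) r)
  standing : ∀ s ∈ Set.Ioo (-r) r, IsStandingWave V (ω s) (φ s)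
  coeff₀ : ∀ s ∈ Set.Ioo (-r) r, ∫ x, φ s x * ψ₀ x = ρ₀ s
  coeff₁ : ∀ s ∈ Set.Ioo (-r) r, ∫ x, φ s x * ψ₁ x = s
  freq : ∀ s ∈ Set.Ioo (-r) r, ω₀ < ω s
  small : ∀ s ∈ Set.Ioo (-r) r, ∀ x, |φ s x| ≤ ε
  ρ₀_pos : 0 < ρ₀ 0

/-- The potential part of `L₊(ω) = -∂ₓ² + V + ω - 5 φ⁴`. -/
def LPlusPotential (V : ℝ → ℝ) (ω : ℝ) (φ : ℝ → ℝ) : ℝ → ℝ :=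
  fun x => V x + ω - 5 * φ x ^ 4

/-! Write d = ω₀ - ω₁, A = ∫ψ₀⁶, B = ∫ψ₀⁴ψ₁², D = ∫ψ₀²ψ₁⁴, and let Z be the L²-orthogonal complement
of ψ₀, ψ₁ in H¹. Odd cutoffs at symmetric zeros show that ψ₀ is even and zero-free and that ψ₁ is
odd.

Reduction. Split φ = ρe + sp with e = ψ₀ + y₁ even and p = ψ₁ + y₂ odd, and put τ = s²/ρ², ω = ω₀ +
ρ⁴μ. The even and odd parts of φ⁵ are ρ⁴·w_e·ρe and ρ⁴·w_o·sp with w_e, w_o polynomial in e, p, τ.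
Dividing by ρ and s gives (-∂² + V + ω₀)e = ρ⁴(w_e - μ)e and (-∂² + V + ω₀)p = ρ⁴(w_o - μ)p; the
division by s removes the symmetric branch, and the system is regular at s = 0. Pairing with ψ₀
determines μ, and pairing with ψ₁ gives d = ρ⁴·gap with gap near 5B - A > a₀. Inverting on Z leaves
y = (d/gap)·rhs(τ, y), a contraction for small d (`exists_curve`). Its fixed points Y τ depend
smoothly on τ, inherit the parities by uniqueness, and account for every small asymmetric wave
(`Setting.exists_isFixed`, `Chart.eventually_eq`). The inverse on Z and the eigenfunctions are
themselves variables ranging over a bounded set of a fixed Banach space, so that all constants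
depend only on bounds for these data.

Monotonicity. Frequency and mass are functions of s² = τρ². At τ = 0 the slope of ω is a positive
multiple of μ'·gap - μ·gap', which is near 10(5B² - AD). The slope of the mass is a positive
multiple of a number near 1 - 5(D - B)/(5B - A), and D - B is small because ψ₁² - ψ₀² is small in L¹
when d is (`IsAdmissible.integral_abs_sub_le`).

Spectrum. Eliminating Z from L₊ leaves a 2×2 Schur complement in the basis ψ₀, p. At the spectral
value ρ⁴l, with t = s/ρ, its determinant is to leading order ρ⁸((4A + l)(20Dt² + l) - 400B²t²), with
roots near l = -4A and l = 20t²(5B² - AD)/A; sign changes locate both (`exists_two_eigenvalues`).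
There are no others: Sturm comparison gives |φ| ≤ 2ρ|ψ₀|, so 5φ⁴ ≤ κψ₀⁴ and the nonresonance bound
yields L₊ ≥ ω on Z, hence at most two eigenvalues below ω, while an ODE argument excludes
eigenvalues at or above ω. -/

namespace Branch
open Set Filter Topology
open scoped BoundedContinuousFunction

/-! ### H¹(ℝ) as a copy of L²(ℝ) through u ↦ u' + u -/

/-- The Hilbert space `L²(ℝ)`. -/
noncomputable abbrev E := Lp ℝ 2 (volume : Measure ℝ)

/-- Continuously differentiable representatives of elements of `H¹(ℝ)`. -/
structure IsH1 (u : ℝ → ℝ) : Prop where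
  contDiff : ContDiff ℝ 1 u
  memLp : MemLp u 2 volume
  memLp_deriv : MemLp (deriv u) 2 volume

theorem integrable_mul_of_memLp {u v : ℝ → ℝ} (hu : MemLp u 2 volume) (hv : MemLp v 2 volume) :
    Integrable (fun x => u x * v x) := hu.integrable_mul hv

theorem integrable_sq_of_memLp {u : ℝ → ℝ} (hu : MemLp u 2 volume) :
    Integrable (fun x => u x ^ 2) := hu.integrable_sq

theorem memLp_bdd_mul {w u : ℝ → ℝ} {C : ℝ} (hw : Continuous w) (hC : ∀ x, |w x| ≤ C)
    (hu : MemLp u 2 volume) : MemLp (fun x => w x * u x) 2 volume := by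
  refine MemLp.of_le_mul (c := C) hu (hw.aestronglyMeasurable.mul hu.aestronglyMeasurable) ?_
  refine Eventually.of_forall fun x => ?_
  rw [norm_mul]
  exact mul_le_mul_of_nonneg_right (hC x) (norm_nonneg _)

namespace IsH1
variable {u v : ℝ → ℝ}

theorem hasDerivAt (hu : IsH1 u) (x : ℝ) : HasDerivAt u (deriv u x) x :=
  (hu.contDiff.differentiable one_ne_zero x).hasDerivAt

theorem continuous (hu : IsH1 u) : Continuous u := hu.contDiff.continuous

theorem continuous_deriv (hu : IsH1 u) : Continuous (deriv u) :=
  hu.contDiff.continuous_deriv le_rfl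

theorem of_hasDerivAt {u' : ℝ → ℝ} (h : ∀ x, HasDerivAt u (u' x) x) (hc : Continuous u')
    (hu : MemLp u 2 volume) (hu' : MemLp u' 2 volume) : IsH1 u := by
  have hd : deriv u = u' := funext fun x => (h x).deriv
  refine ⟨contDiff_one_iff_deriv.2 ⟨fun x => (h x).differentiableAt, hd ▸ hc⟩, hu, hd ▸ hu'⟩

theorem const_mul (c : ℝ) (hu : IsH1 u) : IsH1 (fun x => c * u x) :=
  of_hasDerivAt (fun x => (hu.hasDerivAt x).const_mul c)
    (hu.continuous_deriv.const_mul c) (hu.memLp.const_mul c) (hu.memLp_deriv.const_mul c)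

theorem sub (hu : IsH1 u) (hv : IsH1 v) : IsH1 (fun x => u x - v x) :=
  of_hasDerivAt (fun x => (hu.hasDerivAt x).sub (hv.hasDerivAt x))
    (hu.continuous_deriv.sub hv.continuous_deriv) (hu.memLp.sub hv.memLp)
    (hu.memLp_deriv.sub hv.memLp_deriv)

theorem hasDerivAt_comp_neg (hu : IsH1 u) (x : ℝ) :
    HasDerivAt (fun y => u (-y)) (-deriv u (-x)) x := by
  exact ((hu.hasDerivAt (-x)).comp x (hasDerivAt_neg x)).congr_deriv (by ring)

theorem _root_.Branch.memLp_comp_neg {u : ℝ → ℝ} (hu : MemLp u 2 volume) :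
    MemLp (fun x => u (-x)) 2 volume :=
  hu.comp_measurePreserving (Measure.measurePreserving_neg volume)

theorem comp_neg (hu : IsH1 u) : IsH1 (fun x => u (-x)) :=
  of_hasDerivAt hu.hasDerivAt_comp_neg (hu.continuous_deriv.comp continuous_neg).neg
    (memLp_comp_neg hu.memLp) (memLp_comp_neg hu.memLp_deriv).neg

theorem integral_deriv_mul (hu : IsH1 u) (hv : IsH1 v) :
    ∫ x, (deriv u x * v x + u x * deriv v x) = 0 :=
  integral_eq_zero_of_hasDerivAt_of_integrable
    (fun x => (hu.hasDerivAt x).mul (hv.hasDerivAt x))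
    ((integrable_mul_of_memLp hu.memLp_deriv hv.memLp).add
      (integrable_mul_of_memLp hu.memLp hv.memLp_deriv))
    (integrable_mul_of_memLp hu.memLp hv.memLp)

/-- Both u² and its derivative 2uu' are integrable. -/
theorem tendsto_sq (hu : IsH1 u) :
    Tendsto (fun x => u x ^ 2) atTop (𝓝 0) ∧ Tendsto (fun x => u x ^ 2) atBot (𝓝 0) := by
  have h1 : ∀ x, HasDerivAt (fun x => u x ^ 2) (2 * (u x * deriv u x)) x := fun x => by
    refine ((hu.hasDerivAt x).pow 2).congr_deriv ?_
    simp only [Nat.cast_ofNat, Nat.add_one_sub_one, pow_one]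
    ring
  have h2 := (integrable_mul_of_memLp hu.memLp hu.memLp_deriv).const_mul 2
  have h3 := integrable_sq_of_memLp hu.memLp
  exact ⟨tendsto_zero_of_hasDerivAt_of_integrableOn_Ioi (a := 0) (fun x _ => h1 x)
    h2.integrableOn h3.integrableOn, tendsto_zero_of_hasDerivAt_of_integrableOn_Iic (a := 0)
    (fun x _ => h1 x) h2.integrableOn h3.integrableOn⟩

theorem tendsto_atTop (hu : IsH1 u) : Tendsto u atTop (𝓝 0) := by
  rw [tendsto_zero_iff_abs_tendsto_zero]
  have := hu.tendsto_sq.1.sqrt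
  simpa [Real.sqrt_sq_eq_abs, Function.comp_def] using this

theorem tendsto_atBot (hu : IsH1 u) : Tendsto u atBot (𝓝 0) := by
  rw [tendsto_zero_iff_abs_tendsto_zero]
  have := hu.tendsto_sq.2.sqrt
  simpa [Real.sqrt_sq_eq_abs, Function.comp_def] using this

theorem memLp_add (hu : IsH1 u) : MemLp (fun x => deriv u x + u x) 2 volume :=
  hu.memLp_deriv.add hu.memLp

/-- The element of `L²` representing `u ∈ H¹` under the isometry `u ↦ u' + u`. -/
noncomputable def toE (hu : IsH1 u) : E := hu.memLp_add.toLp _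

theorem coe_toE (hu : IsH1 u) : (hu.toE : ℝ → ℝ) =ᵐ[volume] fun x => deriv u x + u x :=
  MemLp.coeFn_toLp _

/-- The cross terms u'v + uv' are the derivative of uv and integrate to zero, so u ↦ u' + u carries
the H¹ inner product to that of L². The functional analysis can then take place in the concrete
Hilbert space `E`. -/
theorem inner_toE (hu : IsH1 u) (hv : IsH1 v) :
    inner ℝ hu.toE hv.toE = ∫ x, (deriv u x * deriv v x + u x * v x) := by
  rw [L2.inner_def]
  have h1 : ∫ x, inner ℝ ((hu.toE : ℝ → ℝ) x) ((hv.toE : ℝ → ℝ) x) =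
      ∫ x, ((deriv u x * deriv v x + u x * v x) + (deriv u x * v x + u x * deriv v x)) := by
    refine integral_congr_ae ?_
    filter_upwards [hu.coe_toE, hv.coe_toE] with x h1 h2
    rw [h1, h2]
    simp only [RCLike.inner_apply, conj_trivial]
    ring
  rw [h1, integral_add, hu.integral_deriv_mul hv, add_zero]
  · exact (integrable_mul_of_memLp hu.memLp_deriv hv.memLp_deriv).add
      (integrable_mul_of_memLp hu.memLp hv.memLp)
  · exact (integrable_mul_of_memLp hu.memLp_deriv hv.memLp).add
      (integrable_mul_of_memLp hu.memLp hv.memLp_deriv)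

end IsH1

/-! ### The inverse of ∂ₓ + 1 and the evaluation map -/

section Resolvent

theorem integrableOn_exp_Iic_sub (x : ℝ) : IntegrableOn (fun y => Real.exp (y - x)) (Iic x) := by
  have : (fun y => Real.exp (y - x)) = fun y => Real.exp (-x) * Real.exp y := by
    ext y; rw [← Real.exp_add]; ring_nf
  rw [this]
  exact (integrableOn_exp_Iic x).const_mul _

theorem integral_exp_Iic_sub (x : ℝ) : ∫ y in Iic x, Real.exp (y - x) = 1 := by
  have : (fun y => Real.exp (y - x)) = fun y => Real.exp (-x) * Real.exp y := by
    ext y; rw [← Real.exp_add]; ring_nf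
  rw [this, integral_const_mul, integral_exp_Iic, ← Real.exp_add]
  simp

/-- The bounded solution of `u' + u = f`. -/
noncomputable def solve (f : ℝ → ℝ) (x : ℝ) : ℝ := ∫ y in Iic x, Real.exp (y - x) * f y

theorem integrableOn_exp_mul_sq {f : ℝ → ℝ} (hf : MemLp f 2 volume) (x : ℝ) :
    IntegrableOn (fun y => Real.exp (y - x) * f y ^ 2) (Iic x) := by
  refine Integrable.mono (hf.integrable_sq.integrableOn (s := Iic x)) ?_ ?_
  · exact ((by fun_prop : Continuous fun y => Real.exp (y - x)).aestronglyMeasurable.mul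
      (hf.aestronglyMeasurable.pow 2)).restrict
  · filter_upwards [ae_restrict_mem measurableSet_Iic] with y hy
    rw [norm_mul]
    refine mul_le_of_le_one_left (norm_nonneg _) ?_
    rw [Real.norm_eq_abs, Real.abs_exp, Real.exp_le_one_iff]
    simpa using hy

theorem integrableOn_exp_mul {f : ℝ → ℝ} (hf : MemLp f 2 volume) (x : ℝ) :
    IntegrableOn (fun y => Real.exp (y - x) * f y) (Iic x) := by
  refine Integrable.mono ((integrableOn_exp_Iic_sub x).add (integrableOn_exp_mul_sq hf x)) ?_ ?_
  · exact ((by fun_prop : Continuous fun y => Real.exp (y - x)).aestronglyMeasurable.mul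
      hf.aestronglyMeasurable).restrict
  · filter_upwards with y
    have h := Real.exp_pos (y - x)
    simp only [Pi.add_apply]
    rw [norm_mul, Real.norm_eq_abs, Real.norm_eq_abs, Real.norm_eq_abs, abs_of_pos h,
      abs_of_nonneg (add_nonneg h.le (mul_nonneg h.le (sq_nonneg _)))]
    have : |f y| ≤ 1 + f y ^ 2 := by
      rw [← sq_abs]; nlinarith [sq_nonneg (|f y| - 1), abs_nonneg (f y)]
    nlinarith

/-- Jensen's inequality for the probability density e^{y-x} on (-∞, x]: the variance of f about its
mean `solve f x` is nonnegative. -/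
theorem solve_sq_le {f : ℝ → ℝ} (hf : MemLp f 2 volume) (x : ℝ) :
    solve f x ^ 2 ≤ ∫ y in Iic x, Real.exp (y - x) * f y ^ 2 := by
  have h0 : 0 ≤ ∫ y in Iic x, Real.exp (y - x) * (f y - solve f x) ^ 2 :=
    integral_nonneg fun y => by positivity
  have h1 : ∀ y, Real.exp (y - x) * (f y - solve f x) ^ 2 = Real.exp (y - x) * f y ^ 2
      - 2 * solve f x * (Real.exp (y - x) * f y) + solve f x ^ 2 * Real.exp (y - x) := fun y => by
    ring
  simp_rw [h1] at h0
  rw [integral_add, integral_sub, integral_const_mul, integral_const_mul, integral_exp_Iic_sub]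
    at h0
  · have : ∫ y in Iic x, Real.exp (y - x) * f y = solve f x := rfl
    rw [this] at h0
    nlinarith
  · exact integrableOn_exp_mul_sq hf x
  · exact (integrableOn_exp_mul hf x).const_mul _
  · exact (integrableOn_exp_mul_sq hf x).sub ((integrableOn_exp_mul hf x).const_mul _)
  · exact (integrableOn_exp_Iic_sub x).const_mul _

theorem solve_sq_le' {f : ℝ → ℝ} (hf : MemLp f 2 volume) (x : ℝ) :
    solve f x ^ 2 ≤ ∫ y, f y ^ 2 := by
  refine (solve_sq_le hf x).trans ?_
  refine (setIntegral_mono_on (integrableOn_exp_mul_sq hf x) hf.integrable_sq.integrableOn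
    measurableSet_Iic fun y hy => ?_).trans
    (setIntegral_le_integral hf.integrable_sq (Eventually.of_forall fun y => sq_nonneg _))
  refine mul_le_of_le_one_left (sq_nonneg _) ?_
  rw [Real.exp_le_one_iff]
  simpa using hy

theorem solve_eq {f : ℝ → ℝ} (x : ℝ) :
    solve f x = Real.exp (-x) * ∫ y in Iic x, Real.exp y * f y := by
  rw [solve, ← integral_const_mul]
  congr 1; ext y
  rw [← mul_assoc, ← Real.exp_add]
  ring_nf

theorem integrableOn_exp_mul' {f : ℝ → ℝ} (hf : MemLp f 2 volume) (x : ℝ) :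
    IntegrableOn (fun y => Real.exp y * f y) (Iic x) := by
  have := (integrableOn_exp_mul hf x).const_mul (Real.exp x)
  refine this.congr (Eventually.of_forall fun y => ?_)
  simp only
  rw [← mul_assoc, ← Real.exp_add]
  ring_nf

theorem solve_eq' {f : ℝ → ℝ} (hf : MemLp f 2 volume) :
    solve f = fun x => Real.exp (-x) * ((∫ y in Iic 0, Real.exp y * f y) +
      ∫ y in (0 : ℝ)..x, Real.exp y * f y) := by
  ext x
  rw [solve_eq, ← intervalIntegral.integral_Iic_sub_Iic (integrableOn_exp_mul' hf 0)
    (integrableOn_exp_mul' hf x)]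
  ring_nf

theorem intervalIntegrable_exp_mul {f : ℝ → ℝ} (hf : MemLp f 2 volume) (a b : ℝ) :
    IntervalIntegrable (fun y => Real.exp y * f y) volume a b := by
  refine IntegrableOn.intervalIntegrable ((integrableOn_exp_mul' hf (max a b)).mono_set ?_)
  intro y hy
  rw [uIcc, mem_Icc] at hy
  exact hy.2

theorem continuous_solve {f : ℝ → ℝ} (hf : MemLp f 2 volume) : Continuous (solve f) := by
  rw [solve_eq' hf]
  have := intervalIntegral.continuous_primitive (μ := volume) (intervalIntegrable_exp_mul hf) 0
  fun_prop

theorem hasDerivAt_solve {f : ℝ → ℝ} (hf : MemLp f 2 volume) (hc : Continuous f) (x : ℝ) :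
    HasDerivAt (solve f) (f x - solve f x) x := by
  rw [solve_eq' hf]
  have h1 : HasDerivAt (fun x => ∫ y in (0 : ℝ)..x, Real.exp y * f y) (Real.exp x * f x) x :=
    ((by fun_prop : Continuous fun y => Real.exp y * f y).integral_hasStrictDerivAt 0 x).hasDerivAt
  have h2 : HasDerivAt (fun x : ℝ => Real.exp (-x)) (-Real.exp (-x)) x := by
    simpa using (hasDerivAt_neg x).exp
  refine (h2.mul (h1.const_add (∫ y in Iic 0, Real.exp y * f y))).congr_deriv ?_
  have : Real.exp (-x) * (Real.exp x * f x) = f x := by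
    rw [← mul_assoc, ← Real.exp_add]; simp
  rw [this]
  ring

/-- By `solve_sq_le` the square of `solve f` is dominated by the convolution of f² with the kernel
e^{-t} on t ≥ 0, which has integral 1. -/
theorem integrable_and_integral_solve_sq {f : ℝ → ℝ} (hf : MemLp f 2 volume) :
    MemLp (solve f) 2 volume ∧ ∫ x, solve f x ^ 2 ≤ ∫ x, f x ^ 2 := by
  set k : ℝ → ℝ := (Ici (0 : ℝ)).indicator fun t => Real.exp (-t)
  have hk : Integrable k := by
    refine (integrable_indicator_iff measurableSet_Ici).2 ?_
    exact (integrableOn_Ici_iff_integrableOn_Ioi).2 (integrableOn_exp_neg_Ioi 0)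
  have hk1 : ∫ t, k t = 1 := by
    rw [integral_indicator measurableSet_Ici, integral_Ici_eq_integral_Ioi, integral_exp_neg_Ioi]
    simp
  set F : ℝ → ℝ := fun x => f x ^ 2
  have hF : Integrable F := hf.integrable_sq
  have hconv : ∀ x, convolution F k (ContinuousLinearMap.mul ℝ ℝ) volume x
      = ∫ y in Iic x, Real.exp (y - x) * f y ^ 2 := fun x => by
    rw [convolution_def, ← integral_indicator measurableSet_Iic]
    congr 1; ext y
    simp only [ContinuousLinearMap.mul_apply', k, F, indicator_apply, mem_Ici, mem_Iic, sub_nonneg]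
    split_ifs
    · rw [neg_sub]; ring
    · simp
  have hi := hF.integrable_convolution (ContinuousLinearMap.mul ℝ ℝ) hk
  have hint := integral_convolution (ContinuousLinearMap.mul ℝ ℝ) hF hk (μ := volume)
  simp only [ContinuousLinearMap.mul_apply', hk1, mul_one] at hint
  have hle : ∀ x, solve f x ^ 2 ≤ convolution F k (ContinuousLinearMap.mul ℝ ℝ) volume x :=
    fun x => by rw [hconv]; exact solve_sq_le hf x
  have hsq : Integrable fun x => solve f x ^ 2 := by
    refine hi.mono' ((continuous_solve hf).pow 2).aestronglyMeasurable (Eventually.of_forall ?_)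
    intro x
    rw [Real.norm_eq_abs, abs_of_nonneg (sq_nonneg _)]
    exact hle x
  refine ⟨(memLp_two_iff_integrable_sq (continuous_solve hf).aestronglyMeasurable).2 hsq, ?_⟩
  rw [← hint]
  exact integral_mono hsq hi hle

theorem isH1_solve {f : ℝ → ℝ} (hf : MemLp f 2 volume) (hc : Continuous f) : IsH1 (solve f) := by
  have h := (integrable_and_integral_solve_sq hf).1
  exact IsH1.of_hasDerivAt (hasDerivAt_solve hf hc) (hc.sub (continuous_solve hf)) h (hf.sub h)

theorem toE_solve {f : ℝ → ℝ} (hf : MemLp f 2 volume) (hc : Continuous f) :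
    (isH1_solve hf hc).toE = hf.toLp f := by
  unfold IsH1.toE
  congr 1
  ext x
  rw [(hasDerivAt_solve hf hc x).deriv]
  ring

/-- The integrating factor e^y turns u' + u into an exact derivative; the boundary term at -∞
vanishes. -/
theorem solve_deriv_add {u : ℝ → ℝ} (hu : IsH1 u) : solve (fun x => deriv u x + u x) = u := by
  ext x
  rw [solve_eq]
  have h1 : ∀ y, HasDerivAt (fun y => Real.exp y * u y) (Real.exp y * (deriv u y + u y)) y :=
    fun y => by
      refine ((Real.hasDerivAt_exp y).mul (hu.hasDerivAt y)).congr_deriv ?_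
      ring
  have h2 := integral_Iic_of_hasDerivAt_of_tendsto' (a := x) (m := 0) (fun y _ => h1 y)
    (integrableOn_exp_mul' hu.memLp_add x)
    (by simpa using Real.tendsto_exp_atBot.mul hu.tendsto_atBot)
  rw [h2, sub_zero, ← mul_assoc, ← Real.exp_add]
  simp

theorem solve_congr {f g : ℝ → ℝ} (h : f =ᵐ[volume] g) : solve f = solve g := by
  ext x
  exact integral_congr_ae ((ae_restrict_of_ae h).mono fun y hy => by simp only [hy])

theorem norm_sq_eq (f : E) : ‖f‖ ^ 2 = ∫ x, (f x) ^ 2 := by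
  rw [← real_inner_self_eq_norm_sq, L2.inner_def]
  congr 1; ext x
  simp [pow_two]

theorem abs_solve_le (f : E) (x : ℝ) : |solve f x| ≤ ‖f‖ := by
  refine abs_le_of_sq_le_sq ?_ (norm_nonneg _)
  rw [norm_sq_eq]
  exact solve_sq_le' (Lp.memLp f) x

/-- Evaluation of the `H¹` function represented by `f`. -/
noncomputable def ev : E →L[ℝ] (ℝ →ᵇ ℝ) :=
  LinearMap.mkContinuous
    { toFun := fun f => BoundedContinuousFunction.ofNormedAddCommGroup (solve f)
        (continuous_solve (Lp.memLp f)) ‖f‖ (abs_solve_le f)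
      map_add' := fun f g => by
        ext x
        simp only [BoundedContinuousFunction.coe_ofNormedAddCommGroup,
          BoundedContinuousFunction.coe_add, Pi.add_apply]
        rw [solve_congr (Lp.coeFn_add f g)]
        simp only [solve, Pi.add_apply, mul_add]
        exact integral_add (integrableOn_exp_mul (Lp.memLp f) x)
          (integrableOn_exp_mul (Lp.memLp g) x)
      map_smul' := fun c f => by
        ext x
        simp only [BoundedContinuousFunction.coe_ofNormedAddCommGroup, RingHom.id_apply,
          BoundedContinuousFunction.coe_smul]
        rw [solve_congr (Lp.coeFn_smul c f)]
        simp only [solve, Pi.smul_apply, smul_eq_mul]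
        rw [← integral_const_mul]
        congr 1; ext y; ring }
    1 fun f => by
      rw [one_mul]
      exact BoundedContinuousFunction.norm_ofNormedAddCommGroup_le _ (norm_nonneg _)
        (abs_solve_le f)

theorem coe_ev (f : E) : ⇑(ev f) = solve f := rfl

theorem norm_ev_le (f : E) : ‖ev f‖ ≤ ‖f‖ := by
  exact BoundedContinuousFunction.norm_ofNormedAddCommGroup_le _ (norm_nonneg _) (abs_solve_le f)

end Resolvent

/-! ### Density of classical functions and the embedding in L² -/

theorem memLp_ev (f : E) : MemLp (ev f) 2 volume :=
  (integrable_and_integral_solve_sq (Lp.memLp f)).1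

theorem ev_toE {u : ℝ → ℝ} (hu : IsH1 u) : ⇑(ev hu.toE) = u := by
  rw [coe_ev, solve_congr hu.coe_toE, solve_deriv_add hu]

theorem ev_toLp {g : ℝ → ℝ} (hg : MemLp g 2 volume) : ⇑(ev (hg.toLp g)) = solve g := by
  rw [coe_ev, solve_congr hg.coeFn_toLp]

/-- Compactly supported continuous g are dense in L², and each equals u' + u for the C¹ function u =
`solve g`. Closed statements about `E`, such as identities between bounded operators, therefore need
checking on classical functions only. -/
theorem E_induction {P : E → Prop} (hcl : IsClosed {f | P f})
    (h : ∀ u (hu : IsH1 u), P hu.toE) (f : E) : P f := by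
  have : f ∈ closure {f | P f} := by
    rw [Metric.mem_closure_iff]
    intro ε hε
    obtain ⟨g, -, hg, hgc, hgm⟩ := (Lp.memLp f).exists_hasCompactSupport_eLpNorm_sub_le
      (by norm_num) (ε := ENNReal.ofReal (ε / 2)) (by simpa using hε)
    refine ⟨hgm.toLp g, ?_, ?_⟩
    · rw [← toE_solve hgm hgc]
      exact h _ _
    · have h1 : f = (Lp.memLp f).toLp f := (Lp.toLp_coeFn f _).symm
      rw [h1, dist_eq_norm, ← MemLp.toLp_sub, Lp.norm_toLp]
      refine (ENNReal.toReal_mono ENNReal.ofReal_ne_top hg).trans_lt ?_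
      rw [ENNReal.toReal_ofReal (by positivity)]
      linarith
  rwa [hcl.closure_eq] at this

/-- The embedding of `H¹` (represented by `E`) in `L²`. -/
noncomputable def emb : E →L[ℝ] E :=
  LinearMap.mkContinuous
    { toFun := fun f => (memLp_ev f).toLp (ev f)
      map_add' := fun f g => by
        rw [← MemLp.toLp_add]
        exact MemLp.toLp_congr _ _ (by rw [map_add]; rfl)
      map_smul' := fun c f => by
        rw [RingHom.id_apply, ← MemLp.toLp_const_smul]
        exact MemLp.toLp_congr _ _ (by rw [map_smul]; rfl) }
    1 fun f => by
      rw [one_mul]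
      refine le_of_sq_le_sq ?_ (norm_nonneg _)
      rw [norm_sq_eq, norm_sq_eq]
      refine le_trans (le_of_eq ?_) (integrable_and_integral_solve_sq (Lp.memLp f)).2
      refine integral_congr_ae ?_
      filter_upwards [(memLp_ev f).coeFn_toLp] with x hx
      simp only [LinearMap.coe_mk, AddHom.coe_mk]
      rw [hx]; rfl

theorem coe_emb (f : E) : (emb f : ℝ → ℝ) =ᵐ[volume] ev f := (memLp_ev f).coeFn_toLp

theorem norm_emb_le (f : E) : ‖emb f‖ ≤ ‖f‖ := by
  simpa using emb.le_of_opNorm_le (LinearMap.mkContinuous_norm_le _ zero_le_one _) f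

theorem inner_eq_integral {f h : E} {u v : ℝ → ℝ} (hf : (f : ℝ → ℝ) =ᵐ[volume] u)
    (hh : (h : ℝ → ℝ) =ᵐ[volume] v) : inner ℝ f h = ∫ x, u x * v x := by
  rw [L2.inner_def]
  refine integral_congr_ae ?_
  filter_upwards [hf, hh] with x h1 h2
  rw [h1, h2]
  simp [mul_comm]

theorem inner_emb (f h : E) : inner ℝ (emb f) (emb h) = ∫ x, ev f x * ev h x :=
  inner_eq_integral (coe_emb f) (coe_emb h)

theorem norm_emb_sq (f : E) : ‖emb f‖ ^ 2 = ∫ x, ev f x ^ 2 := by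
  rw [← real_inner_self_eq_norm_sq, inner_emb]
  simp_rw [pow_two]

/-! ### Potentials and Schrödinger operators as bounded operators on H¹ -/

/-- Multiplication of `L²` functions by bounded continuous functions. -/
noncomputable def mulOp : (ℝ →ᵇ ℝ) →L[ℝ] E →L[ℝ] E :=
  LinearMap.mkContinuous₂
    (LinearMap.mk₂ ℝ
      (fun w f => (memLp_bdd_mul w.continuous w.norm_coe_le_norm (Lp.memLp f)).toLp _)
      (fun w w' f => by
        rw [← MemLp.toLp_add]
        exact MemLp.toLp_congr _ _ (Eventually.of_forall fun x => by
          simp only [Pi.add_apply, BoundedContinuousFunction.coe_add]; ring))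
      (fun c w f => by
        rw [← MemLp.toLp_const_smul]
        exact MemLp.toLp_congr _ _ (Eventually.of_forall fun x => by
          simp only [Pi.smul_apply, BoundedContinuousFunction.coe_smul, smul_eq_mul]; ring))
      (fun w f g => by
        rw [← MemLp.toLp_add]
        refine MemLp.toLp_congr _ _ ?_
        filter_upwards [Lp.coeFn_add f g] with x hx
        rw [hx]; simp only [Pi.add_apply]; ring)
      (fun c w f => by
        rw [← MemLp.toLp_const_smul]
        refine MemLp.toLp_congr _ _ ?_
        filter_upwards [Lp.coeFn_smul c f] with x hx
        rw [hx]; simp only [Pi.smul_apply, smul_eq_mul]; ring))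
    1 fun w f => by
      rw [one_mul, LinearMap.mk₂_apply]
      refine Lp.norm_le_mul_norm_of_ae_le_mul ?_
      filter_upwards [(memLp_bdd_mul w.continuous w.norm_coe_le_norm (Lp.memLp f)).coeFn_toLp]
        with x hx
      rw [hx, norm_mul]
      exact mul_le_mul_of_nonneg_right (w.norm_coe_le_norm x) (norm_nonneg _)

theorem coe_mulOp (w : ℝ →ᵇ ℝ) (f : E) : (mulOp w f : ℝ → ℝ) =ᵐ[volume] fun x => w x * f x :=
  (memLp_bdd_mul w.continuous w.norm_coe_le_norm (Lp.memLp f)).coeFn_toLp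

theorem norm_mulOp_le (w : ℝ →ᵇ ℝ) (f : E) : ‖mulOp w f‖ ≤ ‖w‖ * ‖f‖ := by
  refine Lp.norm_le_mul_norm_of_ae_le_mul ?_
  filter_upwards [coe_mulOp w f] with x hx
  rw [hx, norm_mul]
  exact mul_le_mul_of_nonneg_right (w.norm_coe_le_norm x) (norm_nonneg _)

/-- The Riesz representative of `h ↦ ∫ w f h`. -/
noncomputable def pot : (ℝ →ᵇ ℝ) →L[ℝ] E →L[ℝ] E :=
  ((ContinuousLinearMap.compL ℝ E E E (ContinuousLinearMap.adjoint emb)) ∘L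
    ((ContinuousLinearMap.compL ℝ E E E).flip emb)) ∘L mulOp

theorem pot_apply (w : ℝ →ᵇ ℝ) (f : E) :
    pot w f = ContinuousLinearMap.adjoint emb (mulOp w (emb f)) := rfl

theorem coe_mulOp_emb (w : ℝ →ᵇ ℝ) (f : E) :
    (mulOp w (emb f) : ℝ → ℝ) =ᵐ[volume] fun x => w x * ev f x := by
  filter_upwards [coe_mulOp w (emb f), coe_emb f] with x h1 h2
  rw [h1, h2]

theorem inner_pot (w : ℝ →ᵇ ℝ) (f h : E) :
    inner ℝ (pot w f) h = ∫ x, w x * ev f x * ev h x := by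
  rw [pot_apply, ContinuousLinearMap.adjoint_inner_left]
  exact inner_eq_integral (coe_mulOp_emb w f) (coe_emb h)

theorem inner_pot_symm (w : ℝ →ᵇ ℝ) (f h : E) :
    inner ℝ (pot w f) h = inner ℝ f (pot w h) := by
  rw [real_inner_comm (pot w h), inner_pot, inner_pot]
  congr 1; ext x; ring

theorem abs_inner_pot_le (w : ℝ →ᵇ ℝ) (f h : E) :
    |inner ℝ (pot w f) h| ≤ ‖w‖ * ‖emb f‖ * ‖emb h‖ := by
  rw [pot_apply, ContinuousLinearMap.adjoint_inner_left]
  exact (abs_real_inner_le_norm _ _).trans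
    (mul_le_mul_of_nonneg_right (norm_mulOp_le _ _) (norm_nonneg _))

theorem norm_pot_le (w : ℝ →ᵇ ℝ) (f : E) : ‖pot w f‖ ≤ ‖w‖ * ‖f‖ := by
  have h := abs_inner_pot_le w f (pot w f)
  rw [real_inner_self_eq_norm_sq, abs_of_nonneg (sq_nonneg _)] at h
  rcases eq_or_lt_of_le (norm_nonneg (pot w f)) with h0 | h0
  · rw [← h0]; positivity
  · have h1 : ‖w‖ * ‖emb f‖ * ‖emb (pot w f)‖ ≤ ‖w‖ * ‖f‖ * ‖pot w f‖ := by
      gcongr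
      · exact norm_emb_le f
      · exact norm_emb_le _
    nlinarith

theorem inner_pot_one (f h : E) : inner ℝ (pot 1 f) h = inner ℝ (emb f) (emb h) := by
  rw [inner_pot, inner_emb]; simp

theorem integrable_mul_ev (w : ℝ →ᵇ ℝ) (f h : E) : Integrable fun x => w x * ev f x * ev h x :=
  integrable_mul_of_memLp (memLp_bdd_mul w.continuous w.norm_coe_le_norm (memLp_ev f)) (memLp_ev h)

theorem inner_pot_self_mono {w w' : ℝ →ᵇ ℝ} (h : ∀ x, w x ≤ w' x) (f : E) :
    inner ℝ (pot w f) f ≤ inner ℝ (pot w' f) f := by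
  rw [inner_pot, inner_pot]
  refine integral_mono (integrable_mul_ev w f f) (integrable_mul_ev w' f f) fun x => ?_
  simp only [mul_assoc]
  exact mul_le_mul_of_nonneg_right (h x) (mul_self_nonneg _)

/-- The bounded operator on `H¹` representing the form of `-∂ₓ² + W`. -/
noncomputable def schr (W : ℝ →ᵇ ℝ) : E →L[ℝ] E := 1 + pot (W - 1)

theorem schr_apply (W : ℝ →ᵇ ℝ) (f : E) : schr W f = f + pot (W - 1) f := rfl

theorem schr_add (W w : ℝ →ᵇ ℝ) (f : E) : schr (W + w) f = schr W f + pot w f := by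
  rw [schr_apply, schr_apply, add_assoc, ← add_apply, ← map_add]
  congr 3
  abel

theorem schr_sub (W w : ℝ →ᵇ ℝ) (f : E) : schr (W - w) f = schr W f - pot w f := by
  rw [sub_eq_add_neg, schr_add, map_neg, sub_eq_add_neg]; rfl

theorem inner_schr_symm (W : ℝ →ᵇ ℝ) (f h : E) :
    inner ℝ (schr W f) h = inner ℝ f (schr W h) := by
  rw [schr_apply, schr_apply, inner_add_left, inner_add_right, inner_pot_symm]

theorem inner_schr_toE (W : ℝ →ᵇ ℝ) {u v : ℝ → ℝ} (hu : IsH1 u) (hv : IsH1 v) :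
    inner ℝ (schr W hu.toE) hv.toE = ∫ x, (deriv u x * deriv v x + W x * u x * v x) := by
  rw [schr_apply, inner_add_left, hu.inner_toE hv, inner_pot, ← integral_add]
  · congr 1; ext x
    rw [ev_toE, ev_toE, BoundedContinuousFunction.coe_sub, Pi.sub_apply,
      BoundedContinuousFunction.coe_one, Pi.one_apply]
    ring
  · exact (integrable_mul_of_memLp hu.memLp_deriv hv.memLp_deriv).add
      (integrable_mul_of_memLp hu.memLp hv.memLp)
  · exact integrable_mul_ev _ _ _

theorem isH1_deriv {W : ℝ →ᵇ ℝ} {u : ℝ → ℝ} (hu : IsH1 u) (hu2 : ContDiff ℝ 2 u)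
    (h : ∀ x, deriv (deriv u) x = W x * u x) : IsH1 (deriv u) := by
  refine IsH1.of_hasDerivAt (u' := fun x => W x * u x) (fun x => ?_)
    (W.continuous.mul hu.continuous) hu.memLp_deriv
    (memLp_bdd_mul W.continuous W.norm_coe_le_norm hu.memLp)
  rw [← h x]
  have : ContDiff ℝ 1 (deriv u) := by
    have h2 : ContDiff ℝ (1 + 1) u := by simpa [one_add_one_eq_two] using hu2
    exact (contDiff_succ_iff_deriv.1 h2).2.2
  exact (this.differentiable one_ne_zero x).hasDerivAt

/-- Classical solutions of `u'' = W u` are weak solutions. -/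
theorem schr_toE_eq_zero {W : ℝ →ᵇ ℝ} {u : ℝ → ℝ} (hu : IsH1 u) (hu2 : ContDiff ℝ 2 u)
    (h : ∀ x, deriv (deriv u) x = W x * u x) : schr W hu.toE = 0 := by
  have key : ∀ g : E, inner ℝ (schr W hu.toE) g = 0 := by
    refine E_induction (isClosed_eq (by fun_prop) continuous_const) fun v hv => ?_
    rw [inner_schr_toE, ← (isH1_deriv hu hu2 h).integral_deriv_mul hv]
    congr 1; ext x
    rw [h]; ring
  exact inner_self_eq_zero.1 (key _)

/-- `ev` inverts ∂ₓ + 1, so the adjoint inverts -∂ₓ + 1; its solution is `solve` conjugated by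
reflection. The derivative gained here makes weak solutions classical. -/
theorem adjoint_emb_toLp {F : ℝ → ℝ} (hF : MemLp F 2 volume) (hc : Continuous F) :
    ∃ (g : ℝ → ℝ) (hg : IsH1 g), (∀ x, HasDerivAt g (g x - F x) x) ∧
      ContinuousLinearMap.adjoint emb (hF.toLp F) = hg.memLp.toLp g := by
  have hF' := memLp_comp_neg hF
  have hc' : Continuous fun x => F (-x) := hc.comp continuous_neg
  have hg := (isH1_solve hF' hc').comp_neg
  have hd : ∀ x, HasDerivAt (fun x => solve (fun x => F (-x)) (-x))
      (solve (fun x => F (-x)) (-x) - F x) x := fun x => by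
    refine ((hasDerivAt_solve hF' hc' (-x)).comp x (hasDerivAt_neg x)).congr_deriv ?_
    simp
  refine ⟨_, hg, hd, ?_⟩
  have key : ∀ h : E, inner ℝ (ContinuousLinearMap.adjoint emb (hF.toLp F) - hg.memLp.toLp _) h
      = 0 := by
    refine E_induction (isClosed_eq (by fun_prop) continuous_const) fun v hv => ?_
    rw [inner_sub_left, ContinuousLinearMap.adjoint_inner_left,
      inner_eq_integral hF.coeFn_toLp (coe_emb _), ev_toE,
      inner_eq_integral hg.memLp.coeFn_toLp hv.coe_toE, ← integral_sub]
    · rw [← neg_eq_zero, ← integral_neg, ← hg.integral_deriv_mul hv]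
      congr 1; ext x
      rw [(hd x).deriv]
      ring
    · exact integrable_mul_of_memLp hF hv.memLp
    · exact integrable_mul_of_memLp hg.memLp hv.memLp_add
  exact sub_eq_zero.1 (inner_self_eq_zero.1 (key _))

/-- Weak solutions of `u'' = W u` are classical solutions. -/
theorem classical_of_schr_eq_zero {W : ℝ →ᵇ ℝ} {f : E} (h : schr W f = 0) :
    (∃ hu : IsH1 (ev f), hu.toE = f) ∧ ContDiff ℝ 2 (ev f) ∧
      ∀ x, deriv (deriv (ev f)) x = W x * ev f x := by
  have hF := memLp_bdd_mul (1 - W).continuous (1 - W).norm_coe_le_norm (memLp_ev f)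
  have hFc : Continuous fun x => (1 - W) x * ev f x := (1 - W).continuous.mul (ev f).continuous
  obtain ⟨g, hg, hd, hgE⟩ := adjoint_emb_toLp hF hFc
  have hf : f = hg.memLp.toLp g := by
    rw [← hgE]
    have h1 : mulOp (1 - W) (emb f) = hF.toLp _ := by
      refine Lp.ext ((coe_mulOp_emb _ f).trans hF.coeFn_toLp.symm)
    -- Since `schr W = 1 + pot (W - 1)`, a kernel element lies in the range of the adjoint of `emb`,
    -- and so f = u' + u is itself C¹.
    have h2 : f = pot (1 - W) f := by
      rw [schr_apply, ← neg_sub, map_neg, neg_apply, ← sub_eq_add_neg] at h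
      exact sub_eq_zero.1 h
    conv_lhs => rw [h2, pot_apply, h1]
  have hev : ⇑(ev f) = solve g := by
    conv_lhs => rw [hf]
    exact ev_toLp hg.memLp
  have hH1 : IsH1 (ev f) := by rw [hev]; exact isH1_solve hg.memLp hg.continuous
  have hd1 : ∀ x, HasDerivAt (ev f) (g x - ev f x) x := fun x => by
    rw [hev]; exact hasDerivAt_solve hg.memLp hg.continuous x
  have hd1' : deriv (ev f) = fun x => g x - ev f x := funext fun x => (hd1 x).deriv
  have hd2 : ∀ x, HasDerivAt (deriv (ev f)) (W x * ev f x) x := fun x => by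
    rw [hd1']
    refine ((hd x).sub (hd1 x)).congr_deriv ?_
    simp only [BoundedContinuousFunction.coe_sub, BoundedContinuousFunction.coe_one, Pi.sub_apply,
      Pi.one_apply]
    ring
  have hd2' : deriv (deriv (ev f)) = fun x => W x * ev f x := funext fun x => (hd2 x).deriv
  refine ⟨⟨hH1, ?_⟩, ?_, fun x => (hd2 x).deriv⟩
  · have : ∀ (u : ℝ → ℝ) (hu : IsH1 u), u = solve g → hu.toE = f := by
      rintro u hu rfl
      rw [hf]; exact toE_solve hg.memLp hg.continuous
    exact this _ _ hev
  · rw [show (2 : WithTop ℕ∞) = 1 + 1 by norm_num, contDiff_succ_iff_deriv]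
    refine ⟨hH1.contDiff.differentiable one_ne_zero, by simp, ?_⟩
    rw [contDiff_one_iff_deriv]
    refine ⟨fun x => (hd2 x).differentiableAt, ?_⟩
    rw [hd2']
    exact W.continuous.mul (ev f).continuous

/-! ### Reflection -/

/-- The operator on `E` representing the reflection `u ↦ u(-·)`. -/
noncomputable def reflect : E →L[ℝ] E :=
  (Lp.compMeasurePreservingₗᵢ ℝ (fun x : ℝ => -x)
    (Measure.measurePreserving_neg volume)).toContinuousLinearMap ∘L ((2 : ℝ) • emb - 1)

/-- The derivative of u(-·) plus u(-·) is the reflection of u - u' = 2u - (u' + u), whence the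
factor `2 • emb - 1`. -/
theorem reflect_toE {u : ℝ → ℝ} (hu : IsH1 u) : reflect hu.toE = hu.comp_neg.toE := by
  have h0 : (emb hu.toE : ℝ → ℝ) =ᵐ[volume] u := by
    have := coe_emb hu.toE
    rwa [ev_toE] at this
  have h1 : (((2 : ℝ) • emb - 1) hu.toE : ℝ → ℝ) =ᵐ[volume] fun x => u x - deriv u x := by
    have e : ((2 : ℝ) • emb - 1) hu.toE = (2 : ℝ) • emb hu.toE - hu.toE := rfl
    rw [e]
    filter_upwards [h0, hu.coe_toE, Lp.coeFn_sub ((2 : ℝ) • emb hu.toE) hu.toE,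
      Lp.coeFn_smul (2 : ℝ) (emb hu.toE)] with x h1 h2 h3 h4
    rw [h3, Pi.sub_apply, h4, Pi.smul_apply, h1, h2, smul_eq_mul]
    ring
  refine Lp.ext ?_
  have hmp := Measure.measurePreserving_neg (volume : Measure ℝ)
  have h2 : (reflect hu.toE : ℝ → ℝ) =ᵐ[volume] (((2 : ℝ) • emb - 1) hu.toE : ℝ → ℝ) ∘ Neg.neg :=
    Lp.coeFn_compMeasurePreserving _ hmp
  filter_upwards [h2, hmp.quasiMeasurePreserving.ae h1, hu.comp_neg.coe_toE] with x h3 h4 h5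
  rw [h3, h5, Function.comp_apply, h4, (hu.hasDerivAt_comp_neg x).deriv]
  ring

theorem ev_reflect (f : E) (x : ℝ) : ev (reflect f) x = ev f (-x) := by
  revert f
  refine E_induction (isClosed_eq ?_ ?_) fun u hu => ?_
  · exact ((BoundedContinuousFunction.evalCLM ℝ x).continuous).comp (ev ∘L reflect).continuous
  · exact ((BoundedContinuousFunction.evalCLM ℝ (-x)).continuous).comp ev.continuous
  · rw [reflect_toE, ev_toE, ev_toE]

theorem inner_reflect (f h : E) : inner ℝ (reflect f) (reflect h) = inner ℝ f h := by
  revert f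
  refine E_induction (isClosed_eq (by fun_prop) (by fun_prop)) fun u hu => ?_
  revert h
  refine E_induction (isClosed_eq (by fun_prop) (by fun_prop)) fun v hv => ?_
  rw [reflect_toE, reflect_toE, IsH1.inner_toE, IsH1.inner_toE, ← integral_neg_eq_self]
  congr 1; ext x
  rw [(hu.hasDerivAt_comp_neg _).deriv, (hv.hasDerivAt_comp_neg _).deriv]
  simp

theorem reflect_reflect (f : E) : reflect (reflect f) = f := by
  revert f
  refine E_induction (isClosed_eq (by fun_prop) (by fun_prop)) fun u hu => ?_
  rw [reflect_toE, reflect_toE]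
  congr 1; ext x; simp

theorem norm_reflect (f : E) : ‖reflect f‖ = ‖f‖ := by
  rw [@norm_eq_sqrt_real_inner _ _ _ (reflect f), inner_reflect, ← norm_eq_sqrt_real_inner]

theorem inner_reflect_left (f h : E) : inner ℝ (reflect f) h = inner ℝ f (reflect h) := by
  rw [← inner_reflect f, reflect_reflect]

theorem pot_reflect {w w' : ℝ →ᵇ ℝ} (hw : ∀ x, w' x = w (-x)) (f : E) :
    pot w' (reflect f) = reflect (pot w f) := by
  refine ext_inner_right ℝ fun h => ?_
  rw [inner_reflect_left, inner_pot, inner_pot, ← integral_neg_eq_self]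
  congr 1; ext x
  rw [ev_reflect, ev_reflect, hw, neg_neg]

theorem schr_reflect {w w' : ℝ →ᵇ ℝ} (hw : ∀ x, w' x = w (-x)) (f : E) :
    schr w' (reflect f) = reflect (schr w f) := by
  rw [schr_apply, schr_apply, map_add, pot_reflect (w := w - 1)]
  intro x
  simp [hw]

/-! ### Square integrable solutions of u'' = qu -/

section ODE

theorem hasDerivAt_of_contDiff_two {u : ℝ → ℝ} (hu : ContDiff ℝ 2 u) (x : ℝ) :
    HasDerivAt u (deriv u x) x ∧ HasDerivAt (deriv u) (deriv (deriv u) x) x := by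
  have h2 : ContDiff ℝ (1 + 1) u := by simpa [one_add_one_eq_two] using hu
  exact ⟨(hu.differentiable two_ne_zero x).hasDerivAt,
    ((contDiff_succ_iff_deriv.1 h2).2.2.differentiable one_ne_zero x).hasDerivAt⟩

theorem contDiff_one_deriv {u : ℝ → ℝ} (hu : ContDiff ℝ 2 u) : ContDiff ℝ 1 (deriv u) := by
  have h2 : ContDiff ℝ (1 + 1) u := by simpa [one_add_one_eq_two] using hu
  exact (contDiff_succ_iff_deriv.1 h2).2.2

/-- Uniqueness for the initial value problem of `u'' = q u`. -/
theorem ode_unique {u q : ℝ → ℝ} {C : ℝ} (hu : ContDiff ℝ 2 u) (hq : ∀ x, |q x| ≤ C)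
    (h : ∀ x, deriv (deriv u) x = q x * u x) {x₀ : ℝ} (h0 : u x₀ = 0) (h1 : deriv u x₀ = 0) :
    u = 0 := by
  have hd : ∀ x, HasDerivAt (fun x => u x ^ 2 + deriv u x ^ 2)
      (2 * (1 + q x) * (u x * deriv u x)) x := fun x => by
    obtain ⟨a, b⟩ := hasDerivAt_of_contDiff_two hu x
    refine ((a.pow 2).add (b.pow 2)).congr_deriv ?_
    rw [h]
    simp only [Nat.cast_ofNat, Nat.add_one_sub_one, pow_one]
    ring
  have hb : ∀ x, |2 * (1 + q x) * (u x * deriv u x)| ≤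
      (1 + C) * (u x ^ 2 + deriv u x ^ 2) := fun x => by
    have e : 2 * (1 + q x) * (u x * deriv u x) = (1 + q x) * (2 * (u x * deriv u x)) := by ring
    rw [e, abs_mul]
    have h2 : |1 + q x| ≤ 1 + C := (abs_add_le _ _).trans (by rw [abs_one]; linarith [hq x])
    have h3 : |2 * (u x * deriv u x)| ≤ u x ^ 2 + deriv u x ^ 2 := by
      rw [abs_le]
      constructor <;> nlinarith [sq_nonneg (u x - deriv u x), sq_nonneg (u x + deriv u x)]
    exact mul_le_mul h2 h3 (abs_nonneg _) ((abs_nonneg _).trans h2)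
  have hexp : ∀ k x : ℝ, HasDerivAt (fun x => Real.exp (k * x)) (k * Real.exp (k * x)) x :=
    fun k x => by
      refine (((hasDerivAt_id x).const_mul k).exp).congr_deriv ?_
      simp only [id, mul_one]; ring
  have hprod : ∀ k x : ℝ, HasDerivAt (fun x => (u x ^ 2 + deriv u x ^ 2) * Real.exp (k * x))
      ((2 * (1 + q x) * (u x * deriv u x) + k * (u x ^ 2 + deriv u x ^ 2)) * Real.exp (k * x)) x :=
    fun k x => by
      refine ((hd x).mul (hexp k x)).congr_deriv ?_
      ring
  -- Grönwall in both directions: u² + u'² times e^{±(1+C)x} is monotone or antitone, nonnegative,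
  -- and zero at x₀.
  have hmono : Monotone fun x => (u x ^ 2 + deriv u x ^ 2) * Real.exp ((1 + C) * x) := by
    refine monotone_of_hasDerivAt_nonneg (hprod _) fun x => ?_
    refine mul_nonneg ?_ (Real.exp_pos _).le
    linarith [(abs_le.1 (hb x)).1]
  have hanti : Antitone fun x => (u x ^ 2 + deriv u x ^ 2) * Real.exp (-(1 + C) * x) := by
    refine antitone_of_hasDerivAt_nonpos (hprod _) fun x => ?_
    refine mul_nonpos_of_nonpos_of_nonneg ?_ (Real.exp_pos _).le
    linarith [(abs_le.1 (hb x)).2]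
  ext x
  have hz : u x ^ 2 + deriv u x ^ 2 ≤ 0 := by
    rcases le_total x x₀ with hx | hx
    · have := hmono hx
      simp only [h0, h1] at this
      exact nonpos_of_mul_nonpos_left (by simpa using this) (Real.exp_pos ((1 + C) * x))
    · have := hanti hx
      simp only [h0, h1] at this
      exact nonpos_of_mul_nonpos_left (by simpa using this) (Real.exp_pos (-(1 + C) * x))
  have : u x ^ 2 ≤ 0 := by nlinarith [sq_nonneg (deriv u x)]
  simpa using this

/-- If y' stayed above 1 on [R, ∞), then y ≥ 1 on [R + 1, ∞), against integrability. For y = u² this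
supplies arbitrarily distant limits of integration at which 2uu' ≤ 1. -/
theorem exists_deriv_le_one {y y' : ℝ → ℝ} (hy : ∀ x, HasDerivAt y (y' x) x) (h0 : ∀ x, 0 ≤ y x)
    (hi : Integrable y) (R : ℝ) : ∃ x, R ≤ x ∧ y' x ≤ 1 := by
  by_contra! hcon
  have h1 : ∀ x ∈ Ici (R + 1), 1 ≤ y x := by
    intro x hx
    have hx' : R + 1 ≤ x := hx
    have hm : MonotoneOn (fun x => y x - x) (Ici R) := by
      refine monotoneOn_of_deriv_nonneg (convex_Ici R)
        (fun z _ => ((hy z).continuousAt.sub continuousAt_id).continuousWithinAt)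
        (fun z _ => ((hy z).sub (hasDerivAt_id z)).differentiableAt.differentiableWithinAt) ?_
      intro z hz
      rw [interior_Ici] at hz
      have : deriv (fun x => y x - x) z = y' z - 1 := ((hy z).sub (hasDerivAt_id z)).deriv
      rw [this]
      linarith [hcon z (le_of_lt hz)]
    have := hm (show R ∈ Ici R from le_refl R) (show x ∈ Ici R by simp only [mem_Ici]; linarith)
      (by linarith)
    simp only at this
    linarith [h0 R]
  have h2 := hi.measure_ge_lt_top (ε := 1) one_pos
  have h3 : volume (Ici (R + 1)) ≤ volume {x | 1 ≤ y x} := measure_mono h1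
  rw [Real.volume_Ici] at h3
  exact absurd h2 (not_lt.2 h3)

/-- Integrate (uu')' = u'² + qu² between points -aₙ and bₙ at which each boundary term contributes
at most 1/2: this bounds ∫u'² by 1 + C∫u², uniformly in n. -/
theorem isH1_of_classical {u : ℝ → ℝ} {q : ℝ → ℝ} {C : ℝ} (hqc : Continuous q)
    (hq : ∀ x, |q x| ≤ C) (hu : ContDiff ℝ 2 u) (hL : MemLp u 2 volume)
    (h : ∀ x, deriv (deriv u) x = q x * u x) : IsH1 u := by
  have hd := hasDerivAt_of_contDiff_two hu
  have hsq : ∀ x, HasDerivAt (fun x => u x ^ 2) (2 * (u x * deriv u x)) x := fun x => by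
    refine ((hd x).1.pow 2).congr_deriv ?_
    simp only [Nat.cast_ofNat, Nat.add_one_sub_one, pow_one]; ring
  have hsq' : ∀ x, HasDerivAt (fun x => u (-x) ^ 2) (-(2 * (u (-x) * deriv u (-x)))) x :=
    fun x => ((hsq (-x)).comp x (hasDerivAt_neg x)).congr_deriv (by ring)
  have hi := hL.integrable_sq
  choose b hb hb' using fun n : ℕ => exists_deriv_le_one hsq (fun x => sq_nonneg _) hi n
  choose a ha ha' using fun n : ℕ => exists_deriv_le_one hsq' (fun x => sq_nonneg _) hi.comp_neg n
  have hcd := contDiff_one_deriv hu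
  have hint : Integrable fun x => deriv u x ^ 2 := by
    refine integrable_of_intervalIntegral_norm_bounded (l := atTop) (a := fun n => -a n) (b := b)
      (1 + C * ∫ x, u x ^ 2) (fun n => ?_) ?_ ?_ ?_
    · exact ((hcd.continuous.pow 2).integrableOn_Icc).mono_set Ioc_subset_Icc_self
    · exact tendsto_neg_atTop_atBot.comp
        (tendsto_atTop_mono ha tendsto_natCast_atTop_atTop)
    · exact tendsto_atTop_mono hb tendsto_natCast_atTop_atTop
    · refine Eventually.of_forall fun n => ?_
      have hab : -a n ≤ b n := by
        have h1 : (0 : ℝ) ≤ n := n.cast_nonneg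
        linarith [ha n, hb n]
      have h1 : ∀ x ∈ uIcc (-a n) (b n), HasDerivAt (fun x => u x * deriv u x)
          (deriv u x ^ 2 + q x * u x ^ 2) x := fun x _ => by
        refine ((hd x).1.mul (hd x).2).congr_deriv ?_
        rw [h]; ring
      have hc1 : Continuous fun x => deriv u x ^ 2 := hcd.continuous.pow 2
      have hc2 : Continuous fun x => q x * u x ^ 2 := hqc.mul (hu.continuous.pow 2)
      have h2 := intervalIntegral.integral_eq_sub_of_hasDerivAt h1
        ((hc1.add hc2).intervalIntegrable _ _)
      rw [intervalIntegral.integral_add (hc1.intervalIntegrable _ _)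
        (hc2.intervalIntegrable _ _)] at h2
      have h3 : -∫ x in (-a n)..b n, q x * u x ^ 2 ≤ C * ∫ x, u x ^ 2 := by
        rw [← intervalIntegral.integral_neg, intervalIntegral.integral_of_le hab,
          ← integral_const_mul]
        have hC : Integrable fun x => C * u x ^ 2 := hi.const_mul C
        refine (setIntegral_mono_on (hc2.neg.integrableOn_Icc.mono_set Ioc_subset_Icc_self)
          hC.integrableOn measurableSet_Ioc fun x _ => ?_).trans
          (setIntegral_le_integral hC (Eventually.of_forall fun x => ?_))
        · have := (abs_le.1 (hq x)).1
          have h2 : 0 ≤ (q x + C) * u x ^ 2 := mul_nonneg (by linarith) (sq_nonneg _)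
          simp only [Pi.neg_apply]
          linarith
        · have := (abs_nonneg _).trans (hq x)
          exact mul_nonneg this (sq_nonneg _)
      have h4 : (∫ x in (-a n)..b n, ‖deriv u x ^ 2‖) = ∫ x in (-a n)..b n, deriv u x ^ 2 := by
        congr 1; ext x
        rw [Real.norm_eq_abs, abs_of_nonneg (sq_nonneg _)]
      rw [h4]
      have h5 := hb' n
      have h6 := ha' n
      linarith
  exact ⟨hu.of_le (by norm_num), hL,
    (memLp_two_iff_integrable_sq hcd.continuous.aestronglyMeasurable).2 hint⟩

/-- `u` is an `H¹`, classical solution of `u'' = q u`. -/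
structure IsSol (q u : ℝ → ℝ) : Prop where
  isH1 : IsH1 u
  contDiff : ContDiff ℝ 2 u
  eq : ∀ x, deriv (deriv u) x = q x * u x

namespace IsSol
variable {q q' u v : ℝ → ℝ}

theorem hasDerivAt_deriv (h : IsSol q u) (x : ℝ) : HasDerivAt (deriv u) (q x * u x) x := by
  rw [← h.eq]; exact (hasDerivAt_of_contDiff_two h.contDiff x).2

theorem comp_neg (h : IsSol q u) (hq : ∀ x, q (-x) = q x) : IsSol q fun x => u (-x) := by
  refine ⟨h.isH1.comp_neg, h.contDiff.comp contDiff_neg, fun x => ?_⟩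
  have : deriv (fun x => u (-x)) = fun x => -deriv u (-x) :=
    funext fun x => (h.isH1.hasDerivAt_comp_neg x).deriv
  rw [this]
  have h2 := ((h.hasDerivAt_deriv (-x)).comp x (hasDerivAt_neg x)).neg
  rw [show (fun x => -deriv u (-x)) = -(deriv u ∘ Neg.neg) from rfl, h2.deriv, hq]
  ring

/-- The Wronskian is constant, and it is integrable because u, v, u', v' lie in L²; on the line it
must vanish. Square integrable solutions thus form a space of dimension at most one. -/
theorem wronskian (hu : IsSol q u) (hv : IsSol q v) (x : ℝ) :
    u x * deriv v x = deriv u x * v x := by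
  have hd : ∀ x, HasDerivAt (fun x => u x * deriv v x - deriv u x * v x) 0 x := fun x => by
    refine (((hu.isH1.hasDerivAt x).mul (hv.hasDerivAt_deriv x)).sub
      ((hu.hasDerivAt_deriv x).mul (hv.isH1.hasDerivAt x))).congr_deriv ?_
    ring
  have hc := is_const_of_deriv_eq_zero (fun x => (hd x).differentiableAt) fun x => (hd x).deriv
  have hi : Integrable fun x => u x * deriv v x - deriv u x * v x :=
    (integrable_mul_of_memLp hu.isH1.memLp hv.isH1.memLp_deriv).sub
      (integrable_mul_of_memLp hu.isH1.memLp_deriv hv.isH1.memLp)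
  have h2 : (fun y => u y * deriv v y - deriv u y * v y) =
      fun _ => u x * deriv v x - deriv u x * v x := funext fun y => hc y x
  rw [h2, integrable_const_iff] at hi
  rcases hi with h | h
  · linarith
  · have := h.measure_univ_lt_top
    simp at this

theorem eq_const_mul {C : ℝ} (hq : ∀ x, |q x| ≤ C) (hu : IsSol q u) (hv : IsSol q v)
    (hv0 : v ≠ 0) : ∃ c : ℝ, u = fun x => c * v x := by
  obtain ⟨x₀, hx₀⟩ := Function.ne_iff.1 hv0
  have hx₀' : v x₀ ≠ 0 := hx₀
  set c := u x₀ / v x₀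
  refine ⟨c, ?_⟩
  have hd : deriv (fun x => u x - c * v x) = fun x => deriv u x - c * deriv v x :=
    funext fun x => ((hu.isH1.hasDerivAt x).sub ((hv.isH1.hasDerivAt x).const_mul c)).deriv
  have h0 : (fun x => u x - c * v x) = 0 := by
    refine ode_unique (q := q) (hu.contDiff.sub (contDiff_const.mul hv.contDiff)) hq (x₀ := x₀)
      (fun x => ?_) ?_ ?_
    · rw [hd]
      have := ((hu.hasDerivAt_deriv x).sub ((hv.hasDerivAt_deriv x).const_mul c)).deriv
      rw [show (fun x => deriv u x - c * deriv v x) = deriv u - fun x => c * deriv v x from rfl,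
        this]
      ring
    · simp only [c]; field_simp; ring
    · rw [hd]
      have := hu.wronskian hv x₀
      simp only [c]
      field_simp
      linarith
  ext x
  have := congrFun h0 x
  simp only [Pi.zero_apply] at this
  linarith

/-- The reflected solution is a multiple cu, and reflecting twice gives c² = 1. -/
theorem even_or_odd {C : ℝ} (hq : ∀ x, |q x| ≤ C) (hqe : ∀ x, q (-x) = q x) (hu : IsSol q u) :
    (∀ x, u (-x) = u x) ∨ ∀ x, u (-x) = -u x := by
  by_cases h0 : u = 0
  · left; simp [h0]
  obtain ⟨c, hc⟩ := eq_const_mul hq (hu.comp_neg hqe) hu h0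
  obtain ⟨x₀, hx₀⟩ := Function.ne_iff.1 h0
  have hx₀' : u x₀ ≠ 0 := hx₀
  have h1 : ∀ x, u (-x) = c * u x := congrFun hc
  have h2 : c * c = 1 := by
    have := h1 (-x₀)
    rw [neg_neg, h1 x₀] at this
    have h3 : (c * c - 1) * u x₀ = 0 := by linarith
    rcases mul_eq_zero.1 h3 with h | h
    · linarith
    · exact absurd h hx₀'
  rcases mul_self_eq_one_iff.1 h2 with h | h
  · left; intro x; rw [h1, h, one_mul]
  · right; intro x; rw [h1, h]; ring

/-- (w' - w)uv is the derivative of the Wronskian. -/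
theorem integral_mul_eq_zero {w w' : ℝ} (hu : IsSol (fun x => q x + w) u)
    (hv : IsSol (fun x => q x + w') v) (hw : w ≠ w') : ∫ x, u x * v x = 0 := by
  have hd : ∀ x, HasDerivAt (fun x => u x * deriv v x - deriv u x * v x)
      ((w' - w) * (u x * v x)) x := fun x => by
    refine (((hu.isH1.hasDerivAt x).mul (hv.hasDerivAt_deriv x)).sub
      ((hu.hasDerivAt_deriv x).mul (hv.isH1.hasDerivAt x))).congr_deriv ?_
    ring
  have h := integral_eq_zero_of_hasDerivAt_of_integrable hd
    ((integrable_mul_of_memLp hu.isH1.memLp hv.isH1.memLp).const_mul _)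
    ((integrable_mul_of_memLp hu.isH1.memLp hv.isH1.memLp_deriv).sub
      (integrable_mul_of_memLp hu.isH1.memLp_deriv hv.isH1.memLp))
  rw [integral_const_mul] at h
  rcases mul_eq_zero.1 h with h | h
  · exact absurd (by linarith) hw
  · exact h

end IsSol

theorem IsH1.bdd_mul {h u : ℝ → ℝ} {C C' : ℝ} (hh : ContDiff ℝ 1 h) (hC : ∀ x, |h x| ≤ C)
    (hC' : ∀ x, |deriv h x| ≤ C') (hu : IsH1 u) : IsH1 fun x => h x * u x :=
  IsH1.of_hasDerivAt (u' := fun x => deriv h x * u x + h x * deriv u x)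
    (fun x => ((hh.differentiable one_ne_zero x).hasDerivAt).mul (hu.hasDerivAt x))
    (((hh.continuous_deriv le_rfl).mul hu.continuous).add (hh.continuous.mul hu.continuous_deriv))
    (memLp_bdd_mul hh.continuous hC hu.memLp)
    ((memLp_bdd_mul (hh.continuous_deriv le_rfl) hC' hu.memLp).add
      (memLp_bdd_mul hh.continuous hC hu.memLp_deriv))

/-- The localization formula for the quadratic form of a Schrödinger operator. -/
theorem IsSol.form_mul {q u h : ℝ → ℝ} {w C C' B : ℝ} (hqc : Continuous q) (hq : ∀ x, |q x| ≤ B)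
    (hu : IsSol (fun x => q x + w) u) (hh : ContDiff ℝ 1 h) (hC : ∀ x, |h x| ≤ C)
    (hC' : ∀ x, |deriv h x| ≤ C') :
    ∫ x, (deriv (fun x => h x * u x) x ^ 2 + q x * (h x * u x) ^ 2) =
      (∫ x, (deriv h x * u x) ^ 2) - w * ∫ x, (h x * u x) ^ 2 := by
  have hhu := hu.isH1.bdd_mul hh hC hC'
  have h2u := hhu.bdd_mul hh hC hC'
  have hdh := fun x => (hh.differentiable one_ne_zero x).hasDerivAt
  have hd1 : ∀ x, deriv (fun x => h x * u x) x = deriv h x * u x + h x * deriv u x := fun x =>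
    ((hdh x).mul (hu.isH1.hasDerivAt x)).deriv
  have hd2 : ∀ x, deriv (fun x => h x * (h x * u x)) x =
      deriv h x * (h x * u x) + h x * (deriv h x * u x + h x * deriv u x) := fun x => by
    rw [← hd1]; exact ((hdh x).mul (hhu.hasDerivAt x)).deriv
  have hud : IsH1 (deriv u) := by
    refine IsH1.of_hasDerivAt hu.hasDerivAt_deriv
      ((hqc.add continuous_const).mul hu.isH1.continuous) hu.isH1.memLp_deriv
      (memLp_bdd_mul (C := B + |w|) (hqc.add continuous_const) (fun x => ?_) hu.isH1.memLp)
    exact (abs_add_le _ _).trans (add_le_add (hq x) le_rfl)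
  -- The two integrands differ by the derivative of h²uu', which integrates to zero.
  have hz := h2u.integral_deriv_mul hud
  have hm1 : MemLp (fun x => deriv h x * u x) 2 volume :=
    memLp_bdd_mul (hh.continuous_deriv le_rfl) hC' hu.isH1.memLp
  have e1 := integrable_sq_of_memLp hm1
  have e2 := (integrable_sq_of_memLp hhu.memLp).const_mul w
  have e3 : Integrable fun x => (deriv h x * u x) ^ 2 - w * (h x * u x) ^ 2 := e1.sub e2
  have e4 : Integrable fun x => deriv (fun x => h x * (h x * u x)) x * deriv u x +
      h x * (h x * u x) * deriv (deriv u) x :=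
    (integrable_mul_of_memLp h2u.memLp_deriv hud.memLp).add
      (integrable_mul_of_memLp h2u.memLp hud.memLp_deriv)
  rw [← add_zero ((∫ x, (deriv h x * u x) ^ 2) - w * ∫ x, (h x * u x) ^ 2), ← hz,
    ← integral_const_mul, ← integral_sub e1 e2, ← integral_add e3 e4]
  congr 1; ext x
  rw [hd1, hd2, hu.eq]
  ring

end ODE

/-! ### Odd cutoffs at symmetric zeros -/

section Cutoff

theorem hasDerivAt_max_sq (t : ℝ) : HasDerivAt (fun t : ℝ => max t 0 ^ 2) (2 * max t 0) t := by
  rcases lt_trichotomy t 0 with h | h | h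
  · have : (fun t : ℝ => max t 0 ^ 2) =ᶠ[𝓝 t] fun _ => 0 := by
      filter_upwards [Iio_mem_nhds h] with s hs
      rw [max_eq_right (le_of_lt hs)]; norm_num
    rw [max_eq_right h.le, mul_zero]
    exact (hasDerivAt_const t (0 : ℝ)).congr_of_eventuallyEq this
  · subst h
    rw [hasDerivAt_iff_isLittleO_nhds_zero]
    simp only [zero_add, max_self, mul_zero, smul_zero, sub_zero, ne_eq, OfNat.ofNat_ne_zero,
      not_false_eq_true, zero_pow]
    refine Asymptotics.IsBigO.trans_isLittleO (g := fun h : ℝ => h ^ 2) ?_ ?_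
    · refine Asymptotics.IsBigO.of_bound 1 (Eventually.of_forall fun h => ?_)
      rw [one_mul, norm_pow, norm_pow]
      gcongr
      rw [Real.norm_eq_abs, Real.norm_eq_abs, abs_of_nonneg (le_max_right _ _)]
      exact max_le (le_abs_self _) (abs_nonneg _)
    · simpa using (Asymptotics.isLittleO_pow_pow (𝕜 := ℝ) (one_lt_two : 1 < 2))
  · have : (fun t : ℝ => max t 0 ^ 2) =ᶠ[𝓝 t] fun t => t ^ 2 := by
      filter_upwards [Ioi_mem_nhds h] with s hs
      rw [max_eq_left (le_of_lt hs)]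
    rw [max_eq_left h.le]
    refine HasDerivAt.congr_of_eventuallyEq ?_ this
    simpa using hasDerivAt_pow 2 t

/-- A `C¹` approximation of the indicator function of the positive half line. -/
noncomputable def step (η t : ℝ) : ℝ := max t 0 ^ 2 / (max t 0 ^ 2 + η ^ 2)

/-- The derivative of `step`. -/
noncomputable def stepDeriv (η t : ℝ) : ℝ := 2 * max t 0 * η ^ 2 / (max t 0 ^ 2 + η ^ 2) ^ 2

variable {η : ℝ}

theorem hasDerivAt_step (hη : 0 < η) (t : ℝ) : HasDerivAt (step η) (stepDeriv η t) t := by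
  have hp : max t 0 ^ 2 + η ^ 2 ≠ 0 := by positivity
  have h := hasDerivAt_max_sq t
  refine (h.div (h.add_const (η ^ 2)) hp).congr_deriv ?_
  rw [stepDeriv]
  congr 1; ring

theorem continuous_stepDeriv (hη : 0 < η) : Continuous (stepDeriv η) := by
  unfold stepDeriv
  refine Continuous.div (by fun_prop) (by fun_prop) fun t => ?_
  positivity

theorem step_of_nonpos {t : ℝ} (ht : t ≤ 0) : step η t = 0 := by
  simp [step, max_eq_right ht]

theorem stepDeriv_of_nonpos {t : ℝ} (ht : t ≤ 0) : stepDeriv η t = 0 := by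
  simp [stepDeriv, max_eq_right ht]

theorem step_nonneg (t : ℝ) : 0 ≤ step η t := by unfold step; positivity

theorem step_le_one (hη : 0 < η) (t : ℝ) : step η t ≤ 1 := by
  rw [step, div_le_one (by positivity)]
  nlinarith

theorem stepDeriv_nonneg (t : ℝ) : 0 ≤ stepDeriv η t := by unfold stepDeriv; positivity

theorem stepDeriv_le (hη : 0 < η) (t : ℝ) : stepDeriv η t ≤ 1 / η := by
  rw [stepDeriv, div_le_div_iff₀ (by positivity) hη]
  set m := max t 0
  have h0 : 0 ≤ m := le_max_right _ _
  have h1 : 2 * m * η ≤ m ^ 2 + η ^ 2 := by nlinarith [sq_nonneg (m - η)]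
  have h2 : η ^ 2 ≤ m ^ 2 + η ^ 2 := by nlinarith
  have := mul_le_mul h1 h2 (by positivity) (by positivity)
  nlinarith

/-- Here 1 - `step` equals (1 + (t/η)²)⁻¹ and 1 - `step`² ≤ 2(1 - `step`), so the mass lost by the
cutoff is controlled by a bump of integral O(η). -/
theorem one_sub_step_sq_le (hη : 0 < η) {t : ℝ} (ht : 0 ≤ t) :
    1 - step η t ^ 2 ≤ 2 * (1 + (t / η) ^ 2)⁻¹ := by
  have h : (1 + (t / η) ^ 2)⁻¹ = 1 - step η t := by
    rw [step, max_eq_left ht]; field_simp; ring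
  rw [h]
  nlinarith [step_nonneg (η := η) t, step_le_one hη t, sq_nonneg (1 - step η t)]

/-- The factor t² stands for u² near a zero of u, where |u| ≤ L|t|. It compensates the slope of size
1/η and leaves a bump of integral O(η). -/
theorem stepDeriv_sq_mul_le (hη : 0 < η) {t : ℝ} (ht : 0 ≤ t) :
    stepDeriv η t ^ 2 * t ^ 2 ≤ 4 * (1 + (t / η) ^ 2)⁻¹ := by
  have h : (1 + (t / η) ^ 2)⁻¹ = η ^ 2 / (t ^ 2 + η ^ 2) := by field_simp; ring
  rw [h, stepDeriv, max_eq_left ht, div_pow, div_mul_eq_mul_div, mul_div_assoc',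
    div_le_div_iff₀ (by positivity) (by positivity)]
  have h1 : t ^ 2 ≤ t ^ 2 + η ^ 2 := by nlinarith
  have h2 : η ^ 2 ≤ t ^ 2 + η ^ 2 := by nlinarith
  set D := t ^ 2 + η ^ 2
  have hD : 0 < D := by positivity
  have : (2 * t * η ^ 2) ^ 2 * t ^ 2 * D = 4 * η ^ 2 * (t ^ 2 * t ^ 2 * η ^ 2 * D) := by ring
  rw [this]
  have h3 : t ^ 2 * t ^ 2 * η ^ 2 * D ≤ D * D * D * D := by gcongr
  calc 4 * η ^ 2 * (t ^ 2 * t ^ 2 * η ^ 2 * D) ≤ 4 * η ^ 2 * (D * D * D * D) := by gcongr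
    _ = 4 * η ^ 2 * (D ^ 2) ^ 2 := by ring

theorem integrable_bump (hη : 0 < η) (a : ℝ) :
    Integrable (fun x : ℝ => (1 + ((x - a) / η) ^ 2)⁻¹) ∧
      ∫ x : ℝ, (1 + ((x - a) / η) ^ 2)⁻¹ = η * Real.pi := by
  have h1 := (integrable_inv_one_add_sq.comp_div hη.ne').comp_sub_right a
  refine ⟨h1, ?_⟩
  rw [integral_sub_right_eq_self (fun x : ℝ => (1 + (x / η) ^ 2)⁻¹) a,
    Measure.integral_comp_div (fun x : ℝ => (1 + x ^ 2)⁻¹) η, integral_univ_inv_one_add_sq,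
    abs_of_pos hη, smul_eq_mul]

/-- An odd `C¹` function vanishing on `[-a, a]` and approximating the sign function outside. -/
noncomputable def oddCutoff (a η x : ℝ) : ℝ := step η (x - a) - step η (-x - a)

theorem hasDerivAt_oddCutoff (hη : 0 < η) (a x : ℝ) :
    HasDerivAt (oddCutoff a η) (stepDeriv η (x - a) + stepDeriv η (-x - a)) x := by
  have h1 := (hasDerivAt_step hη (x - a)).comp x ((hasDerivAt_id x).sub_const a)
  have h2 := (hasDerivAt_step hη (-x - a)).comp x ((hasDerivAt_neg x).sub_const a)
  exact (h1.sub h2).congr_deriv (by ring)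

theorem IsH1.exists_bound {u : ℝ → ℝ} (hu : IsH1 u) : ∃ C, ∀ x, |u x| ≤ C :=
  ⟨‖ev hu.toE‖, fun x => by
    have := (ev hu.toE).norm_coe_le_norm x
    rwa [ev_toE] at this⟩

theorem abs_le_of_deriv_bound {u : ℝ → ℝ} {L a x : ℝ} (hu : IsH1 u)
    (hL : ∀ x, |deriv u x| ≤ L) (ha : u a = 0) : |u x| ≤ L * |x - a| := by
  have := Convex.norm_image_sub_le_of_norm_deriv_le (f := u) (s := univ) (C := L) (x := a) (y := x)
    (fun z _ => (hu.hasDerivAt z).differentiableAt) (fun z _ => hL z) convex_univ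
    (mem_univ _) (mem_univ _)
  simpa [ha] using this

/-- Cutoff away from two symmetric zeros at a small cost. -/
theorem exists_cutoff {u : ℝ → ℝ} (hu : IsH1 u) (hu' : IsH1 (deriv u)) {a : ℝ} (ha : 0 ≤ a)
    (h1 : u a = 0) (h2 : u (-a) = 0) {γ : ℝ} (hγ : 0 < γ) :
    ∃ h : ℝ → ℝ, ContDiff ℝ 1 h ∧ (∀ x, h (-x) = -h x) ∧ (∀ x, |h x| ≤ 1) ∧
      (∃ C, ∀ x, |deriv h x| ≤ C) ∧ ∫ x, (deriv h x * u x) ^ 2 ≤ γ ∧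
      ∫ x in {x | a ≤ |x|}, u x ^ 2 ≤ (∫ x, (h x * u x) ^ 2) + γ := by
  obtain ⟨L, hL⟩ := hu'.exists_bound
  obtain ⟨U, hU⟩ := hu.exists_bound
  set N : ℝ := 4 * L ^ 2 + 2 * U ^ 2 + 1
  have hN : 0 < N := by positivity
  -- Each bump has integral ηπ, so with this width the majorant g, the sum of two bumps times N, has
  -- integral exactly γ.
  set η : ℝ := γ / (N * (2 * Real.pi))
  have hη : 0 < η := by positivity
  set g : ℝ → ℝ := fun x => N * ((1 + ((x - a) / η) ^ 2)⁻¹ + (1 + ((x - -a) / η) ^ 2)⁻¹)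
  have hgi : Integrable g := ((integrable_bump hη a).1.add (integrable_bump hη (-a)).1).const_mul N
  have hg0 : ∀ x, 0 ≤ g x := fun x => by positivity
  have hgγ : ∫ x, g x = γ := by
    rw [integral_const_mul, integral_add (integrable_bump hη a).1 (integrable_bump hη (-a)).1,
      (integrable_bump hη a).2, (integrable_bump hη (-a)).2]
    have hpi := Real.pi_pos
    simp only [η]
    field_simp
    ring
  have hd := hasDerivAt_oddCutoff hη a
  have hd' : deriv (oddCutoff a η) = fun x => stepDeriv η (x - a) + stepDeriv η (-x - a) :=
    funext fun x => (hd x).deriv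
  have hcd : ContDiff ℝ 1 (oddCutoff a η) := by
    rw [contDiff_one_iff_deriv]
    refine ⟨fun x => (hd x).differentiableAt, ?_⟩
    rw [hd']
    have := continuous_stepDeriv hη
    fun_prop
  have hab : ∀ x, |oddCutoff a η x| ≤ 1 := fun x => by
    have e1 := step_nonneg (η := η) (x - a)
    have e2 := step_le_one hη (x - a)
    have e3 := step_nonneg (η := η) (-x - a)
    have e4 := step_le_one hη (-x - a)
    rw [oddCutoff, abs_le]
    constructor <;> linarith
  have hab' : ∀ x, |deriv (oddCutoff a η) x| ≤ 2 / η := fun x => by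
    have e1 := stepDeriv_nonneg (η := η) (x - a)
    have e2 := stepDeriv_le hη (x - a)
    have e3 := stepDeriv_nonneg (η := η) (-x - a)
    have e4 := stepDeriv_le hη (-x - a)
    rw [hd', abs_of_nonneg (add_nonneg e1 e3)]
    have : 2 / η = 1 / η + 1 / η := by ring
    linarith
  have hux : ∀ x, u x ^ 2 ≤ L ^ 2 * (x - a) ^ 2 := fun x => by
    have := abs_le_of_deriv_bound (x := x) hu hL h1
    rw [← sq_abs, ← sq_abs (x - a), ← mul_pow]
    exact pow_le_pow_left₀ (abs_nonneg _) this 2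
  have hux' : ∀ x, u x ^ 2 ≤ L ^ 2 * (-x - a) ^ 2 := fun x => by
    have := abs_le_of_deriv_bound (x := x) hu hL h2
    have e : (-x - a) ^ 2 = (x - -a) ^ 2 := by ring
    rw [e, ← sq_abs, ← sq_abs (x - -a), ← mul_pow]
    exact pow_le_pow_left₀ (abs_nonneg _) this 2
  have hUx : ∀ x, u x ^ 2 ≤ U ^ 2 := fun x => sq_le_sq' (neg_le_of_abs_le (hU x))
    (le_of_abs_le (hU x))
  have hsym : ∀ x : ℝ, (1 + ((x - -a) / η) ^ 2)⁻¹ = (1 + ((-x - a) / η) ^ 2)⁻¹ := fun x => by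
    congr 2; ring
  have hb0 : ∀ y : ℝ, 0 ≤ (1 + (y / η) ^ 2)⁻¹ := fun y => by positivity
  have hNL : 4 * L ^ 2 ≤ N := by simp only [N]; nlinarith [sq_nonneg U]
  have hNU : 2 * U ^ 2 ≤ N := by simp only [N]; nlinarith [sq_nonneg L]
  have hD : ∀ x, (deriv (oddCutoff a η) x * u x) ^ 2 ≤ g x := fun x => by
    simp only [g, hd', hsym]
    have p1 := hb0 (x - a)
    have p2 := hb0 (-x - a)
    rcases le_total (x - a) 0 with hx | hx
    · rw [stepDeriv_of_nonpos hx, zero_add]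
      rcases le_total (-x - a) 0 with hx' | hx'
      · rw [stepDeriv_of_nonpos hx']
        simp only [zero_mul, ne_eq, OfNat.ofNat_ne_zero, not_false_eq_true, zero_pow]
        positivity
      · have := stepDeriv_sq_mul_le hη hx'
        calc (stepDeriv η (-x - a) * u x) ^ 2 = stepDeriv η (-x - a) ^ 2 * u x ^ 2 := by ring
          _ ≤ stepDeriv η (-x - a) ^ 2 * (L ^ 2 * (-x - a) ^ 2) := by gcongr; exact hux' x
          _ = L ^ 2 * (stepDeriv η (-x - a) ^ 2 * (-x - a) ^ 2) := by ring
          _ ≤ L ^ 2 * (4 * (1 + ((-x - a) / η) ^ 2)⁻¹) := by gcongr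
          _ = 4 * L ^ 2 * (1 + ((-x - a) / η) ^ 2)⁻¹ := by ring
          _ ≤ N * ((1 + ((x - a) / η) ^ 2)⁻¹ + (1 + ((-x - a) / η) ^ 2)⁻¹) := by
            gcongr; linarith
    · rw [stepDeriv_of_nonpos (t := -x - a) (by linarith), add_zero]
      have := stepDeriv_sq_mul_le hη hx
      calc (stepDeriv η (x - a) * u x) ^ 2 = stepDeriv η (x - a) ^ 2 * u x ^ 2 := by ring
        _ ≤ stepDeriv η (x - a) ^ 2 * (L ^ 2 * (x - a) ^ 2) := by gcongr; exact hux x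
        _ = L ^ 2 * (stepDeriv η (x - a) ^ 2 * (x - a) ^ 2) := by ring
        _ ≤ L ^ 2 * (4 * (1 + ((x - a) / η) ^ 2)⁻¹) := by gcongr
        _ = 4 * L ^ 2 * (1 + ((x - a) / η) ^ 2)⁻¹ := by ring
        _ ≤ N * ((1 + ((x - a) / η) ^ 2)⁻¹ + (1 + ((-x - a) / η) ^ 2)⁻¹) := by
          gcongr; linarith
  have hS : ∀ x, a ≤ |x| → u x ^ 2 ≤ (oddCutoff a η x * u x) ^ 2 + g x := fun x hx => by
    simp only [g, hsym]
    have p1 := hb0 (x - a)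
    have p2 := hb0 (-x - a)
    have key : 1 - oddCutoff a η x ^ 2 ≤
        2 * ((1 + ((x - a) / η) ^ 2)⁻¹ + (1 + ((-x - a) / η) ^ 2)⁻¹) := by
      rcases le_total 0 x with h0 | h0
      · rw [abs_of_nonneg h0] at hx
        rw [oddCutoff, step_of_nonpos (t := -x - a) (by linarith), sub_zero]
        have := one_sub_step_sq_le hη (sub_nonneg.2 hx)
        linarith
      · rw [abs_of_nonpos h0] at hx
        rw [oddCutoff, step_of_nonpos (t := x - a) (by linarith), zero_sub, neg_sq]
        have := one_sub_step_sq_le hη (sub_nonneg.2 hx)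
        linarith
    calc u x ^ 2 = (oddCutoff a η x * u x) ^ 2 + (1 - oddCutoff a η x ^ 2) * u x ^ 2 := by ring
      _ ≤ (oddCutoff a η x * u x) ^ 2 +
          2 * ((1 + ((x - a) / η) ^ 2)⁻¹ + (1 + ((-x - a) / η) ^ 2)⁻¹) * U ^ 2 := by
        exact add_le_add le_rfl (mul_le_mul key (hUx x) (sq_nonneg _) (by positivity))
      _ = (oddCutoff a η x * u x) ^ 2 +
          2 * U ^ 2 * ((1 + ((x - a) / η) ^ 2)⁻¹ + (1 + ((-x - a) / η) ^ 2)⁻¹) := by ring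
      _ ≤ _ := by gcongr
  have hmem := hu.bdd_mul hcd hab hab'
  have hi2 := integrable_sq_of_memLp hmem.memLp
  refine ⟨oddCutoff a η, hcd, fun x => ?_, hab, ⟨_, hab'⟩, ?_, ?_⟩
  · simp only [oddCutoff, neg_neg]; ring
  · rw [← hgγ]
    refine integral_mono (integrable_sq_of_memLp (memLp_bdd_mul
      (hcd.continuous_deriv le_rfl) hab' hu.memLp)) hgi hD
  · rw [← hgγ, ← integral_add hi2 hgi]
    have hms : MeasurableSet {x : ℝ | a ≤ |x|} := measurableSet_le measurable_const
      continuous_abs.measurable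
    refine (setIntegral_mono_on (integrable_sq_of_memLp hu.memLp).integrableOn
      (hi2.add hgi).integrableOn hms fun x hx => hS x hx).trans
      (setIntegral_le_integral (hi2.add hgi) (Eventually.of_forall fun x => ?_))
    exact add_nonneg (sq_nonneg _) (hg0 x)

end Cutoff

/-! ### Zeros of eigenfunctions -/

theorem pos_or_neg_of_ne_zero {g : ℝ → ℝ} (hg : Continuous g) (h0 : ∀ x, g x ≠ 0) :
    (∀ x, 0 < g x) ∨ ∀ x, g x < 0 := by
  by_contra! hcon
  obtain ⟨⟨x, hx⟩, y, hy⟩ := hcon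
  obtain ⟨z, hz⟩ := mem_range_of_exists_le_of_exists_ge hg ⟨x, hx⟩ ⟨y, hy⟩
  exact h0 z hz

theorem integral_eq_zero_of_odd {g : ℝ → ℝ} (h : ∀ x, g (-x) = -g x) : ∫ x, g x = 0 := by
  have := integral_neg_eq_self g volume
  simp_rw [h, integral_neg] at this
  linarith

theorem isSol_of_isEigenfunction {W : ℝ → ℝ} {C lam : ℝ} {u : ℝ → ℝ} (hW : Continuous W)
    (hC : ∀ x, |W x| ≤ C) (h : IsEigenfunction W lam u) : IsSol (fun x => W x - lam) u := by
  have e : ∀ x, deriv (deriv u) x = (W x - lam) * u x := fun x => by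
    linarith [h.2.2.2 x]
  exact ⟨isH1_of_classical (q := fun x => W x - lam) (C := C + |lam|) (hW.sub continuous_const)
    (fun x => (abs_sub _ _).trans (add_le_add (hC x) le_rfl)) h.2.1 h.2.2.1 e, h.2.1, e⟩

/-- Otherwise u vanishes on (a, ∞), hence everywhere by uniqueness for the initial value problem. -/
theorem IsSol.setIntegral_sq_pos {q u : ℝ → ℝ} {C : ℝ} (hq : ∀ x, |q x| ≤ C) (hu : IsSol q u)
    (h0 : u ≠ 0) (a : ℝ) : 0 < ∫ x in {x | a ≤ |x|}, u x ^ 2 := by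
  have hi := (integrable_sq_of_memLp hu.isH1.memLp).integrableOn (s := {x | a ≤ |x|})
  refine lt_of_le_of_ne (integral_nonneg fun x => sq_nonneg _) fun hz => h0 ?_
  rw [eq_comm, integral_eq_zero_iff_of_nonneg (fun x => sq_nonneg _) hi] at hz
  have h1 : u =ᵐ[volume.restrict (Ioi a)] fun _ => 0 := by
    have : Ioi a ⊆ {x | a ≤ |x|} := fun x hx => (le_of_lt hx).trans (le_abs_self x)
    filter_upwards [ae_restrict_of_ae_restrict_of_subset this hz] with x hx
    simpa using hx
  have h2 := Measure.eqOn_open_of_ae_eq h1 isOpen_Ioi hu.isH1.continuous.continuousOn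
    continuousOn_const
  refine ode_unique hu.contDiff hq hu.eq (x₀ := a + 1) (h2 (by simp)) ?_
  have h3 : u =ᶠ[𝓝 (a + 1)] fun _ => 0 := by
    filter_upwards [Ioi_mem_nhds (show a < a + 1 by linarith)] with x hx using h2 hx
  rw [h3.deriv_eq, deriv_const]

/-- An eigenfunction with symmetric zeros cannot minimize the form among its odd localizations. -/
theorem IsSol.false_of_zero {q u : ℝ → ℝ} {C w l : ℝ} (hqc : Continuous q) (hq : ∀ x, |q x| ≤ C)
    (hu : IsSol (fun x => q x + w) u) (h0 : u ≠ 0) {a : ℝ} (ha : 0 ≤ a) (h1 : u a = 0)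
    (h2 : u (-a) = 0) (hl : l < w)
    (hform : ∀ h : ℝ → ℝ, (∀ x, h (-x) = -h x) → IsH1 (fun x => h x * u x) →
      -l * ∫ x, (h x * u x) ^ 2 ≤
        ∫ x, (deriv (fun x => h x * u x) x ^ 2 + q x * (h x * u x) ^ 2)) : False := by
  have hq' : ∀ x, |q x + w| ≤ C + |w| := fun x => (abs_add_le _ _).trans (add_le_add (hq x) le_rfl)
  have hT := hu.setIntegral_sq_pos hq' h0 a
  set T := ∫ x in {x | a ≤ |x|}, u x ^ 2
  have hwl : 0 < w - l := sub_pos.2 hl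
  have hu' : IsH1 (deriv u) := IsH1.of_hasDerivAt hu.hasDerivAt_deriv
    ((hqc.add continuous_const).mul hu.isH1.continuous) hu.isH1.memLp_deriv
    (memLp_bdd_mul (hqc.add continuous_const) hq' hu.isH1.memLp)
  -- The localization formula will give (w - l)F ≤ γ with F ≥ T - γ, hence (w - l)T ≤ (1 + (w -
  -- l))γ; this γ makes the right-hand side half of the left.
  obtain ⟨h, hcd, hodd, hb, ⟨C', hC'⟩, hi1, hi2⟩ := exists_cutoff hu.isH1 hu' ha h1 h2
    (γ := (w - l) * T / (2 * (1 + (w - l)))) (by positivity)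
  have hf := hform h hodd (hu.isH1.bdd_mul hcd hb hC')
  rw [hu.form_mul hqc hq hcd hb hC'] at hf
  set γ := (w - l) * T / (2 * (1 + (w - l)))
  have hγ : γ * (2 * (1 + (w - l))) = (w - l) * T := by
    simp only [γ]; field_simp
  set F := ∫ x, (h x * u x) ^ 2
  have e1 : (w - l) * F ≤ γ := by linarith
  have e2 : (w - l) * (T - γ) ≤ (w - l) * F := mul_le_mul_of_nonneg_left (by linarith) hwl.le
  have e3 : 0 < (w - l) * T := by positivity
  nlinarith

/-! ### The spectral setting -/

/-- The bounded continuous function underlying a Schwartz function. -/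
noncomputable abbrev toB (V : 𝓢(ℝ, ℝ)) : ℝ →ᵇ ℝ := V.toBoundedContinuousFunction

/-- The orthogonal complement of the two eigenfunctions. -/
def MemZ (k₀ k₁ f : E) : Prop :=
  inner ℝ (emb f) (emb k₀) = 0 ∧ inner ℝ (emb f) (emb k₁) = 0

/-- The facts about the potential and its eigenfunctions used in the bifurcation analysis. -/
structure Setting (m M κ : ℝ) (V : ℝ →ᵇ ℝ) (ω₀ ω₁ : ℝ) (k₀ k₁ : E) : Prop where
  m_pos : 0 < m
  κ_pos : 0 < κ
  lt : ω₁ < ω₀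
  le : m ≤ ω₁
  eq₀ : schr (V + ω₀ • 1) k₀ = 0
  eq₁ : schr (V + ω₁ • 1) k₁ = 0
  norm₀ : inner ℝ (emb k₀) (emb k₀) = 1
  norm₁ : inner ℝ (emb k₁) (emb k₁) = 1
  orth : inner ℝ (emb k₀) (emb k₁) = 0
  even : ∀ x, V (-x) = V x
  reflect₀ : reflect k₀ = k₀
  reflect₁ : reflect k₁ = -k₁
  ne_zero : ∀ x, ev k₀ x ≠ 0
  bound : ∀ x, |V x| ≤ M
  form : ∀ f, MemZ k₀ k₁ f →
    κ * inner ℝ (pot (ev k₀ ^ 4) f) f ≤ inner ℝ (schr V f) f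

theorem schr_smul_one (V : ℝ →ᵇ ℝ) (w : ℝ) (f : E) :
    schr (V + w • 1) f = schr V f + w • pot 1 f := by
  rw [schr_add, map_smul]; rfl

theorem toE_congr {u v : ℝ → ℝ} (hu : IsH1 u) (hv : IsH1 v) (h : u = v) : hu.toE = hv.toE := by
  subst h; rfl

theorem inner_emb_toE {u v : ℝ → ℝ} (hu : IsH1 u) (hv : IsH1 v) :
    inner ℝ (emb hu.toE) (emb hv.toE) = ∫ x, u x * v x := by
  rw [inner_emb, ev_toE, ev_toE]

theorem toE_sub_smul {u v w : ℝ → ℝ} (hu : IsH1 u) (hv : IsH1 v) (hw : IsH1 w) (a b : ℝ) :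
    hu.toE - a • hv.toE - b • hw.toE = ((hu.sub (hv.const_mul a)).sub (hw.const_mul b)).toE := by
  unfold IsH1.toE
  rw [← MemLp.toLp_const_smul, ← MemLp.toLp_const_smul, ← MemLp.toLp_sub, ← MemLp.toLp_sub]
  refine MemLp.toLp_congr _ _ (Eventually.of_forall fun x => ?_)
  have := (((hu.hasDerivAt x).sub ((hv.hasDerivAt x).const_mul a)).sub
    ((hw.hasDerivAt x).const_mul b)).deriv
  simp only [Pi.sub_apply, Pi.smul_apply, smul_eq_mul]
  rw [show deriv (fun x => u x - a * v x - b * w x) x = _ from this]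
  ring

/-! ### Parity of the eigenfunctions and the form bound -/

section Admissible
variable {a₀ m M κ : ℝ} {V : 𝓢(ℝ, ℝ)} {ω₀ ω₁ : ℝ} {ψ₀ ψ₁ : ℝ → ℝ}

theorem _root_.IsAdmissible.isSol₀ (h : IsAdmissible a₀ m M κ V ω₀ ω₁ ψ₀ ψ₁) :
    IsSol (fun x => V x + ω₀) ψ₀ := by
  have := isSol_of_isEigenfunction V.continuous h.bound h.eigenfunction₀
  simpa only [sub_neg_eq_add] using this

theorem _root_.IsAdmissible.isSol₁ (h : IsAdmissible a₀ m M κ V ω₀ ω₁ ψ₀ ψ₁) :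
    IsSol (fun x => V x + ω₁) ψ₁ := by
  have := isSol_of_isEigenfunction V.continuous h.bound h.eigenfunction₁
  simpa only [sub_neg_eq_add] using this

theorem _root_.IsAdmissible.orth (h : IsAdmissible a₀ m M κ V ω₀ ω₁ ψ₀ ψ₁) :
    ∫ x, ψ₀ x * ψ₁ x = 0 := h.isSol₀.integral_mul_eq_zero h.isSol₁ h.lt.ne'

variable (h : IsAdmissible a₀ m M κ V ω₀ ω₁ ψ₀ ψ₁)

/-- Quadratic form of `-∂ₓ² + V` in terms of the spectral decomposition. -/
theorem _root_.IsAdmissible.form_ge (h : IsAdmissible a₀ m M κ V ω₀ ω₁ ψ₀ ψ₁) {f : ℝ → ℝ}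
    (hf : IsH1 f) :
    -ω₀ * (∫ x, f x * ψ₀ x) ^ 2 - ω₁ * (∫ x, f x * ψ₁ x) ^ 2 +
      κ * ∫ x, ψ₀ x ^ 4 * (f x - (∫ x, f x * ψ₀ x) * ψ₀ x - (∫ x, f x * ψ₁ x) * ψ₁ x) ^ 2 ≤
    ∫ x, (deriv f x ^ 2 + V x * f x ^ 2) := by
  set c := ∫ x, f x * ψ₀ x with hc
  set b := ∫ x, f x * ψ₁ x with hb
  have H0 := h.isSol₀.isH1
  have H1 := h.isSol₁.isH1
  have hg := (hf.sub (H0.const_mul c)).sub (H1.const_mul b)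
  have hZ := toE_sub_smul hf H0 H1 c b
  have hn0 : inner ℝ (emb H0.toE) (emb H0.toE) = 1 := by
    rw [inner_emb_toE, ← h.norm₀]; congr 1; ext x; ring
  have hn1 : inner ℝ (emb H1.toE) (emb H1.toE) = 1 := by
    rw [inner_emb_toE, ← h.norm₁]; congr 1; ext x; ring
  have ho : inner ℝ (emb H0.toE) (emb H1.toE) = 0 := by rw [inner_emb_toE, h.orth]
  have hfc : inner ℝ (emb hf.toE) (emb H0.toE) = c := inner_emb_toE _ _
  have hfb : inner ℝ (emb hf.toE) (emb H1.toE) = b := inner_emb_toE _ _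
  have g0 : ∫ x, (f x - c * ψ₀ x - b * ψ₁ x) * ψ₀ x = 0 := by
    rw [← inner_emb_toE hg H0, ← hZ, map_sub, map_sub, map_smul, map_smul, inner_sub_left,
      inner_sub_left, inner_smul_left, inner_smul_left, hfc, hn0, real_inner_comm, ho]
    simp
  have g1 : ∫ x, (f x - c * ψ₀ x - b * ψ₁ x) * ψ₁ x = 0 := by
    rw [← inner_emb_toE hg H1, ← hZ, map_sub, map_sub, map_smul, map_smul, inner_sub_left,
      inner_sub_left, inner_smul_left, inner_smul_left, hfb, hn1, ho]
    simp
  have key := h.nonresonant _ hg.contDiff hg.memLp hg.memLp_deriv g0 g1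
  have s0 : schr (toB V) H0.toE = -(ω₀ • pot 1 H0.toE) := by
    rw [eq_neg_iff_add_eq_zero, ← schr_smul_one]
    refine schr_toE_eq_zero H0 h.isSol₀.contDiff fun x => ?_
    rw [h.isSol₀.eq]; simp
  have s1 : schr (toB V) H1.toE = -(ω₁ • pot 1 H1.toE) := by
    rw [eq_neg_iff_add_eq_zero, ← schr_smul_one]
    refine schr_toE_eq_zero H1 h.isSol₁.contDiff fun x => ?_
    rw [h.isSol₁.eq]; simp
  have q : ∀ {u : ℝ → ℝ} (hu : IsH1 u), inner ℝ (schr (toB V) hu.toE) hu.toE =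
      ∫ x, (deriv u x ^ 2 + V x * u x ^ 2) := fun hu => by
    rw [inner_schr_toE]
    congr 1; ext x
    simp only [SchwartzMap.toBoundedContinuousFunction_apply]
    ring
  have e : hf.toE = hg.toE + c • H0.toE + b • H1.toE := by rw [← hZ]; abel
  have i0 : inner ℝ (schr (toB V) hg.toE) H0.toE = 0 := by
    rw [inner_schr_symm, s0, inner_neg_right, inner_smul_right, ← inner_pot_symm, inner_pot_one,
      inner_emb_toE, g0]
    simp
  have i1 : inner ℝ (schr (toB V) hg.toE) H1.toE = 0 := by
    rw [inner_schr_symm, s1, inner_neg_right, inner_smul_right, ← inner_pot_symm, inner_pot_one,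
      inner_emb_toE, g1]
    simp
  have i2 : inner ℝ (schr (toB V) H0.toE) H0.toE = -ω₀ := by
    rw [s0, inner_neg_left, inner_smul_left, inner_pot_one, hn0]; simp
  have i3 : inner ℝ (schr (toB V) H1.toE) H1.toE = -ω₁ := by
    rw [s1, inner_neg_left, inner_smul_left, inner_pot_one, hn1]; simp
  have i4 : inner ℝ (schr (toB V) H0.toE) H1.toE = 0 := by
    rw [s0, inner_neg_left, inner_smul_left, inner_pot_one, ho]; simp
  have i5 : inner ℝ (schr (toB V) H1.toE) H0.toE = 0 := by
    rw [inner_schr_symm, real_inner_comm, i4]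
  have i6 : inner ℝ (schr (toB V) H0.toE) hg.toE = 0 := by
    rw [inner_schr_symm, real_inner_comm, i0]
  have i7 : inner ℝ (schr (toB V) H1.toE) hg.toE = 0 := by
    rw [inner_schr_symm, real_inner_comm, i1]
  have tot : ∫ x, (deriv f x ^ 2 + V x * f x ^ 2) =
      (∫ x, (deriv (fun x => f x - c * ψ₀ x - b * ψ₁ x) x ^ 2 +
        V x * (f x - c * ψ₀ x - b * ψ₁ x) ^ 2)) - ω₀ * c ^ 2 - ω₁ * b ^ 2 := by
    rw [← q hf, ← q hg, e]
    simp only [map_add, map_smul, inner_add_left, inner_add_right, inner_smul_left,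
      inner_smul_right, i0, i1, i2, i3, i4, i5, i6, i7, conj_trivial]
    ring
  rw [tot]
  linarith

theorem _root_.IsAdmissible.ω₁_pos (h : IsAdmissible a₀ m M κ V ω₀ ω₁ ψ₀ ψ₁) (hm : 0 < m) :
    0 < ω₁ := hm.trans_le h.eigenvalue_bound

theorem _root_.IsAdmissible.sq_integral_le (h : IsAdmissible a₀ m M κ V ω₀ ω₁ ψ₀ ψ₁) {f : ℝ → ℝ}
    (hf : IsH1 f) : (∫ x, f x * ψ₀ x) ^ 2 ≤ ∫ x, f x ^ 2 ∧
      (∫ x, f x * ψ₁ x) ^ 2 ≤ ∫ x, f x ^ 2 := by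
  have cs : ∀ {u v : ℝ → ℝ} (_ : IsH1 u) (_ : IsH1 v), ∫ x, v x ^ 2 = 1 →
      (∫ x, u x * v x) ^ 2 ≤ ∫ x, u x ^ 2 := by
    intro u v hu hv h1
    have := abs_real_inner_le_norm (emb hu.toE) (emb hv.toE)
    have n1 : ‖emb hv.toE‖ ^ 2 = 1 := by rw [norm_emb_sq, ev_toE, h1]
    have n2 : ‖emb hu.toE‖ ^ 2 = ∫ x, u x ^ 2 := by rw [norm_emb_sq, ev_toE]
    rw [← inner_emb_toE hu hv, ← n2]
    have h3 := pow_le_pow_left₀ (abs_nonneg _) this 2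
    rwa [sq_abs, mul_pow, n1, mul_one] at h3
  exact ⟨cs hf h.isSol₀.isH1 h.norm₀, cs hf h.isSol₁.isH1 h.norm₁⟩

/-- A zero of ψ₀ comes with its mirror image because ψ₀ has a parity. Odd cutoffs at these zeros
give functions hψ₀ of opposite parity, orthogonal to ψ₀, on which the form is at least -ω₁ times the
squared norm; yet their Rayleigh quotients come arbitrarily close to -ω₀ < -ω₁. -/
theorem _root_.IsAdmissible.ne_zero₀ (h : IsAdmissible a₀ m M κ V ω₀ ω₁ ψ₀ ψ₁)
    (hm : 0 < m) (hκ : 0 < κ) (x : ℝ) : ψ₀ x ≠ 0 := by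
  intro hx
  have h0 := h.eigenfunction₀.1
  have par := h.isSol₀.even_or_odd (C := M + |ω₀|)
    (fun x => (abs_add_le _ _).trans (add_le_add (h.bound x) le_rfl))
    (fun x => by rw [h.even])
  have h1 : ψ₀ (-x) = 0 := by
    rcases par with p | p <;> rw [p, hx]; simp
  have h2 : ψ₀ |x| = 0 ∧ ψ₀ (-|x|) = 0 := by
    rcases abs_choice x with e | e <;> rw [e]
    · exact ⟨hx, h1⟩
    · rw [neg_neg]; exact ⟨h1, hx⟩
  refine h.isSol₀.false_of_zero V.continuous h.bound h0 (abs_nonneg x) h2.1 h2.2 h.lt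
    fun k hk hf => ?_
  have hge := h.form_ge hf
  have hz : ∫ x, k x * ψ₀ x * ψ₀ x = 0 := by
    refine integral_eq_zero_of_odd fun x => ?_
    rw [hk]
    rcases par with p | p <;> rw [p] <;> ring
  rw [hz] at hge
  have h3 := (h.sq_integral_le hf).2
  have h4 := h.ω₁_pos hm
  have h5 : 0 ≤ κ * ∫ x, ψ₀ x ^ 4 * (k x * ψ₀ x - 0 * ψ₀ x -
      (∫ x, k x * ψ₀ x * ψ₁ x) * ψ₁ x) ^ 2 :=
    mul_nonneg hκ.le (integral_nonneg fun x => by positivity)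
  nlinarith

theorem _root_.IsAdmissible.even₀ (h : IsAdmissible a₀ m M κ V ω₀ ω₁ ψ₀ ψ₁)
    (hm : 0 < m) (hκ : 0 < κ) (x : ℝ) : ψ₀ (-x) = ψ₀ x := by
  rcases h.isSol₀.even_or_odd (C := M + |ω₀|)
    (fun x => (abs_add_le _ _).trans (add_le_add (h.bound x) le_rfl))
    (fun x => by rw [h.even]) with p | p
  · exact p x
  · have := p 0
    rw [neg_zero] at this
    exact absurd (by linarith) (h.ne_zero₀ hm hκ 0)

/-- If ψ₁ were even, orthogonality to the zero-free ψ₀ would give it a zero, and the odd cutoffs hψ₁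
would be orthogonal to both eigenfunctions. The form is nonnegative on such functions, while their
Rayleigh quotients come arbitrarily close to -ω₁ < 0. -/
theorem _root_.IsAdmissible.odd₁ (h : IsAdmissible a₀ m M κ V ω₀ ω₁ ψ₀ ψ₁)
    (hm : 0 < m) (hκ : 0 < κ) (x : ℝ) : ψ₁ (-x) = -ψ₁ x := by
  revert x
  rcases h.isSol₁.even_or_odd (C := M + |ω₁|)
    (fun x => (abs_add_le _ _).trans (add_le_add (h.bound x) le_rfl))
    (fun x => by rw [h.even]) with p | p
  · exfalso
    obtain ⟨a, ha⟩ : ∃ a, ψ₁ a = 0 := by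
      by_contra! hcon
      have hc : Continuous fun x => ψ₀ x * ψ₁ x :=
        h.isSol₀.isH1.continuous.mul h.isSol₁.isH1.continuous
      have hi := integrable_mul_of_memLp h.isSol₀.isH1.memLp h.isSol₁.isH1.memLp
      have hs : Function.support (fun x => ψ₀ x * ψ₁ x) = univ := by
        ext x
        simp [h.ne_zero₀ hm hκ x, hcon x]
      rcases pos_or_neg_of_ne_zero hc (fun x => mul_ne_zero (h.ne_zero₀ hm hκ x) (hcon x))
        with hp | hp
      · have := (integral_pos_iff_support_of_nonneg (fun x => (hp x).le) hi).2
          (by rw [hs]; simp)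
        exact this.ne' h.orth
      · have := (integral_pos_iff_support_of_nonneg (f := fun x => -(ψ₀ x * ψ₁ x))
          (fun x => (neg_pos.2 (hp x)).le) hi.neg).2 (by
            rw [Function.support_fun_neg, hs]; simp)
        rw [integral_neg, h.orth] at this
        simp at this
    have h2 : ψ₁ |a| = 0 ∧ ψ₁ (-|a|) = 0 := by
      rw [p]
      rcases abs_choice a with e | e <;> rw [e]
      · exact ⟨ha, ha⟩
      · rw [p]; exact ⟨ha, ha⟩
    refine h.isSol₁.false_of_zero V.continuous h.bound h.eigenfunction₁.1 (abs_nonneg a) h2.1 h2.2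
      (h.ω₁_pos hm) fun k hk hf => ?_
    have hge := h.form_ge hf
    have hz : ∫ x, k x * ψ₁ x * ψ₀ x = 0 := by
      refine integral_eq_zero_of_odd fun x => ?_
      rw [hk, p, h.even₀ hm hκ]; ring
    have hz1 : ∫ x, k x * ψ₁ x * ψ₁ x = 0 := by
      refine integral_eq_zero_of_odd fun x => ?_
      rw [hk, p]; ring
    rw [hz, hz1] at hge
    have h5 : 0 ≤ κ * ∫ x, ψ₀ x ^ 4 * (k x * ψ₁ x - 0 * ψ₀ x - 0 * ψ₁ x) ^ 2 :=
      mul_nonneg hκ.le (integral_nonneg fun x => by positivity)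
    nlinarith
  · exact p

theorem _root_.IsAdmissible.setting (h : IsAdmissible a₀ m M κ V ω₀ ω₁ ψ₀ ψ₁)
    (hm : 0 < m) (hκ : 0 < κ) :
    Setting m M κ (toB V) ω₀ ω₁ h.isSol₀.isH1.toE h.isSol₁.isH1.toE where
  m_pos := hm
  κ_pos := hκ
  lt := h.lt
  le := h.eigenvalue_bound
  eq₀ := schr_toE_eq_zero _ h.isSol₀.contDiff fun x => by rw [h.isSol₀.eq]; simp
  eq₁ := schr_toE_eq_zero _ h.isSol₁.contDiff fun x => by rw [h.isSol₁.eq]; simp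
  norm₀ := by rw [inner_emb_toE, ← h.norm₀]; congr 1; ext x; ring
  norm₁ := by rw [inner_emb_toE, ← h.norm₁]; congr 1; ext x; ring
  orth := by rw [inner_emb_toE, h.orth]
  even := fun x => by simp [h.even]
  reflect₀ := by
    rw [reflect_toE]
    exact toE_congr _ _ (funext fun x => h.even₀ hm hκ x)
  reflect₁ := by
    rw [reflect_toE]
    have e := toE_sub_smul h.isSol₁.isH1 h.isSol₁.isH1 h.isSol₁.isH1 1 1
    have e2 : h.isSol₁.isH1.toE - (1 : ℝ) • h.isSol₁.isH1.toE - (1 : ℝ) • h.isSol₁.isH1.toE =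
      -h.isSol₁.isH1.toE := by simp
    rw [← e2, e]
    refine toE_congr _ _ (funext fun x => ?_)
    rw [h.odd₁ hm hκ]; ring
  ne_zero := fun x => by rw [ev_toE]; exact h.ne_zero₀ hm hκ x
  bound := fun x => by simpa using h.bound x
  form := by
    have H0 := h.isSol₀.isH1
    have H1 := h.isSol₁.isH1
    -- With the projections written out, the bound is a closed condition on all of `E`, so density
    -- applies; the orthogonality constraints are inserted only afterwards.
    have key : ∀ f : E, κ * inner ℝ (pot (ev H0.toE ^ 4)
        (f - (inner ℝ (emb f) (emb H0.toE)) • H0.toE - (inner ℝ (emb f) (emb H1.toE)) • H1.toE))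
        (f - (inner ℝ (emb f) (emb H0.toE)) • H0.toE - (inner ℝ (emb f) (emb H1.toE)) • H1.toE) -
        ω₀ * (inner ℝ (emb f) (emb H0.toE)) ^ 2 - ω₁ * (inner ℝ (emb f) (emb H1.toE)) ^ 2 ≤
        inner ℝ (schr (toB V) f) f := by
      refine E_induction (isClosed_le (by fun_prop) (by fun_prop)) fun u hu => ?_
      have h1 := h.form_ge hu
      rw [inner_emb_toE, inner_emb_toE, toE_sub_smul hu H0 H1, inner_pot, inner_schr_toE, ev_toE]
      simp only [BoundedContinuousFunction.coe_pow, Pi.pow_apply, ev_toE,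
        SchwartzMap.toBoundedContinuousFunction_apply]
      have e1 : ∀ x, deriv u x * deriv u x + V x * u x * u x = deriv u x ^ 2 + V x * u x ^ 2 :=
        fun x => by ring
      have e2 : ∀ x, ψ₀ x ^ 4 * (u x - (∫ x, u x * ψ₀ x) * ψ₀ x - (∫ x, u x * ψ₁ x) * ψ₁ x) *
          (u x - (∫ x, u x * ψ₀ x) * ψ₀ x - (∫ x, u x * ψ₁ x) * ψ₁ x) =
          ψ₀ x ^ 4 * (u x - (∫ x, u x * ψ₀ x) * ψ₀ x - (∫ x, u x * ψ₁ x) * ψ₁ x) ^ 2 :=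
        fun x => by ring
      simp_rw [e1, e2]
      linarith
    intro f hf
    have := key f
    rw [hf.1, hf.2] at this
    simpa using this

end Admissible

/-! ### Inversion on the complement of the eigenfunctions -/

section Solve

/-- The orthogonal projection of `H¹` onto the complement of the eigenfunctions. -/
noncomputable def projZ (k₀ k₁ : E) : E →L[ℝ] E :=
  (Submodule.span ℝ {pot 1 k₀, pot 1 k₁})ᗮ.starProjection

variable {k₀ k₁ : E}

theorem memZ_iff {f : E} : MemZ k₀ k₁ f ↔ f ∈ (Submodule.span ℝ {pot 1 k₀, pot 1 k₁})ᗮ := by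
  rw [Submodule.mem_orthogonal]
  have e : ∀ k, inner ℝ (emb f) (emb k) = inner ℝ (pot 1 k) f := fun k => by
    rw [inner_pot_one, real_inner_comm]
  constructor
  · rintro ⟨h0, h1⟩ u hu
    rw [Submodule.mem_span_pair] at hu
    obtain ⟨a, b, rfl⟩ := hu
    rw [inner_add_left, inner_smul_left, inner_smul_left, ← e, ← e, h0, h1]
    simp
  · intro h
    rw [MemZ, e, e]
    exact ⟨h _ (Submodule.subset_span (by simp)), h _ (Submodule.subset_span (by simp))⟩

theorem memZ_projZ (f : E) : MemZ k₀ k₁ (projZ k₀ k₁ f) :=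
  memZ_iff.2 (Submodule.starProjection_apply_mem _ f)

theorem projZ_eq {f : E} (hf : MemZ k₀ k₁ f) : projZ k₀ k₁ f = f :=
  Submodule.starProjection_eq_self_iff.2 (memZ_iff.1 hf)

theorem inner_projZ (f g : E) : inner ℝ (projZ k₀ k₁ f) g = inner ℝ f (projZ k₀ k₁ g) :=
  Submodule.inner_starProjection_left_eq_right _ _ _

theorem inner_projZ_left {f h : E} (hh : MemZ k₀ k₁ h) :
    inner ℝ (projZ k₀ k₁ f) h = inner ℝ f h := by
  rw [inner_projZ, projZ_eq hh]

/-- `schr W` compressed to the complement of the eigenfunctions and extended by the identity. -/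
noncomputable def compress (k₀ k₁ : E) (W : ℝ →ᵇ ℝ) : E →L[ℝ] E :=
  projZ k₀ k₁ ∘L schr W ∘L projZ k₀ k₁ + (1 - projZ k₀ k₁)

/-- The inverse of `-∂ₓ² + W` on the complement of the eigenfunctions. -/
noncomputable def solveZ (k₀ k₁ : E) (W : ℝ →ᵇ ℝ) : E →L[ℝ] E :=
  projZ k₀ k₁ ∘L Ring.inverse (compress k₀ k₁ W) ∘L projZ k₀ k₁

/-- Lax–Milgram. -/
theorem isUnit_of_coercive {T : E →L[ℝ] E} {θ : ℝ} (hθ : 0 < θ)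
    (h : ∀ f, θ * ‖f‖ ^ 2 ≤ inner ℝ (T f) f) : IsUnit T := by
  have hco : IsCoercive ((innerSL ℝ : E →L[ℝ] E →L[ℝ] ℝ) ∘L T) :=
    ⟨θ, hθ, fun f => by
      have := h f
      rw [pow_two, ← mul_assoc] at this
      exact this⟩
  have e : ((hco.continuousLinearEquivOfBilin : E ≃L[ℝ] E) : E →L[ℝ] E) = T := by
    ext1 f
    refine ext_inner_right ℝ fun g => ?_
    exact hco.continuousLinearEquivOfBilin_apply f g
  rw [← e]
  exact ContinuousLinearMap.isUnit_iff_bijective.2 (hco.continuousLinearEquivOfBilin).bijective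

/-- Coercivity of `-∂ₓ² + W` on the complement of the eigenfunctions. -/
def CoerciveZ (k₀ k₁ : E) (θ : ℝ) (W : ℝ →ᵇ ℝ) : Prop :=
  ∀ f, MemZ k₀ k₁ f → θ * ‖f‖ ^ 2 ≤ inner ℝ (schr W f) f

variable {W : ℝ →ᵇ ℝ} {θ : ℝ}

/-- The operator is block diagonal, and the identity block does not lower the constant because θ ≤
1. Working in the full operator algebra of `E` makes continuity of inversion available for the
dependence on W. -/
theorem CoerciveZ.isUnit (hθ : 0 < θ) (hθ1 : θ ≤ 1) (h : CoerciveZ k₀ k₁ θ W) :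
    IsUnit (compress k₀ k₁ W) := by
  refine isUnit_of_coercive hθ fun f => ?_
  set P := projZ k₀ k₁
  have e : compress k₀ k₁ W f = P (schr W (P f)) + (f - P f) := rfl
  have hP : MemZ k₀ k₁ (P f) := memZ_projZ f
  have h1 := h _ hP
  have h2 : inner ℝ (f - P f) (P f) = 0 := by
    rw [inner_sub_left, inner_projZ, projZ_eq hP]; ring
  have h3 : ‖f‖ ^ 2 = ‖P f‖ ^ 2 + ‖f - P f‖ ^ 2 := by
    have := norm_add_sq_real (f - P f) (P f)
    rw [h2, sub_add_cancel] at this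
    linarith
  have h4 : inner ℝ (f - P f) f = ‖f - P f‖ ^ 2 := by
    rw [← real_inner_self_eq_norm_sq, inner_sub_right (f - P f) f, h2, sub_zero]
  rw [e, inner_add_left, inner_projZ, h4, h3]
  nlinarith [sq_nonneg ‖f - P f‖]

theorem CoerciveZ.solveZ_spec (hθ : 0 < θ) (hθ1 : θ ≤ 1) (h : CoerciveZ k₀ k₁ θ W) (g : E) :
    MemZ k₀ k₁ (solveZ k₀ k₁ W g) ∧
      ∀ v, MemZ k₀ k₁ v → inner ℝ (schr W (solveZ k₀ k₁ W g)) v = inner ℝ g v := by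
  set P := projZ k₀ k₁
  refine ⟨memZ_projZ _, fun v hv => ?_⟩
  set f := Ring.inverse (compress k₀ k₁ W) (P g) with hf
  have h1 : compress k₀ k₁ W f = P g := by
    have := Ring.mul_inverse_cancel _ (h.isUnit hθ hθ1)
    exact congrArg (fun T : E →L[ℝ] E => T (P g)) this
  have e : compress k₀ k₁ W f = P (schr W (P f)) + (f - P f) := rfl
  have h2 : inner ℝ (P (schr W (P f)) + (f - P f)) v = inner ℝ (P g) v := by rw [← e, h1]
  rw [inner_add_left, inner_sub_left, inner_projZ_left hv, inner_projZ_left hv,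
    inner_projZ_left hv, sub_self, add_zero] at h2
  exact h2

theorem CoerciveZ.eq_of_inner (hθ : 0 < θ) (h : CoerciveZ k₀ k₁ θ W) {f f' : E}
    (hf : MemZ k₀ k₁ f) (hf' : MemZ k₀ k₁ f')
    (he : ∀ v, MemZ k₀ k₁ v → inner ℝ (schr W f) v = inner ℝ (schr W f') v) : f = f' := by
  have hd : MemZ k₀ k₁ (f - f') := by
    rw [memZ_iff] at *; exact Submodule.sub_mem _ hf hf'
  have h1 := h _ hd
  rw [map_sub, inner_sub_left, he _ hd, sub_self] at h1
  have h2 : ‖f - f'‖ ^ 2 ≤ 0 := by nlinarith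
  exact sub_eq_zero.1 (norm_eq_zero.1 (by nlinarith [norm_nonneg (f - f')]))

theorem CoerciveZ.solveZ_unique (hθ : 0 < θ) (hθ1 : θ ≤ 1) (h : CoerciveZ k₀ k₁ θ W) {f g : E}
    (hf : MemZ k₀ k₁ f) (he : ∀ v, MemZ k₀ k₁ v → inner ℝ (schr W f) v = inner ℝ g v) :
    f = solveZ k₀ k₁ W g := by
  obtain ⟨h1, h2⟩ := h.solveZ_spec hθ hθ1 g
  exact h.eq_of_inner hθ hf h1 fun v hv => by rw [he v hv, h2 v hv]

theorem CoerciveZ.norm_solveZ_le (hθ : 0 < θ) (hθ1 : θ ≤ 1) (h : CoerciveZ k₀ k₁ θ W) (g : E) :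
    ‖solveZ k₀ k₁ W g‖ ≤ θ⁻¹ * ‖g‖ := by
  obtain ⟨h1, h2⟩ := h.solveZ_spec hθ hθ1 g
  have h3 := h _ h1
  rw [h2 _ h1] at h3
  have h4 := real_inner_le_norm g (solveZ k₀ k₁ W g)
  set x := ‖solveZ k₀ k₁ W g‖
  have hx : 0 ≤ x := norm_nonneg _
  rw [inv_mul_eq_div, le_div_iff₀ hθ]
  rcases eq_or_lt_of_le hx with h0 | h0
  · rw [← h0, zero_mul]; exact norm_nonneg g
  · nlinarith

theorem CoerciveZ.opNorm_solveZ_le (hθ : 0 < θ) (hθ1 : θ ≤ 1) (h : CoerciveZ k₀ k₁ θ W) :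
    ‖solveZ k₀ k₁ W‖ ≤ θ⁻¹ :=
  ContinuousLinearMap.opNorm_le_bound _ (inv_nonneg.2 hθ.le) (h.norm_solveZ_le hθ hθ1)

theorem CoerciveZ.continuousAt_solveZ (hθ : 0 < θ) (hθ1 : θ ≤ 1) (h : CoerciveZ k₀ k₁ θ W) :
    ContinuousAt (solveZ k₀ k₁) W := by
  have h1 : Continuous (compress k₀ k₁) := by
    unfold compress schr
    fun_prop
  obtain ⟨u, hu⟩ := h.isUnit hθ hθ1
  have h2 : ContinuousAt (fun W => Ring.inverse (compress k₀ k₁ W)) W := by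
    refine ContinuousAt.comp (g := Ring.inverse) ?_ h1.continuousAt
    rw [← hu]
    exact NormedRing.inverse_continuousAt u
  unfold solveZ
  exact continuousAt_const.clm_comp (h2.clm_comp continuousAt_const)

end Solve

/-! ### Uniform coercivity and bounds on the eigenfunctions -/

section Coercive
variable {m M κ : ℝ} {V : ℝ →ᵇ ℝ} {ω₀ ω₁ : ℝ} {k₀ k₁ : E}

/-- The uniform coercivity constant. -/
noncomputable def coer (m M : ℝ) : ℝ := (m / 2) / (m / 2 + M + 1)

theorem Setting.M_nonneg (S : Setting m M κ V ω₀ ω₁ k₀ k₁) : 0 ≤ M :=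
  (abs_nonneg _).trans (S.bound 0)

theorem coer_pos (hm : 0 < m) (hM : 0 ≤ M) : 0 < coer m M := by unfold coer; positivity

theorem coer_le_one (hm : 0 < m) (hM : 0 ≤ M) : coer m M ≤ 1 := by
  rw [coer, div_le_one (by positivity)]; linarith

theorem Setting.form_nonneg (S : Setting m M κ V ω₀ ω₁ k₀ k₁) {f : E} (hf : MemZ k₀ k₁ f) :
    0 ≤ inner ℝ (schr V f) f := by
  refine le_trans (mul_nonneg S.κ_pos.le ?_) (S.form f hf)
  rw [inner_pot]
  refine integral_nonneg fun x => ?_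
  simp only [BoundedContinuousFunction.coe_pow, Pi.pow_apply, Pi.zero_apply]
  rw [mul_assoc]
  exact mul_nonneg (by positivity) (mul_self_nonneg _)

/-- On Z the form of V is nonnegative, so c - q ≥ m/2 gives the lower bound (m/2)‖u‖² in L²; |V| ≤ M
gives the lower bound ‖f‖² - (M + 1)‖u‖². Weighting these by M + 1 and m/2 cancels the L² norm and
yields a constant independent of c and q. -/
theorem Setting.coercive (S : Setting m M κ V ω₀ ω₁ k₀ k₁) {q : ℝ →ᵇ ℝ} {c : ℝ}
    (hq : ∀ x, q x ≤ c - m / 2) : CoerciveZ k₀ k₁ (coer m M) (V + c • 1 - q) := by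
  intro f hf
  have hM := S.M_nonneg
  have hm := S.m_pos
  have hsq : inner ℝ (pot 1 f) f = ‖emb f‖ ^ 2 := by
    rw [inner_pot_one, real_inner_self_eq_norm_sq]
  have h1 : m / 2 * ‖emb f‖ ^ 2 ≤ inner ℝ (schr (V + c • 1 - q) f) f := by
    have e : V + c • 1 - q = V + (c • 1 - q) := by abel
    rw [e, schr_add, inner_add_left]
    have := inner_pot_self_mono (w := (m / 2) • 1) (w' := c • 1 - q) (fun x => by
      simp; linarith [hq x]) f
    rw [map_smul, smul_apply, inner_smul_left, hsq, conj_trivial] at this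
    linarith [S.form_nonneg hf]
  have h2 : ‖f‖ ^ 2 - (M + 1) * ‖emb f‖ ^ 2 ≤ inner ℝ (schr (V + c • 1 - q) f) f := by
    rw [schr_apply, inner_add_left, real_inner_self_eq_norm_sq]
    have := inner_pot_self_mono (w := (-(M + 1)) • 1) (w' := V + c • 1 - q - 1) (fun x => by
      have := (abs_le.1 (S.bound x)).1
      simp
      linarith [hq x]) f
    rw [map_smul, smul_apply, inner_smul_left, hsq, conj_trivial] at this
    linarith
  rw [coer, div_mul_eq_mul_div, div_le_iff₀ (by positivity)]
  nlinarith

theorem Setting.ω₁_pos (S : Setting m M κ V ω₀ ω₁ k₀ k₁) : 0 < ω₁ := S.m_pos.trans_le S.le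

theorem Setting.ω₀_pos (S : Setting m M κ V ω₀ ω₁ k₀ k₁) : 0 < ω₀ := S.ω₁_pos.trans S.lt

/-- Test the equation with k itself: ‖k‖² = ∫(1 - V - w)k² ≤ 1 + M. -/
theorem norm_sq_le_of_schr {w : ℝ} (hb : ∀ x, |V x| ≤ M) (hw : 0 ≤ w) {k : E}
    (hk : schr (V + w • 1) k = 0) (h1 : inner ℝ (emb k) (emb k) = 1) : ‖k‖ ^ 2 ≤ 1 + M := by
  have h2 : inner ℝ (schr (V + w • 1) k) k = 0 := by rw [hk, inner_zero_left]
  rw [schr_apply, inner_add_left, real_inner_self_eq_norm_sq] at h2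
  have := inner_pot_self_mono (w := (-(M + 1)) • 1) (w' := V + w • 1 - 1) (fun x => by
      have := (abs_le.1 (hb x)).1
      simp
      linarith) k
  rw [map_smul, smul_apply, inner_smul_left, inner_pot_one, h1, conj_trivial] at this
  linarith

theorem Setting.norm₀_le (S : Setting m M κ V ω₀ ω₁ k₀ k₁) : ‖k₀‖ ≤ 1 + M := by
  have h := norm_sq_le_of_schr S.bound S.ω₀_pos.le S.eq₀ S.norm₀
  have hM := S.M_nonneg
  nlinarith [norm_nonneg k₀]

theorem Setting.norm₁_le (S : Setting m M κ V ω₀ ω₁ k₀ k₁) : ‖k₁‖ ≤ 1 + M := by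
  have h := norm_sq_le_of_schr S.bound S.ω₁_pos.le S.eq₁ S.norm₁
  have hM := S.M_nonneg
  nlinarith [norm_nonneg k₁]

end Coercive

/-! ### Near coincidence of ψ₀² and ψ₁² -/

section Closeness
variable {a₀ m M κ : ℝ} {V : 𝓢(ℝ, ℝ)} {ω₀ ω₁ : ℝ} {ψ₀ ψ₁ : ℝ → ℝ}

/-- Cutting the odd function ψ₁ off at its zero at the origin gives an even function f = hψ₁,
orthogonal to ψ₁, whose energy is close to -ω₁. The spectral decomposition bounds that energy below
by -ω₀α² with α = ⟨f, ψ₀⟩, so 1 - α² = O(ω₀ - ω₁) and f is close to αψ₀. The parameter θ comes from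
Young's inequality applied to f² - α²ψ₀² = (f - αψ₀)(f + αψ₀). -/
theorem _root_.IsAdmissible.integral_abs_sub_le (h : IsAdmissible a₀ m M κ V ω₀ ω₁ ψ₀ ψ₁)
    (hm : 0 < m) (hκ : 0 < κ) {θ : ℝ} (hθ : 0 < θ) :
    ∫ x, |ψ₁ x ^ 2 - ψ₀ x ^ 2| ≤
      (ω₀ - ω₁) * (1 + 2 / m + 1 / (θ * m)) + 2 * θ := by
  have H0 := h.isSol₀.isH1
  have H1 := h.isSol₁.isH1
  have hω₁ := h.ω₁_pos hm
  have hd : 0 < ω₀ - ω₁ := sub_pos.2 h.lt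
  set d := ω₀ - ω₁
  have h00 : ψ₁ 0 = 0 := by
    have := h.odd₁ hm hκ 0
    rw [neg_zero] at this
    linarith
  have hH1' : IsH1 (deriv ψ₁) := IsH1.of_hasDerivAt h.isSol₁.hasDerivAt_deriv
    ((V.continuous.add continuous_const).mul H1.continuous) H1.memLp_deriv
    (memLp_bdd_mul (C := M + |ω₁|) (V.continuous.add continuous_const)
      (fun x => (abs_add_le _ _).trans (add_le_add (h.bound x) le_rfl)) H1.memLp)
  obtain ⟨k, hcd, hodd, hb, ⟨C', hC'⟩, hi1, hi2⟩ := exists_cutoff H1 hH1' le_rfl h00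
    (by rw [neg_zero, h00]) (γ := d / (1 + ω₁)) (by positivity)
  set γ := d / (1 + ω₁)
  have hγ : γ * (1 + ω₁) = d := by simp only [γ]; field_simp
  have hγ0 : 0 < γ := by positivity
  have hf := H1.bdd_mul hcd hb hC'
  set f : ℝ → ℝ := fun x => k x * ψ₁ x with hfdef
  have hge := h.form_ge hf
  set α := ∫ x, f x * ψ₀ x with hα
  have hz1 : ∫ x, f x * ψ₁ x = 0 := by
    refine integral_eq_zero_of_odd fun x => ?_
    simp only [f]
    rw [hodd, h.odd₁ hm hκ]; ring
  have e1 : ∫ x, (deriv f x ^ 2 + V x * f x ^ 2) =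
      (∫ x, (deriv k x * ψ₁ x) ^ 2) - ω₁ * ∫ x, f x ^ 2 :=
    h.isSol₁.form_mul V.continuous h.bound hcd hb hC'
  have huniv : {x : ℝ | (0 : ℝ) ≤ |x|} = univ := by ext x; simp
  rw [huniv, setIntegral_univ, h.norm₁] at hi2
  set F := ∫ x, f x ^ 2 with hF
  have hi2' : 1 ≤ F + γ := hi2
  have if2 := integrable_sq_of_memLp hf.memLp
  have i02 := integrable_sq_of_memLp H0.memLp
  have i12 := integrable_sq_of_memLp H1.memLp
  have ifp := integrable_mul_of_memLp hf.memLp H0.memLp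
  have hfle : ∀ x, f x ^ 2 ≤ ψ₁ x ^ 2 := fun x => by
    simp only [f]
    rw [mul_pow]
    refine mul_le_of_le_one_left (sq_nonneg _) ?_
    rw [← sq_abs]
    exact pow_le_one₀ (abs_nonneg _) (hb x)
  have hF1 : F ≤ 1 := by
    rw [← h.norm₁]
    exact integral_mono if2 i12 hfle
  rw [hz1, e1] at hge
  have h5 : 0 ≤ κ * ∫ x, ψ₀ x ^ 4 * (f x - α * ψ₀ x - 0 * ψ₁ x) ^ 2 :=
    mul_nonneg hκ.le (integral_nonneg fun x => by positivity)
  have hα1 : α ^ 2 ≤ F := (h.sq_integral_le hf).1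
  have hω₀ : m < ω₀ := h.eigenvalue_bound.trans_lt h.lt
  have hα2 : 1 - α ^ 2 ≤ 2 * d / m := by
    rw [le_div_iff₀ hm]
    have : ω₀ * (1 - α ^ 2) ≤ 2 * d := by
      have e : d = ω₀ - ω₁ := rfl
      nlinarith
    have h6 : 0 ≤ 1 - α ^ 2 := by linarith
    nlinarith
  have hsub : ∫ x, (f x - α * ψ₀ x) ^ 2 = F - α ^ 2 := by
    have e : ∀ x, (f x - α * ψ₀ x) ^ 2 = f x ^ 2 - 2 * α * (f x * ψ₀ x) + α ^ 2 * ψ₀ x ^ 2 :=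
      fun x => by ring
    simp_rw [e]
    have i1 : Integrable fun x => f x ^ 2 - 2 * α * (f x * ψ₀ x) := if2.sub (ifp.const_mul _)
    rw [integral_add i1 (i02.const_mul _), integral_sub if2 (ifp.const_mul _), integral_const_mul,
      integral_const_mul, h.norm₀, ← hα]
    ring
  have isub : Integrable fun x => (f x - α * ψ₀ x) ^ 2 :=
    integrable_sq_of_memLp (hf.sub (H0.const_mul α)).memLp
  have hpt : ∀ x, |ψ₁ x ^ 2 - ψ₀ x ^ 2| ≤ (ψ₁ x ^ 2 - f x ^ 2) +
      (1 / (2 * θ) * (f x - α * ψ₀ x) ^ 2 + (θ * f x ^ 2 + (θ * α ^ 2) * ψ₀ x ^ 2)) +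
      (1 - α ^ 2) * ψ₀ x ^ 2 := fun x => by
    have t1 : |f x ^ 2 - α ^ 2 * ψ₀ x ^ 2| ≤
        1 / (2 * θ) * (f x - α * ψ₀ x) ^ 2 + (θ * f x ^ 2 + (θ * α ^ 2) * ψ₀ x ^ 2) := by
      set p := f x - α * ψ₀ x
      set r := f x + α * ψ₀ x
      have e1 : f x ^ 2 - α ^ 2 * ψ₀ x ^ 2 = p * r := by simp only [p, r]; ring
      have e2 : r ^ 2 ≤ 2 * (f x ^ 2 + α ^ 2 * ψ₀ x ^ 2) := by
        simp only [r]; nlinarith [sq_nonneg (f x - α * ψ₀ x)]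
      have e3 : |p * r| ≤ 1 / (2 * θ) * p ^ 2 + θ / 2 * r ^ 2 := by
        rw [abs_mul, ← sq_abs p, ← sq_abs r]
        have e4 : 1 / (2 * θ) * |p| ^ 2 + θ / 2 * |r| ^ 2 - |p| * |r| =
            (1 / (2 * θ)) * (|p| - θ * |r|) ^ 2 := by field_simp; ring
        have : 0 ≤ (1 / (2 * θ)) * (|p| - θ * |r|) ^ 2 := by positivity
        linarith
      rw [e1]
      nlinarith
    have e : ψ₁ x ^ 2 - ψ₀ x ^ 2 = (ψ₁ x ^ 2 - f x ^ 2) + (f x ^ 2 - α ^ 2 * ψ₀ x ^ 2) -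
      (1 - α ^ 2) * ψ₀ x ^ 2 := by ring
    rw [e]
    have a1 : |ψ₁ x ^ 2 - f x ^ 2| = ψ₁ x ^ 2 - f x ^ 2 := abs_of_nonneg (by linarith [hfle x])
    have a2 : |(1 - α ^ 2) * ψ₀ x ^ 2| = (1 - α ^ 2) * ψ₀ x ^ 2 :=
      abs_of_nonneg (mul_nonneg (by linarith) (sq_nonneg _))
    have := (abs_sub ((ψ₁ x ^ 2 - f x ^ 2) + (f x ^ 2 - α ^ 2 * ψ₀ x ^ 2))
      ((1 - α ^ 2) * ψ₀ x ^ 2)).trans (add_le_add (abs_add_le _ _) le_rfl)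
    linarith
  have j1 : Integrable fun x => ψ₁ x ^ 2 - f x ^ 2 := i12.sub if2
  have j2 : Integrable fun x => θ * f x ^ 2 + (θ * α ^ 2) * ψ₀ x ^ 2 :=
    (if2.const_mul _).add (i02.const_mul _)
  have j3 : Integrable fun x => 1 / (2 * θ) * (f x - α * ψ₀ x) ^ 2 +
      (θ * f x ^ 2 + (θ * α ^ 2) * ψ₀ x ^ 2) := (isub.const_mul _).add j2
  have j4 : Integrable fun x => (ψ₁ x ^ 2 - f x ^ 2) +
      (1 / (2 * θ) * (f x - α * ψ₀ x) ^ 2 + (θ * f x ^ 2 + (θ * α ^ 2) * ψ₀ x ^ 2)) := j1.add j3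
  have j0 : Integrable fun x => |ψ₁ x ^ 2 - ψ₀ x ^ 2| := (i12.sub i02).abs
  have j5 : Integrable fun x => (ψ₁ x ^ 2 - f x ^ 2) +
      (1 / (2 * θ) * (f x - α * ψ₀ x) ^ 2 + (θ * f x ^ 2 + (θ * α ^ 2) * ψ₀ x ^ 2)) +
      (1 - α ^ 2) * ψ₀ x ^ 2 := j4.add (i02.const_mul _)
  have hint := integral_mono j0 j5 hpt
  rw [integral_add j4 (i02.const_mul _), integral_add j1 j3, integral_sub i12 if2,
    integral_add (isub.const_mul _) j2, integral_add (if2.const_mul _) (i02.const_mul _),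
    integral_const_mul, integral_const_mul, integral_const_mul, integral_const_mul, h.norm₀,
    h.norm₁, hsub, ← hF] at hint
  refine hint.trans ?_
  have t2 : 1 / (2 * θ) * (F - α ^ 2) ≤ 1 / (2 * θ) * (2 * d / m) := by gcongr; linarith
  have t3 : 1 / (2 * θ) * (2 * d / m) = d * (1 / (θ * m)) := by field_simp
  have t4 : γ ≤ d := by nlinarith
  have t5 : d * (2 / m) = 2 * d / m := by ring
  have t6 : α ^ 2 ≤ 1 := hα1.trans hF1
  nlinarith

/-- In the limit `ω₀ - ω₁ → 0` the two eigenfunctions have the same modulus. -/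
theorem _root_.IsAdmissible.exists_close {m M κ : ℝ} (hm : 0 < m) (hκ : 0 < κ) {η : ℝ}
    (hη : 0 < η) : ∃ δ > 0, ∀ {a₀ : ℝ} {V : 𝓢(ℝ, ℝ)} {ω₀ ω₁ : ℝ} {ψ₀ ψ₁ : ℝ → ℝ},
      IsAdmissible a₀ m M κ V ω₀ ω₁ ψ₀ ψ₁ → ω₀ - ω₁ < δ → ∫ x, |ψ₁ x ^ 2 - ψ₀ x ^ 2| ≤ η := by
  -- θ = η/4 spends half of η on the term 2θ; this δ keeps the other term below the remaining half.
  refine ⟨(η / 2) / (1 + 2 / m + 1 / (η / 4 * m)), by positivity, fun h hd => ?_⟩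
  have h1 := h.integral_abs_sub_le hm hκ (θ := η / 4) (by positivity)
  rw [lt_div_iff₀ (by positivity)] at hd
  linarith

end Closeness

/-! ### Maps with bounds and Lipschitz constants on bounded sets -/

section Nice
variable {X F G H : Type*} [NormedAddCommGroup X] [NormedSpace ℝ X] [NormedAddCommGroup F]
  [NormedSpace ℝ F] [NormedAddCommGroup G] [NormedSpace ℝ G] [NormedAddCommGroup H]
  [NormedSpace ℝ H]

/-- Smooth maps which are bounded and Lipschitz on bounded sets. -/
def Nice (f : X → F) : Prop :=
  ContDiff ℝ ((⊤ : ℕ∞) : WithTop ℕ∞) f ∧ ∀ r : ℝ, ∃ C : ℝ, 0 ≤ C ∧ ∀ x y, ‖x‖ ≤ r → ‖y‖ ≤ r →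
    ‖f x‖ ≤ C ∧ ‖f x - f y‖ ≤ C * ‖x - y‖

theorem Nice.clm (L : X →L[ℝ] F) : Nice (fun x => L x) := by
  refine ⟨L.contDiff, fun r => ⟨‖L‖ * |r| + ‖L‖, by positivity, fun x y hx hy => ⟨?_, ?_⟩⟩⟩
  · have := L.le_opNorm x
    have h2 : ‖L‖ * ‖x‖ ≤ ‖L‖ * |r| := by gcongr; exact hx.trans (le_abs_self r)
    linarith [norm_nonneg L]
  · rw [← map_sub]
    refine (L.le_opNorm _).trans ?_
    gcongr
    have : 0 ≤ ‖L‖ * |r| := by positivity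
    linarith

theorem Nice.const (c : F) : Nice (fun _ : X => c) :=
  ⟨contDiff_const, fun _ => ⟨‖c‖, norm_nonneg _, fun x y _ _ =>
    ⟨le_rfl, by rw [sub_self, norm_zero]; positivity⟩⟩⟩

theorem Nice.add {f g : X → F} (hf : Nice f) (hg : Nice g) : Nice (fun x => f x + g x) := by
  refine ⟨hf.1.add hg.1, fun r => ?_⟩
  obtain ⟨C, hC, h⟩ := hf.2 r
  obtain ⟨C', hC', h'⟩ := hg.2 r
  refine ⟨C + C', by positivity, fun x y hx hy => ⟨?_, ?_⟩⟩
  · exact (norm_add_le _ _).trans (add_le_add (h x y hx hy).1 (h' x y hx hy).1)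
  · rw [add_sub_add_comm, add_mul]
    exact (norm_add_le _ _).trans (add_le_add (h x y hx hy).2 (h' x y hx hy).2)

theorem Nice.prodMk {f : X → F} {g : X → G} (hf : Nice f) (hg : Nice g) :
    Nice (fun x => (f x, g x)) := by
  refine ⟨hf.1.prodMk hg.1, fun r => ?_⟩
  obtain ⟨C, hC, h⟩ := hf.2 r
  obtain ⟨C', hC', h'⟩ := hg.2 r
  refine ⟨max C C', le_max_of_le_left hC, fun x y hx hy => ⟨?_, ?_⟩⟩
  · exact max_le_max (h x y hx hy).1 (h' x y hx hy).1
  · rw [Prod.mk_sub_mk, Prod.norm_mk]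
    refine max_le ((h x y hx hy).2.trans ?_) ((h' x y hx hy).2.trans ?_)
    · gcongr; exact le_max_left _ _
    · gcongr; exact le_max_right _ _

/-- All the nonlinear expressions below are assembled from bounded bilinear maps, so this closure
property carries the uniform estimates. The factor 2 covers the two terms of the difference. -/
theorem Nice.bilin (L : F →L[ℝ] G →L[ℝ] H) {f : X → F} {g : X → G} (hf : Nice f) (hg : Nice g) :
    Nice (fun x => L (f x) (g x)) := by
  refine ⟨(L.contDiff.comp hf.1).clm_apply hg.1, fun r => ?_⟩
  obtain ⟨C, hC, h⟩ := hf.2 r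
  obtain ⟨C', hC', h'⟩ := hg.2 r
  refine ⟨2 * (‖L‖ * C * C'), by positivity, fun x y hx hy => ?_⟩
  obtain ⟨a1, a2⟩ := h x y hx hy
  obtain ⟨b1, b2⟩ := h' x y hx hy
  obtain ⟨c1, -⟩ := h y x hy hx
  have hp : 0 ≤ ‖L‖ * C * C' := by positivity
  refine ⟨?_, ?_⟩
  · refine (L.le_opNorm₂ _ _).trans ?_
    have : ‖L‖ * ‖f x‖ * ‖g x‖ ≤ ‖L‖ * C * C' := by gcongr
    linarith
  · have e : L (f x) (g x) - L (f y) (g y) = L (f x - f y) (g x) + L (f y) (g x - g y) := by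
      simp only [map_sub, sub_apply]; abel
    rw [e]
    refine (norm_add_le _ _).trans ?_
    have e1 : ‖L (f x - f y) (g x)‖ ≤ ‖L‖ * (C * ‖x - y‖) * C' :=
      (L.le_opNorm₂ _ _).trans (by gcongr)
    have e2 : ‖L (f y) (g x - g y)‖ ≤ ‖L‖ * C * (C' * ‖x - y‖) :=
      (L.le_opNorm₂ _ _).trans (by gcongr)
    linarith

theorem Nice.comp {g : F → G} {f : X → F} (hg : Nice g) (hf : Nice f) :
    Nice (fun x => g (f x)) := by
  refine ⟨hg.1.comp hf.1, fun r => ?_⟩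
  obtain ⟨C, hC, h⟩ := hf.2 r
  obtain ⟨C', hC', h'⟩ := hg.2 C
  refine ⟨max C' (C' * C), le_max_of_le_left hC', fun x y hx hy => ?_⟩
  have h3 := h' (f x) (f y) (h x y hx hy).1 (h y x hy hx).1
  refine ⟨h3.1.trans (le_max_left _ _), h3.2.trans ?_⟩
  calc C' * ‖f x - f y‖ ≤ C' * (C * ‖x - y‖) := by gcongr; exact (h x y hx hy).2
    _ = C' * C * ‖x - y‖ := by ring
    _ ≤ _ := by gcongr; exact le_max_right _ _

theorem Nice.clm_comp (L : F →L[ℝ] G) {f : X → F} (hf : Nice f) : Nice (fun x => L (f x)) :=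
  (Nice.clm L).comp hf

theorem Nice.smul {f : X → ℝ} {g : X → F} (hf : Nice f) (hg : Nice g) :
    Nice (fun x => f x • g x) :=
  Nice.bilin (ContinuousLinearMap.lsmul ℝ ℝ) hf hg

theorem Nice.sub {f g : X → F} (hf : Nice f) (hg : Nice g) : Nice (fun x => f x - g x) := by
  have := hf.add ((Nice.const (X := X) (-1 : ℝ)).smul hg)
  simpa [sub_eq_add_neg] using this

theorem Nice.inner {f g : X → E} (hf : Nice f) (hg : Nice g) :
    Nice (fun x => inner ℝ (f x) (g x)) := Nice.bilin (innerSL ℝ) hf hg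

section Algebra
variable {A : Type*} [NormedCommRing A] [NormedAlgebra ℝ A]

theorem Nice.mul {f g : X → A} (hf : Nice f) (hg : Nice g) : Nice (fun x => f x * g x) :=
  Nice.bilin (ContinuousLinearMap.mul ℝ A) hf hg

theorem Nice.pow {f : X → A} (hf : Nice f) (n : ℕ) : Nice (fun x => f x ^ n) := by
  induction n with
  | zero => simpa using Nice.const (1 : A)
  | succ n ih => simpa only [pow_succ] using ih.mul hf

end Algebra

end Nice

/-! ### The reduced equations -/

/-- The data entering the reduced equations: the solution operator and the eigenfunctions. -/
abbrev Par := (E →L[ℝ] E) × E × E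

/-- The variables of the reduced equations: the data, the bifurcation parameter `τ`, and the
corrections to the two eigenfunctions. -/
abbrev Var := Par × ℝ × E × E

namespace Var

/-- The even profile. -/
noncomputable def e (x : Var) : E := x.1.2.1 + x.2.2.1

/-- The odd profile. -/
noncomputable def p (x : Var) : E := x.1.2.2 + x.2.2.2

/-- The nonlinear potential in the equation of the even profile. -/
noncomputable def we (x : Var) : ℝ →ᵇ ℝ :=
  ev x.e ^ 4 + (10 * x.2.1) • (ev x.e ^ 2 * ev x.p ^ 2) + (5 * x.2.1 ^ 2) • ev x.p ^ 4

/-- The nonlinear potential in the equation of the odd profile. -/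
noncomputable def wo (x : Var) : ℝ →ᵇ ℝ :=
  (5 : ℝ) • ev x.e ^ 4 + (10 * x.2.1) • (ev x.e ^ 2 * ev x.p ^ 2) + x.2.1 ^ 2 • ev x.p ^ 4

/-- The rescaled frequency. -/
noncomputable def mu (x : Var) : ℝ := inner ℝ (pot x.we x.e) x.1.2.1

/-- The reduced bifurcation function. -/
noncomputable def gap (x : Var) : ℝ := inner ℝ (pot x.wo x.p) x.1.2.2 - x.mu

/-- The right-hand side of the equations of the corrections. -/
noncomputable def rhs (x : Var) : E × E :=
  (x.1.1 (pot (x.we - x.mu • 1) x.e), x.1.1 (pot (x.wo - x.mu • 1) x.p))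

/-- The derivative of `mu` with respect to `τ` at `τ = 0`. -/
noncomputable def mu' (x : Var) : ℝ :=
  inner ℝ (pot ((10 : ℝ) • (ev x.e ^ 2 * ev x.p ^ 2)) x.e) x.1.2.1

/-- The derivative of `gap` with respect to `τ` at `τ = 0`. -/
noncomputable def gap' (x : Var) : ℝ :=
  inner ℝ (pot ((10 : ℝ) • (ev x.e ^ 2 * ev x.p ^ 2)) x.p) x.1.2.2 - x.mu'

theorem nice_e : Nice e :=
  (Nice.clm ((ContinuousLinearMap.fst ℝ E E) ∘L (ContinuousLinearMap.snd ℝ (E →L[ℝ] E) (E × E)) ∘L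
    (ContinuousLinearMap.fst ℝ Par (ℝ × E × E)))).add
  (Nice.clm ((ContinuousLinearMap.fst ℝ E E) ∘L (ContinuousLinearMap.snd ℝ ℝ (E × E)) ∘L
    (ContinuousLinearMap.snd ℝ Par (ℝ × E × E))))

theorem nice_p : Nice p :=
  (Nice.clm ((ContinuousLinearMap.snd ℝ E E) ∘L (ContinuousLinearMap.snd ℝ (E →L[ℝ] E) (E × E)) ∘L
    (ContinuousLinearMap.fst ℝ Par (ℝ × E × E)))).add
  (Nice.clm ((ContinuousLinearMap.snd ℝ E E) ∘L (ContinuousLinearMap.snd ℝ ℝ (E × E)) ∘L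
    (ContinuousLinearMap.snd ℝ Par (ℝ × E × E))))

theorem nice_k₀ : Nice (fun x : Var => x.1.2.1) :=
  Nice.clm ((ContinuousLinearMap.fst ℝ E E) ∘L (ContinuousLinearMap.snd ℝ (E →L[ℝ] E) (E × E)) ∘L
    (ContinuousLinearMap.fst ℝ Par (ℝ × E × E)))

theorem nice_k₁ : Nice (fun x : Var => x.1.2.2) :=
  Nice.clm ((ContinuousLinearMap.snd ℝ E E) ∘L (ContinuousLinearMap.snd ℝ (E →L[ℝ] E) (E × E)) ∘L
    (ContinuousLinearMap.fst ℝ Par (ℝ × E × E)))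

theorem nice_op : Nice (fun x : Var => x.1.1) :=
  Nice.clm ((ContinuousLinearMap.fst ℝ (E →L[ℝ] E) (E × E)) ∘L
    (ContinuousLinearMap.fst ℝ Par (ℝ × E × E)))

theorem nice_tau : Nice (fun x : Var => x.2.1) :=
  Nice.clm ((ContinuousLinearMap.fst ℝ ℝ (E × E)) ∘L
    (ContinuousLinearMap.snd ℝ Par (ℝ × E × E)))

theorem nice_ev_e : Nice (fun x : Var => ev x.e) := nice_e.clm_comp ev

theorem nice_ev_p : Nice (fun x : Var => ev x.p) := nice_p.clm_comp ev

theorem nice_we : Nice we :=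
  ((nice_ev_e.pow 4).add (((Nice.const 10).mul nice_tau).smul
    ((nice_ev_e.pow 2).mul (nice_ev_p.pow 2)))).add
    (((Nice.const 5).mul (nice_tau.pow 2)).smul (nice_ev_p.pow 4))

theorem nice_wo : Nice wo :=
  (((Nice.const 5).smul (nice_ev_e.pow 4)).add (((Nice.const 10).mul nice_tau).smul
    ((nice_ev_e.pow 2).mul (nice_ev_p.pow 2)))).add
    ((nice_tau.pow 2).smul (nice_ev_p.pow 4))

theorem nice_mu : Nice mu := (Nice.bilin pot nice_we nice_e).inner nice_k₀

theorem nice_gap : Nice gap := ((Nice.bilin pot nice_wo nice_p).inner nice_k₁).sub nice_mu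

theorem nice_rhs : Nice rhs :=
  (Nice.bilin (ContinuousLinearMap.id ℝ (E →L[ℝ] E)) nice_op
    (Nice.bilin pot (nice_we.sub (nice_mu.smul (Nice.const 1))) nice_e)).prodMk
  (Nice.bilin (ContinuousLinearMap.id ℝ (E →L[ℝ] E)) nice_op
    (Nice.bilin pot (nice_wo.sub (nice_mu.smul (Nice.const 1))) nice_p))

theorem nice_mu' : Nice mu' :=
  (Nice.bilin pot ((Nice.const 10).smul ((nice_ev_e.pow 2).mul (nice_ev_p.pow 2))) nice_e).inner
    nice_k₀

theorem nice_gap' : Nice gap' :=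
  ((Nice.bilin pot ((Nice.const 10).smul ((nice_ev_e.pow 2).mul (nice_ev_p.pow 2))) nice_p).inner
    nice_k₁).sub nice_mu'

end Var

/-- The reduced fixed point problem at `τ`. -/
def IsFixed (D : Par) (d τ : ℝ) (y : E × E) : Prop :=
  y = (d / Var.gap (D, τ, y)) • Var.rhs (D, τ, y)

/-- The curve of solutions of the reduced fixed point problem, with its uniform estimates. -/
structure IsCurve (D : Par) (a₀ d r₀ L : ℝ) (Y : ℝ → E × E) : Prop where
  gap_ge : ∀ τ y, |τ| ≤ r₀ → ‖y‖ ≤ r₀ → a₀ / 2 ≤ Var.gap (D, τ, y)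
  fixed : ∀ τ, |τ| ≤ r₀ → IsFixed D d τ (Y τ)
  unique : ∀ τ y, |τ| ≤ r₀ → ‖y‖ ≤ r₀ → IsFixed D d τ y → y = Y τ
  norm_le : ∀ τ, |τ| ≤ r₀ → ‖Y τ‖ ≤ L * d
  norm_le' : ∀ τ, |τ| ≤ r₀ → ‖Y τ‖ ≤ r₀ / 2
  lip : ∀ τ τ', |τ| ≤ r₀ → |τ'| ≤ r₀ → ‖Y τ - Y τ'‖ ≤ L * d * |τ - τ'|
  smooth : ∀ τ, |τ| < r₀ → ContDiffAt ℝ ((⊤ : ℕ∞) : WithTop ℕ∞) Y τ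

theorem isInvertible_of_isUnit {F : Type*} [NormedAddCommGroup F] [NormedSpace ℝ F]
    {T : F →L[ℝ] F} (h : IsUnit T) : T.IsInvertible := by
  obtain ⟨u, rfl⟩ := h
  exact ⟨ContinuousLinearEquiv.unitsEquiv ℝ F u, rfl⟩

/-- Smooth dependence of the fixed points of a uniform contraction on a parameter. -/
theorem contDiffAt_of_fixedPoint {F : Type*} [NormedAddCommGroup F] [NormedSpace ℝ F]
    [CompleteSpace F] {g : ℝ × F → F} {Y : ℝ → F} {r K : ℝ} {τ : ℝ}
    (hK : K < 1) (hK0 : 0 ≤ K) (hr : 0 < r)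
    (hg : ContDiffAt ℝ ((⊤ : ℕ∞) : WithTop ℕ∞) g (τ, Y τ))
    (hlip : ∀ y y', ‖y‖ ≤ r → ‖y'‖ ≤ r → ‖g (τ, y) - g (τ, y')‖ ≤ K * ‖y - y'‖)
    (hτ : |τ| < r) (hY : ‖Y τ‖ ≤ r / 2) (hfix : g (τ, Y τ) = Y τ)
    (huniq : ∀ s y, |s| ≤ r → ‖y‖ ≤ r → g (s, y) = y → y = Y s) :
    ContDiffAt ℝ ((⊤ : ℕ∞) : WithTop ℕ∞) Y τ := by
  set n : WithTop ℕ∞ := ((⊤ : ℕ∞) : WithTop ℕ∞)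
  have hn : n ≠ 0 := by simp [n]
  -- Implicit function theorem for f = 0: the Lipschitz constant K < 1 makes 1 - ∂_y g invertible,
  -- and uniqueness of fixed points identifies the implicit function with Y.
  set f : ℝ × F → F := fun z => z.2 - g z
  have hf : ContDiffAt ℝ n f (τ, Y τ) := contDiffAt_snd.sub hg
  have hgd : HasFDerivAt g (fderiv ℝ g (τ, Y τ)) (τ, Y τ) :=
    (hg.differentiableAt hn).hasFDerivAt
  have hfd : fderiv ℝ f (τ, Y τ) = ContinuousLinearMap.snd ℝ ℝ F - fderiv ℝ g (τ, Y τ) :=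
    (hasFDerivAt_snd.sub hgd).fderiv
  have hcomp : HasFDerivAt (fun y => g (τ, y)) (fderiv ℝ g (τ, Y τ) ∘L .inr ℝ ℝ F) (Y τ) :=
    hgd.comp (Y τ) (hasFDerivAt_prodMk_right τ (Y τ))
  have hnorm : ‖fderiv ℝ g (τ, Y τ) ∘L .inr ℝ ℝ F‖ ≤ K := by
    refine hcomp.le_of_lipschitzOn (C := ⟨K, hK0⟩) (s := Metric.closedBall 0 r) ?_ ?_
    · refine Metric.closedBall_mem_nhds_of_mem ?_
      rw [mem_ball_zero_iff]
      linarith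
    · refine LipschitzOnWith.of_dist_le_mul fun y hy y' hy' => ?_
      rw [dist_eq_norm, dist_eq_norm]
      exact hlip y y' (by simpa using hy) (by simpa using hy')
  have hinv : (fderiv ℝ f (τ, Y τ) ∘L .inr ℝ ℝ F).IsInvertible := by
    have e : fderiv ℝ f (τ, Y τ) ∘L .inr ℝ ℝ F = 1 - fderiv ℝ g (τ, Y τ) ∘L .inr ℝ ℝ F := by
      rw [hfd]; ext x; simp
    rw [e]
    exact isInvertible_of_isUnit (isUnit_one_sub_of_norm_lt_one (hnorm.trans_lt hK))
  have h1 := hf.eventually_apply_implicitFunction hn hinv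
  have h2 := hf.contDiffAt_implicitFunction hn hinv
  have h3 := hf.implicitFunction_apply_self hn hinv
  set φ := hf.implicitFunction hn hinv
  simp only at h1 h2 h3
  refine h2.congr_of_eventuallyEq ?_
  have h4 : ∀ᶠ s in 𝓝 τ, ‖φ s‖ < r := by
    have : Tendsto (fun s => ‖φ s‖) (𝓝 τ) (𝓝 ‖φ τ‖) := h2.continuousAt.norm
    refine this.eventually_lt_const ?_
    rw [h3]; linarith
  have h5 : ∀ᶠ s in 𝓝 τ, |s| < r := (continuous_abs.tendsto τ).eventually_lt_const hτ
  filter_upwards [h1, h4, h5] with s e1 e2 e3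
  have e4 : f (τ, Y τ) = 0 := by simp only [f, hfix, sub_self]
  rw [e4] at e1
  exact (huniq s (φ s) e3.le e2.le (sub_eq_zero.1 e1).symm).symm

/-- The Lipschitz constant of `gap` is uniform over ‖D‖ ≤ CD, so a uniform radius r₀ keeps `gap`
above a₀/2. There (d / gap) • rhs is of size O(d) with Lipschitz constant O(d), and Banach's fixed
point theorem applies for small d. -/
theorem exists_curve (CD : ℝ) {a₀ : ℝ} (ha₀ : 0 < a₀) {rmax : ℝ} (hrmax : 0 < rmax) :
    ∃ r₀ > 0, r₀ ≤ rmax ∧ r₀ ≤ 1 ∧ ∃ δ > 0, ∃ L ≥ 0, ∀ D : Par, ‖D‖ ≤ CD →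
      a₀ ≤ Var.gap (D, 0, 0) → ∀ d, 0 < d → d < δ → ∃ Y, IsCurve D a₀ d r₀ L Y := by
  set ρ := max CD 1
  obtain ⟨C₁, hC₁, h₁⟩ := Var.nice_gap.2 ρ
  obtain ⟨C₂, hC₂, h₂⟩ := Var.nice_rhs.2 ρ
  set r₀ := min (min rmax 1) (a₀ / (2 * (C₁ + 1)))
  have hr₀ : 0 < r₀ := lt_min (lt_min hrmax one_pos) (by positivity)
  have hr1 : r₀ ≤ 1 := (min_le_left _ _).trans (min_le_right _ _)
  have hrm : r₀ ≤ rmax := (min_le_left _ _).trans (min_le_left _ _)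
  have hrC : C₁ * r₀ ≤ a₀ / 2 := by
    have h3 : r₀ ≤ a₀ / (2 * (C₁ + 1)) := min_le_right _ _
    rw [le_div_iff₀ (by positivity)] at h3
    nlinarith
  -- Lipschitz constant of `rhs / gap`
  set N := 2 / a₀ * C₂ + (2 / a₀) ^ 2 * C₁ * C₂ + 1
  have hN : 0 < N := by positivity
  -- For d < r₀/(2N) the ball of radius r₀ is mapped into the one of radius r₀/2 with contraction
  -- factor dN ≤ 1/2. Absorbing this factor in the Lipschitz estimate of Y doubles N, whence L = 2N.
  refine ⟨r₀, hr₀, hrm, hr1, r₀ / (2 * N), by positivity, 2 * N, by positivity,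
    fun D hD hgap d hd hdδ => ?_⟩
  have hdN : d * N ≤ r₀ / 2 := by
    rw [lt_div_iff₀ (by positivity)] at hdδ
    linarith
  have hdN1 : d * N ≤ 1 / 2 := by linarith
  have hball : ∀ τ (y : E × E), |τ| ≤ r₀ → ‖y‖ ≤ r₀ → ‖((D, τ, y) : Var)‖ ≤ ρ := by
    intro τ y hτ hy
    rw [Prod.norm_mk, Prod.norm_mk]
    refine max_le (hD.trans (le_max_left _ _)) (max_le ?_ ?_)
    · exact (hτ.trans hr1).trans (le_max_right _ _)
    · exact (hy.trans hr1).trans (le_max_right _ _)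
  have hdist : ∀ τ τ' (y y' : E × E), ‖((D, τ, y) : Var) - (D, τ', y')‖ =
      max |τ - τ'| ‖y - y'‖ := by
    intro τ τ' y y'
    have : ((D, τ, y) : Var) - (D, τ', y') = (0, τ - τ', y - y') :=
      Prod.ext (sub_self D) rfl
    rw [this, Prod.norm_mk, Prod.norm_mk (τ - τ'), norm_zero, Real.norm_eq_abs]
    exact max_eq_right (le_max_of_le_left (abs_nonneg _))
  have hge : ∀ τ y, |τ| ≤ r₀ → ‖y‖ ≤ r₀ → a₀ / 2 ≤ Var.gap (D, τ, y) := by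
    intro τ y hτ hy
    have h3 := (h₁ (D, τ, y) (D, 0, 0) (hball _ _ hτ hy)
      (hball _ _ (by simpa using hr₀.le) (by simpa using hr₀.le))).2
    rw [hdist, sub_zero, sub_zero, Real.norm_eq_abs] at h3
    have h4 : C₁ * max |τ| ‖y‖ ≤ C₁ * r₀ := by gcongr; exact max_le hτ hy
    have := (abs_le.1 (h3.trans h4)).1
    linarith
  set g : ℝ × (E × E) → E × E := fun z => (d / Var.gap (D, z)) • Var.rhs (D, z)
  have hgn : ∀ τ y, |τ| ≤ r₀ → ‖y‖ ≤ r₀ → ‖g (τ, y)‖ ≤ d * N := by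
    intro τ y hτ hy
    have h3 := hge τ y hτ hy
    have h4 := (h₂ (D, τ, y) (D, τ, y) (hball _ _ hτ hy) (hball _ _ hτ hy)).1
    have hp : 0 < Var.gap (D, τ, y) := by linarith
    simp only [g]
    rw [norm_smul, Real.norm_eq_abs, abs_of_pos (by positivity)]
    have h5 : d / Var.gap (D, τ, y) ≤ d / (a₀ / 2) := by gcongr
    calc d / Var.gap (D, τ, y) * ‖Var.rhs (D, τ, y)‖ ≤ d / (a₀ / 2) * C₂ := by gcongr
      _ = d * (2 / a₀ * C₂) := by field_simp
      _ ≤ d * N := by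
        gcongr
        have : 0 ≤ (2 / a₀) ^ 2 * C₁ * C₂ := by positivity
        simp only [N]; linarith
  have hgl : ∀ τ τ' y y', |τ| ≤ r₀ → |τ'| ≤ r₀ → ‖y‖ ≤ r₀ → ‖y'‖ ≤ r₀ →
      ‖g (τ, y) - g (τ', y')‖ ≤ d * N * max |τ - τ'| ‖y - y'‖ := by
    intro τ τ' y y' hτ hτ' hy hy'
    have q1 := hge τ y hτ hy
    have q2 := hge τ' y' hτ' hy'
    have p1 : 0 < Var.gap (D, τ, y) := by linarith
    have p2 : 0 < Var.gap (D, τ', y') := by linarith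
    have l1 := h₁ (D, τ, y) (D, τ', y') (hball _ _ hτ hy) (hball _ _ hτ' hy')
    have l2 := h₂ (D, τ, y) (D, τ', y') (hball _ _ hτ hy) (hball _ _ hτ' hy')
    have l3 := (h₂ (D, τ', y') (D, τ, y) (hball _ _ hτ' hy') (hball _ _ hτ hy)).1
    rw [hdist] at l1 l2
    set δ' := max |τ - τ'| ‖y - y'‖
    have hδ' : 0 ≤ δ' := le_max_of_le_left (abs_nonneg _)
    set G := Var.gap (D, τ, y)
    set G' := Var.gap (D, τ', y')
    set R := Var.rhs (D, τ, y)
    set R' := Var.rhs (D, τ', y')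
    have e : g (τ, y) - g (τ', y') = (d / G) • (R - R') + (d * ((G' - G) / (G * G'))) • R' := by
      simp only [g]
      rw [show Var.gap (D, τ, y) = G from rfl, show Var.gap (D, τ', y') = G' from rfl,
        show Var.rhs (D, τ, y) = R from rfl, show Var.rhs (D, τ', y') = R' from rfl]
      have : d * ((G' - G) / (G * G')) = d / G - d / G' := by field_simp
      rw [this, smul_sub, sub_smul]; abel
    have b1 : ‖(d / G) • (R - R')‖ ≤ d / (a₀ / 2) * (C₂ * δ') := by
      rw [norm_smul, Real.norm_eq_abs, abs_of_pos (by positivity)]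
      have : d / G ≤ d / (a₀ / 2) := by gcongr
      exact mul_le_mul this l2.2 (norm_nonneg _) (by positivity)
    have b2 : ‖(d * ((G' - G) / (G * G'))) • R'‖ ≤ d * (C₁ * δ' / (a₀ / 2 * (a₀ / 2))) * C₂ := by
      rw [norm_smul, norm_mul, Real.norm_eq_abs d, abs_of_pos hd, norm_div, norm_mul,
        Real.norm_eq_abs G, Real.norm_eq_abs G', abs_of_pos p1, abs_of_pos p2, norm_sub_rev]
      gcongr
      exact l1.2
    rw [e]
    refine (norm_add_le _ _).trans ((add_le_add b1 b2).trans ?_)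
    have : d / (a₀ / 2) * (C₂ * δ') + d * (C₁ * δ' / (a₀ / 2 * (a₀ / 2))) * C₂ =
        d * (2 / a₀ * C₂ + (2 / a₀) ^ 2 * C₁ * C₂) * δ' := by field_simp
    rw [this]
    gcongr
    simp only [N]; linarith
  have hex : ∀ τ, |τ| ≤ r₀ → ∃ y, ‖y‖ ≤ r₀ ∧ g (τ, y) = y := by
    intro τ hτ
    have hmaps : MapsTo (fun y => g (τ, y)) (Metric.closedBall 0 r₀) (Metric.closedBall 0 r₀) := by
      intro y hy
      rw [mem_closedBall_zero_iff] at hy ⊢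
      exact (hgn τ y hτ hy).trans (by linarith)
    have hcontr : ContractingWith (1 / 2) (hmaps.restrict (fun y => g (τ, y)) _ _) := by
      refine ⟨by rw [← NNReal.coe_lt_coe]; norm_num, LipschitzWith.of_dist_le_mul ?_⟩
      rintro ⟨y, hy⟩ ⟨y', hy'⟩
      rw [mem_closedBall_zero_iff] at hy hy'
      rw [Subtype.dist_eq, Subtype.dist_eq, dist_eq_norm, dist_eq_norm]
      refine (hgl τ τ y y' hτ hτ hy hy').trans ?_
      rw [sub_self, abs_zero, max_eq_right (norm_nonneg _)]
      gcongr
      simpa using hdN1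
    obtain ⟨y, hy, hfix, -⟩ := hcontr.exists_fixedPoint' Metric.isClosed_closedBall.isComplete
      hmaps (x := 0) (by simpa using hr₀.le) (edist_ne_top _ _)
    exact ⟨y, by simpa using hy, hfix⟩
  choose! Y hY1 hY2 using hex
  have huniq : ∀ τ y, |τ| ≤ r₀ → ‖y‖ ≤ r₀ → g (τ, y) = y → y = Y τ := by
    intro τ y hτ hy hfix
    have h3 := hgl τ τ y (Y τ) hτ hτ hy (hY1 τ hτ)
    rw [hfix, hY2 τ hτ, sub_self, abs_zero, max_eq_right (norm_nonneg _)] at h3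
    have h4 : ‖y - Y τ‖ ≤ 0 := by nlinarith [norm_nonneg (y - Y τ)]
    exact sub_eq_zero.1 (norm_le_zero_iff.1 h4)
  have hnorm : ∀ τ, |τ| ≤ r₀ → ‖Y τ‖ ≤ d * N := fun τ hτ => by
    conv_lhs => rw [← hY2 τ hτ]
    exact hgn τ _ hτ (hY1 τ hτ)
  refine ⟨Y, hge, fun τ hτ => (hY2 τ hτ).symm, fun τ y hτ hy hf => huniq τ y hτ hy hf.symm,
    fun τ hτ => (hnorm τ hτ).trans (by nlinarith), fun τ hτ => (hnorm τ hτ).trans hdN,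
    fun τ τ' hτ hτ' => ?_, fun τ hτ => ?_⟩
  · have h3 := hgl τ τ' _ _ hτ hτ' (hY1 τ hτ) (hY1 τ' hτ')
    rw [hY2 τ hτ, hY2 τ' hτ'] at h3
    have h4 : max |τ - τ'| ‖Y τ - Y τ'‖ ≤ |τ - τ'| + ‖Y τ - Y τ'‖ :=
      max_le_add_of_nonneg (abs_nonneg _) (norm_nonneg _)
    have h5 : d * N * max |τ - τ'| ‖Y τ - Y τ'‖ ≤ d * N * (|τ - τ'| + ‖Y τ - Y τ'‖) := by gcongr
    have h6 : d * N * ‖Y τ - Y τ'‖ ≤ 1 / 2 * ‖Y τ - Y τ'‖ := by gcongr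
    linarith
  · have hin : ContDiff ℝ ((⊤ : ℕ∞) : WithTop ℕ∞) fun z : ℝ × (E × E) => ((D, z) : Var) :=
      contDiff_const.prodMk contDiff_id
    have hp : Var.gap (D, τ, Y τ) ≠ 0 := by
      have := hge τ _ hτ.le (hY1 τ hτ.le)
      linarith
    refine contDiffAt_of_fixedPoint (g := g) (K := d * N) (by linarith) (by positivity) hr₀ ?_ ?_ hτ
      ((hnorm τ hτ.le).trans hdN) (hY2 τ hτ.le) huniq
    · exact (contDiffAt_const.div (Var.nice_gap.1.comp hin).contDiffAt hp).smul
        (Var.nice_rhs.1.comp hin).contDiffAt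
    · intro y y' hy hy'
      refine (hgl τ τ y y' hτ.le hτ.le hy hy').trans ?_
      rw [sub_self, abs_zero, max_eq_right (norm_nonneg _)]

/-! ### Profile equations and the fixed point problem -/

section Reduction
variable {m M κ : ℝ} {V : ℝ →ᵇ ℝ} {ω₀ ω₁ : ℝ} {k₀ k₁ : E}

/-- The data of the reduced problem. -/
noncomputable def par (V : ℝ →ᵇ ℝ) (ω₀ : ℝ) (k₀ k₁ : E) : Par :=
  (solveZ k₀ k₁ (V + ω₀ • 1), k₀, k₁)

theorem Setting.coercive₀ (S : Setting m M κ V ω₀ ω₁ k₀ k₁) :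
    CoerciveZ k₀ k₁ (coer m M) (V + ω₀ • 1) := by
  have := S.coercive (q := 0) (c := ω₀) fun x => by
    have := S.m_pos; have := S.le; have := S.lt
    simp; linarith
  rwa [sub_zero] at this

theorem Setting.coer_pos (S : Setting m M κ V ω₀ ω₁ k₀ k₁) : 0 < coer m M :=
  Branch.coer_pos S.m_pos S.M_nonneg

theorem Setting.coer_le_one (S : Setting m M κ V ω₀ ω₁ k₀ k₁) : coer m M ≤ 1 :=
  Branch.coer_le_one S.m_pos S.M_nonneg

theorem Setting.norm_par_le (S : Setting m M κ V ω₀ ω₁ k₀ k₁) :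
    ‖par V ω₀ k₀ k₁‖ ≤ max (coer m M)⁻¹ (1 + M) := by
  rw [par, Prod.norm_mk, Prod.norm_mk]
  exact max_le_max (S.coercive₀.opNorm_solveZ_le S.coer_pos S.coer_le_one)
    (max_le S.norm₀_le S.norm₁_le)

theorem schr_add_smul_one (V : ℝ →ᵇ ℝ) (w w' : ℝ) (f : E) :
    schr (V + w' • 1) f = schr (V + w • 1) f + (w' - w) • pot 1 f := by
  rw [schr_smul_one, schr_smul_one, sub_smul]; abel

theorem Setting.schr_k₀ (S : Setting m M κ V ω₀ ω₁ k₀ k₁) (w : ℝ) :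
    schr (V + w • 1) k₀ = (w - ω₀) • pot 1 k₀ := by
  rw [schr_add_smul_one V ω₀, S.eq₀, zero_add]

theorem Setting.schr_k₁ (S : Setting m M κ V ω₀ ω₁ k₀ k₁) (w : ℝ) :
    schr (V + w • 1) k₁ = (w - ω₁) • pot 1 k₁ := by
  rw [schr_add_smul_one V ω₁, S.eq₁, zero_add]

theorem MemZ.inner_pot_one₀ {v : E} (hv : MemZ k₀ k₁ v) : inner ℝ (pot 1 k₀) v = 0 := by
  rw [inner_pot_one, real_inner_comm]; exact hv.1

theorem MemZ.inner_pot_one₁ {v : E} (hv : MemZ k₀ k₁ v) : inner ℝ (pot 1 k₁) v = 0 := by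
  rw [inner_pot_one, real_inner_comm]; exact hv.2

theorem inner_emb_reflect (f h : E) :
    inner ℝ (emb (reflect f)) (emb h) = inner ℝ (emb f) (emb (reflect h)) := by
  rw [← inner_pot_one, pot_reflect (w := 1) (w' := 1) (fun x => by simp), inner_reflect_left,
    inner_pot_one]

theorem Setting.memZ_sub (S : Setting m M κ V ω₀ ω₁ k₀ k₁) (f : E) :
    MemZ k₀ k₁ (f - inner ℝ (emb f) (emb k₀) • k₀ - inner ℝ (emb f) (emb k₁) • k₁) := by
  have h := S.orth
  have h' : inner ℝ (emb k₁) (emb k₀) = 0 := by rw [real_inner_comm]; exact h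
  constructor <;>
  simp only [map_sub, map_smul, inner_sub_left, inner_smul_left, S.norm₀, S.norm₁, h, h'] <;>
  simp

/-- A functional vanishing on both eigenfunctions and on their complement vanishes. -/
theorem Setting.eq_zero_of_inner (S : Setting m M κ V ω₀ ω₁ k₀ k₁) {g : E}
    (h0 : inner ℝ g k₀ = 0) (h1 : inner ℝ g k₁ = 0)
    (hZ : ∀ v, MemZ k₀ k₁ v → inner ℝ g v = 0) : g = 0 := by
  refine ext_inner_right ℝ fun f => ?_
  have := hZ _ (S.memZ_sub f)
  rw [inner_sub_right, inner_sub_right, inner_smul_right, inner_smul_right, h0, h1] at this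
  rw [inner_zero_left]
  linarith

theorem memZ_smul {f : E} (c : ℝ) (h : MemZ k₀ k₁ f) : MemZ k₀ k₁ (c • f) := by
  rw [memZ_iff] at *; exact Submodule.smul_mem _ _ h

theorem Setting.memZ_reflect (S : Setting m M κ V ω₀ ω₁ k₀ k₁) {f : E} (h : MemZ k₀ k₁ f) :
    MemZ k₀ k₁ (reflect f) := by
  constructor
  · rw [inner_emb_reflect, S.reflect₀]; exact h.1
  · rw [inner_emb_reflect, S.reflect₁, map_neg, inner_neg_right, h.2, neg_zero]

theorem Setting.solveZ_reflect (S : Setting m M κ V ω₀ ω₁ k₀ k₁) (g : E) :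
    solveZ k₀ k₁ (V + ω₀ • 1) (reflect g) = reflect (solveZ k₀ k₁ (V + ω₀ • 1) g) := by
  obtain ⟨h1, h2⟩ := S.coercive₀.solveZ_spec S.coer_pos S.coer_le_one g
  refine (S.coercive₀.solveZ_unique S.coer_pos S.coer_le_one (S.memZ_reflect h1) fun v hv => ?_).symm
  rw [schr_reflect (w := V + ω₀ • 1) fun x => by simp [S.even], inner_reflect_left,
    h2 _ (S.memZ_reflect hv), inner_reflect_left]

variable {τ d : ℝ} {y : E × E}

/-- The reflected corrections. -/
noncomputable def flip (y : E × E) : E × E := (reflect y.1, -reflect y.2)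

theorem Setting.e_flip (S : Setting m M κ V ω₀ ω₁ k₀ k₁) :
    Var.e (par V ω₀ k₀ k₁, τ, flip y) = reflect (Var.e (par V ω₀ k₀ k₁, τ, y)) := by
  simp only [Var.e, par, flip, map_add, S.reflect₀]

theorem Setting.p_flip (S : Setting m M κ V ω₀ ω₁ k₀ k₁) :
    Var.p (par V ω₀ k₀ k₁, τ, flip y) = -reflect (Var.p (par V ω₀ k₀ k₁, τ, y)) := by
  simp only [Var.p, par, flip, map_add, S.reflect₁, neg_add, neg_neg]

theorem we_apply (x : Var) (z : ℝ) : x.we z = ev x.e z ^ 4 +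
    10 * x.2.1 * (ev x.e z ^ 2 * ev x.p z ^ 2) + 5 * x.2.1 ^ 2 * ev x.p z ^ 4 := rfl

theorem wo_apply (x : Var) (z : ℝ) : x.wo z = 5 * ev x.e z ^ 4 +
    10 * x.2.1 * (ev x.e z ^ 2 * ev x.p z ^ 2) + x.2.1 ^ 2 * ev x.p z ^ 4 := rfl

theorem Setting.we_flip (S : Setting m M κ V ω₀ ω₁ k₀ k₁) (z : ℝ) :
    Var.we (par V ω₀ k₀ k₁, τ, flip y) z = Var.we (par V ω₀ k₀ k₁, τ, y) (-z) := by
  rw [we_apply, we_apply, S.e_flip, S.p_flip, ev_reflect, map_neg ev,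
    BoundedContinuousFunction.neg_apply, ev_reflect]
  ring

theorem Setting.wo_flip (S : Setting m M κ V ω₀ ω₁ k₀ k₁) (z : ℝ) :
    Var.wo (par V ω₀ k₀ k₁, τ, flip y) z = Var.wo (par V ω₀ k₀ k₁, τ, y) (-z) := by
  rw [wo_apply, wo_apply, S.e_flip, S.p_flip, ev_reflect, map_neg ev,
    BoundedContinuousFunction.neg_apply, ev_reflect]
  ring

theorem Setting.mu_flip (S : Setting m M κ V ω₀ ω₁ k₀ k₁) :
    Var.mu (par V ω₀ k₀ k₁, τ, flip y) = Var.mu (par V ω₀ k₀ k₁, τ, y) := by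
  rw [Var.mu, S.e_flip, pot_reflect S.we_flip, inner_reflect_left]
  change inner ℝ _ (reflect k₀) = inner ℝ _ k₀
  rw [S.reflect₀]

theorem Setting.gap_flip (S : Setting m M κ V ω₀ ω₁ k₀ k₁) :
    Var.gap (par V ω₀ k₀ k₁, τ, flip y) = Var.gap (par V ω₀ k₀ k₁, τ, y) := by
  rw [Var.gap, S.mu_flip, S.p_flip, map_neg, pot_reflect S.wo_flip, inner_neg_left,
    inner_reflect_left, Var.gap]
  change -inner ℝ _ (reflect k₁) - _ = inner ℝ _ k₁ - _
  rw [S.reflect₁, inner_neg_right, neg_neg]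

theorem Setting.rhs_flip (S : Setting m M κ V ω₀ ω₁ k₀ k₁) :
    Var.rhs (par V ω₀ k₀ k₁, τ, flip y) = flip (Var.rhs (par V ω₀ k₀ k₁, τ, y)) := by
  have h1 : ∀ g, (par V ω₀ k₀ k₁).1 (reflect g) = reflect ((par V ω₀ k₀ k₁).1 g) :=
    S.solveZ_reflect
  rw [Var.rhs, S.mu_flip, S.p_flip, S.e_flip, map_neg,
    pot_reflect (w := Var.we (par V ω₀ k₀ k₁, τ, y) - Var.mu (par V ω₀ k₀ k₁, τ, y) • 1)
      fun z => by simp [S.we_flip],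
    pot_reflect (w := Var.wo (par V ω₀ k₀ k₁, τ, y) - Var.mu (par V ω₀ k₀ k₁, τ, y) • 1)
      fun z => by simp [S.wo_flip], map_neg]
  simp only [h1]
  rfl

theorem flip_smul (c : ℝ) (y : E × E) : flip (c • y) = c • flip y := by
  simp [flip]

theorem norm_flip (y : E × E) : ‖flip y‖ = ‖y‖ := by
  rw [flip, Prod.norm_def, Prod.norm_def, norm_neg, norm_reflect, norm_reflect]

theorem Setting.isFixed_flip (S : Setting m M κ V ω₀ ω₁ k₀ k₁)
    (h : IsFixed (par V ω₀ k₀ k₁) d τ y) : IsFixed (par V ω₀ k₀ k₁) d τ (flip y) := by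
  unfold IsFixed at *
  rw [S.gap_flip, S.rhs_flip, ← flip_smul, ← h]

/-- The fixed point problem commutes with reflection, so uniqueness makes the first correction even
and the second odd. -/
theorem Setting.flip_eq (S : Setting m M κ V ω₀ ω₁ k₀ k₁) {a₀ r₀ L : ℝ} {Y : ℝ → E × E}
    (hY : IsCurve (par V ω₀ k₀ k₁) a₀ d r₀ L Y) (hr₀ : 0 ≤ r₀) (hτ : |τ| ≤ r₀) :
    flip (Y τ) = Y τ := by
  refine hY.unique τ _ hτ ?_ (S.isFixed_flip (hY.fixed τ hτ))
  rw [norm_flip]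
  linarith [hY.norm_le' τ hτ]

/-- The profile equations solved by a fixed point with the right symmetries. -/
theorem Setting.eq_of_isFixed (S : Setting m M κ V ω₀ ω₁ k₀ k₁)
    (h : IsFixed (par V ω₀ k₀ k₁) (ω₀ - ω₁) τ y) (hf : flip y = y)
    (hg : Var.gap (par V ω₀ k₀ k₁, τ, y) ≠ 0) :
    let x : Var := (par V ω₀ k₀ k₁, τ, y)
    let a := (ω₀ - ω₁) / x.gap
    MemZ k₀ k₁ y.1 ∧ MemZ k₀ k₁ y.2 ∧
    schr (V + ω₀ • 1) x.e = a • pot (x.we - x.mu • 1) x.e ∧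
    schr (V + ω₀ • 1) x.p = a • pot (x.wo - x.mu • 1) x.p := by
  intro x a
  have hsp := S.coercive₀.solveZ_spec S.coer_pos S.coer_le_one
  have h1 : y.1 = a • solveZ k₀ k₁ (V + ω₀ • 1) (pot (x.we - x.mu • 1) x.e) := congrArg Prod.fst h
  have h2 : y.2 = a • solveZ k₀ k₁ (V + ω₀ • 1) (pot (x.wo - x.mu • 1) x.p) := congrArg Prod.snd h
  have z1 : MemZ k₀ k₁ y.1 := by rw [h1]; exact memZ_smul _ (hsp _).1
  have z2 : MemZ k₀ k₁ y.2 := by rw [h2]; exact memZ_smul _ (hsp _).1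
  have he : x.e = k₀ + y.1 := rfl
  have hp : x.p = k₁ + y.2 := rfl
  have re : reflect x.e = x.e := by rw [← S.e_flip, hf]
  have rp : reflect x.p = -x.p := by
    have := S.p_flip (τ := τ) (y := y)
    rw [hf] at this
    exact (neg_eq_iff_eq_neg.2 this).symm
  have rwe : ∀ z, x.we (-z) = x.we z := fun z => by rw [← S.we_flip, hf]
  have rwo : ∀ z, x.wo (-z) = x.wo z := fun z => by rw [← S.wo_flip, hf]
  have ez : inner ℝ (emb x.e) (emb k₀) = 1 := by
    rw [he, map_add, inner_add_left, S.norm₀, z1.1, add_zero]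
  have pz : inner ℝ (emb x.p) (emb k₁) = 1 := by
    rw [hp, map_add, inner_add_left, S.norm₁, z2.2, add_zero]
  refine ⟨z1, z2, sub_eq_zero.1 (S.eq_zero_of_inner ?_ ?_ fun v hv => ?_),
    sub_eq_zero.1 (S.eq_zero_of_inner ?_ ?_ fun v hv => ?_)⟩
  · rw [inner_sub_left, inner_schr_symm, S.eq₀, inner_zero_right, inner_smul_left, map_sub,
      map_smul, sub_apply, inner_sub_left, smul_apply, inner_smul_left, inner_pot_one, ez]
    change 0 - a * (x.mu - x.mu * 1) = 0
    ring
  -- An even functional annihilates the odd k₁. This component of the equation is not imposed by the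
  -- fixed point problem and holds by parity alone.
  · have : ∀ g : E, reflect g = g → inner ℝ g k₁ = 0 := fun g hg => by
      have := inner_reflect_left g k₁
      rw [hg, S.reflect₁, inner_neg_right] at this
      linarith
    refine this _ ?_
    rw [map_sub, map_smul, ← schr_reflect (w := V + ω₀ • 1) (w' := V + ω₀ • 1)
      (fun z => by simp [S.even]), ← pot_reflect (w := x.we - x.mu • 1) (w' := x.we - x.mu • 1)
      (fun z => by simp [rwe]), re]
  · rw [inner_sub_left, he, map_add, S.eq₀, zero_add, ← he, h1, map_smul, inner_smul_left,
      (hsp _).2 v hv, inner_smul_left, sub_self]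
  · have : ∀ g : E, reflect g = -g → inner ℝ g k₀ = 0 := fun g hg => by
      have := inner_reflect_left g k₀
      rw [hg, S.reflect₀, inner_neg_left] at this
      linarith
    refine this _ ?_
    rw [map_sub, map_smul, ← schr_reflect (w := V + ω₀ • 1) (w' := V + ω₀ • 1)
      (fun z => by simp [S.even]), ← pot_reflect (w := x.wo - x.mu • 1) (w' := x.wo - x.mu • 1)
      (fun z => by simp [rwo]), rp, map_neg, map_neg, smul_neg]
    abel
  · rw [inner_sub_left, inner_schr_symm, S.schr_k₁, inner_smul_right, ← inner_pot_symm,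
      inner_pot_one, pz, inner_smul_left, map_sub, map_smul, sub_apply, inner_sub_left, smul_apply,
      inner_smul_left, inner_pot_one, pz]
    -- The k₁ component of the odd equation reads ω₀ - ω₁ = a · gap, which is the reason for the
    -- value of a.
    change (ω₀ - ω₁) * 1 - a * (inner ℝ (pot x.wo x.p) k₁ - x.mu * 1) = 0
    have : inner ℝ (pot x.wo x.p) k₁ - x.mu * 1 = x.gap := by rw [mul_one]; rfl
    rw [this, div_mul_cancel₀ _ hg]
    ring
  · rw [inner_sub_left, hp, map_add, S.schr_k₁, ← hp, inner_add_left, inner_smul_left,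
      hv.inner_pot_one₁, mul_zero, zero_add, h2, map_smul, inner_smul_left,
      (hsp _).2 v hv, inner_smul_left, sub_self]

/-- Solutions of the profile equations are fixed points. -/
theorem Setting.isFixed_of_eq (S : Setting m M κ V ω₀ ω₁ k₀ k₁) {a ν : ℝ} (ha : a ≠ 0)
    (z1 : MemZ k₀ k₁ y.1) (z2 : MemZ k₀ k₁ y.2)
    (he : schr (V + ω₀ • 1) (Var.e (par V ω₀ k₀ k₁, τ, y)) =
      a • pot (Var.we (par V ω₀ k₀ k₁, τ, y) - ν • 1) (Var.e (par V ω₀ k₀ k₁, τ, y)))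
    (hp : schr (V + ω₀ • 1) (Var.p (par V ω₀ k₀ k₁, τ, y)) =
      a • pot (Var.wo (par V ω₀ k₀ k₁, τ, y) - ν • 1) (Var.p (par V ω₀ k₀ k₁, τ, y))) :
    IsFixed (par V ω₀ k₀ k₁) (ω₀ - ω₁) τ y ∧ ν = Var.mu (par V ω₀ k₀ k₁, τ, y) ∧
      a * Var.gap (par V ω₀ k₀ k₁, τ, y) = ω₀ - ω₁ := by
  set x : Var := (par V ω₀ k₀ k₁, τ, y) with hx
  have hsp := fun {f g : E} =>
    S.coercive₀.solveZ_unique S.coer_pos S.coer_le_one (f := f) (g := g)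
  have he' : x.e = k₀ + y.1 := rfl
  have hp' : x.p = k₁ + y.2 := rfl
  have ez : inner ℝ (emb x.e) (emb k₀) = 1 := by
    rw [he', map_add, inner_add_left, S.norm₀, z1.1, add_zero]
  have pz : inner ℝ (emb x.p) (emb k₁) = 1 := by
    rw [hp', map_add, inner_add_left, S.norm₁, z2.2, add_zero]
  have hν : ν = x.mu := by
    have := congrArg (fun g => inner ℝ g k₀) he
    rw [inner_schr_symm, S.eq₀, inner_zero_right, inner_smul_left, map_sub,
      map_smul, sub_apply, inner_sub_left, smul_apply, inner_smul_left, inner_pot_one, ez] at this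
    change 0 = a * (x.mu - ν * 1) at this
    have := (mul_eq_zero.1 this.symm).resolve_left ha
    linarith
  have hgap : a * x.gap = ω₀ - ω₁ := by
    have := congrArg (fun g => inner ℝ g k₁) hp
    rw [inner_schr_symm, S.schr_k₁, inner_smul_right, ← inner_pot_symm,
      inner_pot_one, pz, inner_smul_left, map_sub, map_smul, sub_apply, inner_sub_left, smul_apply,
      inner_smul_left, inner_pot_one, pz] at this
    change (ω₀ - ω₁) * 1 = a * (inner ℝ (pot x.wo x.p) k₁ - ν * 1) at this
    rw [hν] at this
    have e : inner ℝ (pot x.wo x.p) k₁ - x.mu * 1 = x.gap := by rw [mul_one]; rfl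
    rw [e] at this
    linarith
  refine ⟨?_, hν, hgap⟩
  have hd : ω₀ - ω₁ ≠ 0 := (sub_pos.2 S.lt).ne'
  have hg : x.gap ≠ 0 := fun h => hd (by rw [← hgap, h, mul_zero])
  have ha' : (ω₀ - ω₁) / x.gap = a := by rw [← hgap]; field_simp
  rw [IsFixed, ha', ← hx]
  rw [hν] at he hp
  refine Prod.ext ?_ ?_
  · refine (hsp z1 (g := a • pot (x.we - x.mu • 1) x.e) fun v hv => ?_).trans (map_smul _ _ _)
    rw [← he, he', map_add, S.eq₀, zero_add]
  · refine (hsp z2 (g := a • pot (x.wo - x.mu • 1) x.p) fun v hv => ?_).trans (map_smul _ _ _)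
    rw [← hp, hp', map_add, S.schr_k₁, inner_add_left, inner_smul_left, hv.inner_pot_one₁]
    simp

end Reduction

/-! ### From profiles to standing waves and back -/

section Waves
variable {m M κ : ℝ} {V : ℝ →ᵇ ℝ} {ω₀ ω₁ : ℝ} {k₀ k₁ : E}

/-- The profile with the given coefficients of the even and odd parts. -/
noncomputable def profile (ρ s : ℝ) (x : Var) : E := ρ • x.e + s • x.p

theorem ev_profile (ρ s : ℝ) (x : Var) (z : ℝ) :
    ev (profile ρ s x) z = ρ * ev x.e z + s * ev x.p z := by
  simp [profile]

/-- Expand (ρe + sp)⁵: the even powers of p are ρ⁵e⁵ + 10ρ³s²e³p² + 5ρs⁴ep⁴ = ρ⁴ · `we` · ρe, the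
odd powers give ρ⁴ · `wo` · sp, once s² is replaced by τρ². -/
theorem pot_profile {ρ s : ℝ} {x : Var} (h : x.2.1 * ρ ^ 2 = s ^ 2) :
    pot (ev (profile ρ s x) ^ 4) (profile ρ s x) =
      ρ ^ 4 • pot x.we (ρ • x.e) + ρ ^ 4 • pot x.wo (s • x.p) := by
  refine ext_inner_right ℝ fun g => ?_
  rw [inner_add_left, inner_smul_left, inner_smul_left, inner_pot, inner_pot, inner_pot]
  simp only [RCLike.conj_to_real]
  rw [← integral_const_mul, ← integral_const_mul, ← integral_add
    ((integrable_mul_ev _ _ _).const_mul _) ((integrable_mul_ev _ _ _).const_mul _)]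
  congr 1; ext z
  rw [BoundedContinuousFunction.coe_pow, Pi.pow_apply, ev_profile, we_apply, wo_apply, map_smul,
    map_smul, BoundedContinuousFunction.smul_apply, BoundedContinuousFunction.smul_apply,
    smul_eq_mul, smul_eq_mul]
  set A := ev x.e z
  set B := ev x.p z
  set t := x.2.1
  have e1 : ρ ^ 4 * ((5 : ℝ) * t ^ 2 * B ^ 4) = 5 * s ^ 4 * B ^ 4 := by
    have : s ^ 4 = (s ^ 2) ^ 2 := by ring
    rw [this, ← h]; ring
  have e2 : ρ ^ 4 * (t * (A ^ 2 * B ^ 2)) = ρ ^ 2 * s ^ 2 * (A ^ 2 * B ^ 2) := by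
    rw [← h]; ring
  linear_combination (-(ρ * A * ev g z) - s * B * ev g z / 5) * e1 -
    (10 * ρ * A * ev g z + 10 * s * B * ev g z) * e2

theorem schr_profile {ρ s ν : ℝ} {x : Var}
    (h : x.2.1 * ρ ^ 2 = s ^ 2)
    (he : schr (V + ω₀ • 1) x.e = ρ ^ 4 • pot (x.we - ν • 1) x.e)
    (hp : schr (V + ω₀ • 1) x.p = ρ ^ 4 • pot (x.wo - ν • 1) x.p) :
    schr (V + (ω₀ + ρ ^ 4 * ν) • 1 - ev (profile ρ s x) ^ 4) (profile ρ s x) = 0 := by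
  rw [schr_sub, pot_profile h, schr_add_smul_one V ω₀, profile]
  simp only [map_add, map_smul, he, hp, map_sub, sub_apply, smul_apply, smul_sub, smul_add,
    add_sub_cancel_left, smul_smul]
  module

theorem isStandingWave_of_schr {ω : ℝ} {f : E} (h : schr (V + ω • 1 - ev f ^ 4) f = 0) :
    IsStandingWave V ω (ev f) := by
  obtain ⟨-, h2, h3⟩ := classical_of_schr_eq_zero h
  refine ⟨h2, memLp_ev f, fun x => ?_⟩
  rw [h3]
  simp
  ring

/-- A small standing wave with nonvanishing coefficients gives a fixed point. -/
theorem Setting.exists_isFixed (S : Setting m M κ V ω₀ ω₁ k₀ k₁) {ω ε ρ s : ℝ} {u : ℝ → ℝ}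
    (hu : IsStandingWave V ω u) (hω : ω₀ < ω) (hε : 16 * ε ^ 4 ≤ m / 2)
    (hsmall : ∀ x, |u x| ≤ ε) (hρ : ρ ≠ 0) (hs : s ≠ 0)
    (h0 : ∫ x, u x * ev k₀ x = ρ) (h1 : ∫ x, u x * ev k₁ x = s) :
    ∃ y : E × E, ‖y‖ ≤ (coer m M)⁻¹ * (16 * ε ^ 4 * (1 + M)) ∧
      u = ev (profile ρ s (par V ω₀ k₀ k₁, s ^ 2 / ρ ^ 2, y)) ∧
      MemZ k₀ k₁ y.1 ∧ MemZ k₀ k₁ y.2 ∧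
      IsFixed (par V ω₀ k₀ k₁) (ω₀ - ω₁) (s ^ 2 / ρ ^ 2) y ∧
      ω = ω₀ + ρ ^ 4 * Var.mu (par V ω₀ k₀ k₁, s ^ 2 / ρ ^ 2, y) ∧
      ρ ^ 4 * Var.gap (par V ω₀ k₀ k₁, s ^ 2 / ρ ^ 2, y) = ω₀ - ω₁ := by
  obtain ⟨hc, hL, heq⟩ := hu
  have hε0 : 0 ≤ ε := (abs_nonneg _).trans (hsmall 0)
  have hode : ∀ x, deriv (deriv u) x = (V x + ω - u x ^ 4) * u x := fun x => by
    linarith [heq x]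
  have hH : IsH1 u := isH1_of_classical (q := fun x => V x + ω - u x ^ 4)
    (C := M + |ω| + ε ^ 4) (by have := hc.continuous; fun_prop)
    (fun x => (abs_sub _ _).trans (add_le_add ((abs_add_le _ _).trans
      (add_le_add (S.bound x) le_rfl)) (by rw [abs_pow]; gcongr; exact hsmall x))) hc hL hode
  set f := hH.toE with hfdef
  have hev : ⇑(ev f) = u := ev_toE hH
  have hf : schr (V + ω • 1) f = pot (ev f ^ 4) f := by
    have : schr (V + ω • 1 - ev f ^ 4) f = 0 :=
      schr_toE_eq_zero hH hc fun x => by rw [hode]; simp [hev]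
    rw [schr_sub] at this
    exact sub_eq_zero.1 this
  have c0 : inner ℝ (emb f) (emb k₀) = ρ := by rw [inner_emb, hev, h0]
  have c1 : inner ℝ (emb f) (emb k₁) = s := by rw [inner_emb, hev, h1]
  have c0' : inner ℝ (emb (reflect f)) (emb k₀) = ρ := by rw [inner_emb_reflect, S.reflect₀, c0]
  have c1' : inner ℝ (emb (reflect f)) (emb k₁) = -s := by
    rw [inner_emb_reflect, S.reflect₁, map_neg, inner_neg_right, c1]
  -- Even and odd parts of the wave, normalized by their coefficients; the odd profile exists only
  -- for s ≠ 0.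
  set e := (2 * ρ)⁻¹ • (f + reflect f) with he
  set p := (2 * s)⁻¹ • (f - reflect f) with hp
  clear_value e p
  set y : E × E := (e - k₀, p - k₁) with hy
  set x : Var := (par V ω₀ k₀ k₁, s ^ 2 / ρ ^ 2, y) with hx
  have xe : x.e = e := add_sub_cancel _ _
  have xp : x.p = p := add_sub_cancel _ _
  have hfx : f = profile ρ s x := by
    rw [profile, xe, xp, he, hp, smul_smul, smul_smul]
    have a1 : ρ * (2 * ρ)⁻¹ = 2⁻¹ := by field_simp
    have a2 : s * (2 * s)⁻¹ = 2⁻¹ := by field_simp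
    rw [a1, a2, ← smul_add, add_add_sub_cancel, ← two_smul ℝ f, smul_smul]
    norm_num
  have re : reflect e = e := by rw [he, map_smul, map_add, reflect_reflect, add_comm]
  have rp : reflect p = -p := by
    rw [hp, map_smul, map_sub, reflect_reflect, ← smul_neg, neg_sub]
  have ee : ∀ z, ev e (-z) = ev e z := fun z => by rw [← ev_reflect, re]
  have ep : ∀ z, ev p (-z) = -ev p z := fun z => by rw [← ev_reflect, rp, map_neg ev]; rfl
  have rwe : ∀ z, x.we z = x.we (-z) := fun z => by
    rw [we_apply, we_apply, xe, xp, ee, ep]; ring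
  have rwo : ∀ z, x.wo z = x.wo (-z) := fun z => by
    rw [wo_apply, wo_apply, xe, xp, ee, ep]; ring
  have hτ : x.2.1 * ρ ^ 2 = s ^ 2 := by
    change s ^ 2 / ρ ^ 2 * ρ ^ 2 = s ^ 2
    field_simp
  have hsum : schr (V + ω • 1) (ρ • e) + schr (V + ω • 1) (s • p) =
      ρ ^ 4 • pot x.we (ρ • e) + ρ ^ 4 • pot x.wo (s • p) := by
    rw [← map_add]
    have := pot_profile hτ
    rw [← hfx, ← hf, xe, xp] at this
    rw [← this, hfx, profile, xe, xp]
  have hdiff : schr (V + ω • 1) (ρ • e) - schr (V + ω • 1) (s • p) =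
      ρ ^ 4 • pot x.we (ρ • e) - ρ ^ 4 • pot x.wo (s • p) := by
    have h := congrArg reflect hsum
    rw [map_add, map_add, map_smul reflect, map_smul reflect,
      ← schr_reflect (w := V + ω • 1) (w' := V + ω • 1) (fun z => by simp [S.even]),
      ← schr_reflect (w := V + ω • 1) (w' := V + ω • 1) (fun z => by simp [S.even]),
      ← pot_reflect rwe, ← pot_reflect rwo, map_smul reflect, map_smul reflect, re, rp,
      smul_neg, map_neg, map_neg, smul_neg] at h
    rw [sub_eq_add_neg, sub_eq_add_neg, h]
  have eqe : schr (V + ω • 1) e = ρ ^ 4 • pot x.we e := by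
    have h : (2 : ℝ) • schr (V + ω • 1) (ρ • e) = (2 : ℝ) • (ρ ^ 4 • pot x.we (ρ • e)) := by
      have := congrArg₂ (· + ·) hsum hdiff
      simp only [add_add_sub_cancel] at this
      rw [two_smul, two_smul, this]
    have h := smul_right_injective E two_ne_zero h
    rw [map_smul, map_smul, smul_comm] at h
    exact smul_right_injective E hρ h
  have eqp : schr (V + ω • 1) p = ρ ^ 4 • pot x.wo p := by
    have h : (2 : ℝ) • schr (V + ω • 1) (s • p) = (2 : ℝ) • (ρ ^ 4 • pot x.wo (s • p)) := by
      have := congrArg₂ (· - ·) hsum hdiff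
      simp only [add_sub_sub_cancel] at this
      rw [two_smul, two_smul, this]
    have h := smul_right_injective E two_ne_zero h
    rw [map_smul, map_smul, smul_comm] at h
    exact smul_right_injective E hs h
  have z1 : MemZ k₀ k₁ y.1 := by
    simp only [hy, MemZ, map_sub, inner_sub_left, S.norm₀, S.orth, he, map_smul, map_add,
      inner_smul_left, inner_add_left, c0, c0', c1, c1']
    constructor
    · simp only [RCLike.conj_to_real]; field_simp; ring
    · simp
  have z2 : MemZ k₀ k₁ y.2 := by
    have ho : inner ℝ (emb k₁) (emb k₀) = 0 := by rw [real_inner_comm]; exact S.orth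
    simp only [hy, MemZ, map_sub, inner_sub_left, S.norm₁, ho, hp, map_smul,
      inner_smul_left, c0, c0', c1, c1']
    constructor
    · simp
    · simp only [RCLike.conj_to_real]; field_simp; ring
  -- The two parts are half-sums and half-differences of u(z) and u(-z), so each inherits the bound
  -- ε; the coefficients 1 + 10 + 5 then give 16ε⁴ for both potentials.
  have hbe : ∀ z, |ρ * ev e z| ≤ ε ∧ |s * ev p z| ≤ ε := fun z => by
    have b1 := abs_le.1 (hsmall z)
    have b2 := abs_le.1 (hsmall (-z))
    have i1 : ρ * ev e z + s * ev p z = u z := by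
      rw [← hev, hfx, ev_profile, xe, xp]
    have i2 : ρ * ev e z - s * ev p z = u (-z) := by
      rw [← hev, hfx, ev_profile, xe, xp, ee, ep]; ring
    constructor <;> rw [abs_le] <;> constructor <;> linarith
  have hτ4 : ρ ^ 4 * x.2.1 ^ 2 = s ^ 4 := by
    have : s ^ 4 = (s ^ 2) ^ 2 := by ring
    rw [this, ← hτ]; ring
  have hτ2 : ρ ^ 4 * x.2.1 = ρ ^ 2 * s ^ 2 := by rw [← hτ]; ring
  have hbw : ∀ z, (ρ ^ 4 • x.we) z ≤ 16 * ε ^ 4 ∧ |(ρ ^ 4 • x.we) z| ≤ 16 * ε ^ 4 ∧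
      (ρ ^ 4 • x.wo) z ≤ 16 * ε ^ 4 ∧ |(ρ ^ 4 • x.wo) z| ≤ 16 * ε ^ 4 := fun z => by
    obtain ⟨b1, b2⟩ := hbe z
    set A := ρ * ev e z
    set B := s * ev p z
    have q1 : A ^ 2 ≤ ε ^ 2 := by rw [← sq_abs A]; gcongr
    have q2 : B ^ 2 ≤ ε ^ 2 := by rw [← sq_abs B]; gcongr
    have q3 : A ^ 4 ≤ ε ^ 4 := by
      calc A ^ 4 = (A ^ 2) ^ 2 := by ring
        _ ≤ (ε ^ 2) ^ 2 := by gcongr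
        _ = ε ^ 4 := by ring
    have q4 : B ^ 4 ≤ ε ^ 4 := by
      calc B ^ 4 = (B ^ 2) ^ 2 := by ring
        _ ≤ (ε ^ 2) ^ 2 := by gcongr
        _ = ε ^ 4 := by ring
    have q5 : A ^ 2 * B ^ 2 ≤ ε ^ 4 := by
      calc A ^ 2 * B ^ 2 ≤ ε ^ 2 * ε ^ 2 := by gcongr
        _ = ε ^ 4 := by ring
    have w1 : (ρ ^ 4 • x.we) z = A ^ 4 + 10 * (A ^ 2 * B ^ 2) + 5 * B ^ 4 := by
      rw [BoundedContinuousFunction.smul_apply, smul_eq_mul, we_apply, xe, xp]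
      linear_combination (5 * ev p z ^ 4) * hτ4 + 10 * (ev e z ^ 2 * ev p z ^ 2) * hτ2
    have w2 : (ρ ^ 4 • x.wo) z = 5 * A ^ 4 + 10 * (A ^ 2 * B ^ 2) + B ^ 4 := by
      rw [BoundedContinuousFunction.smul_apply, smul_eq_mul, wo_apply, xe, xp]
      linear_combination (ev p z ^ 4) * hτ4 + 10 * (ev e z ^ 2 * ev p z ^ 2) * hτ2
    rw [w1, w2, abs_of_nonneg (by positivity), abs_of_nonneg (by positivity)]
    refine ⟨?_, ?_, ?_, ?_⟩ <;> linarith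
  have hωm : 16 * ε ^ 4 ≤ ω - m / 2 := by linarith [S.le, S.lt]
  -- On Z a correction v solves a coercive linear equation with source wk, so ‖v‖ = O(ε⁴) with no
  -- reference to ρ or s. Smallness in sup norm thus puts y in the uniqueness ball of the curve.
  have est : ∀ (w : ℝ →ᵇ ℝ) (k v : E), (∀ z, w z ≤ 16 * ε ^ 4 ∧ |w z| ≤ 16 * ε ^ 4) → ‖k‖ ≤ 1 + M →
      MemZ k₀ k₁ v → (∀ h, MemZ k₀ k₁ h → inner ℝ (schr (V + ω • 1) k) h = 0) →
      schr (V + ω • 1) (k + v) = pot w (k + v) →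
      ‖v‖ ≤ (coer m M)⁻¹ * (16 * ε ^ 4 * (1 + M)) := by
    intro w k v hw hk hv hkz heq
    have hco := S.coercive (q := w) (c := ω) fun z => (hw z).1.trans hωm
    have hv' : v = solveZ k₀ k₁ (V + ω • 1 - w) (pot w k) := by
      refine hco.solveZ_unique S.coer_pos S.coer_le_one hv fun h hh => ?_
      have : schr (V + ω • 1 - w) v = pot w k - schr (V + ω • 1) k := by
        rw [schr_sub]
        rw [map_add, map_add] at heq
        rw [sub_eq_sub_iff_add_eq_add, add_comm, heq]
      rw [this, inner_sub_left, hkz h hh, sub_zero]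
    have hwn : ‖w‖ ≤ 16 * ε ^ 4 :=
      (BoundedContinuousFunction.norm_le (by positivity)).2 fun z => (hw z).2
    rw [hv']
    refine (hco.norm_solveZ_le S.coer_pos S.coer_le_one _).trans ?_
    have := S.coer_pos
    gcongr
    exact (norm_pot_le _ _).trans (by gcongr)
  have hpow : ∀ (w : ℝ →ᵇ ℝ) (g : E), ρ ^ 4 • pot w g = pot (ρ ^ 4 • w) g := fun w g => by
    rw [map_smul]; rfl
  have hfin : ∀ (w : ℝ →ᵇ ℝ) (g : E), schr (V + ω • 1) g = ρ ^ 4 • pot w g →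
      schr (V + ω₀ • 1) g = ρ ^ 4 • pot (w - ((ω - ω₀) / ρ ^ 4) • 1) g := fun w g hg => by
    rw [schr_add_smul_one V ω, hg, map_sub, sub_apply, smul_sub, map_smul, smul_apply, smul_smul,
      mul_div_cancel₀ _ (pow_ne_zero 4 hρ), sub_smul, sub_smul]
    abel
  obtain ⟨hfix, hν, hgap⟩ := S.isFixed_of_eq (τ := s ^ 2 / ρ ^ 2) (y := y) (pow_ne_zero 4 hρ) z1 z2
    (by rw [← hx, xe]; exact hfin _ _ eqe) (by rw [← hx, xp]; exact hfin _ _ eqp)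
  refine ⟨y, ?_, ?_, z1, z2, hfix, ?_, hgap⟩
  · rw [Prod.norm_def]
    refine max_le (est (ρ ^ 4 • x.we) k₀ y.1 (fun z => ⟨(hbw z).1, (hbw z).2.1⟩) S.norm₀_le z1
      (fun h hh => ?_) ?_) (est (ρ ^ 4 • x.wo) k₁ y.2 (fun z => (hbw z).2.2) S.norm₁_le z2
      (fun h hh => ?_) ?_)
    · rw [S.schr_k₀, inner_smul_left, hh.inner_pot_one₀, mul_zero]
    · change schr _ x.e = pot _ x.e
      rw [xe, eqe, hpow]
    · rw [S.schr_k₁, inner_smul_left, hh.inner_pot_one₁, mul_zero]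
    · change schr _ x.p = pot _ x.p
      rw [xp, eqp, hpow]
  · rw [← hfx, hev]
  · rw [← hx] at hν
    rw [← hν, mul_div_cancel₀ _ (pow_ne_zero 4 hρ)]
    ring

end Waves

/-! ### Mass, and first order behaviour along the curve -/

namespace Var

/-- The squared `L²` norm of the odd profile. -/
noncomputable def oddMass (x : Var) : ℝ := inner ℝ (pot 1 x.p) x.p

/-- The rescaled squared `L²` norm of the standing wave. -/
noncomputable def mass (x : Var) : ℝ := inner ℝ (pot 1 x.e) x.e + x.2.1 * x.oddMass

theorem nice_oddMass : Nice oddMass := (Nice.bilin pot (Nice.const 1) nice_p).inner nice_p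

theorem nice_mass : Nice mass :=
  ((Nice.bilin pot (Nice.const 1) nice_e).inner nice_e).add (nice_tau.mul nice_oddMass)

theorem hasDerivAt_quadratic {f : ℝ → ℝ} {a b c : ℝ} (h : ∀ t, f t = a + b * t + c * t ^ 2) :
    HasDerivAt f b 0 := by
  have : f = fun t => a + b * t + c * t ^ 2 := funext h
  rw [this]
  refine ((((hasDerivAt_id (0 : ℝ)).const_mul b).const_add a).add
    (((hasDerivAt_id (0 : ℝ)).pow 2).const_mul c)).congr_deriv ?_
  simp

/-- With the corrections frozen, `mu` is a quadratic polynomial in τ, and `mu'` is its linear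
coefficient. -/
theorem hasDerivAt_mu (D : Par) (y : E × E) :
    HasDerivAt (fun t => mu (D, t, y)) (mu' (D, 0, y)) 0 := by
  refine hasDerivAt_quadratic (a := inner ℝ (pot (ev (e (D, 0, y)) ^ 4) (e (D, 0, y))) D.2.1)
    (c := inner ℝ (pot ((5 : ℝ) • ev (p (D, 0, y)) ^ 4) (e (D, 0, y))) D.2.1) fun t => ?_
  simp only [mu, we, mu', map_add, map_smul, add_apply, smul_apply, inner_add_left,
    inner_smul_left, RCLike.conj_to_real, e, p]
  ring

theorem hasDerivAt_gap (D : Par) (y : E × E) :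
    HasDerivAt (fun t => gap (D, t, y)) (gap' (D, 0, y)) 0 := by
  refine HasDerivAt.sub ?_ (hasDerivAt_mu D y)
  refine hasDerivAt_quadratic
    (a := inner ℝ (pot ((5 : ℝ) • ev (e (D, 0, y)) ^ 4) (p (D, 0, y))) D.2.2)
    (c := inner ℝ (pot (ev (p (D, 0, y)) ^ 4) (p (D, 0, y))) D.2.2) fun t => ?_
  simp only [wo, map_add, map_smul, add_apply, smul_apply, inner_add_left,
    inner_smul_left, RCLike.conj_to_real, e, p]
  ring

theorem hasDerivAt_mass (D : Par) (y : E × E) :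
    HasDerivAt (fun t => mass (D, t, y)) (oddMass (D, 0, y)) 0 := by
  refine hasDerivAt_quadratic (a := inner ℝ (pot 1 (e (D, 0, y))) (e (D, 0, y)))
    (c := 0) fun t => ?_
  simp only [mass, oddMass, e, p]
  ring

end Var

theorem norm_var_sub (D : Par) (τ τ' : ℝ) (y y' : E × E) :
    ‖((D, τ, y) : Var) - (D, τ', y')‖ = max |τ - τ'| ‖y - y'‖ := by
  have : ((D, τ, y) : Var) - (D, τ', y') = (0, τ - τ', y - y') :=
    Prod.ext (sub_self D) rfl
  rw [this, Prod.norm_mk, Prod.norm_mk (τ - τ'), norm_zero, Real.norm_eq_abs]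
  exact max_eq_right (le_max_of_le_left (abs_nonneg _))

theorem norm_var_le {D : Par} {CD τ : ℝ} {y : E × E} (hD : ‖D‖ ≤ CD) (hτ : |τ| ≤ 1)
    (hy : ‖y‖ ≤ 1) : ‖((D, τ, y) : Var)‖ ≤ max CD 1 := by
  rw [Prod.norm_mk, Prod.norm_mk]
  exact max_le (hD.trans (le_max_left _ _))
    (max_le (hτ.trans (le_max_right _ _)) (hy.trans (le_max_right _ _)))

/-- Along the curve, a nice quantity and its `τ`-derivative at `0` are close to the values at the
linear profiles. -/
theorem exists_close_of_curve {f f' : Var → ℝ} (hf : Nice f) (hf' : Nice f')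
    (hd : ∀ D y, HasDerivAt (fun t => f (D, t, y)) (f' (D, 0, y)) 0) (CD L : ℝ) (hL : 0 ≤ L) :
    ∃ C : ℝ, 0 ≤ C ∧ ∀ (D : Par) (a₀ d r₀ : ℝ) (Y : ℝ → E × E), ‖D‖ ≤ CD → 0 < r₀ → r₀ ≤ 1 →
      0 ≤ d → IsCurve D a₀ d r₀ L Y →
      |f (D, 0, Y 0) - f (D, 0, 0)| ≤ C * d ∧
      |deriv (fun t => f (D, t, Y t)) 0 - f' (D, 0, 0)| ≤ C * d := by
  obtain ⟨C₁, hC₁, h₁⟩ := hf.2 (max CD 1)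
  obtain ⟨C₂, hC₂, h₂⟩ := hf'.2 (max CD 1)
  refine ⟨(C₁ + C₂) * L, by positivity, fun D a₀ d r₀ Y hD hr₀ hr1 hd0 hY => ?_⟩
  have habs0 : |(0 : ℝ)| ≤ r₀ := by rw [abs_zero]; exact hr₀.le
  have hYle : ∀ t, |t| ≤ r₀ → ‖Y t‖ ≤ 1 := fun t ht => by linarith [hY.norm_le' t ht]
  have hb : ∀ t s, |t| ≤ r₀ → |s| ≤ r₀ → ‖((D, t, Y s) : Var)‖ ≤ max CD 1 := fun t s ht hs =>
    norm_var_le hD (ht.trans hr1) (hYle s hs)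
  have hb0 : ‖((D, 0, 0) : Var)‖ ≤ max CD 1 := norm_var_le hD (by simp) (by simp)
  have hdist0 : ‖((D, 0, Y 0) : Var) - (D, 0, 0)‖ ≤ L * d := by
    rw [norm_var_sub, sub_self, abs_zero, sub_zero, max_eq_right (norm_nonneg _)]
    exact hY.norm_le 0 habs0
  have hLd : 0 ≤ L * d := by positivity
  constructor
  · refine ((h₁ _ _ (hb 0 0 habs0 habs0) hb0).2.trans
      (mul_le_mul_of_nonneg_left hdist0 hC₁)).trans ?_
    nlinarith
  · have hYd : DifferentiableAt ℝ Y 0 :=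
      (hY.smooth 0 (by simpa using hr₀)).differentiableAt (by simp)
    have hg : HasDerivAt (fun t => f (D, t, Y t)) (deriv (fun t => f (D, t, Y t)) 0) 0 := by
      refine DifferentiableAt.hasDerivAt ?_
      refine DifferentiableAt.comp (g := f) (0 : ℝ) ?_ ?_
      · exact (hf.1.differentiable (by simp)) _
      · exact (differentiableAt_const D).prodMk (differentiableAt_id.prodMk hYd)
    have hdiff := (hg.sub (hd D (Y 0))).hasFDerivAt
    -- The total and partial derivatives differ through the motion of Y only, and Y has Lipschitz
    -- constant Ld.
    have hle : |deriv (fun t => f (D, t, Y t)) 0 - f' (D, 0, Y 0)| ≤ C₁ * (L * d) := by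
      have := hdiff.le_of_lip' (C := C₁ * (L * d)) (by positivity) (by
        have hnear : ∀ᶠ t : ℝ in 𝓝 0, |t| < r₀ := by
          have := (continuous_abs (G := ℝ)).tendsto 0
          rw [abs_zero] at this
          exact this.eventually (gt_mem_nhds hr₀)
        filter_upwards [hnear] with t ht
        have e0 : ((fun t => f (D, t, Y t)) - fun t => f (D, t, Y 0)) 0 = 0 := sub_self _
        rw [e0, sub_zero, sub_zero]
        refine (h₁ _ _ (hb t t ht.le ht.le) (hb t 0 ht.le habs0)).2.trans ?_
        rw [norm_var_sub, sub_self, abs_zero, max_eq_right (norm_nonneg _), mul_assoc]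
        have := hY.lip t 0 ht.le habs0
        rw [sub_zero] at this
        exact mul_le_mul_of_nonneg_left this hC₁)
      simpa using this
    have h3 := (h₂ _ _ (hb 0 0 habs0 habs0) hb0).2.trans (mul_le_mul_of_nonneg_left hdist0 hC₂)
    rw [Real.norm_eq_abs] at h3
    calc _ ≤ |deriv (fun t => f (D, t, Y t)) 0 - f' (D, 0, Y 0)| +
          |f' (D, 0, Y 0) - f' (D, 0, 0)| := abs_sub_le _ _ _
      _ ≤ C₁ * (L * d) + C₂ * (L * d) := add_le_add hle h3
      _ = (C₁ + C₂) * L * d := by ring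

/-! ### Values at the linear profiles -/

section Values
variable {m M κ : ℝ} {V : ℝ →ᵇ ℝ} {ω₀ ω₁ : ℝ} {k₀ k₁ : E}

theorem e_zero : Var.e (par V ω₀ k₀ k₁, 0, 0) = k₀ := add_zero _
theorem p_zero : Var.p (par V ω₀ k₀ k₁, 0, 0) = k₁ := add_zero _

theorem mu_zero : Var.mu (par V ω₀ k₀ k₁, 0, 0) = ∫ x, ev k₀ x ^ 6 := by
  rw [Var.mu, e_zero]
  refine (inner_pot _ _ _).trans (integral_congr_ae (.of_forall fun x => ?_))
  simp only [we_apply, e_zero]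
  simp only [par]
  ring

theorem gap_zero : Var.gap (par V ω₀ k₀ k₁, 0, 0) =
    5 * (∫ x, ev k₀ x ^ 4 * ev k₁ x ^ 2) - ∫ x, ev k₀ x ^ 6 := by
  rw [Var.gap, mu_zero, p_zero]
  congr 1
  rw [← integral_const_mul]
  refine (inner_pot _ _ _).trans (integral_congr_ae (.of_forall fun x => ?_))
  simp only [wo_apply, e_zero]
  simp only [par]
  ring

theorem mu'_zero : Var.mu' (par V ω₀ k₀ k₁, 0, 0) = 10 * ∫ x, ev k₀ x ^ 4 * ev k₁ x ^ 2 := by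
  rw [Var.mu', p_zero, e_zero, ← integral_const_mul]
  refine (inner_pot _ _ _).trans (integral_congr_ae (.of_forall fun x => ?_))
  simp [par]
  ring

/-- The term 10τe²p² is common to `we` and `wo`, so the slope of the gap is a difference of two
mixed moments, small once ψ₁² is close to ψ₀² in L¹. -/
theorem gap'_zero : Var.gap' (par V ω₀ k₀ k₁, 0, 0) =
    10 * (∫ x, ev k₀ x ^ 2 * ev k₁ x ^ 4) - 10 * ∫ x, ev k₀ x ^ 4 * ev k₁ x ^ 2 := by
  rw [Var.gap', mu'_zero, p_zero, e_zero]
  congr 1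
  rw [← integral_const_mul]
  refine (inner_pot _ _ _).trans (integral_congr_ae (.of_forall fun x => ?_))
  simp [par]
  ring

theorem Setting.mass_zero (S : Setting m M κ V ω₀ ω₁ k₀ k₁) :
    Var.mass (par V ω₀ k₀ k₁, 0, 0) = 1 := by
  rw [Var.mass, e_zero, inner_pot_one, S.norm₀]; simp

theorem Setting.oddMass_zero (S : Setting m M κ V ω₀ ω₁ k₀ k₁) :
    Var.oddMass (par V ω₀ k₀ k₁, 0, 0) = 1 := by
  rw [Var.oddMass, p_zero, inner_pot_one, S.norm₁]

end Values

/-! ### Reparametrization by the square of the odd coefficient -/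

section Calculus

theorem continuousAt_deriv_of_smooth {w : ℝ → ℝ} {x : ℝ}
    (h : ContDiffAt ℝ ((⊤ : ℕ∞) : WithTop ℕ∞) w x) : ContinuousAt (deriv w) x :=
  (h.continuousAt_fderiv (by simp)).clm_apply continuousAt_const

/-- A smooth local inverse. -/
theorem exists_localInverse {σ : ℝ → ℝ} {r₀ : ℝ} (hr₀ : 0 < r₀)
    (hσ : ∀ t, |t| < r₀ → ContDiffAt ℝ ((⊤ : ℕ∞) : WithTop ℕ∞) σ t) (h0 : σ 0 = 0)
    (h1 : 0 < deriv σ 0) :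
    ∃ (T : ℝ → ℝ) (η : ℝ), 0 < η ∧ T 0 = 0 ∧ 0 < deriv T 0 ∧
      (∀ v, |v| < η → ContDiffAt ℝ ((⊤ : ℕ∞) : WithTop ℕ∞) T v ∧ |T v| < r₀ ∧ σ (T v) = v) ∧
      ∀ᶠ t in 𝓝 0, T (σ t) = t := by
  have hc0 := hσ 0 (by simpa using hr₀)
  have hd0 : HasDerivAt σ (deriv σ 0) 0 := (hc0.differentiableAt (by simp)).hasDerivAt
  have hs0 : HasStrictDerivAt σ (deriv σ 0) 0 := hc0.hasStrictDerivAt' hd0 (by simp)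
  set f := (hs0.hasStrictFDerivAt_equiv h1.ne').toOpenPartialHomeomorph σ with hf
  have hfc : ⇑f = σ := HasStrictFDerivAt.toOpenPartialHomeomorph_coe _
  have hsrc : (0 : ℝ) ∈ f.source := HasStrictFDerivAt.mem_toOpenPartialHomeomorph_source _
  have htgt : (0 : ℝ) ∈ f.target := by
    have := f.map_source hsrc
    rwa [hfc, h0] at this
  have hT0 : f.symm 0 = 0 := by
    have := f.left_inv hsrc
    rwa [hfc, h0] at this
  have hTc : ContinuousAt f.symm 0 := f.continuousAt_symm htgt
  have hdc : ContinuousAt (deriv σ) 0 := continuousAt_deriv_of_smooth hc0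
  have hnear : ∀ᶠ t : ℝ in 𝓝 0, |t| < r₀ ∧ deriv σ t ≠ 0 := by
    refine Filter.Eventually.and ?_ (hdc.eventually_ne h1.ne')
    have := (continuous_abs (G := ℝ)).tendsto 0
    rw [abs_zero] at this
    exact this.eventually (gt_mem_nhds hr₀)
  have hev : ∀ᶠ v in 𝓝 (0 : ℝ), v ∈ f.target ∧ |f.symm v| < r₀ ∧ deriv σ (f.symm v) ≠ 0 := by
    refine Filter.Eventually.and (f.open_target.mem_nhds htgt) ?_
    have hT := hTc.tendsto
    rw [hT0] at hT
    exact hT.eventually hnear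
  obtain ⟨η, hη, hball⟩ := Metric.eventually_nhds_iff.1 hev
  have hprop : ∀ v, |v| < η → ContDiffAt ℝ ((⊤ : ℕ∞) : WithTop ℕ∞) f.symm v ∧
      |f.symm v| < r₀ ∧ σ (f.symm v) = v := fun v hv => by
    obtain ⟨h2, h3, h4⟩ := hball (y := v) (by simpa [Real.dist_eq] using hv)
    have h5 := hσ _ h3
    refine ⟨f.contDiffAt_symm_deriv h4 h2 ?_ (by rw [hfc]; exact h5), h3, ?_⟩
    · rw [hfc]; exact (h5.differentiableAt (by simp)).hasDerivAt
    · have := f.right_inv h2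
      rwa [hfc] at this
  refine ⟨f.symm, η, hη, hT0, ?_, hprop, ?_⟩
  · have hTd : HasDerivAt f.symm (deriv f.symm 0) 0 :=
      ((hprop 0 (by simpa using hη)).1.differentiableAt (by simp)).hasDerivAt
    have hd0' : HasDerivAt σ (deriv σ 0) (f.symm 0) := by rw [hT0]; exact hd0
    have hcomp := hd0'.comp 0 hTd
    have hid : HasDerivAt (σ ∘ f.symm) 1 0 := by
      refine (hasDerivAt_id (0 : ℝ)).congr_of_eventuallyEq ?_
      refine Metric.eventually_nhds_iff.2 ⟨η, hη, fun v hv => ?_⟩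
      exact (hprop v (by simpa [Real.dist_eq] using hv)).2.2
    have := hcomp.unique hid
    by_contra hcon
    nlinarith
  · filter_upwards [f.open_source.mem_nhds hsrc] with t ht
    have := f.left_inv ht
    rwa [hfc] at this

/-- Monotone dependence on the square of the parameter. -/
theorem exists_parametrization {w n : ℝ → ℝ} {η r : ℝ}
    (hw : ∀ v, |v| < η → ContDiffAt ℝ ((⊤ : ℕ∞) : WithTop ℕ∞) w v ∧ 0 < deriv w v)
    (hn : ∀ v, |v| < η → DifferentiableAt ℝ n v ∧ 0 < deriv n v) {ω q₀ : ℝ → ℝ} (hr : 0 < r)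
    (hrη : r ^ 2 < η) (hω : ∀ s, |s| < r → ω s = w (s ^ 2))
    (hq : ∀ s, 0 < |s| → |s| < r → q₀ s = n (s ^ 2)) :
    ∃ (ωmax : ℝ) (q : ℝ → ℝ), ω 0 < ωmax ∧
      BijOn ω (Ioo 0 r) (Ioo (ω 0) ωmax) ∧ BijOn ω (Ioo (-r) 0) (Ioo (ω 0) ωmax) ∧
      (∀ s, 0 < |s| → |s| < r → q (ω s) = q₀ s) ∧
      ∀ v ∈ Ioo (ω 0) ωmax, DifferentiableAt ℝ q v ∧ 0 < deriv q v := by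
  have hI : ∀ v ∈ Icc 0 (r ^ 2), |v| < η := fun v hv => by
    rw [abs_of_nonneg hv.1]; exact hv.2.trans_lt hrη
  have hcont : ContinuousOn w (Icc 0 (r ^ 2)) := fun v hv =>
    (hw v (hI v hv)).1.continuousAt.continuousWithinAt
  have hmono : StrictMonoOn w (Icc 0 (r ^ 2)) := by
    refine strictMonoOn_of_deriv_pos (convex_Icc _ _) hcont fun v hv => ?_
    rw [interior_Icc] at hv
    exact (hw v (hI v (Ioo_subset_Icc_self hv))).2
  have hr2 : 0 < r ^ 2 := by positivity
  have hω0 : ω 0 = w 0 := by rw [hω 0 (by simpa using hr)]; norm_num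
  have m0 : (0 : ℝ) ∈ Icc 0 (r ^ 2) := ⟨le_rfl, hr2.le⟩
  have m1 : r ^ 2 ∈ Icc 0 (r ^ 2) := ⟨hr2.le, le_rfl⟩
  have hbij : BijOn w (Ioo 0 (r ^ 2)) (Ioo (w 0) (w (r ^ 2))) := by
    refine ⟨fun v hv => ⟨hmono m0 (Ioo_subset_Icc_self hv) hv.1,
      hmono (Ioo_subset_Icc_self hv) m1 hv.2⟩, (hmono.injOn).mono Ioo_subset_Icc_self,
      fun z hz => ?_⟩
    exact intermediate_value_Ioo hr2.le hcont hz
  have hsq : BijOn (fun s : ℝ => s ^ 2) (Ioo 0 r) (Ioo 0 (r ^ 2)) := by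
    refine ⟨fun s hs => ⟨by have := hs.1; positivity, pow_lt_pow_left₀ hs.2 hs.1.le two_ne_zero⟩,
      fun s hs s' hs' h => ?_, fun v hv => ⟨√v, ⟨Real.sqrt_pos.2 hv.1, ?_⟩, Real.sq_sqrt hv.1.le⟩⟩
    · exact (pow_left_inj₀ hs.1.le hs'.1.le two_ne_zero).1 h
    · rw [Real.sqrt_lt' hr]; exact hv.2
  have hneg : BijOn (fun s : ℝ => -s) (Ioo (-r) 0) (Ioo 0 r) := by
    refine ⟨fun s hs => ⟨neg_pos.2 hs.2, by linarith [hs.1]⟩, neg_injective.injOn,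
      fun v hv => ⟨-v, ⟨by linarith [hv.2], neg_lt_zero.2 hv.1⟩, neg_neg v⟩⟩
  have hpos : BijOn ω (Ioo 0 r) (Ioo (w 0) (w (r ^ 2))) := by
    refine (hbij.comp hsq).congr fun s hs => ?_
    exact (hω s (by rw [abs_of_pos hs.1]; exact hs.2)).symm
  -- g recovers v = s² from the frequency, so the mass is the single function n ∘ g of ω on both
  -- halves of the branch.
  set g := Function.invFunOn w (Ioo 0 (r ^ 2))
  have hg : ∀ v ∈ Ioo 0 (r ^ 2), g (w v) = v := fun v hv => hbij.injOn.leftInvOn_invFunOn hv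
  refine ⟨w (r ^ 2), fun z => n (g z), ?_, hω0 ▸ hpos, ?_, fun s hs hsr => ?_, fun z hz => ?_⟩
  · rw [hω0]; exact hmono m0 m1 hr2
  · rw [hω0]
    refine (hpos.comp hneg).congr fun s hs => ?_
    have h1 : |s| < r := by rw [abs_of_neg hs.2]; linarith [hs.1]
    simp only [Function.comp]
    rw [hω s h1, hω (-s) (by rwa [abs_neg])]
    ring_nf
  · have hmem : s ^ 2 ∈ Ioo 0 (r ^ 2) := by
      rw [← sq_abs s]
      exact ⟨pow_pos hs 2, pow_lt_pow_left₀ hsr hs.le two_ne_zero⟩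
    simp only
    rw [hω s hsr, hg _ hmem, hq s hs hsr]
  · rw [hω0] at hz
    obtain ⟨v, hv, rfl⟩ := hbij.surjOn hz
    obtain ⟨c1, c2⟩ := hw v (hI v (Ioo_subset_Icc_self hv))
    obtain ⟨d1, d2⟩ := hn v (hI v (Ioo_subset_Icc_self hv))
    have hs : HasStrictDerivAt w (deriv w v) v :=
      c1.hasStrictDerivAt' (c1.differentiableAt (by simp)).hasDerivAt (by simp)
    have hginv : HasDerivAt g (deriv w v)⁻¹ (w v) := by
      refine (hs.to_local_left_inverse c2.ne' ?_).hasDerivAt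
      filter_upwards [isOpen_Ioo.mem_nhds hv] with v' hv'
      exact hg v' hv'
    have hfin : HasDerivAt (fun z => n (g z)) (deriv n v * (deriv w v)⁻¹) (w v) := by
      have hnd : HasDerivAt n (deriv n v) (g (w v)) := by rw [hg v hv]; exact d1.hasDerivAt
      exact hnd.comp (w v) hginv
    exact ⟨hfin.differentiableAt, by rw [hfin.deriv]; positivity⟩

/-- Monotonicity of the frequency and of the mass along the curve of solutions. -/
theorem exists_reparametrization {H μ N : ℝ → ℝ} {r₀ d : ℝ} (ω₀ : ℝ) (hr₀ : 0 < r₀) (hd : 0 < d)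
    (hHs : ∀ t, |t| < r₀ → ContDiffAt ℝ ((⊤ : ℕ∞) : WithTop ℕ∞) H t)
    (hμs : ∀ t, |t| < r₀ → ContDiffAt ℝ ((⊤ : ℕ∞) : WithTop ℕ∞) μ t)
    (hNs : ∀ t, |t| < r₀ → ContDiffAt ℝ ((⊤ : ℕ∞) : WithTop ℕ∞) N t)
    (hH : ∀ t, |t| < r₀ → 0 < H t)
    (h1 : 0 < deriv μ 0 * H 0 - μ 0 * deriv H 0)
    (h2 : 0 < deriv N 0 - deriv H 0 / (2 * H 0) * N 0) :
    ∃ (T : ℝ → ℝ) (η : ℝ), 0 < η ∧ T 0 = 0 ∧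
      (∀ v, |v| < η → ContDiffAt ℝ ((⊤ : ℕ∞) : WithTop ℕ∞) T v ∧ |T v| < r₀ ∧
        T v * √(d / H (T v)) = v) ∧
      (∀ᶠ t in 𝓝 0, T (t * √(d / H t)) = t) ∧
      (∀ v, |v| < η →
        ContDiffAt ℝ ((⊤ : ℕ∞) : WithTop ℕ∞) (fun v => ω₀ + d / H (T v) * μ (T v)) v ∧
        0 < deriv (fun v => ω₀ + d / H (T v) * μ (T v)) v) ∧
      ∀ v, |v| < η → DifferentiableAt ℝ (fun v => √(d / H (T v)) * N (T v)) v ∧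
        0 < deriv (fun v => √(d / H (T v)) * N (T v)) v := by
  have m0 : |(0 : ℝ)| < r₀ := by simpa using hr₀
  have haS : ∀ t, |t| < r₀ → ContDiffAt ℝ ((⊤ : ℕ∞) : WithTop ℕ∞) (fun t => d / H t) t :=
    fun t ht => contDiffAt_const.div (hHs t ht) (hH t ht).ne'
  have hap : ∀ t, |t| < r₀ → 0 < d / H t := fun t ht => div_pos hd (hH t ht)
  have hbS : ∀ t, |t| < r₀ → ContDiffAt ℝ ((⊤ : ℕ∞) : WithTop ℕ∞) (fun t => √(d / H t)) t :=
    fun t ht => (haS t ht).sqrt (hap t ht).ne'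
  have dd : ∀ {f : ℝ → ℝ} {t : ℝ}, ContDiffAt ℝ ((⊤ : ℕ∞) : WithTop ℕ∞) f t →
      HasDerivAt f (deriv f t) t := fun h => (h.differentiableAt (by simp)).hasDerivAt
  have hb0 : 0 < √(d / H 0) := Real.sqrt_pos.2 (hap 0 m0)
  have hH0 := hH 0 m0
  -- s² = τρ² and ρ² = √(d / H), so T recovers τ from v = s².
  obtain ⟨T, η, hη, hT0, hT', hT, hinv⟩ := exists_localInverse (σ := fun t => t * √(d / H t)) hr₀
    (fun t ht => contDiffAt_id.mul (hbS t ht)) (by simp) (by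
      have := ((hasDerivAt_id (0 : ℝ)).mul (dd (hbS 0 m0))).deriv
      have e : (id * fun t => √(d / H t)) = fun t : ℝ => t * √(d / H t) := rfl
      rw [e] at this
      rw [this]
      simpa using hb0)
  have mη : |(0 : ℝ)| < η := by simpa using hη
  have comp : ∀ {f : ℝ → ℝ}, (∀ t, |t| < r₀ → ContDiffAt ℝ ((⊤ : ℕ∞) : WithTop ℕ∞) f t) →
      ∀ v, |v| < η → ContDiffAt ℝ ((⊤ : ℕ∞) : WithTop ℕ∞) (fun v => f (T v)) v :=
    fun hf v hv => (hf _ (hT v hv).2.1).comp v (hT v hv).1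
  have hwS : ∀ t, |t| < r₀ → ContDiffAt ℝ ((⊤ : ℕ∞) : WithTop ℕ∞) (fun t => ω₀ + d / H t * μ t) t :=
    fun t ht => contDiffAt_const.add ((haS t ht).mul (hμs t ht))
  have hnS : ∀ t, |t| < r₀ → ContDiffAt ℝ ((⊤ : ℕ∞) : WithTop ℕ∞) (fun t => √(d / H t) * N t) t :=
    fun t ht => (hbS t ht).mul (hNs t ht)
  have chain : ∀ {f : ℝ → ℝ}, ContDiffAt ℝ ((⊤ : ℕ∞) : WithTop ℕ∞) f 0 → 0 < deriv f 0 →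
      0 < deriv (fun v => f (T v)) 0 := fun {f} hf hpos => by
    have e1 : HasDerivAt f (deriv f 0) (T 0) := by rw [hT0]; exact dd hf
    have e2 : HasDerivAt (fun v => f (T v)) (deriv f 0 * deriv T 0) 0 := e1.comp 0 (dd (hT 0 mη).1)
    rw [e2.deriv]
    positivity
  have ha' : HasDerivAt (fun t => d / H t) (-(d * deriv H 0) / H 0 ^ 2) 0 := by
    refine ((hasDerivAt_const (0 : ℝ) d).div (dd (hHs 0 m0)) hH0.ne').congr_deriv ?_
    ring
  have pw : 0 < deriv (fun v => ω₀ + d / H (T v) * μ (T v)) 0 := by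
    refine chain (f := fun t => ω₀ + d / H t * μ t) (hwS 0 m0) ?_
    have e : HasDerivAt (fun t => ω₀ + d / H t * μ t)
        (d / H 0 ^ 2 * (deriv μ 0 * H 0 - μ 0 * deriv H 0)) 0 := by
      refine ((ha'.mul (dd (hμs 0 m0))).const_add ω₀).congr_deriv ?_
      field_simp
      ring
    rw [e.deriv]
    positivity
  have pn : 0 < deriv (fun v => √(d / H (T v)) * N (T v)) 0 := by
    refine chain (f := fun t => √(d / H t) * N t) (hnS 0 m0) ?_
    have e : HasDerivAt (fun t => √(d / H t) * N t)
        (√(d / H 0) * (deriv N 0 - deriv H 0 / (2 * H 0) * N 0)) 0 := by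
      refine ((ha'.sqrt (hap 0 m0).ne').mul (dd (hNs 0 m0))).congr_deriv ?_
      have hs : √(d / H 0) * √(d / H 0) = d / H 0 := Real.mul_self_sqrt (hap 0 m0).le
      have e3 : -(d * deriv H 0) / H 0 ^ 2 = -(√(d / H 0) * √(d / H 0)) * deriv H 0 / H 0 := by
        rw [hs]; field_simp
      rw [e3]
      field_simp
      ring
    rw [e.deriv]
    positivity
  have ev : ∀ᶠ v in 𝓝 (0 : ℝ), 0 < deriv (fun v => ω₀ + d / H (T v) * μ (T v)) v ∧
      0 < deriv (fun v => √(d / H (T v)) * N (T v)) v :=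
    ((continuousAt_deriv_of_smooth (comp hwS 0 mη)).eventually (lt_mem_nhds pw)).and
      ((continuousAt_deriv_of_smooth (comp hnS 0 mη)).eventually (lt_mem_nhds pn))
  obtain ⟨η', hη', hball⟩ := Metric.eventually_nhds_iff.1 ev
  have hb : ∀ v, |v| < min η η' → _ := fun v hv =>
    hball (y := v) (by simpa [Real.dist_eq] using hv.trans_le (min_le_right _ _))
  have hlt : ∀ v, |v| < min η η' → |v| < η := fun v hv => hv.trans_le (min_le_left _ _)
  exact ⟨T, min η η', lt_min hη hη', hT0, fun v hv => hT v (hlt v hv), hinv,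
    fun v hv => ⟨comp hwS v (hlt v hv), (hb v hv).1⟩,
    fun v hv => ⟨(comp hnS v (hlt v hv)).differentiableAt (by simp), (hb v hv).2⟩⟩

end Calculus

/-! ### Decay of solutions and absence of eigenvalues at high energy -/

section Decay

theorem IsSol.isH1_deriv {q u : ℝ → ℝ} {C : ℝ} (hqc : Continuous q) (hq : ∀ x, |q x| ≤ C)
    (h : IsSol q u) : IsH1 (deriv u) :=
  IsH1.of_hasDerivAt h.hasDerivAt_deriv (hqc.mul h.isH1.continuous) h.isH1.memLp_deriv
    (memLp_bdd_mul hqc hq h.isH1.memLp)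

theorem monotoneOn_Ici_of_hasDerivAt {h h' : ℝ → ℝ} {R : ℝ}
    (hd : ∀ x, R ≤ x → HasDerivAt h (h' x) x) (h0 : ∀ x, R ≤ x → 0 ≤ h' x) :
    MonotoneOn h (Ici R) := by
  refine monotoneOn_of_deriv_nonneg (convex_Ici R)
    (fun x hx => (hd x hx).continuousAt.continuousWithinAt) (fun x hx => ?_) fun x hx => ?_
  · exact (hd x (interior_subset hx)).differentiableAt.differentiableWithinAt
  · rw [(hd x (interior_subset hx)).deriv]; exact h0 x (interior_subset hx)

theorem nonpos_of_monotoneOn_of_tendsto {h : ℝ → ℝ} {R : ℝ} (hm : MonotoneOn h (Ici R))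
    (ht : Tendsto h atTop (𝓝 0)) {x : ℝ} (hx : R ≤ x) : h x ≤ 0 := by
  refine ge_of_tendsto ht ?_
  filter_upwards [Ici_mem_atTop x] with y hy
  exact hm hx (le_trans hx hy) hy

/-- By convexity h' increases to its limit 0, so h' ≤ 0 and h decreases to its limit 0. -/
theorem nonneg_of_convex {h h' h'' : ℝ → ℝ} {R : ℝ} (hd : ∀ x, R ≤ x → HasDerivAt h (h' x) x)
    (hd' : ∀ x, R ≤ x → HasDerivAt h' (h'' x) x) (h0 : ∀ x, R ≤ x → 0 ≤ h'' x)
    (ht : Tendsto h atTop (𝓝 0)) (ht' : Tendsto h' atTop (𝓝 0)) {x : ℝ} (hx : R ≤ x) : 0 ≤ h x := by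
  have h1 : ∀ y, R ≤ y → h' y ≤ 0 := fun y hy =>
    nonpos_of_monotoneOn_of_tendsto (monotoneOn_Ici_of_hasDerivAt hd' h0) ht' hy
  have h2 : MonotoneOn (fun y => -h y) (Ici R) :=
    monotoneOn_Ici_of_hasDerivAt (fun y hy => (hd y hy).neg) fun y hy => neg_nonneg.2 (h1 y hy)
  have h3 := nonpos_of_monotoneOn_of_tendsto h2 (by simpa using ht.neg) hx
  linarith

/-- Maximum principle on a half-line. -/
theorem nonpos_of_deriv_deriv_pos {h h' h'' : ℝ → ℝ} {R : ℝ} (hd : ∀ x, HasDerivAt h (h' x) x)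
    (hd' : ∀ x, HasDerivAt h' (h'' x) x) (hR : h R ≤ 0) (ht : Tendsto h atTop (𝓝 0))
    (hpos : ∀ x, R < x → 0 < h x → 0 < h'' x) {x : ℝ} (hx : R ≤ x) : h x ≤ 0 := by
  by_contra! hcon
  obtain ⟨b, hxb, hb⟩ : ∃ b, x < b ∧ h b < h x := by
    have := (ht.eventually (gt_mem_nhds hcon)).and (Ioi_mem_atTop x)
    obtain ⟨b, h1, h2⟩ := this.exists
    exact ⟨b, h2, h1⟩
  have hc : Continuous h := continuous_iff_continuousAt.2 fun y => (hd y).continuousAt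
  obtain ⟨y, hy, hmax⟩ := isCompact_Icc.exists_isMaxOn (nonempty_Icc.2 (hx.trans hxb.le))
    hc.continuousOn
  have hxy : h x ≤ h y := hmax ⟨hx, hxb.le⟩
  have hy0 : 0 < h y := hcon.trans_le hxy
  have hRy : R < y := lt_of_le_of_ne hy.1 fun e => by rw [← e] at hy0; linarith
  have hyb : y < b := lt_of_le_of_ne hy.2 fun e => by rw [e] at hxy; linarith
  have hlm : IsLocalMax h y := by
    filter_upwards [Ioo_mem_nhds hRy hyb] with z hz
    exact hmax (Ioo_subset_Icc_self hz)
  have e1 : deriv h = h' := funext fun z => (hd z).deriv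
  have hdd : deriv (deriv h) y = h'' y := by rw [e1]; exact (hd' y).deriv
  -- At an interior positive maximum h'' > 0 makes the point a local minimum too; then h is locally
  -- constant and h'' = 0, a contradiction.
  have hmin : IsLocalMin h y :=
    isLocalMin_of_deriv_deriv_pos (by rw [hdd]; exact hpos y hRy hy0)
      (by rw [e1]; exact hlm.hasDerivAt_eq_zero (hd y)) hc.continuousAt
  have hconst : h =ᶠ[𝓝 y] fun _ => h y := by
    filter_upwards [hlm, hmin] with z h1 h2
    exact le_antisymm h1 h2
  have := hconst.deriv.deriv_eq
  rw [hdd] at this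
  have h3 := hpos y hRy hy0
  simp at this
  linarith

/-- Exponential decay of square integrable solutions. -/
theorem IsSol.sq_le_exp {Q u : ℝ → ℝ} {k R : ℝ} (hk : 0 < k) (h : IsSol Q u)
    (hQ : ∀ x, R ≤ x → k ^ 2 ≤ Q x) {x : ℝ} (hx : R ≤ x) :
    u x ^ 2 ≤ u R ^ 2 * Real.exp (-k * (x - R)) := by
  have hexp : ∀ x, HasDerivAt (fun x => Real.exp (-k * (x - R))) (-k * Real.exp (-k * (x - R))) x :=
    fun x => by
      have := (((hasDerivAt_id x).sub_const R).const_mul (-k)).exp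
      refine this.congr_deriv ?_
      simp only [id_eq, mul_one]; ring
  have hd : ∀ x, HasDerivAt (fun x => u x ^ 2 - u R ^ 2 * Real.exp (-k * (x - R)))
      (2 * (u x * deriv u x) - u R ^ 2 * (-k * Real.exp (-k * (x - R)))) x := fun x => by
    refine (((h.isH1.hasDerivAt x).pow 2).sub ((hexp x).const_mul _)).congr_deriv ?_
    simp only [Nat.cast_ofNat, Nat.add_one_sub_one, pow_one]; ring
  have hd' : ∀ x, HasDerivAt
      (fun x => 2 * (u x * deriv u x) - u R ^ 2 * (-k * Real.exp (-k * (x - R))))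
      (2 * (deriv u x ^ 2 + Q x * u x ^ 2) - u R ^ 2 * (k ^ 2 * Real.exp (-k * (x - R)))) x :=
    fun x => by
      refine ((((h.isH1.hasDerivAt x).mul (h.hasDerivAt_deriv x)).const_mul 2).sub
        (((hexp x).const_mul (-k)).const_mul _)).congr_deriv ?_
      ring
  have ht : Tendsto (fun x => u x ^ 2 - u R ^ 2 * Real.exp (-k * (x - R))) atTop (𝓝 0) := by
    have h1 : Tendsto (fun x => Real.exp (-k * (x - R))) atTop (𝓝 0) := by
      refine Real.tendsto_exp_atBot.comp ?_
      exact (tendsto_atTop_add_const_right _ (-R) tendsto_id).const_mul_atTop_of_neg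
        (neg_lt_zero.2 hk)
    simpa using h.isH1.tendsto_sq.1.sub (h1.const_mul (u R ^ 2))
  -- Since (u²)'' ≥ 2Qu² ≥ 2k²u², the difference h with the exponential satisfies h'' ≥ k²h, which
  -- the maximum principle requires where h > 0.
  have := nonpos_of_deriv_deriv_pos (R := R) hd hd' (by simp) ht (fun y hy hpos => by
    have h1 := hQ y hy.le
    have h2 : k ^ 2 * u y ^ 2 ≤ Q y * u y ^ 2 := by gcongr
    have h3 : 0 < k ^ 2 * (u y ^ 2 - u R ^ 2 * Real.exp (-k * (y - R))) := by positivity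
    nlinarith [sq_nonneg (deriv u y), mul_nonneg (sq_nonneg k) (sq_nonneg (u y))]) hx
  linarith

/-- There are no eigenvalues in the essential spectrum of a short range potential. -/
theorem IsSol.eq_zero_of_decay {q u : ℝ → ℝ} {B C R e : ℝ} (hqc : Continuous q)
    (hq : ∀ x, |q x| ≤ B) (he : 0 ≤ e) (h : IsSol (fun x => q x - e) u) (hR : 0 < R)
    (hC : ∀ x, R ≤ x → |q x| ≤ C / x ^ 3) : u = 0 := by
  have hq' : ∀ x, |q x - e| ≤ B + |e| := fun x => (abs_sub _ _).trans (by gcongr; exact hq x)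
  have hC0 : 0 ≤ C := by
    have := (abs_nonneg _).trans (hC R le_rfl)
    by_contra! hn
    have : C / R ^ 3 < 0 := div_neg_of_neg_of_pos hn (by positivity)
    linarith
  have hu0 := h.isH1.tendsto_atTop
  have hu'0 := (h.isH1_deriv (hqc.sub continuous_const) hq').tendsto_atTop
  rcases he.eq_or_lt with rfl | he
  · set R' := max R C
    have hR' : 0 < R' := lt_max_of_lt_left hR
    -- At the threshold u'' = qu with |q| ≤ C/x³. Integrated twice from infinity, in the form that
    -- CK/(2x) ± u is convex, a bound K improves to CK/(2x) ≤ K/2 for x ≥ C. Iteration makes u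
    -- vanish near infinity.
    have step : ∀ K : ℝ, 0 ≤ K → (∀ x, R' ≤ x → |u x| ≤ K) → ∀ x, R' ≤ x → |u x| ≤ K / 2 := by
      intro K hK hu x hx
      have hg : ∀ y, R' ≤ y → HasDerivAt (fun y => C * K / 2 * y⁻¹) (-(C * K / 2) / y ^ 2) y :=
        fun y hy => ((hasDerivAt_inv (hR'.trans_le hy).ne').const_mul _).congr_deriv (by ring)
      have hg' : ∀ y, R' ≤ y → HasDerivAt (fun y => -(C * K / 2) / y ^ 2) (C * K / y ^ 3) y :=
        fun y hy => by
          have hy0 := (hR'.trans_le hy).ne'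
          refine ((hasDerivAt_const y (-(C * K / 2))).div ((hasDerivAt_id y).pow 2)
            (pow_ne_zero 2 hy0)).congr_deriv ?_
          simp only [id_eq, Nat.cast_ofNat, Nat.add_one_sub_one, pow_one, Pi.pow_apply]
          field_simp
          ring
      have tg : Tendsto (fun y : ℝ => C * K / 2 * y⁻¹) atTop (𝓝 0) := by
        simpa using tendsto_inv_atTop_zero.const_mul (C * K / 2)
      have tg' : Tendsto (fun y : ℝ => -(C * K / 2) / y ^ 2) atTop (𝓝 0) :=
        tendsto_const_nhds.div_atTop (tendsto_pow_atTop two_ne_zero)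
      have hb : ∀ y, R' ≤ y → |(q y - 0) * u y| ≤ C * K / y ^ 3 := fun y hy => by
        have hy0 : 0 < y := hR'.trans_le hy
        rw [sub_zero, abs_mul]
        calc |q y| * |u y| ≤ C / y ^ 3 * K := by
              gcongr
              · exact hC y ((le_max_left _ _).trans hy)
              · exact hu y hy
          _ = _ := by ring
      have l1 := nonneg_of_convex (fun y hy => (hg y hy).sub (h.isH1.hasDerivAt y))
        (fun y hy => (hg' y hy).sub (h.hasDerivAt_deriv y))
        (fun y hy => by linarith [(abs_le.1 (hb y hy)).2])
        (sub_zero (0 : ℝ) ▸ tg.sub hu0) (sub_zero (0 : ℝ) ▸ tg'.sub hu'0) hx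
      have l2 := nonneg_of_convex (fun y hy => (hg y hy).add (h.isH1.hasDerivAt y))
        (fun y hy => (hg' y hy).add (h.hasDerivAt_deriv y))
        (fun y hy => by linarith [(abs_le.1 (hb y hy)).1])
        (add_zero (0 : ℝ) ▸ tg.add hu0) (add_zero (0 : ℝ) ▸ tg'.add hu'0) hx
      simp only [Pi.sub_apply, Pi.add_apply] at l1 l2
      have l3 : C * K / 2 * x⁻¹ ≤ K / 2 := by
        have hx0 : 0 < x := hR'.trans_le hx
        have : C * x⁻¹ ≤ 1 := by
          rw [← div_eq_mul_inv, div_le_one hx0]; exact (le_max_right _ _).trans hx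
        nlinarith
      rw [abs_le]
      constructor <;> linarith
    obtain ⟨K, hK⟩ : ∃ K, ∀ x, |u x| ≤ K := ⟨‖ev h.isH1.toE‖, fun x => by
      have := (ev h.isH1.toE).norm_coe_le_norm x
      rwa [ev_toE] at this⟩
    have hK0 : 0 ≤ K := (abs_nonneg _).trans (hK 0)
    have iter : ∀ n : ℕ, ∀ x, R' ≤ x → |u x| ≤ K * (1 / 2) ^ n := by
      intro n
      induction n with
      | zero => intro x _; simpa using hK x
      | succ n ih =>
        intro x hx
        have := step _ (by positivity) ih x hx
        rw [pow_succ]; linarith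
    have hz : ∀ x, R' ≤ x → u x = 0 := fun x hx => by
      have ht : Tendsto (fun n : ℕ => K * (1 / 2 : ℝ) ^ n) atTop (𝓝 0) := by
        simpa using (tendsto_pow_atTop_nhds_zero_of_lt_one (by norm_num : (0 : ℝ) ≤ 1 / 2)
          (by norm_num)).const_mul K
      exact abs_nonpos_iff.1 (ge_of_tendsto ht (Eventually.of_forall fun n => iter n x hx))
    refine ode_unique (x₀ := R' + 1) h.contDiff hq' h.eq (hz _ (by linarith)) ?_
    have : u =ᶠ[𝓝 (R' + 1)] fun _ => 0 := by
      filter_upwards [Ioi_mem_nhds (show R' < R' + 1 by linarith)] with y hy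
      exact hz y (le_of_lt hy)
    rw [this.deriv_eq]; simp
  · set K := C * (1 + 1 / e) with hK
    -- For e > 0 the energy u'² + eu² changes at relative rate at most K/x³, and the integrating
    -- factor G makes its product with the energy nondecreasing. That product tends to 0, so the
    -- energy vanishes at R.
    set G : ℝ → ℝ := fun x => Real.exp (-(K / 2) / x ^ 2)
    have hG : ∀ x, R ≤ x → HasDerivAt G (G x * (K / x ^ 3)) x := fun x hx => by
      have hx0 : x ≠ 0 := (hR.trans_le hx).ne'
      have := ((hasDerivAt_const x (-(K / 2))).div ((hasDerivAt_id x).pow 2)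
            (pow_ne_zero 2 hx0)).exp
      refine this.congr_deriv ?_
      simp only [id_eq, Nat.cast_ofNat, Nat.add_one_sub_one, pow_one, G, Pi.pow_apply, Pi.div_apply]
      field_simp
      ring
    have hE : ∀ x, HasDerivAt (fun x => deriv u x ^ 2 + e * u x ^ 2) (2 * q x * (u x * deriv u x))
        x := fun x => by
      refine (((h.hasDerivAt_deriv x).pow 2).add
        (((h.isH1.hasDerivAt x).pow 2).const_mul e)).congr_deriv ?_
      simp only [Nat.cast_ofNat, Nat.add_one_sub_one, pow_one]; ring
    have hm : MonotoneOn (fun x => (deriv u x ^ 2 + e * u x ^ 2) * G x) (Ici R) := by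
      refine monotoneOn_Ici_of_hasDerivAt (fun x hx => (hE x).mul (hG x hx)) fun x hx => ?_
      have hx0 : 0 < x := hR.trans_le hx
      have hGx : 0 < G x := Real.exp_pos _
      have h1 : |2 * q x * (u x * deriv u x)| ≤ C / x ^ 3 * (u x ^ 2 + deriv u x ^ 2) := by
        have e1 : 2 * q x * (u x * deriv u x) = q x * (2 * (u x * deriv u x)) := by ring
        rw [e1, abs_mul]
        gcongr
        · exact hC x hx
        · rw [abs_le]; constructor <;>
          nlinarith [sq_nonneg (u x + deriv u x), sq_nonneg (u x - deriv u x)]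
      have h2 : C / x ^ 3 * (u x ^ 2 + deriv u x ^ 2) ≤
          (deriv u x ^ 2 + e * u x ^ 2) * (K / x ^ 3) := by
        have : u x ^ 2 + deriv u x ^ 2 ≤ (1 + 1 / e) * (deriv u x ^ 2 + e * u x ^ 2) := by
          have e2 : (1 + 1 / e) * (deriv u x ^ 2 + e * u x ^ 2) =
            u x ^ 2 + deriv u x ^ 2 + e * u x ^ 2 + deriv u x ^ 2 / e := by field_simp; ring
          rw [e2]
          have : 0 ≤ e * u x ^ 2 + deriv u x ^ 2 / e := by positivity
          linarith
        calc _ ≤ C / x ^ 3 * ((1 + 1 / e) * (deriv u x ^ 2 + e * u x ^ 2)) := by gcongr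
          _ = _ := by rw [hK]; ring
      have h3 := (abs_le.1 (h1.trans h2)).1
      nlinarith
    have ht : Tendsto (fun x => (deriv u x ^ 2 + e * u x ^ 2) * G x) atTop (𝓝 0) := by
      have t1 : Tendsto (fun x => deriv u x ^ 2 + e * u x ^ 2) atTop (𝓝 0) := by
        simpa using (hu'0.pow 2).add ((hu0.pow 2).const_mul e)
      have t2 : Tendsto G atTop (𝓝 1) := by
        have : Tendsto (fun y : ℝ => -(K / 2) / y ^ 2) atTop (𝓝 0) :=
          tendsto_const_nhds.div_atTop (tendsto_pow_atTop two_ne_zero)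
        have h3 := (Real.continuous_exp.tendsto 0).comp this
        rwa [Real.exp_zero] at h3
      simpa using t1.mul t2
    have h0 := nonpos_of_monotoneOn_of_tendsto hm ht (le_refl R)
    have hGx : 0 < G R := Real.exp_pos _
    have h1 : deriv u R ^ 2 + e * u R ^ 2 ≤ 0 := by
      by_contra! hn
      have := mul_pos hn hGx
      linarith
    have h2 : 0 ≤ e * u R ^ 2 := by positivity
    have h3 : deriv u R = 0 := by
      have : deriv u R ^ 2 = 0 := le_antisymm (by linarith) (sq_nonneg _)
      exact pow_eq_zero_iff two_ne_zero |>.1 this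
    have h4 : u R = 0 := by
      have h5 : u R ^ 2 = 0 := by
        have : e * u R ^ 2 = 0 := le_antisymm (by nlinarith [sq_nonneg (deriv u R)]) h2
        exact (mul_eq_zero.1 this).resolve_left he.ne'
      exact pow_eq_zero_iff two_ne_zero |>.1 h5
    exact ode_unique h.contDiff hq' h.eq h4 h3

end Decay

/-! ### Sturm comparison -/

section Comparison
variable {q₁ q₂ u w : ℝ → ℝ} {C₁ C₂ : ℝ}

theorem IsSol.comp_neg' {q u : ℝ → ℝ} (h : IsSol q u) :
    IsSol (fun x => q (-x)) fun x => u (-x) := by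
  refine ⟨h.isH1.comp_neg, h.contDiff.comp contDiff_neg, fun x => ?_⟩
  have : deriv (fun x => u (-x)) = fun x => -deriv u (-x) :=
    funext fun x => (h.isH1.hasDerivAt_comp_neg x).deriv
  rw [this]
  have h2 := ((h.hasDerivAt_deriv (-x)).comp x (hasDerivAt_neg x)).neg
  rw [show (fun x => -deriv u (-x)) = -(deriv u ∘ Neg.neg) from rfl, h2.deriv]
  ring

/-- While u exceeds w, the Wronskian W = u'w - uw' increases. To the right of x₀ either u > w
forever, and W increases to its limit 0, or u/w falls from above 1 to at most 1 and W is negative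
somewhere before the first crossing. Both give W(x₀) < 0; reflection gives the opposite sign, and
the comparison theorem results. -/
theorem IsSol.wronskian_neg (hu : IsSol q₁ u) (hw : IsSol q₂ w) (hq₁ : Continuous q₁)
    (hC₁ : ∀ x, |q₁ x| ≤ C₁) (hq₂ : Continuous q₂) (hC₂ : ∀ x, |q₂ x| ≤ C₂) (hpos : ∀ x, 0 < w x)
    (hcmp : ∀ x, w x < u x → q₂ x < q₁ x) {x₀ : ℝ} (h0 : w x₀ < u x₀) :
    deriv u x₀ * w x₀ - u x₀ * deriv w x₀ < 0 := by
  set W : ℝ → ℝ := fun x => deriv u x * w x - u x * deriv w x with hW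
  have hd : ∀ x, HasDerivAt W ((q₁ x - q₂ x) * (u x * w x)) x := fun x => by
    refine (((hu.hasDerivAt_deriv x).mul (hw.isH1.hasDerivAt x)).sub
      ((hu.isH1.hasDerivAt x).mul (hw.hasDerivAt_deriv x))).congr_deriv ?_
    ring
  have hWc : Continuous W := continuous_iff_continuousAt.2 fun x => (hd x).continuousAt
  have hsm : ∀ b, (∀ x ∈ Ioo x₀ b, w x < u x) → StrictMonoOn W (Icc x₀ b) := fun b hb => by
    refine strictMonoOn_of_deriv_pos (convex_Icc _ _) hWc.continuousOn fun x hx => ?_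
    rw [interior_Icc] at hx
    rw [(hd x).deriv]
    have := hb x hx
    have h1 := hpos x
    have h2 : 0 < u x := h1.trans this
    have h3 := sub_pos.2 (hcmp x this)
    positivity
  by_cases hall : ∀ x, x₀ < x → w x < u x
  · have ht : Tendsto W atTop (𝓝 0) := by
      have a1 := (hu.isH1_deriv hq₁ hC₁).tendsto_atTop
      have a2 := (hw.isH1_deriv hq₂ hC₂).tendsto_atTop
      simpa using (a1.mul hw.isH1.tendsto_atTop).sub (hu.isH1.tendsto_atTop.mul a2)
    have h1 : W x₀ < W (x₀ + 1) := hsm (x₀ + 1) (fun x hx => hall x hx.1)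
      ⟨le_rfl, by linarith⟩ ⟨by linarith, le_rfl⟩ (by linarith)
    have h2 : W (x₀ + 1) ≤ 0 := by
      refine ge_of_tendsto ht ?_
      filter_upwards [Ici_mem_atTop (x₀ + 1)] with y hy
      have hy' : x₀ + 1 ≤ y := hy
      exact (hsm y fun x hx => hall x hx.1).monotoneOn ⟨by linarith, hy'⟩ ⟨by linarith, le_rfl⟩ hy'
    exact h1.trans_le h2
  · push Not at hall
    obtain ⟨b, hb, hub⟩ := hall
    set s : Set ℝ := Ici x₀ ∩ {x | u x ≤ w x}
    have hs : IsClosed s := isClosed_Ici.inter (isClosed_le hu.isH1.continuous hw.isH1.continuous)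
    have hne : s.Nonempty := ⟨b, hb.le, hub⟩
    have hbdd : BddBelow s := ⟨x₀, fun x hx => hx.1⟩
    set β := sInf s
    obtain ⟨hβ1, hβ2⟩ : β ∈ s := hs.csInf_mem hne hbdd
    have hβ2' : u β ≤ w β := hβ2
    have hlt : x₀ < β := lt_of_le_of_ne hβ1 fun e => by rw [e] at h0; linarith
    have hin : ∀ x ∈ Ioo x₀ β, w x < u x := fun x hx => by
      by_contra! hcon
      have := csInf_le hbdd (show x ∈ s from ⟨hx.1.le, hcon⟩)
      exact absurd hx.2 (not_lt.2 this)
    have hk : ∀ x, HasDerivAt (fun x => u x / w x) (W x / w x ^ 2) x := fun x =>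
      (hu.isH1.hasDerivAt x).div (hw.isH1.hasDerivAt x) (hpos x).ne'
    obtain ⟨c, hc, hcd⟩ := exists_hasDerivAt_eq_slope (fun x => u x / w x) _ hlt
      (continuous_iff_continuousAt.2 fun x => (hk x).continuousAt).continuousOn
      fun x _ => hk x
    have h1 : u β / w β ≤ 1 := (div_le_one (hpos β)).2 hβ2'
    have h2 : 1 < u x₀ / w x₀ := (one_lt_div (hpos x₀)).2 h0
    have h3 : W c / w c ^ 2 < 0 := by
      rw [hcd]
      exact div_neg_of_neg_of_pos (by linarith) (by linarith)
    have h4 : W c < 0 := by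
      by_contra! hn
      have : 0 ≤ W c / w c ^ 2 := div_nonneg hn (sq_nonneg _)
      linarith
    exact (hsm β hin ⟨le_rfl, hlt.le⟩ (Ioo_subset_Icc_self hc) hc.1).trans h4

/-- Sturm comparison on the line. -/
theorem IsSol.le_of_comparison (hu : IsSol q₁ u) (hw : IsSol q₂ w) (hq₁ : Continuous q₁)
    (hC₁ : ∀ x, |q₁ x| ≤ C₁) (hq₂ : Continuous q₂) (hC₂ : ∀ x, |q₂ x| ≤ C₂) (hpos : ∀ x, 0 < w x)
    (hcmp : ∀ x, w x < u x → q₂ x < q₁ x) (x : ℝ) : u x ≤ w x := by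
  by_contra! hcon
  have h1 := hu.wronskian_neg hw hq₁ hC₁ hq₂ hC₂ hpos hcmp hcon
  have h2 := hu.comp_neg'.wronskian_neg hw.comp_neg' (x₀ := -x) (hq₁.comp continuous_neg)
    (fun y => hC₁ (-y)) (hq₂.comp continuous_neg) (fun y => hC₂ (-y)) (fun y => hpos (-y))
    (fun y => hcmp (-y)) (by simpa using hcon)
  rw [(hu.isH1.hasDerivAt_comp_neg _).deriv, (hw.isH1.hasDerivAt_comp_neg _).deriv, neg_neg] at h2
  linarith

end Comparison

/-! ### Counting eigenvalues -/

section Counting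
variable {k₀ k₁ : E} {W : ℝ →ᵇ ℝ}

/-- For a kernel element the squared H¹ norm equals ∫(1 - W)u², so it is controlled by the L² norm.
-/
theorem norm_emb_pos {g : E} (hg : g ≠ 0) (h : schr W g = 0) : 0 < inner ℝ (emb g) (emb g) := by
  rw [real_inner_self_eq_norm_sq]
  refine lt_of_le_of_ne (sq_nonneg _) fun h0 => hg ?_
  have h1 : ‖emb g‖ = 0 := by
    rw [eq_comm] at h0; exact pow_eq_zero_iff two_ne_zero |>.1 h0
  have h2 := congrArg (fun f => inner ℝ f g) h
  simp only [schr_apply, inner_add_left, inner_zero_left, real_inner_self_eq_norm_sq] at h2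
  have h3 := abs_inner_pot_le (W - 1) g g
  rw [h1, mul_zero, abs_nonpos_iff] at h3
  rw [h3, add_zero] at h2
  exact norm_eq_zero.1 (pow_eq_zero_iff two_ne_zero |>.1 h2)

/-- Three coefficients against two linear conditions. -/
theorem exists_smul_memZ (g : Fin 3 → E) :
    ∃ c : Fin 3 → ℝ, c ≠ 0 ∧ MemZ k₀ k₁ (∑ i, c i • g i) := by
  set f : (Fin 3 → ℝ) →ₗ[ℝ] (Fin 2 → ℝ) :=
    { toFun := fun c => ![inner ℝ (emb (∑ i, c i • g i)) (emb k₀),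
        inner ℝ (emb (∑ i, c i • g i)) (emb k₁)]
      map_add' := fun c c' => by
        simp only [Pi.add_apply, add_smul, Finset.sum_add_distrib, map_add, inner_add_left]
        ext i; fin_cases i <;> simp
      map_smul' := fun r c => by
        simp only [Pi.smul_apply, smul_eq_mul, mul_smul, ← Finset.smul_sum, map_smul,
          inner_smul_left]
        ext i; fin_cases i <;> simp }
  have hker : LinearMap.ker f ≠ ⊥ := LinearMap.ker_ne_bot_of_finrank_lt (by simp)
  obtain ⟨c, hc, hc0⟩ := (Submodule.ne_bot_iff _).1 hker
  rw [LinearMap.mem_ker] at hc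
  exact ⟨c, hc0, congrFun hc 0, congrFun hc 1⟩

/-- At most two eigenvalues lie below a lower bound of the form on a subspace of codimension
two. -/
theorem false_of_three {ω : ℝ}
    (hform : ∀ f, MemZ k₀ k₁ f → ω * inner ℝ (emb f) (emb f) ≤ inner ℝ (schr W f) f)
    {l : Fin 3 → ℝ} (hl : Function.Injective l) (hlt : ∀ i, l i < ω) {g : Fin 3 → E}
    (hg : ∀ i, g i ≠ 0) (heq : ∀ i, schr (W - l i • 1) (g i) = 0) : False := by
  have hn : ∀ i, 0 < inner ℝ (emb (g i)) (emb (g i)) := fun i => norm_emb_pos (hg i) (heq i)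
  have hs : ∀ i, schr W (g i) = l i • pot 1 (g i) := fun i => by
    have := heq i
    rw [schr_sub, sub_eq_zero, map_smul] at this
    exact this
  have ho : ∀ i j, i ≠ j → inner ℝ (emb (g i)) (emb (g j)) = 0 := fun i j hij => by
    have h1 := inner_schr_symm W (g i) (g j)
    rw [hs, hs, inner_smul_left, inner_smul_right, ← inner_pot_symm, inner_pot_one] at h1
    simp only [RCLike.conj_to_real] at h1
    have h2 : (l i - l j) * inner ℝ (emb (g i)) (emb (g j)) = 0 := by linarith
    exact (mul_eq_zero.1 h2).resolve_left (sub_ne_zero.2 fun e => hij (hl e))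
  -- Eigenvectors of distinct eigenvalues are L²-orthogonal, so on this combination the form is
  -- strictly below ω times the squared norm, although the combination lies in Z.
  obtain ⟨c, hc0, hc⟩ := exists_smul_memZ (k₀ := k₀) (k₁ := k₁) g
  have h1 := hform _ hc
  have e1 : ∀ b : Fin 3 → ℝ, inner ℝ (∑ i, b i • emb (g i)) (∑ i, c i • emb (g i)) =
      ∑ i, b i * c i * inner ℝ (emb (g i)) (emb (g i)) := fun b => by
    rw [sum_inner]
    refine Finset.sum_congr rfl fun i _ => ?_
    rw [inner_sum, Finset.sum_eq_single i]
    · rw [inner_smul_left, inner_smul_right]; simp only [RCLike.conj_to_real]; ring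
    · intro j _ hj
      rw [inner_smul_left, inner_smul_right, ho i j hj.symm]; ring
    · simp
  have e2 : inner ℝ (schr W (∑ i, c i • g i)) (∑ i, c i • g i) =
      ∑ i, l i * c i * c i * inner ℝ (emb (g i)) (emb (g i)) := by
    have : schr W (∑ i, c i • g i) = pot 1 (∑ i, (l i * c i) • g i) := by
      simp only [map_sum, map_smul, hs, smul_smul]
      refine Finset.sum_congr rfl fun i _ => ?_
      rw [mul_comm]
    rw [this, inner_pot_one, map_sum, map_sum]
    simp only [map_smul]
    exact e1 _
  rw [e2, map_sum] at h1
  simp only [map_smul] at h1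
  rw [e1, Finset.mul_sum] at h1
  obtain ⟨i, hi⟩ := Function.ne_iff.1 hc0
  have hi' : c i ≠ 0 := hi
  have : ∑ i, l i * c i * c i * inner ℝ (emb (g i)) (emb (g i)) <
      ∑ i, ω * (c i * c i * inner ℝ (emb (g i)) (emb (g i))) := by
    refine Finset.sum_lt_sum (fun j _ => ?_) ⟨i, Finset.mem_univ _, ?_⟩
    · have : 0 ≤ c j * c j * inner ℝ (emb (g j)) (emb (g j)) :=
        mul_nonneg (mul_self_nonneg _) (hn j).le
      nlinarith [hlt j]
    · have : 0 < c i * c i * inner ℝ (emb (g i)) (emb (g i)) :=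
        mul_pos (mul_self_pos.2 hi') (hn i)
      nlinarith [hlt i]
  linarith

end Counting

/-! ### The 2×2 Schur complement -/

section Feshbach
variable {k₀ k₁ : E} {W : ℝ →ᵇ ℝ} {θ : ℝ}

/-- The form of `schr W` reduced to a complement of `MemZ` by elimination. -/
noncomputable def feshbach (k₀ k₁ : E) (W : ℝ →ᵇ ℝ) (f g : E) : ℝ :=
  inner ℝ (schr W f) g - inner ℝ (solveZ k₀ k₁ W (schr W f)) (schr W g)

theorem CoerciveZ.inner_solveZ_symm (hθ : 0 < θ) (hθ1 : θ ≤ 1) (h : CoerciveZ k₀ k₁ θ W) (f g : E) :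
    inner ℝ (solveZ k₀ k₁ W f) g = inner ℝ f (solveZ k₀ k₁ W g) := by
  obtain ⟨f1, f2⟩ := h.solveZ_spec hθ hθ1 f
  obtain ⟨g1, g2⟩ := h.solveZ_spec hθ hθ1 g
  rw [← f2 _ g1, inner_schr_symm, real_inner_comm, ← g2 _ f1, real_inner_comm]

theorem CoerciveZ.feshbach_symm (hθ : 0 < θ) (hθ1 : θ ≤ 1) (h : CoerciveZ k₀ k₁ θ W) (f g : E) :
    feshbach k₀ k₁ W f g = feshbach k₀ k₁ W g f := by
  rw [feshbach, feshbach, inner_schr_symm, real_inner_comm, h.inner_solveZ_symm hθ hθ1,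
    real_inner_comm (solveZ k₀ k₁ W (schr W g))]

theorem exists_kernel_two {a b c : ℝ} (h : a * c = b ^ 2) :
    ∃ x y : ℝ, (x ≠ 0 ∨ y ≠ 0) ∧ x * a + y * b = 0 ∧ x * b + y * c = 0 := by
  by_cases hb : b = 0
  · rw [hb] at h ⊢
    rcases mul_eq_zero.1 (h.trans (by norm_num)) with h0 | h0
    · exact ⟨1, 0, by simp, by simp [h0], by simp⟩
    · exact ⟨0, 1, by simp, by simp, by simp [h0]⟩
  · exact ⟨b, -a, Or.inl hb, by ring, by linarith⟩

/-- A singular reduced matrix gives a kernel element. -/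
theorem exists_kernel {m M κ ω₀ ω₁ : ℝ} {V : ℝ →ᵇ ℝ} (S : Setting m M κ V ω₀ ω₁ k₀ k₁)
    (hθ : 0 < θ) (hθ1 : θ ≤ 1) (h : CoerciveZ k₀ k₁ θ W) {z : E}
    (hz : MemZ k₀ k₁ z) (hdet : feshbach k₀ k₁ W k₀ k₀ * feshbach k₀ k₁ W (k₁ + z) (k₁ + z) =
      feshbach k₀ k₁ W k₀ (k₁ + z) ^ 2) : ∃ g, g ≠ 0 ∧ schr W g = 0 := by
  obtain ⟨x, y, hxy, h1, h2⟩ := exists_kernel_two hdet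
  set p := k₁ + z
  set R := solveZ k₀ k₁ W
  set f := x • k₀ + y • p with hf
  obtain ⟨r1, r2⟩ := h.solveZ_spec hθ hθ1 (schr W f)
  -- Subtracting the response on Z kills the pairings of `schr W g` with Z; the two pairings left
  -- over are the rows of the reduced matrix applied to (x, y).
  set g := f - R (schr W f) with hg
  have hgZ : ∀ v, MemZ k₀ k₁ v → inner ℝ (schr W g) v = 0 := fun v hv => by
    rw [hg, map_sub, inner_sub_left, r2 v hv, sub_self]
  have hgf : ∀ v, inner ℝ (schr W g) v =
      x * feshbach k₀ k₁ W k₀ v + y * feshbach k₀ k₁ W p v := fun v => by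
    rw [hg, map_sub, inner_sub_left, inner_schr_symm W (R _), hf]
    simp only [map_add, map_smul, inner_add_left, inner_smul_left, feshbach, RCLike.conj_to_real]
    ring
  have g0 : inner ℝ (schr W g) k₀ = 0 := by
    rw [hgf, h.feshbach_symm hθ hθ1 p k₀, h1]
  have gp : inner ℝ (schr W g) p = 0 := by rw [hgf, h2]
  have g1 : inner ℝ (schr W g) k₁ = 0 := by
    rw [inner_add_right, hgZ z hz, add_zero] at gp; exact gp
  refine ⟨g, fun hg0 => ?_, S.eq_zero_of_inner g0 g1 hgZ⟩
  have ho : inner ℝ (emb k₁) (emb k₀) = 0 := by rw [real_inner_comm]; exact S.orth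
  have c0 : inner ℝ (emb g) (emb k₀) = x := by
    rw [hg, map_sub, inner_sub_left, r1.1, hf]
    simp only [p, map_add, map_smul, inner_add_left, inner_smul_left, S.norm₀, ho, hz.1,
      RCLike.conj_to_real]
    ring
  have c1 : inner ℝ (emb g) (emb k₁) = y := by
    rw [hg, map_sub, inner_sub_left, r1.2, hf]
    simp only [p, map_add, map_smul, inner_add_left, inner_smul_left, S.norm₁, S.orth, hz.2,
      RCLike.conj_to_real]
    ring
  rw [hg0, map_zero, inner_zero_left] at c0 c1
  rcases hxy with h0 | h0
  · exact h0 c0.symm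
  · exact h0 c1.symm

theorem continuousOn_feshbach {s : Set ℝ} (hθ : 0 < θ) (hθ1 : θ ≤ 1)
    (h : ∀ l ∈ s, CoerciveZ k₀ k₁ θ (W - l • 1)) (f g : E) :
    ContinuousOn (fun l : ℝ => feshbach k₀ k₁ (W - l • 1) f g) s := by
  intro l hl
  refine ContinuousAt.continuousWithinAt ?_
  have hW : Continuous fun l : ℝ => W - l • (1 : ℝ →ᵇ ℝ) := by fun_prop
  have hs : ∀ f : E, ContinuousAt (fun l : ℝ => schr (W - l • 1) f) l := fun f => by
    unfold schr
    exact Continuous.continuousAt (by fun_prop)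
  have hR : ContinuousAt (fun l : ℝ => solveZ k₀ k₁ (W - l • 1)) l :=
    ContinuousAt.comp (f := fun l : ℝ => W - l • (1 : ℝ →ᵇ ℝ))
      ((h l hl).continuousAt_solveZ hθ hθ1) hW.continuousAt
  exact ((hs f).inner continuousAt_const).sub ((hR.clm_apply (hs f)).inner (hs g))

end Feshbach

/-! ### The linearized operator in rescaled variables -/

namespace Var

/-- The variables with the second one squared. -/
def sq (x : Var) : Var := (x.1, x.2.1 ^ 2, x.2.2)

theorem nice_sq : Nice sq :=
  (Nice.clm (ContinuousLinearMap.fst ℝ Par (ℝ × E × E))).prodMk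
    ((nice_tau.pow 2).prodMk (Nice.clm ((ContinuousLinearMap.snd ℝ ℝ (E × E)) ∘L
      (ContinuousLinearMap.snd ℝ Par (ℝ × E × E)))))

/-- The fourth power of the rescaled profile. -/
noncomputable def four (x : Var) : ℝ →ᵇ ℝ := (ev x.e + x.2.1 • ev x.p) ^ 4

theorem nice_four : Nice four := (nice_ev_e.add (nice_tau.smul nice_ev_p)).pow 4

/-- `schr` on the even eigenfunction, rescaled. -/
noncomputable def vec₀ (x : Var) : E := pot (x.sq.mu • 1 - (5 : ℝ) • x.four) x.1.2.1

theorem nice_vec₀ : Nice vec₀ :=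
  Nice.bilin pot (((nice_mu.comp nice_sq).smul (Nice.const 1)).sub
    ((Nice.const 5).smul nice_four)) nice_k₀

/-- The quadratic part of the coupling potential. -/
noncomputable def coup' (x : Var) : ℝ →ᵇ ℝ :=
  (20 : ℝ) • (ev x.e ^ 2 * ev x.p ^ 2) + (20 * x.2.1) • (ev x.e * ev x.p ^ 3) +
    (4 * x.2.1 ^ 2) • ev x.p ^ 4

/-- The coupling potential. -/
noncomputable def coup (x : Var) : ℝ →ᵇ ℝ :=
  (20 : ℝ) • (ev x.e ^ 3 * ev x.p) + x.2.1 • x.coup'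

theorem nice_coup' : Nice coup' :=
  (((Nice.const 20).smul ((nice_ev_e.pow 2).mul (nice_ev_p.pow 2))).add
    (((Nice.const 20).mul nice_tau).smul (nice_ev_e.mul (nice_ev_p.pow 3)))).add
    (((Nice.const 4).mul (nice_tau.pow 2)).smul (nice_ev_p.pow 4))

theorem nice_coup : Nice coup :=
  ((Nice.const 20).smul ((nice_ev_e.pow 3).mul nice_ev_p)).add (nice_tau.smul nice_coup')

/-- The coupling potential applied to the odd profile. -/
noncomputable def vec₁ (x : Var) : E := pot x.coup x.p

theorem nice_vec₁ : Nice vec₁ := Nice.bilin pot nice_coup nice_p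

/-- The leading terms of the reduced matrix. -/
noncomputable def lead₀₀ (x : Var) : ℝ := inner ℝ x.vec₀ x.1.2.1
noncomputable def lead₀₁ (x : Var) : ℝ := inner ℝ x.vec₁ x.1.2.1
noncomputable def lead₁₁ (x : Var) : ℝ := inner ℝ (pot x.coup' x.p) x.p

theorem nice_lead₀₀ : Nice lead₀₀ := nice_vec₀.inner nice_k₀
theorem nice_lead₀₁ : Nice lead₀₁ := nice_vec₁.inner nice_k₀
theorem nice_lead₁₁ : Nice lead₁₁ := (Nice.bilin pot nice_coup' nice_p).inner nice_p

theorem coup_apply (x : Var) (z : ℝ) : x.coup z = 20 * (ev x.e z ^ 3 * ev x.p z) + x.2.1 *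
    (20 * (ev x.e z ^ 2 * ev x.p z ^ 2) + 20 * x.2.1 * (ev x.e z * ev x.p z ^ 3) +
    4 * x.2.1 ^ 2 * ev x.p z ^ 4) := rfl

theorem four_apply (x : Var) (z : ℝ) : x.four z = (ev x.e z + x.2.1 * ev x.p z) ^ 4 := rfl

/-- The terms 5e⁴ cancel. With t = s/ρ as second variable, L₊ differs from the operator annihilating
p by a potential with a factor t, so p is almost in the kernel of L₊. -/
theorem wo_sub_four (x : Var) : x.sq.wo - (5 : ℝ) • x.four = -(x.2.1 • x.coup) := by
  ext z
  rw [BoundedContinuousFunction.sub_apply, BoundedContinuousFunction.smul_apply, wo_apply,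
    BoundedContinuousFunction.neg_apply, BoundedContinuousFunction.smul_apply, coup_apply,
    four_apply]
  change 5 * ev x.e z ^ 4 + 10 * x.2.1 ^ 2 * (ev x.e z ^ 2 * ev x.p z ^ 2) +
    (x.2.1 ^ 2) ^ 2 * ev x.p z ^ 4 - 5 * (ev x.e z + x.2.1 * ev x.p z) ^ 4 = -(x.2.1 * _)
  ring

end Var

/-! ### Leading entries of the reduced matrix -/

section Values
variable {m M κ : ℝ} {V : ℝ →ᵇ ℝ} {ω₀ ω₁ : ℝ} {k₀ k₁ : E}

theorem lead₀₀_zero (S : Setting m M κ V ω₀ ω₁ k₀ k₁) :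
    Var.lead₀₀ (par V ω₀ k₀ k₁, 0, 0) = -4 * ∫ x, ev k₀ x ^ 6 := by
  have hsq : Var.sq (par V ω₀ k₀ k₁, 0, 0) = (par V ω₀ k₀ k₁, 0, 0) := by simp [Var.sq]
  have h4 : Var.four (par V ω₀ k₀ k₁, 0, 0) = ev k₀ ^ 4 := by simp [Var.four, e_zero]
  rw [Var.lead₀₀, Var.vec₀, hsq, h4, mu_zero, map_sub, map_smul, map_smul, sub_apply, smul_apply,
    smul_apply, inner_sub_left, inner_smul_left, inner_smul_left, inner_pot_one]
  change _ * inner ℝ (emb k₀) (emb k₀) - _ * inner ℝ (pot (ev k₀ ^ 4) k₀) k₀ = _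
  have : inner ℝ (pot (ev k₀ ^ 4) k₀) k₀ = ∫ x, ev k₀ x ^ 6 := by
    refine (inner_pot _ _ _).trans (integral_congr_ae (.of_forall fun x => ?_))
    simp only [BoundedContinuousFunction.coe_pow, Pi.pow_apply]
    ring
  rw [S.norm₀, this]
  simp only [RCLike.conj_to_real]
  ring

theorem lead₀₁_zero : Var.lead₀₁ (par V ω₀ k₀ k₁, 0, 0) =
    20 * ∫ x, ev k₀ x ^ 4 * ev k₁ x ^ 2 := by
  rw [Var.lead₀₁, Var.vec₁, p_zero, ← integral_const_mul]
  refine (inner_pot _ _ _).trans (integral_congr_ae (.of_forall fun x => ?_))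
  simp only [Var.coup_apply, e_zero, p_zero]
  simp only [par]
  ring

theorem lead₁₁_zero : Var.lead₁₁ (par V ω₀ k₀ k₁, 0, 0) =
    20 * ∫ x, ev k₀ x ^ 2 * ev k₁ x ^ 4 := by
  rw [Var.lead₁₁, p_zero, ← integral_const_mul]
  refine (inner_pot _ _ _).trans (integral_congr_ae (.of_forall fun x => ?_))
  simp [Var.coup', e_zero, p_zero]
  ring

end Values

/-! ### Signs of the determinant -/

section Signs
variable {A B D M₁ η Λ a t ν f₀₀ f₀₁ f₁₁ n e₀₀ e₀₁ e₁₁ : ℝ}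

theorem det_bounds (hη : 1 ≤ η) (hM₁ : 1 ≤ M₁) (ha : 0 < a) (ha1 : a ≤ 1)
    (ht : |t| ≤ a) (h₀₁ : |f₀₁| ≤ 20 * M₁ + η) (h₁₁ : |f₁₁| ≤ 20 * M₁ + η)
    (he₀₁ : |e₀₁| ≤ η) (he₁₁ : |e₁₁| ≤ η) :
    |t ^ 2 * f₁₁ + a * e₁₁| ≤ a * (22 * M₁ * η) ∧ |t * f₀₁ - a * e₀₁| ≤ a * (22 * M₁ * η) := by
  have hMη : M₁ ≤ M₁ * η := by nlinarith
  have hηM : η ≤ M₁ * η := by nlinarith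
  have h22 : 20 * M₁ + η + η ≤ 22 * M₁ * η := by nlinarith
  have ht2 : |t| ^ 2 ≤ a := by nlinarith [abs_nonneg t]
  constructor
  · calc |t ^ 2 * f₁₁ + a * e₁₁| ≤ |t ^ 2 * f₁₁| + |a * e₁₁| := abs_add_le _ _
      _ = |t| ^ 2 * |f₁₁| + a * |e₁₁| := by rw [abs_mul, abs_mul, abs_pow, abs_of_pos ha]
      _ ≤ a * (20 * M₁ + η) + a * η := by gcongr
      _ ≤ _ := by nlinarith
  · calc |t * f₀₁ - a * e₀₁| ≤ |t * f₀₁| + |a * e₀₁| := abs_sub _ _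
      _ = |t| * |f₀₁| + a * |e₀₁| := by rw [abs_mul, abs_mul, abs_of_pos ha]
      _ ≤ a * (20 * M₁ + η) + a * η := by gcongr
      _ ≤ _ := by nlinarith

/-- The expression is the determinant divided by a² at the spectral value al with l = -8A; e₀₀, e₀₁,
e₁₁ come from the elimination of Z. The leading value is 4A · 8A, and the rest is small with a. -/
theorem det_pos (hη : 1 ≤ η) (hM₁ : 1 ≤ M₁) (ha : 0 < a) (ha1 : a ≤ 1) (hA : A ≤ M₁)
    (hsm : a * (60 * M₁ * η) ≤ A) (ht : |t| ≤ a) (h₀₀ : |f₀₀ + 4 * A| ≤ η * a)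
    (h₀₁ : |f₀₁| ≤ 20 * M₁ + η) (h₁₁ : |f₁₁| ≤ 20 * M₁ + η) (hn : |n - 1| ≤ η * a)
    (he₀₀ : |e₀₀| ≤ η) (he₀₁ : |e₀₁| ≤ η) (he₁₁ : |e₁₁| ≤ η) :
    0 < -(f₀₀ - -8 * A - a * e₀₀) * (t ^ 2 * f₁₁ + -8 * A * n + a * e₁₁) -
      (t * f₀₁ - a * e₀₁) ^ 2 := by
  obtain ⟨b1, b2⟩ := det_bounds hη hM₁ ha ha1 ht h₀₁ h₁₁ he₀₁ he₁₁
  have hMη : 1 ≤ M₁ * η := by nlinarith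
  have hηM : η * a ≤ a * (M₁ * η) := by
    rw [mul_comm]
    exact mul_le_mul_of_nonneg_left (le_mul_of_one_le_left (by linarith) hM₁) ha.le
  have hA0 : 0 < A := lt_of_lt_of_le (by positivity) hsm
  set q := a * (M₁ * η)
  have hq : 0 < q := by positivity
  have hqA : 60 * q ≤ A := by simp only [q]; linarith
  have b1' : |t ^ 2 * f₁₁ + a * e₁₁| ≤ 22 * q := by simp only [q]; linarith
  have b2' : |t * f₀₁ - a * e₀₁| ≤ 22 * q := by simp only [q]; linarith
  have b3 : |a * e₀₀| ≤ q := by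
    rw [abs_mul, abs_of_pos ha]
    exact (mul_le_mul_of_nonneg_left he₀₀ ha.le).trans (by linarith)
  have b4 : |A * (n - 1)| ≤ q := by
    rw [abs_mul, abs_of_pos hA0]
    calc A * |n - 1| ≤ M₁ * (η * a) := by gcongr
      _ = q := by simp only [q]; ring
  have c1 := abs_le.1 h₀₀
  have c2 := abs_le.1 b3
  have c3 := abs_le.1 b1'
  have c4 := abs_le.1 b4
  have x1 : 2 * A ≤ f₀₀ - -8 * A - a * e₀₀ := by linarith
  have x2 : 4 * A ≤ -(t ^ 2 * f₁₁ + -8 * A * n + a * e₁₁) := by linarith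
  have x3 : (t * f₀₁ - a * e₀₁) ^ 2 ≤ A ^ 2 := by
    rw [← sq_abs]
    exact pow_le_pow_left₀ (abs_nonneg _) (by linarith) 2
  have x4 := mul_le_mul x1 x2 (by positivity) (by linarith)
  nlinarith

/-- f₀₀ and its elimination term deviate from -4A by at most 2ηa, so the offset 4ηa makes the first
factor positive while the second stays near -4A. This offset becomes the O(ρ⁸) error in the bound
for μ₀. -/
theorem det_neg (hη : 1 ≤ η) (hM₁ : 1 ≤ M₁) (ha : 0 < a) (ha1 : a ≤ 1) (hA : A ≤ M₁)
    (hsm : a * (60 * M₁ * η) ≤ A) (ht : |t| ≤ a) (h₀₀ : |f₀₀ + 4 * A| ≤ η * a)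
    (h₀₁ : |f₀₁| ≤ 20 * M₁ + η) (h₁₁ : |f₁₁| ≤ 20 * M₁ + η) (hn : |n - 1| ≤ η * a)
    (he₀₀ : |e₀₀| ≤ η) (he₀₁ : |e₀₁| ≤ η) (he₁₁ : |e₁₁| ≤ η) :
    -(f₀₀ - (-4 * A + 4 * η * a) - a * e₀₀) *
      (t ^ 2 * f₁₁ + (-4 * A + 4 * η * a) * n + a * e₁₁) - (t * f₀₁ - a * e₀₁) ^ 2 < 0 := by
  obtain ⟨b1, b2⟩ := det_bounds hη hM₁ ha ha1 ht h₀₁ h₁₁ he₀₁ he₁₁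
  have hMη : 1 ≤ M₁ * η := by nlinarith
  have hηM : η * a ≤ a * (M₁ * η) := by
    rw [mul_comm]
    exact mul_le_mul_of_nonneg_left (le_mul_of_one_le_left (by linarith) hM₁) ha.le
  have hA0 : 0 < A := lt_of_lt_of_le (by positivity) hsm
  set q := a * (M₁ * η)
  have hq : 0 < q := by positivity
  have hqA : 60 * q ≤ A := by simp only [q]; linarith
  have b1' : |t ^ 2 * f₁₁ + a * e₁₁| ≤ 22 * q := by simp only [q]; linarith
  have b3 : |a * e₀₀| ≤ η * a := by
    rw [abs_mul, abs_of_pos ha]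
    exact (mul_le_mul_of_nonneg_left he₀₀ ha.le).trans (by linarith)
  have hηa : 0 < η * a := by positivity
  have b4 : |(-4 * A + 4 * η * a) * (n - 1)| ≤ 4 * q := by
    rw [abs_mul]
    have : |-4 * A + 4 * η * a| ≤ 4 * M₁ := by rw [abs_le]; constructor <;> nlinarith
    calc |-4 * A + 4 * η * a| * |n - 1| ≤ 4 * M₁ * (η * a) := by gcongr
      _ = 4 * q := by simp only [q]; ring
  have c1 := abs_le.1 h₀₀
  have c2 := abs_le.1 b3
  have c3 := abs_le.1 b1'
  have c4 := abs_le.1 b4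
  have x1 : 0 < -(f₀₀ - (-4 * A + 4 * η * a) - a * e₀₀) := by linarith
  have x2 : t ^ 2 * f₁₁ + (-4 * A + 4 * η * a) * n + a * e₁₁ < 0 := by linarith
  have := mul_neg_of_pos_of_neg x1 x2
  nlinarith [sq_nonneg (t * f₀₁ - a * e₀₁)]

/-- On the scale l = t²ν the determinant is divisible by t², and the quotient is to leading order
4A(20D + ν) - 400B², affine in ν with root 20(5B² - AD)/A. -/
theorem det_close (hη : 1 ≤ η) (hM₁ : 1 ≤ M₁) (hΛ : 1 ≤ Λ) (ha : 0 < a) (ha1 : a ≤ 1)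
    (hA : A ≤ M₁) (hA0 : 0 ≤ A) (hB : |B| ≤ M₁) (hD : |D| ≤ M₁) (hsm : a * (3 * η * Λ) ≤ 1)
    (ht : |t| ≤ a) (hν : |ν| ≤ Λ) (h₀₀ : |f₀₀ + 4 * A| ≤ η * a)
    (h₀₁ : |f₀₁ - 20 * B| ≤ η * a) (h₁₁ : |f₁₁ - 20 * D| ≤ η * a) (hn : |n - 1| ≤ η * a)
    (he₀₀ : |e₀₀| ≤ η) (he₀₁ : |e₀₁| ≤ η) (he₁₁ : |e₁₁| ≤ η) :
    |(-(f₀₀ - t ^ 2 * ν - a * e₀₀) * (f₁₁ + ν * n + a * e₁₁) - (f₀₁ - a * e₀₁) ^ 2) -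
      (4 * A * ν - 80 * (5 * B ^ 2 - A * D))| ≤ a * (210 * η * Λ ^ 2 * M₁) := by
  set e := a * (3 * η * Λ) with he
  have he0 : 0 < e := by positivity
  have k1 : η * a ≤ a * (η * Λ) := by nlinarith [mul_pos (zero_lt_one.trans_le hη) ha]
  have ht2 : |t| ^ 2 ≤ a := by nlinarith [abs_nonneg t]
  have k2 : Λ * a ≤ a * (η * Λ) := by nlinarith [mul_pos (zero_lt_one.trans_le hΛ) ha]
  have ae : ∀ {z : ℝ}, |z| ≤ η → |a * z| ≤ η * a := fun hz => by
    rw [abs_mul, abs_of_pos ha, mul_comm]; gcongr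
  have tn : |t ^ 2 * ν| ≤ Λ * a := by
    rw [abs_mul, abs_pow, mul_comm]; gcongr
  have nn : |ν * (n - 1)| ≤ a * (η * Λ) := by
    rw [abs_mul]
    calc |ν| * |n - 1| ≤ Λ * (η * a) := by gcongr
      _ = _ := by ring
  set X := -(f₀₀ - t ^ 2 * ν - a * e₀₀) with hX
  set Y := f₁₁ + ν * n + a * e₁₁ with hY
  set Z := f₀₁ - a * e₀₁ with hZ
  have c1 := abs_le.1 h₀₀
  have c2 := abs_le.1 h₀₁
  have c3 := abs_le.1 h₁₁
  have c4 := abs_le.1 (ae he₀₀)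
  have c5 := abs_le.1 (ae he₀₁)
  have c6 := abs_le.1 (ae he₁₁)
  have c7 := abs_le.1 tn
  have c8 := abs_le.1 nn
  have c9 := abs_le.1 hB
  have c10 := abs_le.1 hD
  have c11 := abs_le.1 hν
  have ee : e = 3 * (a * (η * Λ)) := by rw [he]; ring
  have hXe : |X - 4 * A| ≤ e := by rw [abs_le, ee, hX]; constructor <;> linarith only [c1, c4, c7, k1, k2]
  have hYe : |Y - (20 * D + ν)| ≤ e := by rw [abs_le, ee, hY]; constructor <;> linarith only [c3, c6, c8, k1, k2]
  have hZe : |Z - 20 * B| ≤ e := by rw [abs_le, ee, hZ]; constructor <;> linarith only [c2, c5, k1, mul_pos ha (mul_pos (zero_lt_one.trans_le hη) (zero_lt_one.trans_le hΛ))]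
  have hYb : |Y| ≤ 20 * M₁ + Λ + 1 := by
    have := abs_le.1 hYe
    rw [abs_le]; constructor <;> linarith
  have hZb : |Z + 20 * B| ≤ 40 * M₁ + 1 := by
    have := abs_le.1 hZe
    rw [abs_le]; constructor <;> linarith
  have id1 : X * Y - Z ^ 2 - (4 * A * ν - 80 * (5 * B ^ 2 - A * D)) =
      (X - 4 * A) * Y + 4 * A * (Y - (20 * D + ν)) - (Z - 20 * B) * (Z + 20 * B) := by ring
  rw [id1]
  clear_value X Y Z e
  have s1 : |(X - 4 * A) * Y| ≤ e * (20 * M₁ + Λ + 1) := by rw [abs_mul]; gcongr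
  have s2 : |4 * A * (Y - (20 * D + ν))| ≤ 4 * M₁ * e := by
    rw [abs_mul, abs_of_nonneg (by positivity : 0 ≤ 4 * A)]; gcongr
  have s3 : |(Z - 20 * B) * (Z + 20 * B)| ≤ e * (40 * M₁ + 1) := by rw [abs_mul]; gcongr
  have hMΛ : 1 ≤ M₁ * Λ := one_le_mul_of_one_le_of_one_le hM₁ hΛ
  have hM' : M₁ ≤ M₁ * Λ := le_mul_of_one_le_right (by linarith) hΛ
  have hΛ' : Λ ≤ M₁ * Λ := le_mul_of_one_le_left (by linarith) hM₁
  calc _ ≤ |(X - 4 * A) * Y| + |4 * A * (Y - (20 * D + ν))| + |(Z - 20 * B) * (Z + 20 * B)| :=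
        (abs_sub _ _).trans (add_le_add (abs_add_le _ _) le_rfl)
    _ ≤ e * (64 * M₁ + Λ + 2) := by linarith only [s1, s2, s3]
    _ ≤ e * (70 * (M₁ * Λ)) := by gcongr; linarith only [hMΛ, hM', hΛ']
    _ = _ := by rw [he]; ring

end Signs

/-- Uniform bounds on the entries of the reduced matrix. -/
theorem exists_entry_bounds (CD : ℝ) : ∃ C : ℝ, 1 ≤ C ∧ ∀ (D : Par) (t : ℝ) (y : E × E),
    ‖D‖ ≤ CD → |t| ≤ 1 → ‖y‖ ≤ 1 →
    |Var.lead₀₀ (D, t, y) - Var.lead₀₀ (D, 0, 0)| ≤ C * max |t| ‖y‖ ∧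
    |Var.lead₀₁ (D, t, y) - Var.lead₀₁ (D, 0, 0)| ≤ C * max |t| ‖y‖ ∧
    |Var.lead₁₁ (D, t, y) - Var.lead₁₁ (D, 0, 0)| ≤ C * max |t| ‖y‖ ∧
    |Var.oddMass (D, t, y) - Var.oddMass (D, 0, 0)| ≤ C * max |t| ‖y‖ ∧
    ‖Var.vec₀ (D, t, y)‖ ≤ C ∧ ‖Var.vec₁ (D, t, y)‖ ≤ C ∧ ‖Var.four (D, t, y)‖ ≤ C ∧
    ‖pot 1 D.2.1‖ ≤ C ∧ ‖pot 1 (Var.p (D, t, y))‖ ≤ C := by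
  set r := max CD 1
  obtain ⟨c1, -, h1⟩ := Var.nice_lead₀₀.2 r
  obtain ⟨c2, -, h2⟩ := Var.nice_lead₀₁.2 r
  obtain ⟨c3, -, h3⟩ := Var.nice_lead₁₁.2 r
  obtain ⟨c4, -, h4⟩ := Var.nice_oddMass.2 r
  obtain ⟨c5, -, h5⟩ := Var.nice_vec₀.2 r
  obtain ⟨c6, -, h6⟩ := Var.nice_vec₁.2 r
  obtain ⟨c7, -, h7⟩ := Var.nice_four.2 r
  obtain ⟨c8, -, h8⟩ := (Nice.bilin pot (Nice.const 1) Var.nice_k₀).2 r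
  obtain ⟨c9, -, h9⟩ := (Nice.bilin pot (Nice.const 1) Var.nice_p).2 r
  set C := 1 + |c1| + |c2| + |c3| + |c4| + |c5| + |c6| + |c7| + |c8| + |c9| with hC
  have n1 := le_abs_self c1
  have n2 := le_abs_self c2
  have n3 := le_abs_self c3
  have n4 := le_abs_self c4
  have n5 := le_abs_self c5
  have n6 := le_abs_self c6
  have n7 := le_abs_self c7
  have n8 := le_abs_self c8
  have n9 := le_abs_self c9
  have p1 := abs_nonneg c1
  have p2 := abs_nonneg c2
  have p3 := abs_nonneg c3
  have p4 := abs_nonneg c4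
  have p5 := abs_nonneg c5
  have p6 := abs_nonneg c6
  have p7 := abs_nonneg c7
  have p8 := abs_nonneg c8
  have p9 := abs_nonneg c9
  refine ⟨C, by linarith, fun D t y hD ht hy => ?_⟩
  have m1 : ‖((D, t, y) : Var)‖ ≤ r := norm_var_le hD ht hy
  have m0 : ‖((D, 0, 0) : Var)‖ ≤ r := norm_var_le hD (by simp) (by simp)
  have hdist : ‖((D, t, y) : Var) - (D, 0, 0)‖ = max |t| ‖y‖ := by
    rw [norm_var_sub, sub_zero, sub_zero]
  have hδ : 0 ≤ max |t| ‖y‖ := le_max_of_le_left (abs_nonneg _)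
  refine ⟨?_, ?_, ?_, ?_, ?_, ?_, ?_, ?_, ?_⟩
  · have := (h1 _ _ m1 m0).2
    rw [hdist] at this
    exact this.trans (by gcongr; linarith)
  · have := (h2 _ _ m1 m0).2
    rw [hdist] at this
    exact this.trans (by gcongr; linarith)
  · have := (h3 _ _ m1 m0).2
    rw [hdist] at this
    exact this.trans (by gcongr; linarith)
  · have := (h4 _ _ m1 m0).2
    rw [hdist] at this
    exact this.trans (by gcongr; linarith)
  · exact (h5 _ _ m1 m0).1.trans (by linarith)
  · exact (h6 _ _ m1 m0).1.trans (by linarith)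
  · exact (h7 _ _ m1 m0).1.trans (by linarith)
  · exact (h8 _ _ m1 m0).1.trans (by linarith)
  · exact (h9 _ _ m1 m0).1.trans (by linarith)

/-! ### Bounds on the moments -/

section Moments
variable {m M κ : ℝ} {V : ℝ →ᵇ ℝ} {ω₀ ω₁ : ℝ} {k₀ k₁ : E}

theorem integral_eq_inner₆ (k : E) : ∫ x, ev k x ^ 6 = inner ℝ (pot (ev k ^ 4) k) k := by
  rw [inner_pot]
  refine integral_congr_ae (.of_forall fun x => ?_)
  simp only [BoundedContinuousFunction.coe_pow, Pi.pow_apply]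
  ring

theorem integral_eq_inner₄ (k l : E) :
    ∫ x, ev k x ^ 4 * ev l x ^ 2 = inner ℝ (pot (ev k ^ 2 * ev l ^ 2) k) k := by
  rw [inner_pot]
  congr 1; ext x
  simp only [BoundedContinuousFunction.coe_mul, BoundedContinuousFunction.coe_pow, Pi.pow_apply,
    Pi.mul_apply]
  ring

theorem integral_eq_inner₂ (k l : E) :
    ∫ x, ev k x ^ 2 * ev l x ^ 4 = inner ℝ (pot (ev k ^ 2 * ev l ^ 2) l) l := by
  rw [inner_pot]
  congr 1; ext x
  simp only [BoundedContinuousFunction.coe_mul, BoundedContinuousFunction.coe_pow, Pi.pow_apply,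
    Pi.mul_apply]
  ring

theorem Setting.norm_ev₀_le (S : Setting m M κ V ω₀ ω₁ k₀ k₁) : ‖ev k₀‖ ≤ 1 + M :=
  (norm_ev_le _).trans S.norm₀_le

theorem Setting.norm_ev₁_le (S : Setting m M κ V ω₀ ω₁ k₀ k₁) : ‖ev k₁‖ ≤ 1 + M :=
  (norm_ev_le _).trans S.norm₁_le

theorem norm_emb_eq_one {k : E} (h : inner ℝ (emb k) (emb k) = 1) : ‖emb k‖ = 1 := by
  rw [real_inner_self_eq_norm_sq] at h
  nlinarith [norm_nonneg (emb k)]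

/-- Four of the six factors are bounded by 1 + M in sup norm, the other two by the L² normalization.
-/
theorem Setting.moments_le (S : Setting m M κ V ω₀ ω₁ k₀ k₁) :
    |∫ x, ev k₀ x ^ 6| ≤ (1 + M) ^ 4 ∧ |∫ x, ev k₀ x ^ 4 * ev k₁ x ^ 2| ≤ (1 + M) ^ 4 ∧
      |∫ x, ev k₀ x ^ 2 * ev k₁ x ^ 4| ≤ (1 + M) ^ 4 := by
  have n0 := norm_emb_eq_one S.norm₀
  have n1 := norm_emb_eq_one S.norm₁
  have hM := S.M_nonneg
  have e0 := S.norm_ev₀_le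
  have e1 := S.norm_ev₁_le
  have h22 : ‖ev k₀ ^ 2 * ev k₁ ^ 2‖ ≤ (1 + M) ^ 4 := by
    calc _ ≤ ‖ev k₀ ^ 2‖ * ‖ev k₁ ^ 2‖ := norm_mul_le _ _
      _ ≤ ‖ev k₀‖ ^ 2 * ‖ev k₁‖ ^ 2 := by gcongr <;> exact norm_pow_le _ _
      _ ≤ (1 + M) ^ 2 * (1 + M) ^ 2 := by gcongr
      _ = _ := by ring
  refine ⟨?_, ?_, ?_⟩
  · rw [integral_eq_inner₆]
    refine (abs_inner_pot_le _ _ _).trans ?_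
    rw [n0, mul_one, mul_one]
    exact (norm_pow_le _ _).trans (by gcongr)
  · rw [integral_eq_inner₄]
    refine (abs_inner_pot_le _ _ _).trans ?_
    rwa [n0, mul_one, mul_one]
  · rw [integral_eq_inner₂]
    refine (abs_inner_pot_le _ _ _).trans ?_
    rwa [n1, mul_one, mul_one]

end Moments

/-! ### Entries of the reduced matrix -/

section Entries
variable {m M κ : ℝ} {V : ℝ →ᵇ ℝ} {ω₀ ω₁ : ℝ} {k₀ k₁ : E} {a t : ℝ} {y : E × E}

/-- The potential of the linearized operator. -/
noncomputable def linPot (V : ℝ →ᵇ ℝ) (ω₀ a : ℝ) (x : Var) : ℝ →ᵇ ℝ :=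
  V + (ω₀ + a * x.sq.mu) • 1 - (5 * a) • x.four

theorem Setting.schr_linPot₀ (S : Setting m M κ V ω₀ ω₁ k₀ k₁) (l : ℝ) :
    schr (linPot V ω₀ a (par V ω₀ k₀ k₁, t, y) - (a * l) • 1) k₀ =
      a • (Var.vec₀ (par V ω₀ k₀ k₁, t, y) - l • pot 1 k₀) := by
  have : Var.vec₀ (par V ω₀ k₀ k₁, t, y) = Var.mu (Var.sq (par V ω₀ k₀ k₁, t, y)) • pot 1 k₀ -
      (5 : ℝ) • pot (Var.four (par V ω₀ k₀ k₁, t, y)) k₀ := by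
    rw [Var.vec₀, map_sub, map_smul, map_smul]; rfl
  rw [linPot, schr_sub, schr_sub, S.schr_k₀, this, map_smul, map_smul, smul_apply, smul_apply]
  module

theorem schr_linPot₁ {x : Var} (hp : schr (V + ω₀ • 1) x.p = a • pot (x.sq.wo - x.sq.mu • 1) x.p)
    (l : ℝ) : schr (linPot V ω₀ a x - (a * l) • 1) x.p =
      -a • (x.2.1 • x.vec₁ + l • pot 1 x.p) := by
  have h1 : x.sq.wo = (5 : ℝ) • x.four - x.2.1 • x.coup := by
    rw [sub_eq_iff_eq_add.1 x.wo_sub_four]; abel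
  rw [linPot, schr_sub, schr_sub, schr_add_smul_one V ω₀, hp, h1, Var.vec₁]
  simp only [map_sub, map_smul, sub_apply, smul_apply]
  module

/-- The contribution e³p³ of order zero in t is odd and integrates to zero. The diagonal entry of p
thereby gains a second factor t, which puts the small eigenvalue at order t². -/
theorem inner_vec₁_p {x : Var} (he : ∀ z, ev x.e (-z) = ev x.e z)
    (hp : ∀ z, ev x.p (-z) = -ev x.p z) : inner ℝ x.vec₁ x.p = x.2.1 * x.lead₁₁ := by
  have h0 : inner ℝ (pot (ev x.e ^ 3 * ev x.p) x.p) x.p = 0 := by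
    rw [inner_pot]
    refine integral_eq_zero_of_odd fun z => ?_
    simp only [BoundedContinuousFunction.coe_mul, BoundedContinuousFunction.coe_pow, Pi.pow_apply,
      Pi.mul_apply, he, hp]
    ring
  rw [Var.vec₁, Var.coup, map_add, map_smul, map_smul, add_apply, smul_apply, smul_apply,
    inner_add_left, inner_smul_left, inner_smul_left, h0, Var.lead₁₁]
  simp

theorem abs_inner_solveZ_le {W : ℝ →ᵇ ℝ} {θ : ℝ} (hθ : 0 < θ) (hθ1 : θ ≤ 1)
    (h : CoerciveZ k₀ k₁ θ W) {f g : E} {C : ℝ} (hf : ‖f‖ ≤ C) (hg : ‖g‖ ≤ C) :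
    |inner ℝ (solveZ k₀ k₁ W f) g| ≤ θ⁻¹ * C ^ 2 := by
  have hC : 0 ≤ C := (norm_nonneg _).trans hf
  calc _ ≤ ‖solveZ k₀ k₁ W f‖ * ‖g‖ := abs_real_inner_le_norm _ _
    _ ≤ θ⁻¹ * ‖f‖ * ‖g‖ := by gcongr; exact h.norm_solveZ_le hθ hθ1 f
    _ ≤ θ⁻¹ * C * C := by gcongr
    _ = _ := by ring

/-- The entries of the reduced matrix. -/
theorem Setting.feshbach_eq (S : Setting m M κ V ω₀ ω₁ k₀ k₁)
    (hz : MemZ k₀ k₁ y.2) {x : Var} (hx : x = (par V ω₀ k₀ k₁, t, y))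
    (he : ∀ z, ev x.e (-z) = ev x.e z) (ho : ∀ z, ev x.p (-z) = -ev x.p z)
    (hp : schr (V + ω₀ • 1) x.p = a • pot (x.sq.wo - x.sq.mu • 1) x.p) (l : ℝ)
    {F : E → E → ℝ} (hF : F = feshbach k₀ k₁ (linPot V ω₀ a x - (a * l) • 1))
    {R : E → E} (hR : R = solveZ k₀ k₁ (linPot V ω₀ a x - (a * l) • 1)) :
    F k₀ k₀ = a * (x.lead₀₀ - l - a * inner ℝ (R (x.vec₀ - l • pot 1 k₀)) (x.vec₀ - l • pot 1 k₀)) ∧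
    F k₀ x.p = -a * (t * x.lead₀₁ -
      a * inner ℝ (R (x.vec₀ - l • pot 1 k₀)) (t • x.vec₁ + l • pot 1 x.p)) ∧
    F x.p x.p = -a * (t ^ 2 * x.lead₁₁ + l * x.oddMass +
      a * inner ℝ (R (t • x.vec₁ + l • pot 1 x.p)) (t • x.vec₁ + l • pot 1 x.p)) := by
  have hx1 : x.2.1 = t := by rw [hx]
  have hxk : x.1.2.1 = k₀ := by rw [hx]; rfl
  have hxp : x.p = k₁ + y.2 := by rw [hx]; rfl
  have e0 : schr (linPot V ω₀ a x - (a * l) • 1) k₀ = a • (x.vec₀ - l • pot 1 k₀) := by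
    rw [hx]; exact S.schr_linPot₀ l
  have e1 := schr_linPot₁ hp l
  rw [hx1] at e1
  have hpk : inner ℝ (pot 1 x.p) k₀ = 0 := by
    rw [inner_pot_one, hxp, map_add, inner_add_left, hz.1, real_inner_comm, S.orth, add_zero]
  have hv := inner_vec₁_p he ho
  rw [hx1] at hv
  have hkk : inner ℝ (pot 1 k₀) k₀ = 1 := by rw [inner_pot_one, S.norm₀]
  have hl0 : inner ℝ x.vec₀ k₀ = x.lead₀₀ := by rw [Var.lead₀₀, hxk]
  have hl1 : inner ℝ x.vec₁ k₀ = x.lead₀₁ := by rw [Var.lead₀₁, hxk]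
  rw [hF]
  simp only [feshbach, ← hR]
  have hRs : ∀ (c : ℝ) f, R (c • f) = c • R f :=
    fun c f => by rw [hR, map_smul]
  refine ⟨?_, ?_, ?_⟩
  · rw [e0, hRs, inner_smul_left, inner_smul_left, inner_smul_right, inner_sub_left,
      inner_smul_left, hkk, hl0]
    simp only [RCLike.conj_to_real]
    ring
  · rw [inner_schr_symm, e0, e1, hRs, real_inner_comm, inner_smul_left, inner_smul_left,
      inner_smul_right, inner_add_left, inner_smul_left, inner_smul_left, hpk, hl1]
    simp only [RCLike.conj_to_real]
    ring
  · rw [e1, hRs, inner_smul_left, inner_smul_left, inner_smul_right, inner_add_left,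
      inner_smul_left, inner_smul_left, hv, Var.oddMass]
    simp only [RCLike.conj_to_real]
    ring

end Entries

/-- νl and νh will bracket the root ν for A between a₀/8 and M₁, Λ bounds all rescaled spectral
values, η bounds the Lipschitz and elimination errors, and 1/Q is the admissible size of a = ρ⁴. -/
theorem exists_constants {m a₀ K θ M₁ C₀ : ℝ} (hm : 0 < m) (ha₀ : 0 < a₀) (hM₁ : 1 ≤ M₁)
    (hC₀ : 1 ≤ C₀) (hK : 1 ≤ K) (hθ : 0 < θ) : ∃ νl νh Λ η Q : ℝ, 0 < νl ∧ 0 < νh ∧ 1 ≤ Λ ∧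
      1 ≤ η ∧ 1 ≤ Q ∧ M₁ * νl = 10 * a₀ ∧ a₀ * νh = 2 * (400 * M₁ ^ 2 + 20 * a₀ + 1) ∧
      Λ = 8 * M₁ + νl + νh + 1 ∧ C₀ * K ≤ η ∧ θ⁻¹ * (C₀ * (1 + Λ)) ^ 2 ≤ η ∧
      K ≤ Q ∧ 60 * M₁ * η * (8 / a₀) ≤ Q ∧ 3 * η * Λ ≤ Q ∧
      210 * η * Λ ^ 2 * M₁ / (20 * a₀) ≤ Q ∧ (5 * C₀ + Λ) * (2 / m) ≤ Q := by
  obtain ⟨νl, hνl⟩ : ∃ ν, ν = 10 * a₀ / M₁ := ⟨_, rfl⟩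
  obtain ⟨νh, hνh⟩ : ∃ ν, ν = 2 / a₀ * (400 * M₁ ^ 2 + 20 * a₀ + 1) := ⟨_, rfl⟩
  have pl : 0 < νl := by rw [hνl]; positivity
  have ph : 0 < νh := by rw [hνh]; positivity
  obtain ⟨Λ, hΛ⟩ : ∃ Λ, Λ = 8 * M₁ + νl + νh + 1 := ⟨_, rfl⟩
  have pΛ : 1 ≤ Λ := by linarith
  obtain ⟨η, hη⟩ : ∃ η, η = C₀ * K + θ⁻¹ * (C₀ * (1 + Λ)) ^ 2 + 1 := ⟨_, rfl⟩
  have e1 : 0 ≤ C₀ * K := by positivity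
  have e2 : 0 ≤ θ⁻¹ * (C₀ * (1 + Λ)) ^ 2 := by positivity
  have pη : 1 ≤ η := by linarith
  have q1 : 0 ≤ 60 * M₁ * η * (8 / a₀) := by positivity
  have q2 : 0 ≤ 3 * η * Λ := by positivity
  have q3 : 0 ≤ 210 * η * Λ ^ 2 * M₁ / (20 * a₀) := by positivity
  have q4 : 0 ≤ (5 * C₀ + Λ) * (2 / m) := by positivity
  refine ⟨νl, νh, Λ, η, K + 60 * M₁ * η * (8 / a₀) + 3 * η * Λ +
    210 * η * Λ ^ 2 * M₁ / (20 * a₀) + (5 * C₀ + Λ) * (2 / m), pl, ph, pΛ, pη, by linarith,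
    by rw [hνl]; field_simp, by rw [hνh]; field_simp, hΛ, by linarith, by linarith, by linarith,
    by linarith, by linarith, by linarith, by linarith⟩

set_option maxHeartbeats 1600000 in
/-- The two eigenvalues of the linearized operator near zero. -/
theorem exists_two_eigenvalues {m M a₀ K : ℝ} (hm : 0 < m) (hM : 0 ≤ M) (ha₀ : 0 < a₀)
    (hK : 1 ≤ K) : ∃ C > 0, ∃ c > 0, ∃ a₁ > 0, ∀ {κ : ℝ} {V : ℝ →ᵇ ℝ} {ω₀ ω₁ : ℝ} {k₀ k₁ : E},
    Setting m M κ V ω₀ ω₁ k₀ k₁ → ∀ {a t : ℝ} {y : E × E} {x : Var} {A B D : ℝ},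
    x = (par V ω₀ k₀ k₁, t, y) → A = ∫ z, ev k₀ z ^ 6 → B = ∫ z, ev k₀ z ^ 4 * ev k₁ z ^ 2 →
    D = ∫ z, ev k₀ z ^ 2 * ev k₁ z ^ 4 → a₀ / 8 ≤ A → a₀ < 5 * B ^ 2 - A * D →
    0 < a → a ≤ a₁ → |t| ≤ a → t ≠ 0 → ‖y‖ ≤ K * a → MemZ k₀ k₁ y.2 →
    (∀ z, ev x.e (-z) = ev x.e z) → (∀ z, ev x.p (-z) = -ev x.p z) →
    schr (V + ω₀ • 1) x.p = a • pot (x.sq.wo - x.sq.mu • 1) x.p → 0 ≤ x.sq.mu →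
    ∃ μ₀ μ₁ : ℝ, 0 < μ₀ ∧ 0 < μ₁ ∧ (∃ g, g ≠ 0 ∧ schr (linPot V ω₀ a x - (-μ₀) • 1) g = 0) ∧
      (∃ g, g ≠ 0 ∧ schr (linPot V ω₀ a x - μ₁ • 1) g = 0) ∧
      4 * a * A - C * a ^ 2 ≤ μ₀ ∧ c * (a * t ^ 2) ≤ μ₁ ∧ μ₁ ≤ C * (a * t ^ 2) ∧
      μ₁ < ω₀ + a * x.sq.mu := by
  have hθ : 0 < coer m M := coer_pos hm hM
  have hθ1 : coer m M ≤ 1 := coer_le_one hm hM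
  obtain ⟨C₀, hC₀, hbd⟩ := exists_entry_bounds (max (coer m M)⁻¹ (1 + M))
  have hM₁ : 1 ≤ (1 + M) ^ 4 := one_le_pow₀ (by linarith)
  obtain ⟨νl, νh, Λ, η, Q, hνl, hνh, hΛ, hη, hQ1, hνM, hνA, hΛdef, hηK, hηθ, u1, u2, u3, u4, u5⟩ :=
    exists_constants hm ha₀ hM₁ hC₀ hK hθ
  obtain ⟨M₁, hM₁def⟩ : ∃ M₁, M₁ = (1 + M) ^ 4 := ⟨_, rfl⟩
  rw [← hM₁def] at hM₁ hνM hνA hΛdef u2 u4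
  refine ⟨4 * η + νh, by positivity, νl, hνl, 1 / Q, by positivity, ?_⟩
  intro κ V ω₀ ω₁ k₀ k₁ S a t y x A B D hx hA hB hD hA8 h5 ha ha1 ht ht0 hy hz he ho hp hmu
  obtain ⟨mA, mB, mD⟩ := S.moments_le
  rw [← hA, ← hM₁def] at mA
  rw [← hB, ← hM₁def] at mB
  rw [← hD, ← hM₁def] at mD
  have hA0 : 0 < A := by linarith
  have hAM : A ≤ M₁ := (le_abs_self _).trans mA
  have hD0 : 0 ≤ D := by
    rw [hD]; exact integral_nonneg fun z => by simp only [Pi.zero_apply]; positivity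
  have haQ : a * Q ≤ 1 := by rwa [le_div_iff₀ (by positivity)] at ha1
  have use : ∀ {w : ℝ}, w ≤ Q → a * w ≤ 1 := fun hw =>
    (mul_le_mul_of_nonneg_left hw ha.le).trans haQ
  have ha1' : a ≤ 1 := by simpa using use hQ1
  have haK : K * a ≤ 1 := by
    rw [mul_comm]; exact use u1
  have hs1 : a * (60 * M₁ * η) ≤ A := by
    have : a * (60 * M₁ * η * (8 / a₀)) ≤ 1 := use u2
    have e : a * (60 * M₁ * η * (8 / a₀)) = a * (60 * M₁ * η) / (a₀ / 8) := by field_simp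
    rw [e, div_le_one (by positivity)] at this
    linarith
  have hs2 : a * (3 * η * Λ) ≤ 1 := use u3
  have hs3 : a * (210 * η * Λ ^ 2 * M₁) ≤ 20 * a₀ := by
    have : a * (210 * η * Λ ^ 2 * M₁ / (20 * a₀)) ≤ 1 := use u4
    rw [← mul_div_assoc, div_le_one (by positivity)] at this
    exact this
  have hs4 : a * (5 * C₀ + Λ) ≤ m / 2 := by
    have : a * ((5 * C₀ + Λ) * (2 / m)) ≤ 1 := use u5
    have e : a * ((5 * C₀ + Λ) * (2 / m)) = a * (5 * C₀ + Λ) / (m / 2) := by field_simp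
    rw [e, div_le_one (by positivity)] at this
    exact this
  have hδ : max |t| ‖y‖ ≤ K * a :=
    max_le (ht.trans (le_mul_of_one_le_left ha.le hK)) hy
  obtain ⟨d1, d2, d3, d4, d5, d6, d7, d8, d9⟩ := hbd (par V ω₀ k₀ k₁) t y S.norm_par_le
    (ht.trans ha1') (hy.trans haK)
  rw [← hx] at d1 d2 d3 d4 d5 d6 d7 d9
  have hδη : C₀ * max |t| ‖y‖ ≤ η * a := by
    calc C₀ * max |t| ‖y‖ ≤ C₀ * (K * a) := by gcongr
      _ = C₀ * K * a := by ring
      _ ≤ η * a := by gcongr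
  have f₀₀ : |x.lead₀₀ + 4 * A| ≤ η * a := by
    rw [lead₀₀_zero S, ← hA] at d1
    have e : x.lead₀₀ + 4 * A = x.lead₀₀ - -4 * A := by ring
    rw [e]; exact d1.trans hδη
  have f₀₁ : |x.lead₀₁ - 20 * B| ≤ η * a := by
    rw [lead₀₁_zero, ← hB] at d2; exact d2.trans hδη
  have f₁₁ : |x.lead₁₁ - 20 * D| ≤ η * a := by
    rw [lead₁₁_zero, ← hD] at d3; exact d3.trans hδη
  have fn : |x.oddMass - 1| ≤ η * a := by
    rw [S.oddMass_zero] at d4; exact d4.trans hδη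
  have hηa : η * a ≤ η := mul_le_of_le_one_right (by linarith) ha1'
  have g₀₁ : |x.lead₀₁| ≤ 20 * M₁ + η := by
    have e1 := abs_le.1 f₀₁
    have e2 := abs_le.1 mB
    rw [abs_le]; constructor <;> linarith
  have g₁₁ : |x.lead₁₁| ≤ 20 * M₁ + η := by
    have e1 := abs_le.1 f₁₁
    have e2 := abs_le.1 mD
    rw [abs_le]; constructor <;> linarith
  have hω : m ≤ ω₀ + a * x.sq.mu := by
    have := S.le
    have := S.lt
    have : 0 ≤ a * x.sq.mu := by positivity
    linarith
  -- The perturbation 5a · `four` + l is at most m/2, half of the available gap, so L₊ - l stays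
  -- invertible on Z throughout the search interval.
  have hco' : ∀ l : ℝ, |l| ≤ Λ * a → CoerciveZ k₀ k₁ (coer m M) (linPot V ω₀ a x - l • 1) := fun l hl => by
    have := S.coercive (q := (5 * a) • x.four + l • 1) (c := ω₀ + a * x.sq.mu) fun z => by
      have h1 : x.four z ≤ C₀ := (le_abs_self _).trans ((x.four.norm_coe_le_norm z).trans d7)
      have h2 : 5 * a * x.four z ≤ 5 * a * C₀ := by gcongr
      have h3 := (le_abs_self l).trans hl
      have h4 : ((5 * a) • x.four + l • 1) z = 5 * a * x.four z + l := by simp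
      rw [h4]
      linarith
    have e : linPot V ω₀ a x - l • 1 =
        V + (ω₀ + a * x.sq.mu) • 1 - ((5 * a) • x.four + l • 1) := by rw [linPot, sub_sub]
    rw [e]; exact this
  have hco : ∀ l : ℝ, |l| ≤ Λ → CoerciveZ k₀ k₁ (coer m M) (linPot V ω₀ a x - (a * l) • 1) := fun l hl =>
    hco' _ (by rw [abs_mul, abs_of_pos ha, mul_comm]; gcongr)
  have hxp : x.p = k₁ + y.2 := by rw [hx]; rfl
  have hk0 : ‖pot 1 k₀‖ ≤ C₀ := d8
  have hP0 : ∀ l : ℝ, |l| ≤ Λ → ‖x.vec₀ - l • pot 1 k₀‖ ≤ C₀ * (1 + Λ) := fun l hl => by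
    calc _ ≤ ‖x.vec₀‖ + ‖l • pot 1 k₀‖ := norm_sub_le _ _
      _ ≤ C₀ + Λ * C₀ := by rw [norm_smul, Real.norm_eq_abs]; gcongr
      _ = _ := by ring
  have hP1 : ∀ b l : ℝ, |b| ≤ 1 → |l| ≤ Λ → ‖b • x.vec₁ + l • pot 1 x.p‖ ≤ C₀ * (1 + Λ) :=
    fun b l hb hl => by
      calc _ ≤ ‖b • x.vec₁‖ + ‖l • pot 1 x.p‖ := norm_add_le _ _
        _ ≤ 1 * C₀ + Λ * C₀ := by
          rw [norm_smul, norm_smul, Real.norm_eq_abs, Real.norm_eq_abs]; gcongr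
        _ = _ := by ring
  have hRb : ∀ l : ℝ, |l| ≤ Λ → ∀ f g, ‖f‖ ≤ C₀ * (1 + Λ) → ‖g‖ ≤ C₀ * (1 + Λ) →
      |inner ℝ (solveZ k₀ k₁ (linPot V ω₀ a x - (a * l) • 1) f) g| ≤ η := fun l hl f g hf hg =>
    (abs_inner_solveZ_le hθ hθ1 (hco l hl) hf hg).trans hηθ
  set det : ℝ → ℝ := fun l => feshbach k₀ k₁ (linPot V ω₀ a x - l • 1) k₀ k₀ *
    feshbach k₀ k₁ (linPot V ω₀ a x - l • 1) x.p x.p -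
    feshbach k₀ k₁ (linPot V ω₀ a x - l • 1) k₀ x.p ^ 2 with hdet
  have hdc : ∀ s : Set ℝ, (∀ l ∈ s, |l| ≤ Λ * a) → ContinuousOn det s := fun s hs => by
    have hc := fun f g => continuousOn_feshbach (s := s) hθ hθ1 (fun l hl => hco' l (hs l hl)) f g
    exact ((hc _ _).mul (hc _ _)).sub ((hc _ _).pow 2)
  have hker : ∀ l : ℝ, |l| ≤ Λ * a → det l = 0 →
      ∃ g, g ≠ 0 ∧ schr (linPot V ω₀ a x - l • 1) g = 0 := fun l hl h0 => by
    refine exists_kernel S hθ hθ1 (hco' l hl) hz ?_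
    rw [← hxp]
    exact sub_eq_zero.1 h0
  have hdet1 : ∀ l : ℝ, |l| ≤ Λ → ∃ e₀₀ e₀₁ e₁₁ : ℝ, |e₀₀| ≤ η ∧ |e₀₁| ≤ η ∧ |e₁₁| ≤ η ∧
      det (a * l) = a ^ 2 * (-(x.lead₀₀ - l - a * e₀₀) *
        (t ^ 2 * x.lead₁₁ + l * x.oddMass + a * e₁₁) - (t * x.lead₀₁ - a * e₀₁) ^ 2) :=
    fun l hl => by
      obtain ⟨F1, F2, F3⟩ := S.feshbach_eq hz hx he ho hp l rfl rfl
      refine ⟨_, _, _, hRb l hl _ _ (hP0 l hl) (hP0 l hl),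
        hRb l hl _ _ (hP0 l hl) (hP1 t l (ht.trans ha1') hl),
        hRb l hl _ _ (hP1 t l (ht.trans ha1') hl) (hP1 t l (ht.trans ha1') hl), ?_⟩
      simp only [hdet]
      rw [F1, F2, F3]
      ring
  have ht2 : t ^ 2 ≤ 1 := by
    rw [← sq_abs]; exact pow_le_one₀ (abs_nonneg _) (ht.trans ha1')
  have ht2p : 0 < t ^ 2 := by positivity
  -- At l = t²ν the vector attached to p is t times a bounded vector, so the elimination errors
  -- carry the same powers of t as the leading terms and the whole determinant is divisible by t².
  have hdet2 : ∀ ν : ℝ, |ν| ≤ Λ → ∃ e₀₀ e₀₁ e₁₁ : ℝ, |e₀₀| ≤ η ∧ |e₀₁| ≤ η ∧ |e₁₁| ≤ η ∧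
      det (a * (t ^ 2 * ν)) = a ^ 2 * t ^ 2 * (-(x.lead₀₀ - t ^ 2 * ν - a * e₀₀) *
        (x.lead₁₁ + ν * x.oddMass + a * e₁₁) - (x.lead₀₁ - a * e₀₁) ^ 2) :=
    fun ν hν => by
      have hl : |t ^ 2 * ν| ≤ Λ := by
        rw [abs_mul, abs_of_pos ht2p]
        exact (mul_le_of_le_one_left (abs_nonneg _) ht2).trans hν
      have htν : |t * ν| ≤ Λ := by
        rw [abs_mul]
        exact (mul_le_of_le_one_left (abs_nonneg _) (ht.trans ha1')).trans hν
      obtain ⟨F1, F2, F3⟩ := S.feshbach_eq hz hx he ho hp (t ^ 2 * ν) rfl rfl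
      have hP : t • x.vec₁ + (t ^ 2 * ν) • pot 1 x.p =
          t • ((1 : ℝ) • x.vec₁ + (t * ν) • pot 1 x.p) := by module
      have hb := hP1 1 (t * ν) (by simp) htν
      refine ⟨_, _, _, hRb _ hl _ _ (hP0 _ hl) (hP0 _ hl),
        hRb _ hl _ _ (hP0 _ hl) hb, hRb _ hl _ _ hb hb, ?_⟩
      simp only [hdet]
      rw [F1, F2, F3, hP]
      simp only [map_smul, inner_smul_left, inner_smul_right, RCLike.conj_to_real]
      ring
  have root : ∀ l₁ l₂ : ℝ, l₁ ≤ l₂ → |l₁| ≤ Λ * a → |l₂| ≤ Λ * a →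
      (det l₁ ≤ 0 ∧ 0 ≤ det l₂ ∨ det l₂ ≤ 0 ∧ 0 ≤ det l₁) →
      ∃ l, l₁ ≤ l ∧ l ≤ l₂ ∧ ∃ g, g ≠ 0 ∧ schr (linPot V ω₀ a x - l • 1) g = 0 := by
    intro l₁ l₂ h12 hl₁ hl₂ hsign
    have hin : ∀ l ∈ Icc l₁ l₂, |l| ≤ Λ * a := fun l hl =>
      abs_le.2 ⟨(abs_le.1 hl₁).1.trans hl.1, hl.2.trans (abs_le.1 hl₂).2⟩
    have hc := hdc (Icc l₁ l₂) hin
    obtain ⟨l, hl, h0⟩ : ∃ l ∈ Icc l₁ l₂, det l = 0 := by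
      rcases hsign with ⟨s1, s2⟩ | ⟨s1, s2⟩
      · exact intermediate_value_Icc h12 hc ⟨s1, s2⟩
      · exact intermediate_value_Icc' h12 hc ⟨s1, s2⟩
    exact ⟨l, hl.1, hl.2, hker l (hin l hl) h0⟩
  have toΛ : ∀ l : ℝ, |l| ≤ Λ → |a * l| ≤ Λ * a := fun l hl => by
    rw [abs_mul, abs_of_pos ha, mul_comm]; gcongr
  have ha2 : 0 < a ^ 2 := by positivity
  have hηA : 4 * η * a < 4 * A := by
    have : η * a * 2 ≤ η * a * (60 * M₁) := by gcongr; linarith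
    have h2 : 0 < η * a := by positivity
    linarith only [this, h2, hs1]
  obtain ⟨l, hl1, hl2, hg⟩ := root (a * (-8 * A)) (a * (-4 * A + 4 * η * a))
    (by gcongr; linarith [mul_pos (zero_lt_one.trans_le hη) ha])
    (toΛ _ (by rw [abs_mul, abs_of_pos hA0]; norm_num; linarith))
    (toΛ _ (by
      rw [abs_le]
      have : 0 < η * a := by positivity
      constructor <;> linarith)) (Or.inr ⟨by
      obtain ⟨e₀₀, e₀₁, e₁₁, b1, b2, b3, hd⟩ := hdet1 (-4 * A + 4 * η * a) (by
        rw [abs_le]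
        have : 0 < η * a := by positivity
        constructor <;> linarith)
      rw [hd]
      exact (mul_neg_of_pos_of_neg ha2
        (det_neg hη hM₁ ha ha1' hAM hs1 ht f₀₀ g₀₁ g₁₁ fn b1 b2 b3)).le, by
      obtain ⟨e₀₀, e₀₁, e₁₁, b1, b2, b3, hd⟩ := hdet1 (-8 * A) (by
        rw [abs_mul, abs_of_pos hA0]; norm_num; linarith)
      rw [hd]
      exact (mul_pos ha2
        (det_pos hη hM₁ ha ha1' hAM hs1 ht f₀₀ g₀₁ g₁₁ fn b1 b2 b3)).le⟩)
  have close : ∀ ν : ℝ, |ν| ≤ Λ → ∃ G : ℝ, det (a * (t ^ 2 * ν)) = a ^ 2 * t ^ 2 * G ∧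
      |G - (4 * A * ν - 80 * (5 * B ^ 2 - A * D))| ≤ 20 * a₀ := fun ν hν => by
    obtain ⟨e₀₀, e₀₁, e₁₁, b1, b2, b3, hd⟩ := hdet2 ν hν
    exact ⟨_, hd, (det_close hη hM₁ hΛ ha ha1' hAM hA0.le mB mD hs2 ht hν f₀₀ f₀₁ f₁₁ fn
      b1 b2 b3).trans hs3⟩
  have hat : 0 < a ^ 2 * t ^ 2 := by positivity
  have hνlh : νl ≤ νh := by
    have e1 : νl ≤ 10 * a₀ := hνM ▸ le_mul_of_one_le_left hνl.le hM₁
    have e3 : a₀ ≤ 5 * M₁ ^ 2 := by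
      have : B ^ 2 ≤ M₁ ^ 2 := by rw [← sq_abs]; gcongr
      have : 0 ≤ A * D := by positivity
      linarith
    have e4 : a₀ ≤ 8 * M₁ := by linarith
    have e5 : a₀ * (10 * a₀) ≤ 5 * M₁ ^ 2 * (10 * (8 * M₁)) := by gcongr
    refine e1.trans (le_of_mul_le_mul_left ?_ ha₀)
    have e6 : a₀ * a₀ ≤ (8 * M₁) * (8 * M₁) := by gcongr
    rw [hνA]
    linarith only [e6, ha₀, sq_nonneg M₁]
  have Λl : |νl| ≤ Λ := by rw [abs_of_pos hνl]; linarith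
  have Λh : |νh| ≤ Λ := by rw [abs_of_pos hνh]; linarith
  have sq : ∀ ν : ℝ, |ν| ≤ Λ → |t ^ 2 * ν| ≤ Λ := fun ν hν => by
    rw [abs_mul, abs_of_pos ht2p]
    exact (mul_le_of_le_one_left (abs_nonneg _) ht2).trans hν
  -- At νl one has 4Aν ≤ 40a₀, below 80(5B² - AD) even after an error 20a₀; at νh, 4Aν ≥ 400M₁² +
  -- 20a₀ + 1 exceeds it by more than the error.
  obtain ⟨l', hl1', hl2', hg'⟩ := root (a * (t ^ 2 * νl)) (a * (t ^ 2 * νh)) (by gcongr)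
    (toΛ _ (sq _ Λl)) (toΛ _ (sq _ Λh)) (Or.inl ⟨by
      obtain ⟨G, hG, hGc⟩ := close νl Λl
      rw [hG]
      refine (mul_neg_of_pos_of_neg hat ?_).le
      have : A * νl ≤ 10 * a₀ := by
        calc A * νl ≤ M₁ * νl := by gcongr
          _ = 10 * a₀ := hνM
      linarith [(abs_le.1 hGc).2], by
      obtain ⟨G, hG, hGc⟩ := close νh Λh
      rw [hG]
      refine (mul_pos hat ?_).le
      have e1 : 400 * M₁ ^ 2 + 20 * a₀ + 1 ≤ 4 * (A * νh) := by
        have : a₀ / 8 * νh ≤ A * νh := by gcongr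
        linarith only [this, hνA]
      have : B ^ 2 ≤ M₁ ^ 2 := by rw [← sq_abs]; gcongr
      have : 0 ≤ A * D := by positivity
      linarith [(abs_le.1 hGc).1]⟩)
  have hat' : 0 < a * t ^ 2 := by positivity
  refine ⟨-l, l', ?_, ?_, by rwa [neg_neg], hg', ?_, ?_, ?_, ?_⟩
  · have : a * (-4 * A + 4 * η * a) < 0 := mul_neg_of_pos_of_neg ha (by linarith)
    linarith
  · have : 0 < a * (t ^ 2 * νl) := by positivity
    linarith
  · have : νh * a ^ 2 ≥ 0 := by positivity
    linarith only [this, hl2]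
  · linarith
  · have : 0 ≤ 4 * η * (a * t ^ 2) := by positivity
    linarith
  · have h1 : a * (t ^ 2 * νh) ≤ a * Λ := by
      gcongr
      exact (le_abs_self _).trans (sq _ Λh)
    have h2 : 0 ≤ a * (5 * C₀) := by positivity
    linarith

/-! ### The complete set of eigenvalues of L₊ -/

section Spectrum

theorem isSol_of_schr {W : ℝ →ᵇ ℝ} {g : E} (h : schr W g = 0) : IsSol W (ev g) := by
  obtain ⟨⟨h1, -⟩, h2, h3⟩ := classical_of_schr_eq_zero h
  exact ⟨h1, h2, h3⟩

theorem eq_zero_of_ev {W : ℝ →ᵇ ℝ} {g : E} (h : schr W g = 0) (h0 : ⇑(ev g) = 0) : g = 0 := by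
  obtain ⟨⟨h1, h2⟩, -⟩ := classical_of_schr_eq_zero h
  by_contra hg
  have h3 := norm_emb_pos hg h
  rw [inner_emb, h0] at h3
  simp at h3

theorem mem_schrodingerEigenvalues_iff {W : ℝ →ᵇ ℝ} {l : ℝ} :
    l ∈ schrodingerEigenvalues W ↔ ∃ g, g ≠ 0 ∧ schr (W - l • 1) g = 0 := by
  constructor
  · rintro ⟨u, hu⟩
    have hs := isSol_of_isEigenfunction W.continuous W.norm_coe_le_norm hu
    refine ⟨hs.isH1.toE, fun h0 => hu.1 ?_, schr_toE_eq_zero hs.isH1 hs.contDiff fun x => ?_⟩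
    · rw [← ev_toE hs.isH1, h0, map_zero]; rfl
    · rw [hs.eq]; simp
  · rintro ⟨g, hg, h⟩
    have hs := isSol_of_schr h
    refine ⟨ev g, fun h0 => hg (eq_zero_of_ev h h0), hs.contDiff, memLp_ev g, fun x => ?_⟩
    rw [hs.eq]
    simp only [BoundedContinuousFunction.coe_sub, BoundedContinuousFunction.coe_smul,
      BoundedContinuousFunction.coe_one, Pi.sub_apply, Pi.one_apply, smul_eq_mul]
    ring

variable {V : ℝ →ᵇ ℝ} {ω : ℝ} {f : E}

/-- Cubic decay of the linearized potential. -/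
theorem exists_decay {C : ℝ} (hω : 0 < ω) (hV : ∀ x : ℝ, 0 < x → |V x| ≤ C / x ^ 3)
    (hf : schr (V + ω • 1 - ev f ^ 4) f = 0) :
    ∃ R > 0, ∃ C', ∀ x, R ≤ x → |V x - 5 * ev f x ^ 4| ≤ C' / x ^ 3 := by
  have hs := isSol_of_schr hf
  have hV0 : Tendsto (fun x => V x) atTop (𝓝 0) := by
    have h1 : Tendsto (fun x : ℝ => C / x ^ 3) atTop (𝓝 0) :=
      tendsto_const_nhds.div_atTop (tendsto_pow_atTop three_ne_zero)
    refine squeeze_zero_norm' ?_ h1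
    filter_upwards [eventually_gt_atTop 0] with x hx using hV x hx
  -- The wave solves a linear equation whose potential tends to ω > 0, so it decays exponentially
  -- and V - 5φ⁴ keeps the cubic decay of V.
  have hQ : Tendsto (fun x => V x + ω - ev f x ^ 4) atTop (𝓝 ω) := by
    simpa using (hV0.add_const ω).sub (hs.isH1.tendsto_atTop.pow 4)
  obtain ⟨k, hk, hk2⟩ : ∃ k > 0, k ^ 2 = ω / 2 :=
    ⟨√(ω / 2), Real.sqrt_pos.2 (by positivity), Real.sq_sqrt (by positivity)⟩
  obtain ⟨R₀, hR₀⟩ := eventually_atTop.1 (hQ.eventually (lt_mem_nhds (half_lt_self hω)))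
  have hexp : ∀ x, R₀ ≤ x → ev f x ^ 2 ≤ ev f R₀ ^ 2 * Real.exp (-k * (x - R₀)) :=
    fun x hx => hs.sq_le_exp hk (fun y hy => by
      have := (hR₀ y hy).le
      simpa [hk2] using this) hx
  have hlo := (isLittleO_pow_exp_pos_mul_atTop 3 hk).bound one_pos
  obtain ⟨R₁, hR₁⟩ := eventually_atTop.1 hlo
  set P := ev f R₀ ^ 2
  have hP : 0 ≤ P := sq_nonneg _
  refine ⟨max 1 (max R₀ R₁), by positivity, C + 5 * (P ^ 2 * Real.exp (k * R₀)), fun x hx => ?_⟩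
  have hx1 : 1 ≤ x := (le_max_left _ _).trans hx
  have hx0 : R₀ ≤ x := (le_max_left _ _).trans ((le_max_right _ _).trans hx)
  have hx2 : R₁ ≤ x := (le_max_right _ _).trans ((le_max_right _ _).trans hx)
  have hxp : 0 < x := by linarith
  have h3 := hR₁ x hx2
  rw [one_mul, Real.norm_eq_abs, Real.norm_eq_abs, Real.abs_exp, abs_of_pos (by positivity)] at h3
  have e1 : Real.exp (-k * (x - R₀)) ≤ 1 := by
    rw [Real.exp_le_one_iff]; nlinarith
  have e2 : Real.exp (-k * (x - R₀)) ≤ Real.exp (k * R₀) / x ^ 3 := by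
    rw [le_div_iff₀ (by positivity)]
    calc _ ≤ Real.exp (-k * (x - R₀)) * Real.exp (k * x) := by gcongr
      _ = _ := by rw [← Real.exp_add]; congr 1; ring
  have h4 : ev f x ^ 4 ≤ P ^ 2 * Real.exp (k * R₀) / x ^ 3 := by
    calc ev f x ^ 4 = ev f x ^ 2 * ev f x ^ 2 := by ring
      _ ≤ (P * 1) * (P * (Real.exp (k * R₀) / x ^ 3)) := by
        refine mul_le_mul ((hexp x hx0).trans (by gcongr)) ((hexp x hx0).trans (by gcongr))
          (sq_nonneg _) (by positivity)
      _ = _ := by ring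
  calc |V x - 5 * ev f x ^ 4| ≤ |V x| + |5 * ev f x ^ 4| := abs_sub _ _
    _ ≤ C / x ^ 3 + 5 * (P ^ 2 * Real.exp (k * R₀) / x ^ 3) := by
      rw [abs_of_nonneg (by positivity : 0 ≤ 5 * ev f x ^ 4)]
      gcongr
      exact hV x hxp
    _ = _ := by ring

/-- The linearized operator has no eigenvalue at or above the bottom of the essential spectrum. -/
theorem lt_of_eigenvalue {C l : ℝ} (hω : 0 < ω) (hV : ∀ x : ℝ, 0 < x → |V x| ≤ C / x ^ 3)
    (hf : schr (V + ω • 1 - ev f ^ 4) f = 0) {g : E} (hg : g ≠ 0)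
    (h : schr (V + ω • 1 - (5 : ℝ) • ev f ^ 4 - l • 1) g = 0) : l < ω := by
  by_contra! hl
  obtain ⟨R, hR, C', hC'⟩ := exists_decay hω hV hf
  have hs := isSol_of_schr h
  have hs' : IsSol (fun x => (V - (5 : ℝ) • ev f ^ 4) x - (l - ω)) (ev g) :=
    ⟨hs.isH1, hs.contDiff, fun x => by
      rw [hs.eq]
      simp only [BoundedContinuousFunction.coe_sub, BoundedContinuousFunction.coe_smul,
        BoundedContinuousFunction.coe_one, BoundedContinuousFunction.coe_add, Pi.add_apply,
        Pi.sub_apply, Pi.one_apply, smul_eq_mul]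
      ring⟩
  exact hg (eq_zero_of_ev h (hs'.eq_zero_of_decay (V - (5 : ℝ) • ev f ^ 4).continuous
    (V - (5 : ℝ) • ev f ^ 4).norm_coe_le_norm (sub_nonneg.2 hl) hR hC'))

variable {m M κ : ℝ} {ω₀ ω₁ : ℝ} {k₀ k₁ : E}

/-- A wave close to a multiple of the ground state is dominated by it. -/
theorem Setting.abs_le_two_mul (S : Setting m M κ V ω₀ ω₁ k₀ k₁) {ρ β : ℝ} (hρ : 0 < ρ)
    (hf : schr (V + ω • 1 - ev f ^ 4) f = 0)
    (hclose : ∀ z, |ev f z - ρ * ev k₀ z| ≤ ρ * β) (hβ : 16 * ρ ^ 4 * β ^ 4 < ω - ω₀) (z : ℝ) :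
    |ev f z| ≤ 2 * ρ * |ev k₀ z| := by
  obtain ⟨σ, hσ, habs⟩ : ∃ σ : ℝ, σ ≠ 0 ∧ ∀ z, |ev k₀ z| = σ * ev k₀ z := by
    rcases pos_or_neg_of_ne_zero (ev k₀).continuous S.ne_zero with h | h
    · exact ⟨1, one_ne_zero, fun z => by rw [abs_of_pos (h z), one_mul]⟩
    · exact ⟨-1, by norm_num, fun z => by rw [abs_of_neg (h z), neg_one_mul]⟩
  -- Where |φ| exceeds 2ρ|ψ₀|, closeness forces |φ| ≤ 2ρβ, so φ⁴ < ω - ω₀ there. Sturm comparison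
  -- needs the inequality of potentials only on that set.
  have hcmp : ∀ x, 2 * ρ * |ev k₀ x| < |ev f x| → ev f x ^ 4 < ω - ω₀ := fun x hx => by
    refine lt_of_le_of_lt ?_ hβ
    have h1 : |ev f x| ≤ ρ * β + ρ * |ev k₀ x| := by
      have h2 : ev f x = (ev f x - ρ * ev k₀ x) + ρ * ev k₀ x := by ring
      rw [h2]
      refine (abs_add_le _ _).trans (add_le_add (hclose x) ?_)
      rw [abs_mul, abs_of_pos hρ]
    have h3 : |ev f x| ≤ 2 * (ρ * β) := by linarith
    calc ev f x ^ 4 = |ev f x| ^ 4 := (Even.pow_abs (by decide) _).symm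
      _ ≤ (2 * (ρ * β)) ^ 4 := by gcongr
      _ = _ := by ring
  have hw : ∀ c : ℝ, IsSol (V + ω₀ • 1 : ℝ →ᵇ ℝ) (fun x => c * ev k₀ x) := fun c => by
    have h0 : schr (V + ω₀ • 1) (c • k₀) = 0 := by rw [map_smul, S.eq₀, smul_zero]
    have := isSol_of_schr h0
    rw [map_smul] at this
    exact this
  have hu : ∀ c : ℝ, IsSol (V + ω • 1 - ev f ^ 4 : ℝ →ᵇ ℝ) (fun x => c * ev f x) := fun c => by
    have h0 : schr (V + ω • 1 - ev f ^ 4) (c • f) = 0 := by rw [map_smul, hf, smul_zero]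
    have := isSol_of_schr h0
    rw [map_smul] at this
    exact this
  have hpos : ∀ x, 0 < 2 * ρ * σ * ev k₀ x := fun x => by
    have h1 := abs_pos.2 (S.ne_zero x)
    rw [habs] at h1
    rw [mul_assoc]; positivity
  have key : ∀ c : ℝ, |c| = 1 → c * ev f z ≤ 2 * ρ * σ * ev k₀ z := fun c hc => by
    refine (hu c).le_of_comparison (hw _) (V + ω • 1 - ev f ^ 4 : ℝ →ᵇ ℝ).continuous
      (V + ω • 1 - ev f ^ 4 : ℝ →ᵇ ℝ).norm_coe_le_norm (V + ω₀ • 1 : ℝ →ᵇ ℝ).continuous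
      (V + ω₀ • 1 : ℝ →ᵇ ℝ).norm_coe_le_norm hpos (fun x hx => ?_) z
    have h1 : c * ev f x ≤ |ev f x| := (le_abs_self _).trans (by rw [abs_mul, hc, one_mul])
    have h2 := hcmp x (by rw [habs, ← mul_assoc]; exact hx.trans_le h1)
    simp only [BoundedContinuousFunction.coe_sub, BoundedContinuousFunction.coe_smul,
        BoundedContinuousFunction.coe_one, BoundedContinuousFunction.coe_add, Pi.add_apply,
        Pi.sub_apply, Pi.one_apply, smul_eq_mul, BoundedContinuousFunction.coe_pow, Pi.pow_apply]
    linarith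
  rw [habs, ← mul_assoc]
  refine abs_le'.2 ⟨by simpa using key 1 (by simp), by simpa using key (-1) (by simp)⟩

/-- 5φ⁴ ≤ 80ρ⁴ψ₀⁴ ≤ κψ₀⁴ is absorbed by the nonresonance bound, so the form of V - 5φ⁴ is
nonnegative on Z. This is the purpose of the weight ψ₀⁴ in that bound. -/
theorem Setting.form_linearized (S : Setting m M κ V ω₀ ω₁ k₀ k₁) {ρ : ℝ}
    (hκ : 80 * ρ ^ 4 ≤ κ) (hle : ∀ z, |ev f z| ≤ 2 * ρ * |ev k₀ z|) {g : E} (hg : MemZ k₀ k₁ g) :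
    ω * inner ℝ (emb g) (emb g) ≤ inner ℝ (schr (V + ω • 1 - (5 : ℝ) • ev f ^ 4) g) g := by
  have h1 := inner_pot_self_mono (w := (5 : ℝ) • ev f ^ 4) (w' := κ • ev k₀ ^ 4) (fun x => by
    have h2 : ev f x ^ 4 ≤ (2 * ρ * |ev k₀ x|) ^ 4 := by
      rw [← Even.pow_abs (by decide : Even 4) (ev f x)]
      gcongr
      exact hle x
    have h3 : (2 * ρ * |ev k₀ x|) ^ 4 = 16 * ρ ^ 4 * ev k₀ x ^ 4 := by
      rw [mul_pow, Even.pow_abs (by decide)]; ring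
    have h4 : 80 * ρ ^ 4 * ev k₀ x ^ 4 ≤ κ * ev k₀ x ^ 4 := by gcongr
    simp only [BoundedContinuousFunction.coe_smul, BoundedContinuousFunction.coe_pow, Pi.pow_apply,
      smul_eq_mul]
    linarith) g
  have h2 := S.form g hg
  rw [map_smul pot κ, smul_apply, inner_smul_left, conj_trivial] at h1
  rw [schr_sub, schr_smul_one, inner_sub_left, inner_add_left, inner_smul_left, conj_trivial,
    inner_pot_one]
  linarith

/-- The spectrum of the linearized operator. -/
theorem Setting.eigenvalues_eq (S : Setting m M κ V ω₀ ω₁ k₀ k₁) {C ρ μ₀ μ₁ : ℝ} (hω : 0 < ω)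
    (hV : ∀ x : ℝ, 0 < x → |V x| ≤ C / x ^ 3) (hf : schr (V + ω • 1 - ev f ^ 4) f = 0)
    (hκ : 80 * ρ ^ 4 ≤ κ) (hle : ∀ z, |ev f z| ≤ 2 * ρ * |ev k₀ z|) (hμ₀ : 0 < μ₀) (hμ₁ : 0 < μ₁)
    (h₀ : ∃ g, g ≠ 0 ∧ schr (V + ω • 1 - (5 : ℝ) • ev f ^ 4 - (-μ₀) • 1) g = 0)
    (h₁ : ∃ g, g ≠ 0 ∧ schr (V + ω • 1 - (5 : ℝ) • ev f ^ 4 - μ₁ • 1) g = 0) :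
    schrodingerEigenvalues (LPlusPotential V ω (ev f)) = {-μ₀, μ₁} := by
  have hW : LPlusPotential V ω (ev f) = ⇑(V + ω • 1 - (5 : ℝ) • ev f ^ 4 : ℝ →ᵇ ℝ) := by
    ext x
    simp [LPlusPotential]
  rw [hW]
  ext l
  rw [mem_schrodingerEigenvalues_iff, mem_insert_iff, mem_singleton_iff]
  constructor
  · rintro ⟨g, hg, h⟩
    by_contra! hne
    obtain ⟨g₀, hg₀, e₀⟩ := h₀
    obtain ⟨g₁, hg₁, e₁⟩ := h₁
    have l0 := lt_of_eigenvalue hω hV hf hg₀ e₀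
    have l1 := lt_of_eigenvalue hω hV hf hg₁ e₁
    have l2 := lt_of_eigenvalue hω hV hf hg h
    -- All eigenvalues lie below ω, and a third one would exceed the count allowed by the form bound
    -- on codimension two.
    refine false_of_three (l := ![-μ₀, μ₁, l]) (g := ![g₀, g₁, g])
      (fun v hv => S.form_linearized (ω := ω) hκ hle hv) ?_ ?_ ?_ ?_
    · have h01 : -μ₀ ≠ μ₁ := by linarith
      intro i j
      fin_cases i <;> fin_cases j <;>
        simp [h01, h01.symm, hne.1, hne.2, hne.1.symm, hne.2.symm]
    · intro i; fin_cases i <;> assumption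
    · intro i; fin_cases i <;> assumption
    · intro i; fin_cases i <;> assumption
  · rintro (rfl | rfl) <;> assumption

end Spectrum

/-! ### Charts of the solution curve -/

/-- A quantity along a curve. -/
noncomputable def along (f : Var → ℝ) (D : Par) (Y : ℝ → E × E) (t : ℝ) : ℝ := f (D, t, Y t)

/-- The curve of solutions together with its parametrization by the square `v = s²` of the odd
coefficient. -/
structure Chart (a₀ : ℝ) (D : Par) (ω₀ d r₀ L : ℝ) (Y : ℝ → E × E) (T : ℝ → ℝ) (η : ℝ) :
    Prop where
  curve : IsCurve D a₀ d r₀ L Y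
  a₀_pos : 0 < a₀
  d_pos : 0 < d
  r₀_pos : 0 < r₀
  η_pos : 0 < η
  T_zero : T 0 = 0
  T_spec : ∀ v, |v| < η → ContDiffAt ℝ ((⊤ : ℕ∞) : WithTop ℕ∞) T v ∧ |T v| < r₀ ∧
    T v * √(d / along Var.gap D Y (T v)) = v
  T_left : ∀ᶠ t in 𝓝 0, T (t * √(d / along Var.gap D Y t)) = t
  freq : ∀ v, |v| < η → ContDiffAt ℝ ((⊤ : ℕ∞) : WithTop ℕ∞)
      (fun v => ω₀ + d / along Var.gap D Y (T v) * along Var.mu D Y (T v)) v ∧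
    0 < deriv (fun v => ω₀ + d / along Var.gap D Y (T v) * along Var.mu D Y (T v)) v
  mass : ∀ v, |v| < η → DifferentiableAt ℝ
      (fun v => √(d / along Var.gap D Y (T v)) * along Var.mass D Y (T v)) v ∧
    0 < deriv (fun v => √(d / along Var.gap D Y (T v)) * along Var.mass D Y (T v)) v

theorem along_smooth {f : Var → ℝ} (hf : Nice f) {D : Par} {a₀ d r₀ L : ℝ} {Y : ℝ → E × E}
    (h : IsCurve D a₀ d r₀ L Y) {t : ℝ} (ht : |t| < r₀) :
    ContDiffAt ℝ ((⊤ : ℕ∞) : WithTop ℕ∞) (along f D Y) t :=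
  hf.1.contDiffAt.comp t (contDiffAt_const.prodMk (contDiffAt_id.prodMk (h.smooth t ht)))

/-- At the limiting values μ'H - μH' = 10B(5B - A) - A(10D - 10B) = 10(5B² - AD): here the second
interaction hypothesis decides the direction of the branch. -/
theorem frequency_slope_pos {a₀ M₁ A B D e H H' μ μ' : ℝ} (hM₁ : 1 ≤ M₁)
    (mA : |A| ≤ M₁) (mB : |B| ≤ M₁) (mD : |D| ≤ M₁) (h5 : a₀ < 5 * B ^ 2 - A * D)
    (he : 0 ≤ e) (he1 : e ≤ 1) (hea : 50 * M₁ * e ≤ 10 * a₀)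
    (hH : |H - (5 * B - A)| ≤ e) (hH' : |H' - (10 * D - 10 * B)| ≤ e) (hμ : |μ - A| ≤ e)
    (hμ' : |μ' - 10 * B| ≤ e) : 0 < μ' * H - μ * H' := by
  have id1 : μ' * H - μ * H' = 10 * (5 * B ^ 2 - A * D) + (μ' - 10 * B) * H +
      10 * B * (H - (5 * B - A)) - (μ - A) * H' - A * (H' - (10 * D - 10 * B)) := by ring
  have bH : |H| ≤ 7 * M₁ := by
    have := abs_le.1 hH; have := abs_le.1 mA; have := abs_le.1 mB
    rw [abs_le]; constructor <;> linarith
  have bH' : |H'| ≤ 21 * M₁ := by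
    have := abs_le.1 hH'; have := abs_le.1 mD; have := abs_le.1 mB
    rw [abs_le]; constructor <;> linarith
  have s1 : |(μ' - 10 * B) * H| ≤ e * (7 * M₁) := by rw [abs_mul]; gcongr
  have s2 : |10 * B * (H - (5 * B - A))| ≤ 10 * M₁ * e := by
    rw [abs_mul, abs_mul, abs_of_pos (by norm_num : (0 : ℝ) < 10)]; gcongr
  have s3 : |(μ - A) * H'| ≤ e * (21 * M₁) := by rw [abs_mul]; gcongr
  have s4 : |A * (H' - (10 * D - 10 * B))| ≤ M₁ * e := by rw [abs_mul]; gcongr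
  have t1 := (abs_le.1 s1).1
  have t2 := (abs_le.1 s2).1
  have t3 := (abs_le.1 s3).2
  have t4 := (abs_le.1 s4).2
  have : 0 ≤ M₁ * e := by positivity
  rw [id1]
  linarith only [t1, t2, t3, t4, this, hea, h5]

/-- N and N' are near 1, so only H'/(2H) could spoil the sign; H' is near 10(D - B), which is small
compared with H ≥ a₀/2. -/
theorem mass_slope_pos {a₀ B D e H H' N N' : ℝ} (ha₀ : 0 < a₀)
    (he8 : e ≤ 1 / 8) (hea : e ≤ a₀ / 16) (hBD : 10 * |D - B| ≤ a₀ / 4) (hH : a₀ / 2 ≤ H)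
    (hH' : |H' - (10 * D - 10 * B)| ≤ e) (hN : |N - 1| ≤ e) (hN' : |N' - 1| ≤ e) :
    0 < N' - H' / (2 * H) * N := by
  have b1 : |H'| ≤ 5 * a₀ / 16 := by
    have h1 := abs_le.1 hH'
    have h2 : |D - B| ≤ a₀ / 40 := by linarith
    have h3 := abs_le.1 h2
    rw [abs_le]; constructor <;> linarith
  have b2 : |H' / (2 * H)| ≤ 5 / 16 := by
    have : 0 < H := by linarith
    rw [abs_div, abs_of_pos (by positivity : 0 < 2 * H), div_le_iff₀ (by positivity)]
    linarith
  have b3 : |N| ≤ 9 / 8 := by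
    have := abs_le.1 hN
    rw [abs_le]; constructor <;> linarith
  have b4 : |H' / (2 * H) * N| ≤ 5 / 16 * (9 / 8) := by rw [abs_mul]; gcongr
  have := (abs_le.1 b4).2
  have := (abs_le.1 hN').1
  linarith

theorem exists_chart {a₀ m M : ℝ} (ha₀ : 0 < a₀) (hM : 0 ≤ M) :
    ∃ r₀ > 0, r₀ ≤ 1 ∧ ∃ δ > 0, ∃ L ≥ 0, ∃ C₁ > 0, ∀ {κ : ℝ} {V : ℝ →ᵇ ℝ} {ω₀ ω₁ : ℝ} {k₀ k₁ : E},
      Setting m M κ V ω₀ ω₁ k₀ k₁ → ∀ {A B D : ℝ}, A = ∫ z, ev k₀ z ^ 6 →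
      B = ∫ z, ev k₀ z ^ 4 * ev k₁ z ^ 2 → D = ∫ z, ev k₀ z ^ 2 * ev k₁ z ^ 4 →
      a₀ < 5 * B - A → a₀ < 5 * B ^ 2 - A * D → a₀ / 8 ≤ A → 10 * |D - B| ≤ a₀ / 4 →
      ω₀ - ω₁ < δ → ∃ Y T η, Chart a₀ (par V ω₀ k₀ k₁) ω₀ (ω₀ - ω₁) r₀ L Y T η ∧
        along Var.gap (par V ω₀ k₀ k₁) Y 0 ≤ C₁ ∧ a₀ / 16 ≤ along Var.mu (par V ω₀ k₀ k₁) Y 0 := by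
  set CD := max (coer m M)⁻¹ (1 + M)
  obtain ⟨r₀, hr₀, -, hr1, δ, hδ, L, hL, hcurve⟩ := exists_curve CD ha₀ one_pos
  obtain ⟨c₁, hc₁, h₁⟩ := exists_close_of_curve Var.nice_gap Var.nice_gap' Var.hasDerivAt_gap CD L hL
  obtain ⟨c₂, hc₂, h₂⟩ := exists_close_of_curve Var.nice_mu Var.nice_mu' Var.hasDerivAt_mu CD L hL
  obtain ⟨c₃, hc₃, h₃⟩ :=
    exists_close_of_curve Var.nice_mass Var.nice_oddMass Var.hasDerivAt_mass CD L hL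
  obtain ⟨M₁, hM₁def⟩ : ∃ M₁, M₁ = (1 + M) ^ 4 := ⟨_, rfl⟩
  have hM₁ : 1 ≤ M₁ := hM₁def ▸ one_le_pow₀ (by linarith)
  obtain ⟨C, hC⟩ : ∃ C, C = c₁ + c₂ + c₃ + 1 := ⟨_, rfl⟩
  -- b is the tolerance of the two slope estimates for the O(d) deviations from the linear profiles.
  -- The bound 7M₁ for the gap comes from |5B - A| ≤ 6M₁ and a deviation below 1.
  obtain ⟨b, hb⟩ : ∃ b, b = min (1 / 8) (a₀ / (16 * M₁)) := ⟨_, rfl⟩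
  have hb0 : 0 < b := by rw [hb]; positivity
  have hb1 : b ≤ 1 / 8 := hb ▸ min_le_left _ _
  have hb2 : 16 * M₁ * b ≤ a₀ := by
    have : b ≤ a₀ / (16 * M₁) := hb ▸ min_le_right _ _
    rwa [le_div_iff₀ (by positivity), mul_comm] at this
  have hC0 : 0 < C := by linarith
  refine ⟨r₀, hr₀, hr1, min δ (b / C), lt_min hδ (by positivity), L, hL, 7 * M₁, by positivity, ?_⟩
  intro κ V ω₀ ω₁ k₀ k₁ S A B D hA hB hD h5 h52 hA8 hBD hd
  obtain ⟨d, hdd⟩ : ∃ d, d = ω₀ - ω₁ := ⟨_, rfl⟩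
  rw [← hdd] at hd ⊢
  have hd0 : 0 < d := by rw [hdd]; linarith [S.lt]
  obtain ⟨mA, mB, mD⟩ := S.moments_le
  rw [← hA, ← hM₁def] at mA
  rw [← hB, ← hM₁def] at mB
  rw [← hD, ← hM₁def] at mD
  obtain ⟨Y, hY⟩ := hcurve (par V ω₀ k₀ k₁) S.norm_par_le
    (by rw [gap_zero, ← hA, ← hB]; exact h5.le) d hd0 (hd.trans_le (min_le_left _ _))
  obtain ⟨g0, g1⟩ := h₁ _ a₀ d r₀ Y S.norm_par_le hr₀ hr1 hd0.le hY
  obtain ⟨u0, u1⟩ := h₂ _ a₀ d r₀ Y S.norm_par_le hr₀ hr1 hd0.le hY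
  obtain ⟨n0, n1⟩ := h₃ _ a₀ d r₀ Y S.norm_par_le hr₀ hr1 hd0.le hY
  rw [gap_zero, ← hA, ← hB] at g0
  rw [gap'_zero, ← hD, ← hB] at g1
  rw [mu_zero, ← hA] at u0
  rw [mu'_zero, ← hB] at u1
  rw [S.mass_zero] at n0
  rw [S.oddMass_zero] at n1
  obtain ⟨e, he⟩ : ∃ e, e = C * d := ⟨_, rfl⟩
  have he0 : 0 ≤ e := by rw [he]; positivity
  have heb : e ≤ b := by
    have := hd.trans_le (min_le_right _ _)
    rw [lt_div_iff₀ hC0] at this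
    rw [he]; linarith
  have k1 : c₁ * d ≤ e := by rw [he]; gcongr; linarith
  have k2 : c₂ * d ≤ e := by rw [he]; gcongr; linarith
  have k3 : c₃ * d ≤ e := by rw [he]; gcongr; linarith
  have heM : 16 * M₁ * e ≤ a₀ := le_trans (by gcongr) hb2
  have hea : e ≤ a₀ / 16 := by
    have : e ≤ M₁ * e := le_mul_of_one_le_left he0 hM₁
    linarith
  have z0 : |(0 : ℝ)| ≤ r₀ := by simpa using hr₀.le
  have hge : ∀ t, |t| ≤ r₀ → a₀ / 2 ≤ along Var.gap (par V ω₀ k₀ k₁) Y t := fun t ht =>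
    hY.gap_ge t _ ht (by linarith [hY.norm_le' t ht])
  obtain ⟨T, η, hη, r1, r2, r3, r4, r5⟩ := exists_reparametrization
    (H := along Var.gap (par V ω₀ k₀ k₁) Y) (μ := along Var.mu (par V ω₀ k₀ k₁) Y)
    (N := along Var.mass (par V ω₀ k₀ k₁) Y) ω₀ hr₀ hd0
    (fun t ht => along_smooth Var.nice_gap hY ht) (fun t ht => along_smooth Var.nice_mu hY ht)
    (fun t ht => along_smooth Var.nice_mass hY ht)
    (fun t ht => lt_of_lt_of_le (by positivity) (hge t ht.le))
    (frequency_slope_pos hM₁ mA mB mD h52 he0 (by linarith) (by linarith) (g0.trans k1)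
      (g1.trans k1) (u0.trans k2) (u1.trans k2))
    (mass_slope_pos ha₀ (heb.trans hb1) hea hBD (hge 0 z0) (g1.trans k1) (n0.trans k3)
      (n1.trans k3))
  refine ⟨Y, T, η, ⟨hY, ha₀, hd0, hr₀, hη, r1, r2, r3, r4, r5⟩, ?_, ?_⟩
  · have := (abs_le.1 (g0.trans k1)).2
    have := abs_le.1 mA
    have := abs_le.1 mB
    change Var.gap _ ≤ _
    linarith
  · have := (abs_le.1 (u0.trans k2)).1
    change _ ≤ Var.mu _
    linarith

/-! ### Existence of the branch and its uniqueness -/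

section Waves
variable {m M κ : ℝ} {V : ℝ →ᵇ ℝ} {ω₀ ω₁ : ℝ} {k₀ k₁ : E} {a₀ r₀ L η : ℝ} {Y : ℝ → E × E}
  {T : ℝ → ℝ}

theorem Chart.gap_ge {D : Par} {d : ℝ} (h : Chart a₀ D ω₀ d r₀ L Y T η) {t : ℝ} (ht : |t| ≤ r₀) :
    a₀ / 2 ≤ along Var.gap D Y t :=
  h.curve.gap_ge t _ ht (by linarith [h.curve.norm_le' t ht, h.r₀_pos])

theorem Chart.gap_pos {D : Par} {d : ℝ} (h : Chart a₀ D ω₀ d r₀ L Y T η) {t : ℝ} (ht : |t| ≤ r₀) :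
    0 < along Var.gap D Y t := lt_of_lt_of_le (by have := h.a₀_pos; positivity) (h.gap_ge ht)

/-- The properties of the waves on the curve. -/
structure IsWave (V : ℝ →ᵇ ℝ) (ω₀ : ℝ) (k₀ k₁ : E) (ρ s : ℝ) (x : Var) : Prop where
  sq_eq : x.2.1 * ρ ^ 2 = s ^ 2
  memZ₀ : MemZ k₀ k₁ x.2.2.1
  memZ₁ : MemZ k₀ k₁ x.2.2.2
  even : ∀ z, ev x.e (-z) = ev x.e z
  odd : ∀ z, ev x.p (-z) = -ev x.p z
  eq_odd : schr (V + ω₀ • 1) x.p = ρ ^ 4 • pot (x.wo - x.mu • 1) x.p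
  eq : schr (V + (ω₀ + ρ ^ 4 * x.mu) • 1 - ev (profile ρ s x) ^ 4) (profile ρ s x) = 0

/-- The value of ρ⁴ gives ρ² = √(d / gap), so the defining property of T becomes τρ² = s², the
compatibility under which the two profile equations add up to the wave equation. -/
theorem Chart.isWave (h : Chart a₀ (par V ω₀ k₀ k₁) ω₀ (ω₀ - ω₁) r₀ L Y T η)
    (S : Setting m M κ V ω₀ ω₁ k₀ k₁) {ρ s : ℝ} (hs : |s ^ 2| < η)
    (hρ : ρ ^ 4 = (ω₀ - ω₁) / along Var.gap (par V ω₀ k₀ k₁) Y (T (s ^ 2))) :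
    IsWave V ω₀ k₀ k₁ ρ s (par V ω₀ k₀ k₁, T (s ^ 2), Y (T (s ^ 2))) := by
  obtain ⟨-, hT, hTs⟩ := h.T_spec _ hs
  have hflip := S.flip_eq h.curve h.r₀_pos.le hT.le
  obtain ⟨z0, z1, he, hp⟩ := S.eq_of_isFixed (h.curve.fixed _ hT.le) hflip (h.gap_pos hT.le).ne'
  rw [show Var.gap (par V ω₀ k₀ k₁, T (s ^ 2), Y (T (s ^ 2))) =
    along Var.gap (par V ω₀ k₀ k₁) Y (T (s ^ 2)) from rfl, ← hρ] at he hp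
  have hsq : T (s ^ 2) * ρ ^ 2 = s ^ 2 := by
    rw [← hρ, show ρ ^ 4 = (ρ ^ 2) ^ 2 by ring, Real.sqrt_sq (sq_nonneg ρ)] at hTs
    exact hTs
  have hfe : reflect (Y (T (s ^ 2))).1 = (Y (T (s ^ 2))).1 := congrArg Prod.fst hflip
  have hfo : -reflect (Y (T (s ^ 2))).2 = (Y (T (s ^ 2))).2 := congrArg Prod.snd hflip
  refine ⟨hsq, z0, z1, fun z => ?_, fun z => ?_, hp, schr_profile hsq he hp⟩
  · rw [← ev_reflect]
    change ev (reflect (k₀ + (Y (T (s ^ 2))).1)) z = ev (k₀ + (Y (T (s ^ 2))).1) z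
    rw [map_add, S.reflect₀, hfe]
  · rw [← ev_reflect]
    change ev (reflect (k₁ + (Y (T (s ^ 2))).2)) z = -ev (k₁ + (Y (T (s ^ 2))).2) z
    have : reflect (Y (T (s ^ 2))).2 = -(Y (T (s ^ 2))).2 := neg_eq_iff_eq_neg.1 hfo
    rw [map_add, S.reflect₁, this, ← neg_add, map_neg]
    rfl

theorem IsWave.coeff (S : Setting m M κ V ω₀ ω₁ k₀ k₁) {ρ s τ : ℝ} {y : E × E}
    (h : IsWave V ω₀ k₀ k₁ ρ s (par V ω₀ k₀ k₁, τ, y)) :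
    ∫ z, ev (profile ρ s (par V ω₀ k₀ k₁, τ, y)) z * ev k₀ z = ρ ∧
      ∫ z, ev (profile ρ s (par V ω₀ k₀ k₁, τ, y)) z * ev k₁ z = s := by
  have ho : inner ℝ (emb k₁) (emb k₀) = 0 := by rw [real_inner_comm]; exact S.orth
  have e : profile ρ s (par V ω₀ k₀ k₁, τ, y) = ρ • (k₀ + y.1) + s • (k₁ + y.2) := rfl
  rw [← inner_emb, ← inner_emb, e]
  simp only [map_add, map_smul, inner_add_left, inner_smul_left, S.norm₀, S.norm₁, S.orth, ho,
    h.memZ₀.1, h.memZ₀.2, h.memZ₁.1, h.memZ₁.2, conj_trivial]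
  constructor <;> ring

/-- The even and odd profiles are orthogonal, and s² = τρ². -/
theorem IsWave.integral_sq {ρ s : ℝ} {x : Var} (h : IsWave V ω₀ k₀ k₁ ρ s x) :
    ∫ z, ev (profile ρ s x) z ^ 2 = ρ ^ 2 * x.mass := by
  have hpe : inner ℝ (emb x.e) (emb x.p) = 0 := by
    rw [inner_emb]
    refine integral_eq_zero_of_odd fun z => ?_
    rw [h.even, h.odd, mul_neg]
  have hpe' : inner ℝ (emb x.p) (emb x.e) = 0 := by rw [real_inner_comm]; exact hpe
  have : ∫ z, ev (profile ρ s x) z ^ 2 = inner ℝ (emb (profile ρ s x)) (emb (profile ρ s x)) := by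
    rw [inner_emb]; congr 1; ext z; ring
  rw [this, profile, Var.mass, Var.oddMass, inner_pot_one, inner_pot_one]
  simp only [map_add, map_smul, inner_add_left, inner_add_right, inner_smul_left, inner_smul_right,
    hpe, hpe', conj_trivial]
  linear_combination (-inner ℝ (emb x.p) (emb x.p)) * h.sq_eq

theorem abs_profile_le {ρ s N : ℝ} {x : Var} (he : ‖x.e‖ ≤ N) (hp : ‖x.p‖ ≤ N) (z : ℝ) :
    |ev (profile ρ s x) z| ≤ (|ρ| + |s|) * N := by
  rw [ev_profile]
  have h1 : |ev x.e z| ≤ N := ((ev x.e).norm_coe_le_norm z).trans ((norm_ev_le _).trans he)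
  have h2 : |ev x.p z| ≤ N := ((ev x.p).norm_coe_le_norm z).trans ((norm_ev_le _).trans hp)
  calc _ ≤ |ρ * ev x.e z| + |s * ev x.p z| := abs_add_le _ _
    _ ≤ |ρ| * N + |s| * N := by rw [abs_mul, abs_mul]; gcongr
    _ = _ := by ring

theorem Setting.norm_e_le (S : Setting m M κ V ω₀ ω₁ k₀ k₁) {τ : ℝ} {y : E × E} (hy : ‖y‖ ≤ 1) :
    ‖Var.e (par V ω₀ k₀ k₁, τ, y)‖ ≤ 2 + M ∧ ‖Var.p (par V ω₀ k₀ k₁, τ, y)‖ ≤ 2 + M := by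
  have h1 := (norm_fst_le y).trans hy
  have h2 := (norm_snd_le y).trans hy
  constructor
  · refine (norm_add_le k₀ y.1).trans ?_
    linarith [S.norm₀_le]
  · refine (norm_add_le k₁ y.2).trans ?_
    linarith [S.norm₁_le]

theorem Chart.along_tendsto {D : Par} {d : ℝ} (h : Chart a₀ D ω₀ d r₀ L Y T η) {f : Var → ℝ}
    (hf : Nice f) : ContinuousAt (fun s : ℝ => along f D Y (T (s ^ 2))) 0 := by
  have hsq : ContinuousAt (fun s : ℝ => s ^ 2) 0 := by fun_prop
  have hT : ContinuousAt T ((0 : ℝ) ^ 2) := by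
    rw [zero_pow two_ne_zero]
    exact (h.T_spec 0 (by simpa using h.η_pos)).1.continuousAt
  have ha : ContinuousAt (along f D Y) (T ((0 : ℝ) ^ 2)) := by
    rw [zero_pow two_ne_zero, h.T_zero]
    exact (along_smooth hf h.curve (by simpa using h.r₀_pos)).continuousAt
  exact ContinuousAt.comp (f := fun s : ℝ => T (s ^ 2)) ha
    (ContinuousAt.comp (f := fun s : ℝ => s ^ 2) hT hsq)

/-- The curve of solutions is an asymmetric branch. -/
theorem Chart.exists_branch (h : Chart a₀ (par V ω₀ k₀ k₁) ω₀ (ω₀ - ω₁) r₀ L Y T η)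
    (S : Setting m M κ V ω₀ ω₁ k₀ k₁) (hr1 : r₀ ≤ 1) {ε : ℝ} (hε : 0 < ε)
    (hμ : 0 < along Var.mu (par V ω₀ k₀ k₁) Y 0)
    (hd : 2 * (ω₀ - ω₁) / a₀ ≤ (ε / (2 * (2 + M))) ^ 4) :
    ∃ (r : ℝ) (ρ₀ ω : ℝ → ℝ) (φ : ℝ → ℝ → ℝ),
      IsAsymmetricBranch V ω₀ (ev k₀) (ev k₁) ε r ρ₀ ω φ := by
  have hM := S.M_nonneg
  set D := par V ω₀ k₀ k₁ with hD
  set d := ω₀ - ω₁ with hdd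
  have ha₀ := h.a₀_pos
  have hd0 := h.d_pos
  have hη := h.η_pos
  -- Both profiles are bounded by 2 + M, so ρ and |s| at most b give |φ| ≤ 2b(2 + M) = ε.
  set b := ε / (2 * (2 + M)) with hb
  have hb0 : 0 < b := by positivity
  have hmu : ∀ᶠ s : ℝ in 𝓝 0, 0 < along Var.mu D Y (T (s ^ 2)) := by
    refine (h.along_tendsto Var.nice_mu).eventually (lt_mem_nhds ?_)
    simpa [h.T_zero] using hμ
  obtain ⟨r, hr, hev⟩ := Metric.eventually_nhds_iff.1 ((hmu.and (eventually_abs_sub_lt 0 hb0)).and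
    ((continuous_pow 2).tendsto' (0 : ℝ) 0 (by norm_num) |>.eventually (eventually_abs_sub_lt 0 hη)))
  have hmem : ∀ s ∈ Ioo (-r) r, 0 < along Var.mu D Y (T (s ^ 2)) ∧ |s| < b ∧ |s ^ 2| < η :=
    fun s hs => by
      have := hev (y := s) (by rw [Real.dist_eq, sub_zero]; exact abs_lt.2 hs)
      simpa only [sub_zero, and_assoc] using this
  have hpos : ∀ s ∈ Ioo (-r) r, 0 < d / along Var.gap D Y (T (s ^ 2)) := fun s hs =>
    div_pos hd0 (h.gap_pos (h.T_spec _ (hmem s hs).2.2).2.1.le)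
  set ρ₀ : ℝ → ℝ := fun s => √(√(d / along Var.gap D Y (T (s ^ 2)))) with hρ₀
  have hρpos : ∀ s ∈ Ioo (-r) r, 0 < ρ₀ s := fun s hs =>
    Real.sqrt_pos.2 (Real.sqrt_pos.2 (hpos s hs))
  have hρ4 : ∀ s ∈ Ioo (-r) r, ρ₀ s ^ 4 = d / along Var.gap D Y (T (s ^ 2)) := fun s hs => by
    rw [show ρ₀ s ^ 4 = (ρ₀ s ^ 2) ^ 2 by ring, hρ₀]
    simp only
    rw [Real.sq_sqrt (Real.sqrt_nonneg _), Real.sq_sqrt (hpos s hs).le]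
  have hw : ∀ s ∈ Ioo (-r) r, IsWave V ω₀ k₀ k₁ (ρ₀ s) s (D, T (s ^ 2), Y (T (s ^ 2))) :=
    fun s hs => h.isWave S (hmem s hs).2.2 (hρ4 s hs)
  have hsm : ∀ {g : ℝ → ℝ}, (∀ v, |v| < η → ContDiffAt ℝ ((⊤ : ℕ∞) : WithTop ℕ∞) g v) →
      ∀ s ∈ Ioo (-r) r, ContDiffAt ℝ ((⊤ : ℕ∞) : WithTop ℕ∞) (fun s => g (s ^ 2)) s :=
    fun {g} hg s hs => ContDiffAt.comp (g := g) (f := fun s : ℝ => s ^ 2) s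
      (hg _ (hmem s hs).2.2) (contDiff_id.pow 2).contDiffAt
  have hgap : ∀ v, |v| < η →
      ContDiffAt ℝ ((⊤ : ℕ∞) : WithTop ℕ∞) (fun v => d / along Var.gap D Y (T v)) v := fun v hv => by
    obtain ⟨t1, t2, -⟩ := h.T_spec v hv
    exact contDiffAt_const.div ((along_smooth Var.nice_gap h.curve t2).comp v t1)
      (h.gap_pos t2.le).ne'
  refine ⟨r, ρ₀, fun s => ω₀ + d / along Var.gap D Y (T (s ^ 2)) * along Var.mu D Y (T (s ^ 2)),
    fun s => ev (profile (ρ₀ s) s (D, T (s ^ 2), Y (T (s ^ 2)))), hr, ?_, ?_, ?_, ?_, ?_, ?_, ?_, ?_⟩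
  · refine fun s hs => ContDiffAt.contDiffWithinAt ?_
    exact ((hsm hgap s hs).sqrt (hpos s hs).ne').sqrt (Real.sqrt_pos.2 (hpos s hs)).ne'
  · exact fun s hs => (hsm (fun v hv => (h.freq v hv).1) s hs).contDiffWithinAt
  · intro s hs
    have := isStandingWave_of_schr (hw s hs).eq
    rw [hρ4 s hs] at this
    exact this
  · exact fun s hs => ((hw s hs).coeff S).1
  · exact fun s hs => ((hw s hs).coeff S).2
  · intro s hs
    have := mul_pos (hpos s hs) (hmem s hs).1
    linarith
  · intro s hs z
    have t2 := (h.T_spec _ (hmem s hs).2.2).2.1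
    obtain ⟨n1, n2⟩ := S.norm_e_le (τ := T (s ^ 2)) (y := Y (T (s ^ 2)))
      (by linarith [h.curve.norm_le' _ t2.le, h.r₀_pos])
    refine (abs_profile_le n1 n2 z).trans ?_
    have hρb : ρ₀ s ≤ b := by
      refine le_of_pow_le_pow_left₀ four_ne_zero hb0.le ?_
      rw [hρ4 s hs]
      refine le_trans ?_ hd
      rw [div_le_div_iff₀ (h.gap_pos t2.le) ha₀]
      have := h.gap_ge t2.le
      nlinarith
    rw [abs_of_pos (hρpos s hs)]
    calc (ρ₀ s + |s|) * (2 + M) ≤ (b + b) * (2 + M) := by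
          have := (hmem s hs).2.1.le
          gcongr
      _ = ε := by rw [hb]; field_simp; ring
  · exact hρpos 0 ⟨by linarith, hr⟩

/-- Every asymmetric branch follows the curve of solutions. -/
theorem Chart.eventually_eq (h : Chart a₀ (par V ω₀ k₀ k₁) ω₀ (ω₀ - ω₁) r₀ L Y T η)
    (S : Setting m M κ V ω₀ ω₁ k₀ k₁) {ε r : ℝ} (hε : 16 * ε ^ 4 ≤ m / 2)
    (hεr : (coer m M)⁻¹ * (16 * ε ^ 4 * (1 + M)) ≤ r₀) {ρ₀ ω : ℝ → ℝ} {φ : ℝ → ℝ → ℝ}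
    (hb : IsAsymmetricBranch V ω₀ (ev k₀) (ev k₁) ε r ρ₀ ω φ) :
    ∀ᶠ s in 𝓝 0, ρ₀ s ^ 4 = (ω₀ - ω₁) / along Var.gap (par V ω₀ k₀ k₁) Y (T (s ^ 2)) ∧
      ω s = ω₀ + (ω₀ - ω₁) / along Var.gap (par V ω₀ k₀ k₁) Y (T (s ^ 2)) *
        along Var.mu (par V ω₀ k₀ k₁) Y (T (s ^ 2)) ∧
      (s ≠ 0 → φ s =
        ev (profile (ρ₀ s) s (par V ω₀ k₀ k₁, T (s ^ 2), Y (T (s ^ 2))))) := by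
  set D := par V ω₀ k₀ k₁ with hD
  have hnhds : Ioo (-r) r ∈ 𝓝 (0 : ℝ) := Ioo_mem_nhds (by linarith [hb.r_pos]) hb.r_pos
  have hρc : ContinuousAt ρ₀ 0 := (hb.smooth_ρ₀.contDiffAt hnhds).continuousAt
  have hωc : ContinuousAt ω 0 := (hb.smooth_ω.contDiffAt hnhds).continuousAt
  have hρp : ∀ᶠ s in 𝓝 0, 0 < ρ₀ s := hρc.eventually (lt_mem_nhds hb.ρ₀_pos)
  have hτc : Tendsto (fun s => s ^ 2 / ρ₀ s ^ 2) (𝓝 0) (𝓝 0) := by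
    have : ContinuousAt (fun s => s ^ 2 / ρ₀ s ^ 2) 0 :=
      (continuous_pow 2).continuousAt.div (hρc.pow 2) (pow_pos hb.ρ₀_pos 2).ne'
    simpa [ContinuousAt] using this
  -- For s ≠ 0 the wave yields a fixed point at τ = s²/ρ₀(s)²; uniqueness identifies it with Y τ,
  -- and then s² = τ√(d / gap) says τ = T(s²).
  have key : ∀ᶠ s in 𝓝 0, s ≠ 0 →
      ρ₀ s ^ 4 = (ω₀ - ω₁) / along Var.gap D Y (T (s ^ 2)) ∧
      ω s = ω₀ + (ω₀ - ω₁) / along Var.gap D Y (T (s ^ 2)) * along Var.mu D Y (T (s ^ 2)) ∧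
      φ s = ev (profile (ρ₀ s) s (D, T (s ^ 2), Y (T (s ^ 2)))) := by
    filter_upwards [hnhds, hρp, hτc.eventually h.T_left,
      hτc.eventually (eventually_abs_sub_lt 0 h.r₀_pos)] with s hs hρs hTs hτs hs0
    rw [sub_zero] at hτs
    obtain ⟨y, hy, hφ, -, -, hfix, hω, hgap⟩ := S.exists_isFixed (hb.standing s hs) (hb.freq s hs)
      hε (hb.small s hs) hρs.ne' hs0 (hb.coeff₀ s hs) (hb.coeff₁ s hs)
    have hyY := h.curve.unique _ y hτs.le (hy.trans hεr) hfix
    rw [hyY] at hφ hω hgap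
    have hg := h.gap_pos hτs.le
    have e4 : ρ₀ s ^ 4 = (ω₀ - ω₁) / along Var.gap D Y (s ^ 2 / ρ₀ s ^ 2) := by
      rw [eq_div_iff hg.ne']; exact hgap
    rw [← e4, show ρ₀ s ^ 4 = (ρ₀ s ^ 2) ^ 2 by ring, Real.sqrt_sq (sq_nonneg _),
      div_mul_cancel₀ _ (pow_pos hρs 2).ne'] at hTs
    rw [hTs]
    refine ⟨e4, ?_, hφ⟩
    rw [← e4]
    exact hω
  have hne : ∀ᶠ s in 𝓝[≠] (0 : ℝ), s ≠ 0 := eventually_mem_nhdsWithin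
  have hg0 : along Var.gap D Y (T ((0 : ℝ) ^ 2)) ≠ 0 := by
    rw [zero_pow two_ne_zero, h.T_zero]
    exact (h.gap_pos (by simpa using h.r₀_pos.le)).ne'
  have hac : ContinuousAt (fun s : ℝ => (ω₀ - ω₁) / along Var.gap D Y (T (s ^ 2))) 0 :=
    continuousAt_const.div (h.along_tendsto Var.nice_gap) hg0
  have hwc : ContinuousAt (fun s : ℝ => ω₀ + (ω₀ - ω₁) / along Var.gap D Y (T (s ^ 2)) *
      along Var.mu D Y (T (s ^ 2))) 0 :=
    continuousAt_const.add (hac.mul (h.along_tendsto Var.nice_mu))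
  have key' := eventually_nhdsWithin_of_eventually_nhds (s := {0}ᶜ) key
  -- At s = 0 the wave does not determine an odd profile, and the identities for ρ₀ and ω are
  -- obtained by continuity of these functions.
  have k0 : ρ₀ 0 ^ 4 = (ω₀ - ω₁) / along Var.gap D Y (T ((0 : ℝ) ^ 2)) := by
    refine tendsto_nhds_unique (l := 𝓝[≠] (0 : ℝ)) (((hρc.pow 4).tendsto.mono_left nhdsWithin_le_nhds).congr' ?_)
      (hac.tendsto.mono_left nhdsWithin_le_nhds)
    filter_upwards [key', hne] with s hs hs0 using (hs hs0).1
  have k1 : ω 0 = ω₀ + (ω₀ - ω₁) / along Var.gap D Y (T ((0 : ℝ) ^ 2)) *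
      along Var.mu D Y (T ((0 : ℝ) ^ 2)) := by
    refine tendsto_nhds_unique (l := 𝓝[≠] (0 : ℝ)) ((hωc.tendsto.mono_left nhdsWithin_le_nhds).congr' ?_)
      (hwc.tendsto.mono_left nhdsWithin_le_nhds)
    filter_upwards [key', hne] with s hs hs0 using (hs hs0).2.1
  filter_upwards [key] with s hs
  by_cases hs0 : s = 0
  · rw [hs0]; exact ⟨k0, k1, fun h => absurd rfl h⟩
  · exact ⟨(hs hs0).1, (hs hs0).2.1, fun _ => (hs hs0).2.2⟩

end Waves

/-! ### Spectrum along the branch and conclusion -/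

/-- The eigenvalues of the linearization at a small wave. -/
theorem exists_linearized_spectrum {m M a₀ κ K : ℝ} (hm : 0 < m) (hM : 0 ≤ M) (ha₀ : 0 < a₀)
    (hκ : 0 < κ) (hK : 1 ≤ K) : ∃ C > 0, ∃ c > 0, ∃ a₁ > 0,
    ∀ {V : ℝ →ᵇ ℝ} {ω₀ ω₁ : ℝ} {k₀ k₁ : E}, Setting m M κ V ω₀ ω₁ k₀ k₁ →
    (∃ N, ∀ x : ℝ, 0 < x → |V x| ≤ N / x ^ 3) → ∀ {ρ s τ : ℝ} {y : E × E} {A B D : ℝ},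
    IsWave V ω₀ k₀ k₁ ρ s (par V ω₀ k₀ k₁, τ, y) → A = ∫ z, ev k₀ z ^ 6 →
    B = ∫ z, ev k₀ z ^ 4 * ev k₁ z ^ 2 → D = ∫ z, ev k₀ z ^ 2 * ev k₁ z ^ 4 → a₀ / 8 ≤ A →
    a₀ < 5 * B ^ 2 - A * D → 0 < ρ → ρ ^ 4 ≤ a₁ → |s / ρ| ≤ ρ ^ 4 → s ≠ 0 → ‖y‖ ≤ K * ρ ^ 4 →
    a₀ / 32 ≤ Var.mu (par V ω₀ k₀ k₁, τ, y) →
    ∃ μ₀ μ₁ : ℝ, 0 < μ₀ ∧ 0 < μ₁ ∧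
      schrodingerEigenvalues (LPlusPotential V (ω₀ + ρ ^ 4 * Var.mu (par V ω₀ k₀ k₁, τ, y))
        (ev (profile ρ s (par V ω₀ k₀ k₁, τ, y)))) = {-μ₀, μ₁} ∧
      4 * ρ ^ 4 * A - C * ρ ^ 8 ≤ μ₀ ∧ c * ρ ^ 2 * s ^ 2 ≤ μ₁ ∧ μ₁ ≤ C * ρ ^ 2 * s ^ 2 := by
  obtain ⟨C, hC, c, hc, a₁, ha₁, H⟩ := exists_two_eigenvalues hm hM ha₀ hK
  -- κ/80 serves the form bound on Z. The last entry makes β = (K + 2 + M)ρ⁴ satisfy 16β⁴ < a₀/32 ≤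
  -- μ, as needed to compare the wave with 2ρ|ψ₀|.
  refine ⟨C, hC, c, hc, min a₁ (min (κ / 80) (min 1 (a₀ / 1024) / (K + 2 + M))), by positivity, ?_⟩
  intro V ω₀ ω₁ k₀ k₁ S hV ρ s τ y A B D hw hA hB hD hA8 h5 hρ hρa ht hs hy hmu
  obtain ⟨N, hN⟩ := hV
  obtain ⟨a, ha⟩ : ∃ a, a = ρ ^ 4 := ⟨_, rfl⟩
  obtain ⟨t, htdef⟩ : ∃ t, t = s / ρ := ⟨_, rfl⟩
  have ha0 : 0 < a := by rw [ha]; positivity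
  have hst : s = ρ * t := by rw [htdef]; field_simp
  have hτ : τ = t ^ 2 := by
    have := hw.sq_eq
    change τ * ρ ^ 2 = s ^ 2 at this
    rw [hst, mul_pow, mul_comm] at this
    exact mul_left_cancel₀ (pow_pos hρ 2).ne' this
  rw [← ha, ← htdef] at ht
  rw [← ha] at hρa hy
  have haa : a ≤ a₁ := hρa.trans (min_le_left _ _)
  have haκ : 80 * a ≤ κ := by
    have := hρa.trans ((min_le_right _ _).trans (min_le_left _ _))
    linarith
  set x : Var := (par V ω₀ k₀ k₁, τ, y) with hx
  obtain ⟨X, hX⟩ : ∃ X : Var, X = (par V ω₀ k₀ k₁, t, y) := ⟨_, rfl⟩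
  have hXsq : X.sq = x := by rw [hX, hx, hτ]; rfl
  have hXe : X.e = x.e := by rw [hX]; rfl
  have hXp : X.p = x.p := by rw [hX]; rfl
  have hmu0 : 0 < x.mu := by linarith
  have ht0 : t ≠ 0 := by
    rintro rfl
    exact hs (by rw [hst, mul_zero])
  obtain ⟨μ₀, μ₁, p0, p1, g0, g1, b0, b1, b2, -⟩ := H S hX hA hB hD hA8 h5 ha0 haa ht ht0 hy
    hw.memZ₁ (by rw [hXe]; exact hw.even) (by rw [hXp]; exact hw.odd)
    (by rw [hXp, hXsq, ha]; exact hw.eq_odd) (by rw [hXsq]; exact hmu0.le)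
  have hlin : linPot V ω₀ a X =
      V + (ω₀ + ρ ^ 4 * x.mu) • 1 - (5 : ℝ) • ev (profile ρ s x) ^ 4 := by
    rw [linPot, hXsq, ← ha]
    congr 1
    ext z
    have h1 : X.2.1 = t := by rw [hX]
    simp only [BoundedContinuousFunction.coe_smul, BoundedContinuousFunction.coe_pow, Pi.pow_apply,
      smul_eq_mul, Var.four_apply, ev_profile, hXe, hXp, h1, ha]
    rw [hst]
    ring
  rw [hlin] at g0 g1
  have hβ : (K + 2 + M) * a ≤ min 1 (a₀ / 1024) := by
    have := hρa.trans ((min_le_right _ _).trans (min_le_right _ _))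
    rwa [le_div_iff₀ (by positivity), mul_comm] at this
  have hKa : K * a ≤ 1 := le_trans (by gcongr; linarith) (hβ.trans (min_le_left _ _))
  have hω : 0 < ω₀ + ρ ^ 4 * x.mu := by
    have h1 := S.m_pos
    have h2 := S.le
    have h3 := S.lt
    have : 0 < ρ ^ 4 * x.mu := by positivity
    linarith
  have hclose : ∀ z, |ev (profile ρ s x) z - ρ * ev k₀ z| ≤ ρ * ((K + 2 + M) * a) := fun z => by
    have e1 : ev x.e z = ev k₀ z + ev y.1 z := by
      change ev (k₀ + y.1) z = _
      rw [map_add]; rfl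
    have e2 : |ev y.1 z| ≤ K * a :=
      ((ev y.1).norm_coe_le_norm z).trans ((norm_ev_le _).trans ((norm_fst_le y).trans hy))
    have e3 : |ev x.p z| ≤ 2 + M := ((ev x.p).norm_coe_le_norm z).trans ((norm_ev_le _).trans
      (S.norm_e_le (hy.trans hKa)).2)
    have e4 : ev (profile ρ s x) z - ρ * ev k₀ z = ρ * (ev y.1 z + t * ev x.p z) := by
      rw [ev_profile, e1, hst]; ring
    rw [e4, abs_mul, abs_of_pos hρ]
    refine mul_le_mul_of_nonneg_left ?_ hρ.le
    calc |ev y.1 z + t * ev x.p z| ≤ |ev y.1 z| + |t * ev x.p z| := abs_add_le _ _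
      _ ≤ K * a + a * (2 + M) := by rw [abs_mul]; gcongr
      _ = _ := by ring
  have hsmall : 16 * ρ ^ 4 * ((K + 2 + M) * a) ^ 4 < ω₀ + ρ ^ 4 * x.mu - ω₀ := by
    have hb0 : 0 ≤ (K + 2 + M) * a := by positivity
    have h1 : ((K + 2 + M) * a) ^ 4 ≤ (K + 2 + M) * a :=
      pow_le_of_le_one hb0 (hβ.trans (min_le_left _ _)) four_ne_zero
    have h2 := hβ.trans (min_le_right _ _)
    have h3 : 16 * ((K + 2 + M) * a) ^ 4 < x.mu := by linarith
    have h4 := mul_lt_mul_of_pos_left h3 (pow_pos hρ 4)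
    linarith
  refine ⟨μ₀, μ₁, p0, p1, S.eigenvalues_eq (C := N) hω hN hw.eq (ρ := ρ) (by rwa [← ha])
    (S.abs_le_two_mul hρ hw.eq hclose hsmall) p0 p1 g0 g1, ?_, ?_, ?_⟩
  · rw [ha] at b0
    convert b0 using 2
    ring
  · convert b1 using 1
    rw [ha, hst]; ring
  · convert b2 using 1
    rw [ha, hst]; ring

theorem abs_integral_sub_le (w : ℝ →ᵇ ℝ) (k l : E) :
    |(∫ x, w x * ev l x ^ 2) - ∫ x, w x * ev k x ^ 2| ≤
      ‖w‖ * ∫ x, |ev l x ^ 2 - ev k x ^ 2| := by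
  have hi : ∀ k : E, Integrable fun x => w x * ev k x ^ 2 := fun k => by
    simpa only [mul_assoc, ← sq] using integrable_mul_ev w k k
  have hs : ∀ k : E, Integrable fun x => ev k x ^ 2 := fun k => integrable_sq_of_memLp (memLp_ev k)
  rw [← integral_sub (hi l) (hi k), ← integral_const_mul]
  refine (abs_integral_le_integral_abs).trans
    (integral_mono ((hi l).sub (hi k)).abs (((hs l).sub (hs k)).abs.const_mul _) fun x => ?_)
  simp only
  rw [← mul_sub, abs_mul]
  exact mul_le_mul_of_nonneg_right (w.norm_coe_le_norm x) (abs_nonneg _)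

/-- Each difference replaces one factor ψ₀² by ψ₁² against a weight bounded by (1 + M)⁴. -/
theorem Setting.moments_close {m M κ : ℝ} {V : ℝ →ᵇ ℝ} {ω₀ ω₁ : ℝ} {k₀ k₁ : E}
    (S : Setting m M κ V ω₀ ω₁ k₀ k₁) :
    |(∫ x, ev k₀ x ^ 4 * ev k₁ x ^ 2) - ∫ x, ev k₀ x ^ 6| ≤
        (1 + M) ^ 4 * ∫ x, |ev k₁ x ^ 2 - ev k₀ x ^ 2| ∧
      |(∫ x, ev k₀ x ^ 2 * ev k₁ x ^ 4) - ∫ x, ev k₀ x ^ 4 * ev k₁ x ^ 2| ≤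
        (1 + M) ^ 4 * ∫ x, |ev k₁ x ^ 2 - ev k₀ x ^ 2| := by
  have hM := S.M_nonneg
  have h0 : 0 ≤ ∫ x, |ev k₁ x ^ 2 - ev k₀ x ^ 2| := integral_nonneg fun x => abs_nonneg _
  have e0 := S.norm_ev₀_le
  have e1 := S.norm_ev₁_le
  constructor
  · have := abs_integral_sub_le (ev k₀ ^ 4) k₀ k₁
    have n : ‖ev k₀ ^ 4‖ ≤ (1 + M) ^ 4 := (norm_pow_le _ _).trans (by gcongr)
    refine le_trans (le_of_eq ?_) (this.trans (mul_le_mul_of_nonneg_right n h0))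
    simp only [BoundedContinuousFunction.coe_pow, Pi.pow_apply, ← pow_add]
  · have := abs_integral_sub_le (ev k₀ ^ 2 * ev k₁ ^ 2) k₀ k₁
    have n : ‖ev k₀ ^ 2 * ev k₁ ^ 2‖ ≤ (1 + M) ^ 4 := by
      calc _ ≤ ‖ev k₀ ^ 2‖ * ‖ev k₁ ^ 2‖ := norm_mul_le _ _
        _ ≤ ‖ev k₀‖ ^ 2 * ‖ev k₁‖ ^ 2 := by gcongr <;> exact norm_pow_le _ _
        _ ≤ (1 + M) ^ 2 * (1 + M) ^ 2 := by gcongr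
        _ = _ := by ring
    refine le_trans (le_of_eq ?_) (this.trans (mul_le_mul_of_nonneg_right n h0))
    congr 2 <;> congr 1 <;> ext x <;>
      simp only [BoundedContinuousFunction.coe_mul, BoundedContinuousFunction.coe_pow, Pi.pow_apply,
        Pi.mul_apply] <;> ring

/-- The size of admissible waves. -/
theorem exists_amplitude {m θ M r₀ : ℝ} (hm : 0 < m) (hθ : 0 < θ) (hM : 0 ≤ M) (hr₀ : 0 < r₀) :
    ∃ ε > 0, 16 * ε ^ 4 ≤ m / 2 ∧ θ⁻¹ * (16 * ε ^ 4 * (1 + M)) ≤ r₀ := by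
  refine ⟨min 1 (min (m / 32) (r₀ * θ / (16 * (1 + M)))), by positivity, ?_, ?_⟩
  all_goals
    set ε := min 1 (min (m / 32) (r₀ * θ / (16 * (1 + M)))) with hε
    have h0 : 0 < ε := by positivity
    have h1 : ε ^ 4 ≤ ε := pow_le_of_le_one h0.le (min_le_left _ _) four_ne_zero
  · have : ε ≤ m / 32 := (min_le_right _ _).trans (min_le_left _ _)
    linarith
  · have h2 : ε ≤ r₀ * θ / (16 * (1 + M)) := (min_le_right _ _).trans (min_le_right _ _)
    calc θ⁻¹ * (16 * ε ^ 4 * (1 + M)) ≤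
        θ⁻¹ * (16 * (r₀ * θ / (16 * (1 + M))) * (1 + M)) := by gcongr; exact h1.trans h2
      _ = r₀ := by field_simp

/-- Transfers estimates from ρ(s) to the crossing value ρ(0). The tolerance ρ(0)⁸ for the fourth
powers lets their difference disappear in the error term of μ₀. -/
theorem eventually_amplitude {ρ : ℝ → ℝ} (hc : ContinuousAt ρ 0) (hp : 0 < ρ 0) :
    ∀ᶠ s in 𝓝 0, 0 < ρ s ∧ |ρ s ^ 4 - ρ 0 ^ 4| ≤ (ρ 0 ^ 4) ^ 2 ∧ ρ 0 ^ 4 / 2 ≤ ρ s ^ 4 ∧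
      ρ s ^ 4 ≤ 2 * ρ 0 ^ 4 ∧ ρ 0 ^ 2 / 2 ≤ ρ s ^ 2 ∧ ρ s ^ 2 ≤ 2 * ρ 0 ^ 2 ∧
      |s / ρ s| ≤ ρ 0 ^ 4 / 2 := by
  have p2 : 0 < ρ 0 ^ 2 := by positivity
  have p4 : 0 < ρ 0 ^ 4 := by positivity
  have c2 := hc.pow 2
  have c4 := hc.pow 4
  have cq : ContinuousAt (fun s => s / ρ s) 0 := continuousAt_id.div hc hp.ne'
  have hq : ∀ᶠ s in 𝓝 0, |s / ρ s - 0 / ρ 0| < ρ 0 ^ 4 / 2 :=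
    cq.eventually (eventually_abs_sub_lt _ (by positivity))
  filter_upwards [hc.eventually (lt_mem_nhds hp),
    c4.eventually (eventually_abs_sub_lt _ (pow_pos p4 2)),
    c4.eventually (lt_mem_nhds (half_lt_self p4)),
    c4.eventually (gt_mem_nhds (by linarith : ρ 0 ^ 4 < 2 * ρ 0 ^ 4)),
    c2.eventually (lt_mem_nhds (half_lt_self p2)),
    c2.eventually (gt_mem_nhds (by linarith : ρ 0 ^ 2 < 2 * ρ 0 ^ 2)), hq] with
    s h1 h2 h3 h4 h5 h6 h7
  rw [zero_div, sub_zero] at h7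
  exact ⟨h1, h2.le, h3.le, h4.le, h5.le, h6.le, h7.le⟩

set_option maxHeartbeats 800000 in
/-- Bifurcation of the asymmetric branch, in terms of the spectral setting. -/
theorem exists_bifurcation {a₀ m M κ : ℝ} (ha₀ : 0 < a₀) (hm : 0 < m) (hM : 0 ≤ M) (hκ : 0 < κ) :
    ∃ ε > 0, ∃ δ > 0, ∃ c > 0, ∃ C > 0, ∀ {V : ℝ →ᵇ ℝ} {ω₀ ω₁ : ℝ} {k₀ k₁ : E} {A B D : ℝ},
      Setting m M κ V ω₀ ω₁ k₀ k₁ → (∃ N, ∀ x : ℝ, 0 < x → |V x| ≤ N / x ^ 3) →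
      A = ∫ z, ev k₀ z ^ 6 → B = ∫ z, ev k₀ z ^ 4 * ev k₁ z ^ 2 →
      D = ∫ z, ev k₀ z ^ 2 * ev k₁ z ^ 4 →
      a₀ < 5 * B - A → a₀ < 5 * B ^ 2 - A * D → a₀ / 8 ≤ A → 10 * |D - B| ≤ a₀ / 4 →
      ω₀ - ω₁ < δ →
      (∃ (r : ℝ) (ρ₀ ω : ℝ → ℝ) (φ : ℝ → ℝ → ℝ),
        IsAsymmetricBranch V ω₀ (ev k₀) (ev k₁) ε r ρ₀ ω φ) ∧
      ∀ (r : ℝ) (ρ₀ ω : ℝ → ℝ) (φ : ℝ → ℝ → ℝ),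
        IsAsymmetricBranch V ω₀ (ev k₀) (ev k₁) ε r ρ₀ ω φ →
        (c * (ω₀ - ω₁) ≤ ρ₀ 0 ^ 4 ∧ ρ₀ 0 ^ 4 ≤ C * (ω₀ - ω₁)) ∧
        ∃ r' : ℝ, 0 < r' ∧ r' ≤ r ∧
          (∃ (ωmax : ℝ) (q : ℝ → ℝ), ω 0 < ωmax ∧
            Set.BijOn ω (Set.Ioo 0 r') (Set.Ioo (ω 0) ωmax) ∧
            Set.BijOn ω (Set.Ioo (-r') 0) (Set.Ioo (ω 0) ωmax) ∧
            (∀ s, 0 < |s| → |s| < r' → q (ω s) = ∫ x, φ s x ^ 2) ∧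
            ∀ w ∈ Set.Ioo (ω 0) ωmax, DifferentiableAt ℝ q w ∧ 0 < deriv q w) ∧
          ∀ s, 0 < |s| → |s| < r' →
            ∃ μ₀ μ₁ : ℝ, 0 < μ₀ ∧ 0 < μ₁ ∧
              schrodingerEigenvalues (LPlusPotential V (ω s) (φ s)) = {-μ₀, μ₁} ∧
              4 * ρ₀ 0 ^ 4 * A - C * ρ₀ 0 ^ 8 ≤ μ₀ ∧
              c * ρ₀ 0 ^ 2 * s ^ 2 ≤ μ₁ ∧ μ₁ ≤ C * ρ₀ 0 ^ 2 * s ^ 2 := by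
  obtain ⟨r₀, hr₀, hr1, δ₁, hδ₁, L, hL, C₁, hC₁, hch⟩ := exists_chart (m := m) ha₀ hM
  -- ‖Y‖ ≤ Ld and d ≤ C₁ρ₀(0)⁴ ≤ 2C₁ρ₀(s)⁴ give ‖Y‖ ≤ Kρ₀(s)⁴.
  obtain ⟨K, hKdef⟩ : ∃ K, K = 2 * C₁ * L + 1 := ⟨_, rfl⟩
  have hK : 1 ≤ K := by
    have : 0 ≤ 2 * C₁ * L := by positivity
    linarith
  obtain ⟨C₂, hC₂, c₂, hc₂, a₁, ha₁, hspec⟩ := exists_linearized_spectrum hm hM ha₀ hκ hK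
  obtain ⟨ε, hε, hε1, hε2⟩ := exists_amplitude hm (coer_pos hm hM) hM hr₀
  obtain ⟨M₁, hM₁⟩ : ∃ M₁, M₁ = (1 + M) ^ 4 := ⟨_, rfl⟩
  have hM₁p : 0 < M₁ := by rw [hM₁]; positivity
  obtain ⟨C, hCdef⟩ : ∃ C, C = 2 / a₀ + 4 * M₁ + 4 * C₂ := ⟨_, rfl⟩
  have h2a : 0 < 2 / a₀ := by positivity
  -- From ρ₀⁴ ≤ 2d/a₀: the second entry keeps the constructed waves below ε, and the third keeps
  -- ρ₀(s)⁴ ≤ 2ρ₀(0)⁴ below a₁.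
  refine ⟨ε, hε, min δ₁ (min (a₀ * (ε / (2 * (2 + M))) ^ 4 / 2) (a₀ * a₁ / 4)), by positivity,
    min (1 / C₁) (c₂ / 2), by positivity, C, by rw [hCdef]; positivity, ?_⟩
  intro V ω₀ ω₁ k₀ k₁ A B D S hV hA hB hD h5 h52 hA8 hBD hd
  obtain ⟨Y, T, η, h, hG1, hmu⟩ := hch S hA hB hD h5 h52 hA8 hBD (hd.trans_le (min_le_left _ _))
  have hdb := (hd.trans_le ((min_le_right _ _).trans (min_le_left _ _))).le
  have hda := (hd.trans_le ((min_le_right _ _).trans (min_le_right _ _))).le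
  have hmu0 : 0 < along Var.mu (par V ω₀ k₀ k₁) Y 0 := lt_of_lt_of_le (by positivity) hmu
  refine ⟨h.exists_branch S hr1 hε hmu0 (by rw [div_le_iff₀ ha₀]; linarith), ?_⟩
  intro r ρ₀ ω φ hb
  have hE := h.eventually_eq S hε1 hε2 hb
  have hd0 := h.d_pos
  have hη := h.η_pos
  have hw := fun (ρ s : ℝ) => h.isWave S (ρ := ρ) (s := s)
  have hAM : A ≤ M₁ := by
    have := S.moments_le.1
    rw [← hA, ← hM₁] at this
    exact (le_abs_self A).trans this
  generalize ω₀ - ω₁ = d at *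
  have hnhds : Ioo (-r) r ∈ 𝓝 (0 : ℝ) := Ioo_mem_nhds (by linarith [hb.r_pos]) hb.r_pos
  have hρc : ContinuousAt ρ₀ 0 := (hb.smooth_ρ₀.contDiffAt hnhds).continuousAt
  have hp := hb.ρ₀_pos
  have hG0 := h.gap_ge (t := 0) (by simpa using hr₀.le)
  have hG0p := h.gap_pos (t := 0) (by simpa using hr₀.le)
  have ha4 : ρ₀ 0 ^ 4 = d / along Var.gap (par V ω₀ k₀ k₁) Y 0 := by
    have := hE.self_of_nhds.1
    rwa [zero_pow two_ne_zero, h.T_zero] at this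
  have hlo : d ≤ C₁ * ρ₀ 0 ^ 4 := by
    rw [ha4, ← mul_div_assoc, le_div_iff₀ hG0p, mul_comm]
    gcongr
  have hhi : a₀ * ρ₀ 0 ^ 4 ≤ 2 * d := by
    rw [ha4, ← mul_div_assoc, div_le_iff₀ hG0p]
    nlinarith
  have hmuE : ∀ᶠ s : ℝ in 𝓝 0, a₀ / 32 < along Var.mu (par V ω₀ k₀ k₁) Y (T (s ^ 2)) := by
    refine (h.along_tendsto Var.nice_mu).eventually (lt_mem_nhds ?_)
    simp only [zero_pow two_ne_zero, h.T_zero]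
    linarith
  have hηE : ∀ᶠ s : ℝ in 𝓝 0, |s ^ 2 - 0| < η :=
    (continuous_pow 2).tendsto' (0 : ℝ) 0 (by norm_num) |>.eventually (eventually_abs_sub_lt 0 hη)
  obtain ⟨R, hR, hev⟩ := Metric.eventually_nhds_iff.1
    ((hE.and (eventually_amplitude hρc hp)).and (hmuE.and hηE))
  have hall := fun (s : ℝ) (hs : |s| < R) => hev (y := s) (by rwa [Real.dist_eq, sub_zero])
  have hr' : min (R / 2) r ≤ R / 2 := min_le_left _ _
  have hin : ∀ s : ℝ, |s| < min (R / 2) r → |s| < R := fun s hs => by linarith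
  have hwave : ∀ s : ℝ, |s| < R →
      IsWave V ω₀ k₀ k₁ (ρ₀ s) s (par V ω₀ k₀ k₁, T (s ^ 2), Y (T (s ^ 2))) := fun s hs => by
    obtain ⟨⟨⟨e1, -⟩, -⟩, -, hη'⟩ := hall s hs
    rw [sub_zero] at hη'
    exact hw _ _ hη' e1
  refine ⟨⟨?_, ?_⟩, min (R / 2) r, lt_min (half_pos hR) hb.r_pos, min_le_right _ _, ?_, ?_⟩
  · calc min (1 / C₁) (c₂ / 2) * d ≤ 1 / C₁ * (C₁ * ρ₀ 0 ^ 4) := by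
          gcongr; exact min_le_left _ _
      _ = _ := by field_simp
  · have h1 : ρ₀ 0 ^ 4 ≤ 2 / a₀ * d := by
      rw [div_mul_eq_mul_div, le_div_iff₀ ha₀]; linarith
    have h2 : 0 ≤ (4 * M₁ + 4 * C₂) * d := by positivity
    rw [hCdef]
    linarith
  · refine exists_parametrization (q₀ := fun s => ∫ x, φ s x ^ 2) h.freq h.mass
      (lt_min (half_pos hR) hb.r_pos) ?_ (fun s hs => (hall s (hin s hs)).1.1.2.1) fun s hs0 hs => ?_
    · have h1 := (hall (R / 2) (by rw [abs_of_pos (half_pos hR)]; linarith)).2.2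
      rw [sub_zero, abs_of_pos (by positivity)] at h1
      refine lt_of_le_of_lt ?_ h1
      have : 0 < min (R / 2) r := lt_min (half_pos hR) hb.r_pos
      gcongr
    · obtain ⟨⟨⟨e1, -, e3⟩, -⟩, -⟩ := hall s (hin s hs)
      rw [e3 (abs_pos.1 hs0), (hwave s (hin s hs)).integral_sq, ← e1,
        show ρ₀ s ^ 4 = (ρ₀ s ^ 2) ^ 2 by ring, Real.sqrt_sq (sq_nonneg _)]
      rfl
  · intro s hs0 hs
    have hs1 := hin s hs
    have hsne := abs_pos.1 hs0
    obtain ⟨⟨⟨e1, e2, e3⟩, p1, p2, p3, p4, p5, p6, p7⟩, hm1, hη1⟩ := hall s hs1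
    rw [sub_zero] at hη1
    have hT := (h.T_spec _ hη1).2.1
    have hsa : ρ₀ s ^ 4 ≤ a₁ := by
      have : a₀ * ρ₀ 0 ^ 4 ≤ a₀ * (a₁ / 2) := by linarith only [hhi, hda]
      linarith only [le_of_mul_le_mul_left this ha₀, p4]
    have hsd : d ≤ C₁ * (2 * ρ₀ s ^ 4) := by
      linarith only [mul_le_mul_of_nonneg_left p3 hC₁.le, hlo]
    obtain ⟨μ₀, μ₁, u0, u1, hset, b0, b1, b2⟩ := hspec S hV (hwave s hs1) hA hB hD hA8 h52 p1
      hsa (p7.trans p3) hsne ((h.curve.norm_le _ hT.le).trans (by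
        have h1 : L * d ≤ L * (C₁ * (2 * ρ₀ s ^ 4)) := by gcongr
        rw [hKdef]
        have : 0 ≤ ρ₀ s ^ 4 := by positivity
        linarith)) hm1.le
    refine ⟨μ₀, μ₁, u0, u1, ?_, ?_, ?_, ?_⟩
    · rw [e1] at hset
      rw [e3 hsne, e2]
      exact hset
    · refine le_trans ?_ b0
      have q1 : 4 * A * (ρ₀ 0 ^ 4 - ρ₀ s ^ 4) ≤ 4 * M₁ * (ρ₀ 0 ^ 4) ^ 2 := by
        have := (abs_le.1 p2).1
        have hA0 : 0 ≤ A := by linarith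
        calc 4 * A * (ρ₀ 0 ^ 4 - ρ₀ s ^ 4) ≤ 4 * A * (ρ₀ 0 ^ 4) ^ 2 := by gcongr; linarith
          _ ≤ _ := by gcongr
      have q2 : C₂ * ρ₀ s ^ 8 ≤ 4 * C₂ * (ρ₀ 0 ^ 4) ^ 2 := by
        calc C₂ * ρ₀ s ^ 8 = C₂ * (ρ₀ s ^ 4) ^ 2 := by ring
          _ ≤ C₂ * (2 * ρ₀ 0 ^ 4) ^ 2 := by gcongr
          _ = _ := by ring
      have q3 : 0 ≤ 2 / a₀ * (ρ₀ 0 ^ 4) ^ 2 := by positivity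
      have q4 : C * ρ₀ 0 ^ 8 = 2 / a₀ * (ρ₀ 0 ^ 4) ^ 2 + 4 * M₁ * (ρ₀ 0 ^ 4) ^ 2 +
          4 * C₂ * (ρ₀ 0 ^ 4) ^ 2 := by rw [hCdef]; ring
      rw [q4]
      linarith only [q1, q2, q3]
    · refine le_trans ?_ b1
      have : min (1 / C₁) (c₂ / 2) ≤ c₂ / 2 := min_le_right _ _
      calc min (1 / C₁) (c₂ / 2) * ρ₀ 0 ^ 2 * s ^ 2 ≤ c₂ / 2 * ρ₀ 0 ^ 2 * s ^ 2 := by gcongr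
        _ = c₂ * (ρ₀ 0 ^ 2 / 2) * s ^ 2 := by ring
        _ ≤ _ := by gcongr
    · refine b2.trans ?_
      calc C₂ * ρ₀ s ^ 2 * s ^ 2 ≤ C₂ * (2 * ρ₀ 0 ^ 2) * s ^ 2 := by gcongr
        _ = 2 * C₂ * ρ₀ 0 ^ 2 * s ^ 2 := by ring
        _ ≤ _ := by gcongr; linarith

end Branch

theorem mainTheorem4 (a₀ m M κ : ℝ) (ha₀ : 0 < a₀) (hm : 0 < m) (hM : 0 < M) (hκ : 0 < κ) :
    ∃ ε > 0, ∃ δ > 0, ∃ c > 0, ∃ C > 0,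
      ∀ (V : 𝓢(ℝ, ℝ)) (ω₀ ω₁ : ℝ) (ψ₀ ψ₁ : ℝ → ℝ),
        IsAdmissible a₀ m M κ V ω₀ ω₁ ψ₀ ψ₁ → ω₀ - ω₁ < δ →
        -- the asymmetric branch exists
        (∃ (r : ℝ) (ρ₀ ω : ℝ → ℝ) (φ : ℝ → ℝ → ℝ),
          IsAsymmetricBranch V ω₀ ψ₀ ψ₁ ε r ρ₀ ω φ) ∧
        ∀ (r : ℝ) (ρ₀ ω : ℝ → ℝ) (φ : ℝ → ℝ → ℝ),
          IsAsymmetricBranch V ω₀ ψ₀ ψ₁ ε r ρ₀ ω φ →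
          (c * (ω₀ - ω₁) ≤ ρ₀ 0 ^ 4 ∧ ρ₀ 0 ^ 4 ≤ C * (ω₀ - ω₁)) ∧
          ∃ r' : ℝ, 0 < r' ∧ r' ≤ r ∧
            -- near `ω* = ω 0` each half of the branch is parametrized by `ω ∈ (ω*, ωmax)`,
            -- and the squared `L²` norm is an increasing function of `ω`
            (∃ (ωmax : ℝ) (q : ℝ → ℝ), ω 0 < ωmax ∧
              Set.BijOn ω (Set.Ioo 0 r') (Set.Ioo (ω 0) ωmax) ∧
              Set.BijOn ω (Set.Ioo (-r') 0) (Set.Ioo (ω 0) ωmax) ∧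
              (∀ s, 0 < |s| → |s| < r' → q (ω s) = ∫ x, φ s x ^ 2) ∧
              ∀ w ∈ Set.Ioo (ω 0) ωmax, DifferentiableAt ℝ q w ∧ 0 < deriv q w) ∧
            -- the eigenvalues of `L₊`
            ∀ s, 0 < |s| → |s| < r' →
              ∃ μ₀ μ₁ : ℝ, 0 < μ₀ ∧ 0 < μ₁ ∧
                schrodingerEigenvalues (LPlusPotential V (ω s) (φ s)) = {-μ₀, μ₁} ∧
                4 * ρ₀ 0 ^ 4 * (∫ x, ψ₀ x ^ 6) - C * ρ₀ 0 ^ 8 ≤ μ₀ ∧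
                c * ρ₀ 0 ^ 2 * s ^ 2 ≤ μ₁ ∧ μ₁ ≤ C * ρ₀ 0 ^ 2 * s ^ 2 := by
  obtain ⟨ε, hε, δ, hδ, c, hc, C, hC, H⟩ := Branch.exists_bifurcation ha₀ hm hM.le hκ
  -- This closeness makes |B - A| and |D - B| at most a₀/40. The first turns 5B - A > a₀ into A ≥
  -- a₀/8; the second is the smallness required for the slope of the mass.
  obtain ⟨δ', hδ', hclose⟩ := IsAdmissible.exists_close (M := M) hm hκ
    (η := a₀ / (40 * (1 + M) ^ 4)) (by positivity)
  refine ⟨ε, hε, min δ δ', lt_min hδ hδ', c, hc, C, hC, ?_⟩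
  intro V ω₀ ω₁ ψ₀ ψ₁ h hd
  have S := h.setting hm hκ
  have hcl := hclose h (hd.trans_le (min_le_right _ _))
  have e0 : ⇑(Branch.ev h.isSol₀.isH1.toE) = ψ₀ := Branch.ev_toE _
  have e1 : ⇑(Branch.ev h.isSol₁.isH1.toE) = ψ₁ := Branch.ev_toE _
  have hV : ⇑(Branch.toB V) = ⇑V := rfl
  -- Cubic decay is all that the exclusion of eigenvalues at or above ω requires of V at infinity.
  have hdecay : ∃ N, ∀ x : ℝ, 0 < x → |Branch.toB V x| ≤ N / x ^ 3 := by
    obtain ⟨N, -, hN⟩ := V.decay 3 0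
    refine ⟨N, fun x hx => ?_⟩
    have := hN x
    rw [norm_iteratedFDeriv_zero, Real.norm_eq_abs, Real.norm_eq_abs, abs_of_pos hx] at this
    rw [le_div_iff₀ (by positivity), mul_comm]
    exact this
  obtain ⟨m1, m2⟩ := S.moments_close
  simp only [e0, e1] at m1 m2
  have hsm : (1 + M) ^ 4 * ∫ x, |ψ₁ x ^ 2 - ψ₀ x ^ 2| ≤ a₀ / 40 := by
    calc _ ≤ (1 + M) ^ 4 * (a₀ / (40 * (1 + M) ^ 4)) := by gcongr
      _ = _ := by field_simp
  have b1 := abs_le.1 (m1.trans hsm)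
  have key := H S hdecay rfl rfl rfl (by simpa only [e0, e1] using h.interaction)
    (by simpa only [e0, e1] using h.interaction')
    (by
      simp only [e0]
      linarith [h.interaction])
    (by
      simp only [e0, e1]
      linarith [m2.trans hsm]) (hd.trans_le (min_le_left _ _))
  simpa only [e0, e1, hV] using key
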